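/- **Conventions.** An $r$-dimensional based cochain complex $\mathcal K^*$ over $\mathbb F_2$ has a finite set of cells $K=\bigsqcup_{j=0}^rK^j$, spaces $\mathcal K^j=\mathbb F_2^{K^j}$, a coboundary map $\delta$ ($\delta(\mathcal K^j)\subseteq\mathcal K^{j+1}$, $\delta^2=0$), and a chain complex $\mathcal K_*$ with $\partial=\delta^\top$; $|\cdot|$ is Hamming weight. Let $\preceq$ be the partial order on $K$ generated by $c\triangleleft c'$ if $c'\in\operatorname{supp}\delta(\mathbb 1_c)$; for a cochain $x$ write $c\preceq x$ if $c\preceq c'$ for all $c'\in\operatorname{supp}x$. Locality $w$ means that every cell is comparable with at most $w$ cells (itself included). $d^j(\mathcal K)$ and $d_j(\mathcal K)$ are the least weights of a level-$j$ cocycle that is not a coboundary, resp. cycle that is not a boundary ($\infty$ if there is none). The connectivity graph $G^{\mathcal K}$ has vertex set $K$ and joins two distinct cells that are both $\succeq$ some common cell of level $0$, or both $\preceq$ some common cell of level $r$. $\mathcal K^*$ has an $(m,0)$-small-set flip decoder at level $j$ if for every $e\in\mathcal K^j$ with $|e|\le m$: (a) if $e\ne0$, there is $c^0\in K^0$ and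 either $x\in\mathcal K^{j-1}$ with $c^0\preceq x$, $|e+\delta x|<|e|$, or $x\in\mathcal K^j$ with $c^0\preceq x$, $|\delta(e+x)|<|\delta e|$; (b) if $\delta e\neq0$, there are $c^0\in K^0$ and $x\in\mathcal K^j$ with $c^0\preceq x$ and $|\delta(e+x)|<|\delta e|$. A chain complex has such a decoder at chain level $j$ if, relabelled as a cochain complex, it has one at level $r-j$. Tensor products carry the product basis. The CSS code at level $j$ has physical qubits $K^j$. Given a cochain map $\operatorname{Enc}$ to $\mathcal K^*$ from a based graded space $\mathcal M^*$ with zero differential and basis $M=\bigsqcup_j M^j$, inducing isomorphisms on cohomology, its logical qubits are $M^j$ and its encoding isometry sends $|x\rangle$ to the normalized uniform superposition of the basis states in the class $\operatorname{Enc}(x)+\delta(\mathcal K^{j-1})$. For a graph $G=(V,E)$ and $\eta,\gamma>0$, $\mathcal E(G,\eta,\gamma)$ is the family of all $S\subseteq V$ contained in the vertex set $W$ of a finite connected subgraph with $|W|\ge\eta$ and $|S|\ge\gamma|W|$. A set avoids a family if it contains no member of it; $\mathcal E^{\sqcup t}$ is the disjoint union of $t$ copies of $\mathcal E$ on $t$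 copies of the ground set. An adaptive Clifford circuit with quantum space $N$, classical space $M\ge N$ and time $T$ performs in each step $t=1,\dots,T$ an arbitrary noiseless classical map on the $M$-bit register, then gates $1,\dots,g_t$ ($g_t\le M$) with disjoint supports, each from $I,X,Y,Z,H,S$, CNOT, Pauli measurements, resets to $|0\rangle$ or $|+\rangle$; gate $k$ is applied iff the $k$-th bit is $1$, except that measurements are always applied and overwrite the $k$-th bit by the outcome. A Pauli fault inserts after each step $t$ a map $\rho\mapsto F_t\rho F_t'$ with Pauli strings $F_t,F_t'$ on the $N$ qubits; its support is the set of space-time locations where $F_t$ or $F_t'$ is not the identity. A decorated code is a code with an encoding isometry $\operatorname{Enc}$ and a family $\mathcal E$ of bad sets on a set containing its physical qubits. For a state $\rho$ of the logical qubits and a reference system, an operator $\sigma$ on the $N$ qubits, the classical register (diagonal in the computational basis) and the reference is a Pauli $\mathcal E$-deviation of $\operatorname{Enc}(\rho)$ if tracing out the classical register and all qubits other than the physical qubits of the code gives $\lambda F\operatorname{Enc}(\rho)F'$ for some $\lambda\in\mathbb C$ and Pauli strings $F,F'$ for which the set of qubits where $F$ or $F'$ is not the identity avoids $\mathcal E$.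 A circuit with a family $\mathcal E$ of bad sets of space-time locations is a Pauli fault-tolerant gadget from $D_{\rm in}$ to $D_{\rm out}$ for a channel $\bar{\mathcal O}$ if for every finite reference system of qubits, every density operator $\rho$, every Pauli $\mathcal E_{\rm in}$-deviation $\sigma$ of $\operatorname{Enc}_{\rm in}(\rho)$ and every Pauli fault with $\mathcal E$-avoiding support, the corrupted circuit maps $\sigma$ to a Pauli $\mathcal E_{\rm out}$-deviation of $\operatorname{Enc}_{\rm out}(\bar{\mathcal O}(\rho))$. **Setting.** Let $r\in\mathbb N$, let $\mathcal A^*$ be an $(r-1)$-dimensional based cochain complex with an encoding cochain map $\operatorname{Enc}^{\mathcal A}:\mathcal M^{\mathcal A,*}\to\mathcal A^*$ (zero differential on $\mathcal M^{\mathcal A}$, inducing an isomorphism on cohomology), such that any two cells $a\triangleleft a'$ of $\mathcal A$ are adjacent in $G^{\mathcal A}$. Let $\mathcal B^*$ be a $1$-dimensional based cochain complex, $M^{\mathcal B,0}\subseteq B^0$ and $M^{\mathcal B,1}\subseteq B^1$ information sets (maximal sets on which every bit assignment extends to a codeword) for $\ker\delta^{\mathcal B}$ and $\ker\partial^{\mathcal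 B}$, and $\operatorname{Enc}^{\mathcal B}$ the map sending $x\in\mathbb F_2^{M^{\mathcal B,0}}$ to the codeword of $\ker\delta^{\mathcal B}$ that restricts to $x$, and $x\in\mathbb F_2^{M^{\mathcal B,1}}$ to its extension by zero. Let $L\subseteq M^{\mathcal B,1}$, and let $\mathcal B_{\bar L}$ be $\mathcal B$ with the cells of $L$ removed. Put $\mathcal C^*=\mathcal A^*\otimes\mathcal B^*$, $\operatorname{Enc}^{\mathcal C}=\operatorname{Enc}^{\mathcal A}\otimes\operatorname{Enc}^{\mathcal B}$, $\mathcal D^*=\mathcal A^*\otimes\mathcal B_*$, $\mathcal D_{\bar L}^*=\mathcal A^*\otimes(\mathcal B_{\bar L})_*$ ($\mathcal B$ dualized), and let $w$ be a locality of $\mathcal C$. Let $2\le i\le r-1$ and $m\in\mathbb N$, and assume that the chain complex $\mathcal C_*$ has an $(m,0)$-small-set flip decoder at chain level $i-1$, the cochain complex $\mathcal D^*$ has one at level $i$, and the chain complex $\mathcal D_{\bar L,*}$ has one at chain level $i-1$. Let $G_{\rm run}$ be a graph on a vertex set containing $C=A\times B=D$ which contains $G^{\mathcal C}$ and $G^{\mathcal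 D}$ as subgraphs. **Proposition.** There are a universal constant $\kappa$ and, for each $w$, constants $\gamma_{\rm in}(w)>0$ and $\zeta_{\rm out}(w)>0$ such that in every such setting the following holds for all real numbers $$0<\eta\le\min\{m,\,d_{i-1}(\mathcal A),\,d^{i-1}(\mathcal A),\,d^i(\mathcal D_{\bar L})\},\qquad 0<\gamma_{\rm in}\le\gamma_{\rm in}(w),\qquad \gamma_{\rm out}\ge\zeta_{\rm out}(w)\,\gamma_{\rm in}.$$ Let $\mathcal E_{\rm in}=\mathcal E(G^{\mathcal A},\eta,\gamma_{\rm in})$, $\mathcal E_{\rm run}=\mathcal E(G_{\rm run},\eta,\gamma_{\rm in})$, $\mathcal E_{\rm out}=\mathcal E(G_{\rm run},\eta,\gamma_{\rm out})$. Let $D_{\rm in}$ consist of $|L|$ copies, labelled by $L$, of the level-$(i-1)$ code of $\mathcal A^*$ with encoding $(\operatorname{Enc}^{\mathcal A})^{\sqcup L}$ and bad sets $\mathcal E_{\rm in}^{\sqcup L}$, and let $D_{\rm out}$ be the level-$i$ code of $\mathcal C^*$ with encoding $\operatorname{Enc}^{\mathcal C}$ and bad sets $\mathcal E_{\rm out}$;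 let $n_{\rm out}=|C^i|$. Let $\bar{\mathcal O}$ be the channel which keeps the logical qubits $M^{\mathcal A,i-1}\times L\subseteq M^{\mathcal C,i}$ and pads by $|0\rangle$ on all other logical qubits of $D_{\rm out}$. Then there are $u\le\kappa$, $N\le\kappa\, n_{\rm out}w$, $T\le\kappa w$ and an adaptive Clifford circuit $\mathcal Q$ with quantum space $N$ and time $T$, whose qubits are distinct elements of $C\times[u]$ (that is, form $u$ blocks, each a subset of $C\subseteq V(G_{\rm run})$), with the input qubits $A^{i-1}\times L\subseteq C$ in one block and the output qubits $C^i$ in one block, at their natural places, such that $((\mathcal Q,(\mathcal E_{\rm run}^{\sqcup u})^{\sqcup T}),D_{\rm in},D_{\rm out})$ is a Pauli fault-tolerant gadget for $\bar{\mathcal O}$. -/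

import Mathlib

open scoped Kronecker ComplexOrder

noncomputable section

namespace QEC

/-! ## Based (co)chain complexes over the field with two elements -/

/-- An `r`-dimensional based cochain complex over `ZMod 2`. The basis elements are the cells;
`deg c` is the level of the cell `c`, and `inc c c'` is the coefficient of `c'` in the coboundary
of the basis vector of `c`. Cochains are functions `Cell → ZMod 2`. The associated chain complex has
the transposed incidence matrix as its boundary map; it is represented by `BasedComplex.dual`. -/
structure BasedComplex (r : ℕ) where
  Cell : Type
  [fintypeCell : Fintype Cell]
  [decEqCell : DecidableEq Cell]
  deg : Cell → ℕ
  deg_le : ∀ c, deg c ≤ r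
  inc : Cell → Cell → ZMod 2
  inc_deg : ∀ c c', inc c c' ≠ 0 → deg c' = deg c + 1
  inc_inc : ∀ c c'', ∑ c', inc c c' * inc c' c'' = 0

attribute [instance] BasedComplex.fintypeCell BasedComplex.decEqCell

namespace BasedComplex

variable {r s : ℕ}

/-- The cells of level `i`. -/
abbrev LevelCell (K : BasedComplex r) (i : ℕ) : Type := {c : K.Cell // K.deg c = i}

/-- The cochains supported on level `i`. -/
def level (K : BasedComplex r) (i : ℕ) : Submodule (ZMod 2) (K.Cell → ZMod 2) where
  carrier := {f | ∀ c, K.deg c ≠ i → f c = 0}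
  add_mem' := fun {f g} hf hg c hc => by simp [hf c hc, hg c hc]
  zero_mem' := fun _ _ => rfl
  smul_mem' := fun a f hf c hc => by simp [hf c hc]

/-- The coboundary map on the space of all cochains. -/
def coboundary (K : BasedComplex r) : (K.Cell → ZMod 2) →ₗ[ZMod 2] (K.Cell → ZMod 2) where
  toFun := fun f c' => ∑ c, f c * K.inc c c'
  map_add' := fun f g => by
    funext c'
    simp [add_mul, Finset.sum_add_distrib]
  map_smul' := fun a f => by
    funext c'
    simp [Finset.mul_sum, mul_assoc]

/-- The cocycles of level `i`. -/
def cocycles (K : BasedComplex r) (i : ℕ) : Submodule (ZMod 2) (K.Cell → ZMod 2) :=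
  K.level i ⊓ LinearMap.ker K.coboundary

/-- The coboundaries of level `i`: images of cochains of level `i - 1`. -/
def coboundaries (K : BasedComplex r) : ℕ → Submodule (ZMod 2) (K.Cell → ZMod 2)
  | 0 => ⊥
  | i + 1 => (K.level i).map K.coboundary

/-- The cohomology at level `i`: cocycles modulo coboundaries. -/
abbrev cohomology (K : BasedComplex r) (i : ℕ) : Type :=
  K.cocycles i ⧸ (K.coboundaries i).submoduleOf (K.cocycles i)

/-- The chain complex of `K`, read as a cochain complex: the incidence matrix is transposed and
chain level `j` becomes level `r - j`. -/
def dual (K : BasedComplex r) : BasedComplex r where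
  Cell := K.Cell
  deg := fun c => r - K.deg c
  deg_le := fun _ => Nat.sub_le _ _
  inc := fun c c' => K.inc c' c
  inc_deg := fun c c' h => by
    have h1 := K.inc_deg c' c h
    have h2 := K.deg_le c
    omega
  inc_inc := fun c c'' => by
    rw [← K.inc_inc c'' c]
    exact Finset.sum_congr rfl fun _ _ => mul_comm _ _

/-- The tensor product of based cochain complexes, with coboundary `δ ⊗ 1 + 1 ⊗ δ`. -/
def tensor (K : BasedComplex r) (K' : BasedComplex s) : BasedComplex (r + s) where
  Cell := K.Cell × K'.Cell
  deg := fun c => K.deg c.1 + K'.deg c.2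
  deg_le := fun c => Nat.add_le_add (K.deg_le c.1) (K'.deg_le c.2)
  inc := fun c c' =>
    (if c.2 = c'.2 then K.inc c.1 c'.1 else 0) + (if c.1 = c'.1 then K'.inc c.2 c'.2 else 0)
  inc_deg := fun c c' h => by
    by_cases h1 : c.2 = c'.2 ∧ K.inc c.1 c'.1 ≠ 0
    · have h2 := K.inc_deg _ _ h1.2
      have h3 := congrArg K'.deg h1.1
      omega
    · by_cases h4 : c.1 = c'.1 ∧ K'.inc c.2 c'.2 ≠ 0
      · have h2 := K'.inc_deg _ _ h4.2
        have h3 := congrArg K.deg h4.1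
        omega
      · exfalso
        apply h
        have e1 : (if c.2 = c'.2 then K.inc c.1 c'.1 else 0) = 0 := by
          split_ifs with h5
          · by_contra h6
            exact h1 ⟨h5, h6⟩
          · rfl
        have e2 : (if c.1 = c'.1 then K'.inc c.2 c'.2 else 0) = 0 := by
          split_ifs with h5
          · by_contra h6
            exact h4 ⟨h5, h6⟩
          · rfl
        rw [e1, e2, add_zero]
  inc_inc := fun c c'' => by
    rcases c with ⟨a, b⟩
    rcases c'' with ⟨a'', b''⟩
    rw [Fintype.sum_prod_type]
    have e : ∀ x : ZMod 2, x + x = 0 := fun x => by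
      revert x
      decide
    have h1 := K.inc_inc a a''
    have h2 := K'.inc_inc b b''
    simp only [add_mul, mul_add, Finset.sum_add_distrib, ite_mul, mul_ite, zero_mul, mul_zero,
      Finset.sum_ite_eq, Finset.sum_ite_eq', Finset.mem_univ, if_true]
    simp only [Finset.sum_ite_irrel, Finset.sum_const_zero, Finset.sum_add_distrib,
      Finset.sum_ite_eq, Finset.sum_ite_eq', Finset.mem_univ, if_true, h1, h2, ite_self]
    rw [mul_comm (K.inc a a'') (K'.inc b b''), zero_add, add_zero, e]

/-- The 1-dimensional complex obtained by deleting the cells of `L`. -/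
def removeCells (B : BasedComplex 1) (L : Finset B.Cell) : BasedComplex 1 where
  Cell := {b : B.Cell // b ∉ L}
  deg := fun b => B.deg b.1
  deg_le := fun b => B.deg_le b.1
  inc := fun b b' => B.inc b.1 b'.1
  inc_deg := fun b b' => B.inc_deg b.1 b'.1
  inc_inc := fun b b'' => by
    refine Finset.sum_eq_zero fun b' _ => ?_
    by_contra h
    have h1 := B.inc_deg _ _ (left_ne_zero_of_mul h)
    have h2 := B.inc_deg _ _ (right_ne_zero_of_mul h)
    have h3 := B.deg_le b''.1
    omega

/-- The partial order on cells generated by incidence. -/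
def Below (K : BasedComplex r) : K.Cell → K.Cell → Prop :=
  Relation.ReflTransGen fun c c' => K.inc c c' ≠ 0

/-- Every cell is comparable with at most `w` cells (itself included). -/
def HasLocality (K : BasedComplex r) (w : ℕ) : Prop :=
  ∀ c, {c' | K.Below c' c ∨ K.Below c c'}.ncard ≤ w

/-- Two cells have a common cell of level `0` below them or a common cell of top level `r`
above them. -/
def Linked (K : BasedComplex r) (c c' : K.Cell) : Prop :=
  (∃ b, K.deg b = 0 ∧ K.Below b c ∧ K.Below b c') ∨
    (∃ t, K.deg t = r ∧ K.Below c t ∧ K.Below c' t)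

/-- The connectivity graph on the cells of all levels. -/
def connGraph (K : BasedComplex r) : SimpleGraph K.Cell where
  Adj := fun c c' => c ≠ c' ∧ K.Linked c c'
  symm := ⟨fun _ _ h => ⟨h.1.symm, h.2.imp (fun ⟨b, h0, h1, h2⟩ => ⟨b, h0, h2, h1⟩)
    (fun ⟨t, h0, h1, h2⟩ => ⟨t, h0, h2, h1⟩)⟩⟩
  loopless := ⟨fun _ h => h.1 rfl⟩

/-- `η` is at most the cosystolic distance of level `i`, the minimum of the weights of the cocycles
which are not coboundaries (the minimum being infinite if there are none). -/
def LeCosystolicDistance (K : BasedComplex r) (i : ℕ) (η : ℝ) : Prop :=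
  ∀ z ∈ K.cocycles i, z ∉ K.coboundaries i → η ≤ (hammingNorm z : ℝ)

/-- `η` is at most the systolic distance of chain level `j ≤ r`. -/
def LeSystolicDistance (K : BasedComplex r) (j : ℕ) (η : ℝ) : Prop :=
  K.dual.LeCosystolicDistance (r - j) η

/-- The cell `b` lies below the cochain `x`, that is, below each cell of its support. -/
def BelowCochain (K : BasedComplex r) (b : K.Cell) (x : K.Cell → ZMod 2) : Prop :=
  ∀ c, x c ≠ 0 → K.Below b c

/-- An `m`-small-set error-flip decoder of a cochain complex at level `i`. -/
def HasErrorFlipDecoder (K : BasedComplex r) (m i : ℕ) : Prop :=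
  ∀ e ∈ K.level i, e ≠ 0 → hammingNorm e ≤ m → ∃ b, K.deg b = 0 ∧
    ((∃ j, j + 1 = i ∧ ∃ x ∈ K.level j, K.BelowCochain b x ∧
        hammingNorm (e + K.coboundary x) < hammingNorm e) ∨
      (∃ x ∈ K.level i, K.BelowCochain b x ∧
        hammingNorm (K.coboundary (e + x)) < hammingNorm (K.coboundary e)))

/-- An `(m, γ)`-small-set syndrome-flip decoder of a cochain complex at level `i`. -/
def HasSyndromeFlipDecoder (K : BasedComplex r) (m : ℕ) (γ : ℝ) (i : ℕ) : Prop :=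
  ∀ e ∈ K.level i, K.coboundary e ≠ 0 → hammingNorm e ≤ m →
    ∀ f ∈ K.level (i + 1), (hammingNorm f : ℝ) ≤ γ * hammingNorm (K.coboundary e) →
      ∃ b, K.deg b = 0 ∧ ∃ x ∈ K.level i, K.BelowCochain b x ∧
        hammingNorm (K.coboundary (e + x) + f) < hammingNorm (K.coboundary e + f)

/-- An `(m, γ)`-small-set flip decoder of a cochain complex at level `i`. -/
def HasFlipDecoder (K : BasedComplex r) (m : ℕ) (γ : ℝ) (i : ℕ) : Prop :=
  K.HasErrorFlipDecoder m i ∧ K.HasSyndromeFlipDecoder m γ i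

/-- An `(m, γ)`-small-set flip decoder at chain level `j ≤ r` of the chain complex of `K`. -/
def HasChainFlipDecoder (K : BasedComplex r) (m : ℕ) (γ : ℝ) (j : ℕ) : Prop :=
  K.dual.HasFlipDecoder m γ (r - j)

/-- A cochain on the cells of level `i`, extended by zero. -/
def extend (K : BasedComplex r) (i : ℕ) (y : K.LevelCell i → ZMod 2) : K.Cell → ZMod 2 :=
  fun c => if h : K.deg c = i then y ⟨c, h⟩ else 0

end BasedComplex

/-! ## Information sets and encoding maps -/

/-- Every assignment of bits to `S` is the restriction of a codeword. -/
def IsExtendable {α : Type} (C : Submodule (ZMod 2) (α → ZMod 2)) (S : Set α) : Prop :=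
  ∀ x : α → ZMod 2, ∃ y ∈ C, ∀ a ∈ S, y a = x a

/-- Information sets are the inclusion-maximal extendable sets. -/
def IsInformationSet {α : Type} (C : Submodule (ZMod 2) (α → ZMod 2)) (S : Set α) : Prop :=
  Maximal (IsExtendable C) S

/-- A cochain map to `K` from a based graded space with zero coboundary: every basis element `x` of
degree `deg x` is sent to a cocycle `rep x` of level `deg x`. -/
structure EncMap {r : ℕ} (K : BasedComplex r) where
  Idx : Type
  [fintypeIdx : Fintype Idx]
  [decEqIdx : DecidableEq Idx]
  deg : Idx → ℕ
  rep : Idx → K.Cell → ZMod 2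
  rep_mem : ∀ x, rep x ∈ K.cocycles (deg x)

attribute [instance] EncMap.fintypeIdx EncMap.decEqIdx

namespace EncMap

variable {r s : ℕ}

/-- The basis elements of degree `i`: the logical qubits at level `i`. -/
abbrev LevelIdx {K : BasedComplex r} (E : EncMap K) (i : ℕ) : Type := {x : E.Idx // E.deg x = i}

/-- The cocycle to which a vector of degree `i` is sent. -/
def encode {K : BasedComplex r} (E : EncMap K) (i : ℕ) (v : E.LevelIdx i → ZMod 2) :
    K.Cell → ZMod 2 :=
  ∑ x, v x • E.rep x.1

theorem encode_mem {K : BasedComplex r} (E : EncMap K) (i : ℕ) (v : E.LevelIdx i → ZMod 2) :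
    E.encode i v ∈ K.cocycles i := by
  refine Submodule.sum_mem _ fun x _ => Submodule.smul_mem _ _ ?_
  have h := E.rep_mem x.1
  rwa [x.2] at h

/-- The cochain map induces isomorphisms on cohomology at all levels. -/
def IsCohomologyIso {K : BasedComplex r} (E : EncMap K) : Prop :=
  ∀ i, Function.Bijective fun v : E.LevelIdx i → ZMod 2 =>
    (Submodule.Quotient.mk ⟨E.encode i v, E.encode_mem i v⟩ : K.cohomology i)

/-- The tensor product of two cochain maps. -/
def tensor {K : BasedComplex r} {K' : BasedComplex s} (E : EncMap K) (E' : EncMap K') :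
    EncMap (K.tensor K') where
  Idx := E.Idx × E'.Idx
  deg := fun x => E.deg x.1 + E'.deg x.2
  rep := fun x c => E.rep x.1 c.1 * E'.rep x.2 c.2
  rep_mem := fun x => by
    obtain ⟨h1, h2⟩ := E.rep_mem x.1
    obtain ⟨h1', h2'⟩ := E'.rep_mem x.2
    refine ⟨fun c hc => ?_, ?_⟩
    · by_cases h : K.deg c.1 = E.deg x.1
      · have h' : K'.deg c.2 ≠ E'.deg x.2 := fun h' => hc (by
          change K.deg c.1 + K'.deg c.2 = _
          rw [h, h'])
        change E.rep x.1 c.1 * E'.rep x.2 c.2 = 0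
        rw [h1' _ h', mul_zero]
      · change E.rep x.1 c.1 * E'.rep x.2 c.2 = 0
        rw [h1 _ h, zero_mul]
    · change (K.tensor K').coboundary _ = 0
      funext c
      rcases c with ⟨a, b⟩
      have e1 : ∑ a', E.rep x.1 a' * K.inc a' a = 0 := congrFun h2 a
      have e2 : ∑ b', E'.rep x.2 b' * K'.inc b' b = 0 := congrFun h2' b
      change ∑ c : K.Cell × K'.Cell, (E.rep x.1 c.1 * E'.rep x.2 c.2) *
        ((if c.2 = b then K.inc c.1 a else 0) + (if c.1 = a then K'.inc c.2 b else 0)) = 0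
      rw [Fintype.sum_prod_type]
      simp only [mul_add, Finset.sum_add_distrib, mul_ite, mul_zero, Finset.sum_ite_eq',
        Finset.sum_ite_irrel, Finset.sum_const_zero, Finset.mem_univ, if_true]
      have e3 : ∑ a', E.rep x.1 a' * E'.rep x.2 b * K.inc a' a
          = E'.rep x.2 b * ∑ a', E.rep x.1 a' * K.inc a' a := by
        rw [Finset.mul_sum]
        exact Finset.sum_congr rfl fun _ _ => by ring
      have e4 : ∑ b', E.rep x.1 a * E'.rep x.2 b' * K'.inc b' b
          = E.rep x.1 a * ∑ b', E'.rep x.2 b' * K'.inc b' b := by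
        rw [Finset.mul_sum]
        exact Finset.sum_congr rfl fun _ _ => by ring
      rw [e3, e4, e1, e2]
      simp

/-- The encoding map of a 1-dimensional complex with information sets `M₀` for `ker δ` and `M₁` for
`ker ∂`: a basis vector of `M₀` goes to the codeword of `ker δ` which restricts to it on `M₀`
(unique, as `M₀` is an information set), and a basis vector of `M₁` goes to itself. -/
def ofInfoSets (B : BasedComplex 1) (M₀ M₁ : Finset B.Cell)
    (h₀ : IsInformationSet (B.cocycles 0) (M₀ : Set B.Cell))
    (h₁ : IsInformationSet (B.dual.cocycles 0) (M₁ : Set B.Cell)) : EncMap B where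
  Idx := M₀ ⊕ M₁
  deg := Sum.elim (fun _ => 0) (fun _ => 1)
  rep := Sum.elim (fun b => (h₀.prop (Pi.single b.1 1)).choose) (fun b => Pi.single b.1 1)
  rep_mem := fun x => by
    rcases x with b | b
    · exact (h₀.prop (Pi.single b.1 1)).choose_spec.1
    · have hb : B.deg b.1 = 1 := by
        obtain ⟨y, hy, hyb⟩ := h₁.prop (fun _ => 1)
        by_contra hne
        have hlt := B.deg_le b.1
        have hz : y b.1 = 0 := hy.1 b.1 (by
          change 1 - B.deg b.1 ≠ 0
          omega)
        have h1 := hyb b.1 b.2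
        rw [hz] at h1
        exact zero_ne_one h1
      refine ⟨fun c hc => ?_, ?_⟩
      · refine Pi.single_eq_of_ne ?_ _
        rintro rfl
        exact hc hb
      · change B.coboundary _ = 0
        funext c
        refine Finset.sum_eq_zero fun c' _ => ?_
        by_contra h
        have h1 := B.inc_deg _ _ (right_ne_zero_of_mul h)
        have h2 : c' = b.1 := by
          by_contra hne
          exact left_ne_zero_of_mul h (Pi.single_eq_of_ne hne _)
        have h3 := B.deg_le c
        rw [h2, hb] at h1
        omega

open Classical in
/-- The encoding isometry of the CSS code at level `i`: the logical basis state of `x` goes to the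
normalized uniform superposition of the basis states of all elements of the cohomology class
of the encoded `x`. -/
def isometry {K : BasedComplex r} (E : EncMap K) (i : ℕ) :
    Matrix (K.LevelCell i → ZMod 2) (E.LevelIdx i → ZMod 2) ℂ :=
  fun y x =>
    if K.extend i y - E.encode i x ∈ K.coboundaries i then
      (((Real.sqrt (Nat.card (K.coboundaries i)))⁻¹ : ℝ) : ℂ) else 0

end EncMap

/-! ## Pauli operators and Clifford gates -/

/-- The computational basis states of a set of (qu)bits. -/
abbrev Bits (Q : Type) : Type := Q → ZMod 2

inductive Pauli
  | I
  | X
  | Y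
  | Z

/-- The matrices of the one-qubit Paulis, rows and columns being indexed by `0, 1`. -/
def Pauli.mat : Pauli → Matrix (ZMod 2) (ZMod 2) ℂ
  | .I => 1
  | .X => fun a b => if a = b then 0 else 1
  | .Y => fun a b => if a = b then 0 else if a = 0 then -Complex.I else Complex.I
  | .Z => fun a b => if a = b then (if a = 0 then 1 else -1) else 0

/-- The tensor product of one-qubit Paulis. -/
def pauliString {Q : Type} [Fintype Q] (P : Q → Pauli) : Matrix (Bits Q) (Bits Q) ℂ :=
  fun x y => ∏ q, (P q).mat (x q) (y q)

/-- A one-qubit operator acting on the qubit `q`. -/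
def onQubit {Q : Type} [Fintype Q] [DecidableEq Q] (q : Q) (U : Matrix (ZMod 2) (ZMod 2) ℂ) :
    Matrix (Bits Q) (Bits Q) ℂ :=
  fun x y => if ∀ p, p ≠ q → x p = y p then U (x q) (y q) else 0

/-- The axes of the one-qubit Pauli measurements. -/
inductive Axis
  | X
  | Y
  | Z

def Axis.pauli : Axis → Pauli
  | .X => .X
  | .Y => .Y
  | .Z => .Z

/-- The projector to the eigenspace of eigenvalue `(-1) ^ b` of a Pauli. -/
def Axis.proj (P : Axis) (b : ZMod 2) : Matrix (ZMod 2) (ZMod 2) ℂ :=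
  (1 / 2 : ℂ) • (1 + (if b = 0 then (1 : ℂ) else -1) • P.pauli.mat)

/-- The Clifford gate set on the qubits `Q`: Pauli, Hadamard and phase (`S = √Z`) unitaries,
controlled NOT, Pauli measurements, and resets to `|0⟩` and `|+⟩`. -/
inductive CliffordGate (Q : Type)
  | pauli (P : Pauli) (q : Q)
  | hadamard (q : Q)
  | phase (q : Q)
  | cnot (control target : Q) (h : control ≠ target)
  | measure (P : Axis) (q : Q)
  | resetZero (q : Q)
  | resetPlus (q : Q)

/-- The set of qubits on which a gate acts. -/
def CliffordGate.support {Q : Type} : CliffordGate Q → Set Q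
  | .pauli _ q => {q}
  | .hadamard q => {q}
  | .phase q => {q}
  | .cnot p q _ => {p, q}
  | .measure _ q => {q}
  | .resetZero q => {q}
  | .resetPlus q => {q}

/-- The (unnormalized) state of a quantum register `Q`, a reference system with basis `R`, and a
classical register of `M` bits which is a mixture of computational basis states: for every
value `x` of the classical register, the corresponding operator on the other two systems. -/
abbrev HybridState (Q R : Type) (M : ℕ) : Type :=
  Bits (Fin M) → Matrix (Bits Q × R) (Bits Q × R) ℂ

section Circuits

variable {Q R : Type} [Fintype Q] [DecidableEq Q] [Fintype R] [DecidableEq R] {M : ℕ}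

/-- Conjugation by a Kraus operator acting on the quantum register only. -/
def kraus (A : Matrix (Bits Q) (Bits Q) ℂ) (ρ : Matrix (Bits Q × R) (Bits Q × R) ℂ) :
    Matrix (Bits Q × R) (Bits Q × R) ℂ :=
  (A ⊗ₖ (1 : Matrix R R ℂ)) * ρ * (A ⊗ₖ (1 : Matrix R R ℂ)).conjTranspose

/-- The matrix unit `|0⟩⟨b|`. -/
def zeroKet (b : ZMod 2) : Matrix (ZMod 2) (ZMod 2) ℂ :=
  fun x y => if x = 0 ∧ y = b then 1 else 0

/-- The matrix `|+⟩⟨b|`. -/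
def plusKet (b : ZMod 2) : Matrix (ZMod 2) (ZMod 2) ℂ :=
  fun _ y => if y = b then (((Real.sqrt 2)⁻¹ : ℝ) : ℂ) else 0

/-- The Hadamard matrix. -/
def hadamardMat : Matrix (ZMod 2) (ZMod 2) ℂ :=
  fun x y => (if x = 1 ∧ y = 1 then (-1 : ℂ) else 1) * (((Real.sqrt 2)⁻¹ : ℝ) : ℂ)

/-- The phase gate `S`. -/
def phaseMat : Matrix (ZMod 2) (ZMod 2) ℂ :=
  fun x y => if x = y then (if x = 0 then 1 else Complex.I) else 0

/-- The controlled NOT matrix. -/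
def cnotMat (p q : Q) : Matrix (Bits Q) (Bits Q) ℂ :=
  fun x y => if x = Function.update y q (y q + y p) then 1 else 0

/-- The action of the gate with classical control bit `i`. Gates other than measurements are applied
if the bit is `1`; a measurement is always applied, and its outcome overwrites the bit. -/
def CliffordGate.act (i : Fin M) : CliffordGate Q → HybridState Q R M → HybridState Q R M
  | .pauli P q, σ => fun x => if x i = 1 then kraus (onQubit q P.mat) (σ x) else σ x
  | .hadamard q, σ => fun x => if x i = 1 then kraus (onQubit q hadamardMat) (σ x) else σ x
  | .phase q, σ => fun x => if x i = 1 then kraus (onQubit q phaseMat) (σ x) else σ x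
  | .cnot p q _, σ => fun x => if x i = 1 then kraus (cnotMat p q) (σ x) else σ x
  | .measure P q, σ => fun x =>
      ∑ b : ZMod 2, kraus (onQubit q (P.proj (x i))) (σ (Function.update x i b))
  | .resetZero q, σ => fun x =>
      if x i = 1 then ∑ b : ZMod 2, kraus (onQubit q (zeroKet b)) (σ x) else σ x
  | .resetPlus q, σ => fun x =>
      if x i = 1 then ∑ b : ZMod 2, kraus (onQubit q (plusKet b)) (σ x) else σ x

/-- The action of a classical computation on the classical register. -/
def classicalAct (f : Bits (Fin M) → Bits (Fin M)) (σ : HybridState Q R M) : HybridState Q R M :=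
  fun x => ∑ y, if f y = x then σ y else 0

/-- A pair of Pauli strings, standing for the superoperator `ρ ↦ F ρ F'`. -/
abbrev PauliPair (Q : Type) : Type := (Q → Pauli) × (Q → Pauli)

/-- The qubits on which a Pauli superoperator acts nontrivially. -/
def PauliPair.support {Q : Type} (F : PauliPair Q) : Set Q := {q | F.1 q ≠ .I ∨ F.2 q ≠ .I}

/-- The action of a Pauli superoperator on the quantum register. -/
def faultAct (F : PauliPair Q) (σ : HybridState Q R M) : HybridState Q R M :=
  fun x => (pauliString F.1 ⊗ₖ (1 : Matrix R R ℂ)) * σ x * (pauliString F.2 ⊗ₖ (1 : Matrix R R ℂ))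

end Circuits

/-! ## Adaptive circuits -/

/-- An adaptive Clifford circuit with quantum space `N`, classical space `M` and time `T`. At each
time step a classical computation acts on the `M`-bit register, and then Clifford gates with disjoint
supports are applied, the `i`-th gate being controlled by (or, for measurements, written to)
the `i`-th classical bit. -/
structure AdaptiveCircuit (N M T : ℕ) where
  space_le : N ≤ M
  classical : Fin T → Bits (Fin M) → Bits (Fin M)
  gateCount : Fin T → ℕ
  gateCount_le : ∀ t, gateCount t ≤ M
  gate : ∀ t, Fin (gateCount t) → CliffordGate (Fin N)
  disjoint_support : ∀ t, Pairwise fun i j => Disjoint (gate t i).support (gate t j).support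

namespace AdaptiveCircuit

variable {N M T : ℕ}

/-- One time step: the classical computation, then the gates (which commute). -/
def step {R : Type} [Fintype R] [DecidableEq R] (𝒬 : AdaptiveCircuit N M T) (t : Fin T)
    (σ : HybridState (Fin N) R M) : HybridState (Fin N) R M :=
  Fin.foldl (𝒬.gateCount t)
    (fun τ i => (𝒬.gate t i).act (Fin.castLE (𝒬.gateCount_le t) i) τ)
    (classicalAct (𝒬.classical t) σ)

/-- The circuit corrupted by a Pauli fault, whose `t`-th superoperator acts after time step `t`;
the reference system is left alone. -/
def run {R : Type} [Fintype R] [DecidableEq R] (𝒬 : AdaptiveCircuit N M T)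
    (F : Fin T → PauliPair (Fin N)) (σ : HybridState (Fin N) R M) : HybridState (Fin N) R M :=
  Fin.foldl T (fun τ t => faultAct (F t) (𝒬.step t τ)) σ

end AdaptiveCircuit

/-! ## Bad sets, decorated codes and fault-tolerant gadgets -/

/-- No bad set is contained in `S`. -/
def Avoids {V : Type} (bad : Set (Set V)) (S : Set V) : Prop := ∀ B ∈ bad, ¬ B ⊆ S

/-- The disjoint union of copies, labelled by `ι`, of a family of sets. -/
def disjPow {V : Type} (bad : Set (Set V)) (ι : Type) : Set (Set (V × ι)) :=
  {S | ∃ j : ι, ∃ B ∈ bad, S = (fun v => (v, j)) '' B}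

/-- The family of sets which lie in a connected subgraph with at least `η` vertices, of which they
make up a proportion of at least `γ`. -/
def badSets {V : Type} (G : SimpleGraph V) (η γ : ℝ) : Set (Set V) :=
  {S | ∃ W : Finset V, S ⊆ (W : Set V) ∧ (G.induce (W : Set V)).Connected ∧
    η ≤ (W.card : ℝ) ∧ γ ≤ (S.ncard : ℝ) / (W.card : ℝ)}

/-- A decorated quantum code: an encoding isometry from logical to physical qubits, and a family of
bad sets on a set `V` in which the physical qubits have locations. -/
structure DecoratedCode (V : Type) where
  Phys : Type
  Log : Type
  [fintypePhys : Fintype Phys]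
  [decEqPhys : DecidableEq Phys]
  [fintypeLog : Fintype Log]
  [decEqLog : DecidableEq Log]
  enc : Matrix (Bits Phys) (Bits Log) ℂ
  loc : Phys ↪ V
  bad : Set (Set V)

attribute [instance] DecoratedCode.fintypePhys DecoratedCode.decEqPhys DecoratedCode.fintypeLog
  DecoratedCode.decEqLog

open Classical in
/-- The partial trace of a hybrid state over the classical register and over all qubits outside the
range of `e`. -/
def partialTrace {Q P R : Type} [Fintype Q] [DecidableEq Q] {M : ℕ} (e : P ↪ Q)
    (σ : HybridState Q R M) : Matrix (Bits P × R) (Bits P × R) ℂ :=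
  fun a b => ∑ x : Bits (Fin M), ∑ y : Bits Q, ∑ y' : Bits Q,
    if y ∘ e = a.1 ∧ y' ∘ e = b.1 ∧ ∀ q ∉ Set.range e, y q = y' q then σ x (y, a.2) (y', b.2) else 0

/-- `σ` is a Pauli deviation of the encoded state `ρ`, the physical qubits of the code being placed
in the quantum register by `e`: its partial trace to these is proportional to the result of applying
to the encoded `ρ` a Pauli superoperator whose support avoids the bad sets. -/
def IsPauliDeviation {V Q R : Type} [Fintype Q] [DecidableEq Q] [Fintype R] [DecidableEq R] {M : ℕ}
    (D : DecoratedCode V) (e : D.Phys ↪ Q) (ρ : Matrix (Bits D.Log × R) (Bits D.Log × R) ℂ)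
    (σ : HybridState Q R M) : Prop :=
  ∃ F : PauliPair D.Phys, Avoids D.bad (D.loc '' F.support) ∧ ∃ c : ℂ,
    partialTrace e σ = c • (((pauliString F.1 * D.enc) ⊗ₖ (1 : Matrix R R ℂ)) * ρ *
      ((D.enc.conjTranspose * pauliString F.2) ⊗ₖ (1 : Matrix R R ℂ)))

/-- A linear superoperator, extended by the identity to a reference system. -/
def onLeft {α β R : Type} (Φ : Matrix α α ℂ →ₗ[ℂ] Matrix β β ℂ) (ρ : Matrix (α × R) (α × R) ℂ) :
    Matrix (β × R) (β × R) ℂ :=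
  fun a b => Φ (fun x y => ρ (x, a.2) (y, b.2)) a.1 b.1

/-- The adaptive circuit `𝒬` with bad sets `badRun` of space-time locations is a Pauli
fault-tolerant gadget, with input code `Din`, output code `Dout` and no classical input or output, for
the logical superoperator `Φ`. Here `runLoc` gives the locations of the qubits of the circuit, and
`inp` and `out` place the physical qubits of the two codes in the quantum register. -/
def IsPauliFaultTolerantGadget {Vin Vout W : Type} {N M T : ℕ}
    (𝒬 : AdaptiveCircuit N M T) (runLoc : Fin N ↪ W) (badRun : Set (Set (W × Fin T)))
    (Din : DecoratedCode Vin) (inp : Din.Phys ↪ Fin N)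
    (Dout : DecoratedCode Vout) (out : Dout.Phys ↪ Fin N)
    (Φ : Matrix (Bits Din.Log) (Bits Din.Log) ℂ →ₗ[ℂ]
      Matrix (Bits Dout.Log) (Bits Dout.Log) ℂ) : Prop :=
  ∀ (ℓ : ℕ) (ρ : Matrix (Bits Din.Log × Bits (Fin ℓ)) (Bits Din.Log × Bits (Fin ℓ)) ℂ),
    ρ.PosSemidef → ρ.trace = 1 →
    ∀ σ : HybridState (Fin N) (Bits (Fin ℓ)) M, IsPauliDeviation Din inp ρ σ →
    ∀ F : Fin T → PauliPair (Fin N),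
      Avoids badRun {p | ∃ q, runLoc q = p.1 ∧ q ∈ (F p.2).support} →
      IsPauliDeviation Dout out (onLeft Φ ρ) (𝒬.run F σ)

open Classical in
/-- The channel padding a state of the qubits `P` by further qubits in the state `|0⟩`. -/
def padZero {P P' : Type} (e : P ↪ P') :
    Matrix (Bits P) (Bits P) ℂ →ₗ[ℂ] Matrix (Bits P') (Bits P') ℂ where
  toFun := fun ρ y y' =>
    if ∀ q ∉ Set.range e, y q = 0 ∧ y' q = 0 then ρ (y ∘ e) (y' ∘ e) else 0
  map_add' := fun ρ ρ' => by
    ext y y'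
    by_cases h : ∀ q ∉ Set.range e, y q = 0 ∧ y' q = 0
    · refine (if_pos h).trans (Eq.symm ?_)
      exact congrArg₂ (fun z z' : ℂ => z + z') (if_pos h) (if_pos h)
    · exact (if_neg h).trans
        ((congrArg₂ (fun z z' : ℂ => z + z') (if_neg h) (if_neg h)).trans (add_zero 0)).symm
  map_smul' := fun a ρ => by
    ext y y'
    by_cases h : ∀ q ∉ Set.range e, y q = 0 ∧ y' q = 0
    · exact (if_pos h).trans (congrArg (fun z : ℂ => a * z) (if_pos h)).symm
    · exact (if_neg h).trans ((congrArg (fun z : ℂ => a * z) (if_neg h)).trans (mul_zero a)).symm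

/-! ## The codes of the upwards switching gadget -/

/-- The decorated code at level `i` of `K`, with the cells of `K` located in `V`. -/
def levelCode {r : ℕ} {K : BasedComplex r} (E : EncMap K) (i : ℕ) {V : Type} (φ : K.Cell ↪ V)
    (bad : Set (Set V)) : DecoratedCode V where
  Phys := K.LevelCell i
  Log := E.LevelIdx i
  enc := E.isometry i
  loc := (Function.Embedding.subtype _).trans φ
  bad := bad

/-- Disjoint copies, labelled by `ι`, of a decorated code. -/
def DecoratedCode.copies {V : Type} (D : DecoratedCode V) (ι : Type) [Fintype ι] [DecidableEq ι] :
    DecoratedCode (V × ι) where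
  Phys := D.Phys × ι
  Log := D.Log × ι
  enc := fun y x => ∏ j, D.enc (fun p => y (p, j)) (fun q => x (q, j))
  loc := D.loc.prodMap (Function.Embedding.refl ι)
  bad := disjPow D.bad ι

/-- The logical qubits of the copies, labelled by `L`, of level `i - 1` of `A`, as a subset of the
logical qubits of level `i` of `A ⊗ B`. -/
def logicalInclusion {d : ℕ} {A : BasedComplex d} (EA : EncMap A) {B : BasedComplex 1}
    {M₀ M₁ : Finset B.Cell} (h₀ : IsInformationSet (B.cocycles 0) (M₀ : Set B.Cell))
    (h₁ : IsInformationSet (B.dual.cocycles 0) (M₁ : Set B.Cell))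
    {L : Finset B.Cell} (hL : L ⊆ M₁) {i : ℕ} (hi : 1 ≤ i) :
    EA.LevelIdx (i - 1) × L ↪ (EA.tensor (EncMap.ofInfoSets B M₀ M₁ h₀ h₁)).LevelIdx i where
  toFun := fun p => ⟨(p.1.1, Sum.inr ⟨p.2.1, hL p.2.2⟩), by
    change EA.deg p.1.1 + 1 = i
    rw [p.1.2]
    omega⟩
  inj' := by
    rintro ⟨x, l⟩ ⟨x', l'⟩ h
    have h1 := Prod.mk.inj (congrArg Subtype.val h)
    have h2 := Subtype.mk.inj (Sum.inr.inj h1.2)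
    exact Prod.ext (Subtype.ext h1.1) (Subtype.ext h2)

end QEC

end

/-!
The circuit switches the logical qubits of the copies of `A`, labelled by `L`, into the code of
`A ⊗ B` with one round of syndrome measurements, and all errors are handled by two facts on sparse
sets.

*The circuit.* Write `D = A ⊗ B*` and `i = j + 1`. The qubits of `A ⊗ B` of level `i` contain
the input. Gauge qubits on the level-`j` cells of `D` off `L` are added in the state `|+⟩`, the new
data qubits start in `|0⟩`. The `Z` checks of level `i` of `D`, which see the input and the gauge
qubits, are measured, then the `X` checks of `A ⊗ B`, and the gauge qubits are measured out in the
`X` basis. Isolated check cells carry no qubit, so that the number of qubits is at most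
`8 * n_out * w`. The encoded state survives because the coboundary of a cocycle of the copies can be
cancelled by gauge qubits (`exists_delD_eq`): the codewords of `ker ∂` which extend the basis vectors
of `L` exist since `L` lies in an information set. The computation of the amplitudes
(`measAmp_codeAmp`) shows that the outcome is a code state of `A ⊗ B` up to a Pauli operator
which is determined by the outcomes. The controlled NOTs of either round form a bipartite graph with
degrees at most `w`, and `2 * w` layers suffice (`exists_edge_colouring`).

*Sparse sets.* A set avoids `badSets G η γ` if it fills less than a proportion `γ` of each connected
set of at least `η` vertices. Growing the clusters of a sparse set by a bounded factor leaves it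
sparse (`Sparse.spread`). Hence faults stay sparse when controlled NOTs spread them to neighbouring
cells (`sparse_spread`). Moreover, sparse cocycles split into clusters of weight below `η`; small
clusters are coboundaries if `η` is at most the cosystolic distance (`mem_coboundaries_of_sparse`), and
coboundaries of sparse cochains if there is a flip decoder (`exists_sparse_preimage`).

*Decoding.* The syndrome of the outcomes of the `Z` checks is that of the measurement errors. A
sparse repair differs from these errors by a sparse cocycle of `D`, the coboundary of a sparse
cochain, whose part over `L` becomes the residual error. What is left is on each copy a sparse cocycle of
`A`, hence a coboundary, that is, a stabilizer (`exists_correction_X`). Phase errors are treated dually: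
the outcomes of the gauge qubits are repaired with the decoder for `D` without `L`, those
of the `X` checks with the decoder for `A ⊗ B`, and the remaining cycle acts trivially on the
copies by the systolic distance of `A` (`exists_correction_Z`). In both cases the residual error
depends on the input errors and the faults only, not on the random outcomes, as the definition of a Pauli deviation
requires.

*Mixed states and two-sided faults.* The two sides of a Pauli superoperator evolve independently.
The predicate `Tracks` records, for each value of the classical register, that the state is a
multiple of `(A ⊗ 1) ρ (B ⊗ 1)ᴴ`; the operators `A` and `B` are propagated through the circuit
separately (`tracks_gadget`, `exists_corrected_apply`), and the result is `exists_gadget`.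
-/

open scoped Kronecker ComplexOrder

noncomputable section

namespace QEC

set_option linter.unusedSectionVars false

/-! ### Sparse sets of a graph -/

/-- A set of vertices is sparse if it fills less than a proportion `γ` of every finite connected
vertex set with at least `η` elements. These are the sets which avoid `badSets G η γ`. -/
def Sparse {V : Type} (G : SimpleGraph V) (η γ : ℝ) (S : Set V) : Prop :=
  ∀ W : Finset V, (G.induce (W : Set V)).Connected → η ≤ (W.card : ℝ) →
    ((S ∩ W).ncard : ℝ) < γ * W.card

section Sparse

variable {V : Type} {G : SimpleGraph V} {η γ γ' : ℝ} {S S' : Set V}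

theorem card_pos_of_connected {W : Finset V} (h : (G.induce (W : Set V)).Connected) :
    0 < W.card := by
  obtain ⟨v⟩ := h.nonempty
  exact Finset.card_pos.2 ⟨v.1, v.2⟩

theorem avoids_badSets_iff : Avoids (badSets G η γ) S ↔ Sparse G η γ S := by
  constructor
  · intro h W hW hη
    by_contra hlt
    have hpos : (0 : ℝ) < W.card := by exact_mod_cast card_pos_of_connected hW
    refine h (S ∩ W) ⟨W, Set.inter_subset_right, hW, hη, ?_⟩ Set.inter_subset_left
    rw [le_div_iff₀ hpos]
    exact not_lt.1 hlt
  · rintro h B ⟨W, hBW, hW, hη, hγ⟩ hBS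
    have hpos : (0 : ℝ) < W.card := by exact_mod_cast card_pos_of_connected hW
    rw [le_div_iff₀ hpos] at hγ
    have h1 : B.ncard ≤ (S ∩ W).ncard :=
      Set.ncard_le_ncard (Set.subset_inter hBS hBW) (W.finite_toSet.inter_of_right _)
    have h2 : (B.ncard : ℝ) ≤ (S ∩ W).ncard := by exact_mod_cast h1
    linarith [h W hW hη]

theorem avoids_disjPow_iff {ι : Type} {bad : Set (Set V)} {S : Set (V × ι)} :
    Avoids (disjPow bad ι) S ↔ ∀ j, Avoids bad {v | (v, j) ∈ S} := by
  constructor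
  · rintro h j B hB hBS
    refine h _ ⟨j, B, hB, rfl⟩ ?_
    rintro _ ⟨v, hv, rfl⟩
    exact hBS hv
  · rintro h _ ⟨j, B, hB, rfl⟩ hS
    exact h j B hB fun v hv => hS ⟨v, hv, rfl⟩

theorem Sparse.mono (h : Sparse G η γ S) (hS : S' ⊆ S) (hγ : γ ≤ γ') : Sparse G η γ' S' := by
  intro W hW hη
  have h1 : (S' ∩ W).ncard ≤ (S ∩ W).ncard :=
    Set.ncard_le_ncard (Set.inter_subset_inter_left _ hS) (W.finite_toSet.inter_of_right _)
  have h2 : ((S' ∩ W).ncard : ℝ) ≤ (S ∩ W).ncard := by exact_mod_cast h1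
  have h3 : γ * (W.card : ℝ) ≤ γ' * W.card := by gcongr
  linarith [h W hW hη]

theorem Sparse.union (h : Sparse G η γ S) (h' : Sparse G η γ' S') :
    Sparse G η (γ + γ') (S ∪ S') := by
  intro W hW hη
  have h1 : ((S ∪ S') ∩ W).ncard ≤ (S ∩ W).ncard + (S' ∩ W).ncard := by
    rw [Set.union_inter_distrib_right]
    exact Set.ncard_union_le _ _
  have h2 : (((S ∪ S') ∩ W).ncard : ℝ) ≤ (S ∩ W).ncard + (S' ∩ W).ncard := by exact_mod_cast h1
  linarith [h W hW hη, h' W hW hη]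

theorem sparse_empty (hγ : 0 < γ) : Sparse G η γ ∅ := by
  intro W hW _
  have hpos : (0 : ℝ) < W.card := by exact_mod_cast card_pos_of_connected hW
  simpa using mul_pos hγ hpos

theorem Sparse.iUnion {ι : Type} [Fintype ι] {S : ι → Set V}
    (h : ∀ j, Sparse G η γ (S j)) (hγ' : Fintype.card ι * γ ≤ γ') (h' : 0 < γ') :
    Sparse G η γ' (⋃ j, S j) := by
  classical
  rcases isEmpty_or_nonempty ι with hι | hι
  · rw [Set.iUnion_of_empty]
    exact sparse_empty h'
  have key : ∀ s : Finset ι, s.Nonempty → Sparse G η (s.card * γ) (⋃ j ∈ s, S j) := by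
    intro s hs
    induction hs using Finset.Nonempty.cons_induction with
    | singleton a => simpa using h a
    | cons a s ha hs ih =>
      rw [Finset.card_cons]
      have h1 := (h a).union ih
      refine h1.mono ?_ (by push_cast; linarith)
      intro v hv
      simpa using hv
  have := key Finset.univ Finset.univ_nonempty
  rw [Finset.card_univ] at this
  refine this.mono ?_ hγ'
  intro v hv
  simpa using hv

/-- Gluing to a connected set finitely many connected sets that meet it. -/
theorem connected_union_biUnion {ι : Type} [DecidableEq V] {W : Finset V}
    (hW : (G.induce (W : Set V)).Connected) (s : Finset ι) (T : ι → Finset V)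
    (hT : ∀ j ∈ s, (G.induce (T j : Set V)).Preconnected) (hne : ∀ j ∈ s, ∃ v ∈ T j, v ∈ W) :
    (G.induce ((W ∪ s.biUnion T : Finset V) : Set V)).Connected := by
  classical
  induction s using Finset.induction_on with
  | empty =>
    rw [Finset.biUnion_empty, Finset.union_empty]
    exact hW
  | insert a s ha ih =>
    have ih' := ih (fun j hj => hT j (Finset.mem_insert_of_mem hj))
      (fun j hj => hne j (Finset.mem_insert_of_mem hj))
    obtain ⟨v, hvT, hvW⟩ := hne a (Finset.mem_insert_self _ _)
    have h1 := SimpleGraph.induce_union_connected ih'.preconnected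
      (hT a (Finset.mem_insert_self _ _)) ⟨v, by simp [hvW], hvT⟩
    have e : ((W ∪ (insert a s).biUnion T : Finset V) : Set V)
        = ((W ∪ s.biUnion T : Finset V) : Set V) ∪ (T a : Set V) := by
      ext x
      simp only [Finset.biUnion_insert, Finset.coe_union, Set.mem_union]
      tauto
    rw [e]
    exact h1

/-- Growing disjoint clusters of a sparse set to connected sets whose sizes are larger by a bounded
factor leaves them sparse: attaching to a connected set `W` the grown clusters which meet it
gives a connected set of comparable size, which contains the original clusters. -/
theorem Sparse.spread {ι : Type} [Fintype ι] (hS : Sparse G η γ S) {K T : ι → Finset V}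
    (hK : ∀ j, (K j : Set V) ⊆ S) (hdisj : Pairwise fun j k => Disjoint (K j) (K k))
    (hKT : ∀ j, K j ⊆ T j) (hT : ∀ j, (G.induce (T j : Set V)).Preconnected) {C : ℝ} (hC : 0 < C)
    (hcard : ∀ j, ((T j).card : ℝ) ≤ C * (K j).card) (hS' : ∀ v ∈ S', ∃ j, v ∈ T j) :
    Sparse G η (2 * C * γ) S' := by
  classical
  intro W hW hη
  by_contra hlt
  rw [not_lt] at hlt
  have hpos : (0 : ℝ) < W.card := by exact_mod_cast card_pos_of_connected hW
  set s : Finset ι := Finset.univ.filter fun j => ∃ v ∈ T j, v ∈ W with hs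
  set W' : Finset V := W ∪ s.biUnion T with hW'
  have hconn : (G.induce (W' : Set V)).Connected :=
    connected_union_biUnion hW s T (fun j _ => hT j) (fun j hj => (Finset.mem_filter.1 hj).2)
  have hWle : (W.card : ℝ) ≤ W'.card := by
    exact_mod_cast Finset.card_le_card Finset.subset_union_left
  have h1 := hS W' hconn (hη.trans hWle)
  have hk : s.biUnion K ⊆ W' := fun v hv => by
    obtain ⟨j, hj, hvj⟩ := Finset.mem_biUnion.1 hv
    exact Finset.mem_union_right _ (Finset.mem_biUnion.2 ⟨j, hj, hKT j hvj⟩)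
  have h2 : ((∑ j ∈ s, (K j).card : ℕ) : ℝ) ≤ (S ∩ W').ncard := by
    rw [← Finset.card_biUnion (fun j _ k _ hjk => hdisj hjk), ← Set.ncard_coe_finset]
    have : ((s.biUnion K : Finset V) : Set V).ncard ≤ (S ∩ W').ncard := by
      refine Set.ncard_le_ncard (fun v hv => ⟨?_, hk hv⟩) (W'.finite_toSet.inter_of_right _)
      obtain ⟨j, _, hvj⟩ := Finset.mem_biUnion.1 (Finset.mem_coe.1 hv)
      exact hK j hvj
    exact_mod_cast this
  have h3 : ((s.biUnion T).card : ℝ) ≤ C * ((∑ j ∈ s, (K j).card : ℕ) : ℝ) := by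
    calc ((s.biUnion T).card : ℝ) ≤ ((∑ j ∈ s, (T j).card : ℕ) : ℝ) := by
          exact_mod_cast Finset.card_biUnion_le
      _ ≤ C * ((∑ j ∈ s, (K j).card : ℕ) : ℝ) := by
          push_cast
          rw [Finset.mul_sum]
          exact Finset.sum_le_sum fun j _ => hcard j
  have h4 : ((S' ∩ W).ncard : ℝ) ≤ (s.biUnion T).card := by
    rw [← Set.ncard_coe_finset]
    have : (S' ∩ W).ncard ≤ ((s.biUnion T : Finset V) : Set V).ncard := by
      refine Set.ncard_le_ncard (fun v hv => ?_) (Finset.finite_toSet _)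
      obtain ⟨j, hj⟩ := hS' v hv.1
      exact Finset.mem_coe.2 (Finset.mem_biUnion.2
        ⟨j, Finset.mem_filter.2 ⟨Finset.mem_univ _, v, hj, hv.2⟩, hj⟩)
    exact_mod_cast this
  have h5 : ((S' ∩ W).ncard : ℝ) ≤ W.card := by
    rw [← Set.ncard_coe_finset W]
    exact_mod_cast Set.ncard_le_ncard Set.inter_subset_right W.finite_toSet
  have h6 : (W'.card : ℝ) ≤ W.card + (s.biUnion T).card := by
    exact_mod_cast Finset.card_union_le _ _
  set k : ℝ := ((∑ j ∈ s, (K j).card : ℕ) : ℝ)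
  have hk0 : 0 ≤ k := Nat.cast_nonneg _
  have hγ : 0 < γ := by
    by_contra hγ
    have : γ * (W'.card : ℝ) ≤ 0 := mul_nonpos_of_nonpos_of_nonneg (not_lt.1 hγ) (by positivity)
    linarith
  -- the new proportion exceeds `1` as soon as `C * γ > 1 / 2`
  have hCγ : C * γ ≤ 1 / 2 := by
    by_contra hc
    nlinarith
  have h7 : k < γ * (W.card + C * k) := by
    have : γ * (W'.card : ℝ) ≤ γ * (W.card + C * k) := by
      refine mul_le_mul_of_nonneg_left ?_ hγ.le
      linarith
    linarith
  have h8 : 2 * γ * W.card ≤ k := by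
    have : C * (2 * γ * W.card) ≤ C * k := by linarith
    exact le_of_mul_le_mul_left this hC
  nlinarith

/-- Passing from a finite sparse set to its neighbourhood. -/
theorem Sparse.neighbourhood {X : Type} [Fintype X] {ψ : X → V} (hψ : Function.Injective ψ)
    {R : X → X → Prop} (hR : ∀ x y, R x y → x = y ∨ G.Adj (ψ x) (ψ y)) {Δ : ℕ}
    (hΔ : ∀ x, {y | R x y}.ncard ≤ Δ) {E E' : Set X} (hE : Sparse G η γ (ψ '' E))
    (hE' : ∀ y ∈ E', y ∈ E ∨ ∃ x ∈ E, R x y) : Sparse G η (2 * (1 + Δ) * γ) (ψ '' E') := by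
  classical
  refine hE.spread (ι := E) (K := fun x => {ψ x.1})
    (T := fun x => insert (ψ x.1) ((Finset.univ.filter fun y => R x.1 y).image ψ))
    ?_ ?_ ?_ ?_ (by positivity) ?_ ?_
  · rintro ⟨x, hx⟩
    simpa using ⟨x, hx, rfl⟩
  · rintro ⟨x, hx⟩ ⟨y, hy⟩ hxy
    simp only [Finset.disjoint_singleton, ne_eq]
    intro h
    exact hxy (Subtype.ext (hψ h))
  · intro x
    simp
  · rintro ⟨x, hx⟩
    have hr : ∀ v : ((insert (ψ x) ((Finset.univ.filter fun y => R x y).image ψ) : Finset V) :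
        Set V), (G.induce _).Reachable ⟨ψ x, by simp⟩ v := by
      rintro ⟨v, hv⟩
      have hv' := hv
      rw [Finset.coe_insert, Set.mem_insert_iff] at hv'
      rcases hv' with rfl | hv'
      · exact SimpleGraph.Reachable.refl _
      · obtain ⟨y, hy, rfl⟩ := Finset.mem_image.1 (Finset.mem_coe.1 hv')
        rcases hR x y (Finset.mem_filter.1 hy).2 with rfl | h
        · exact SimpleGraph.Reachable.refl _
        · exact SimpleGraph.Adj.reachable (by simpa using h)
    intro u v
    exact (hr u).symm.trans (hr v)
  · rintro ⟨x, hx⟩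
    have h1 : ((Finset.univ.filter fun y => R x y).image ψ).card ≤ Δ := by
      refine Finset.card_image_le.trans ?_
      rw [← Set.ncard_coe_finset]
      simpa using hΔ x
    have h2 := Finset.card_insert_le (ψ x) ((Finset.univ.filter fun y => R x y).image ψ)
    have h3 : (insert (ψ x) ((Finset.univ.filter fun y => R x y).image ψ)).card ≤ 1 + Δ := by
      omega
    simp only [Finset.card_singleton, Nat.cast_one, mul_one]
    exact_mod_cast h3
  · rintro _ ⟨y, hy, rfl⟩
    rcases hE' y hy with h | ⟨x, hx, hxy⟩
    · exact ⟨⟨y, h⟩, by simp⟩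
    · refine ⟨⟨x, hx⟩, Finset.mem_insert_of_mem (Finset.mem_image_of_mem _ ?_)⟩
      simpa using hxy

end Sparse

/-! ### Sparse cocycles -/

namespace BasedComplex

variable {r : ℕ}

theorem coboundary_apply (K : BasedComplex r) (f : K.Cell → ZMod 2) (c' : K.Cell) :
    K.coboundary f c' = ∑ c, f c * K.inc c c' := rfl

theorem hammingNorm_eq_card {X : Type} [Fintype X] [DecidableEq X] (f : X → ZMod 2) :
    hammingNorm f = (Finset.univ.filter fun c => f c ≠ 0).card := rfl

/-- A cocycle splits into cocycles supported on the connected components of the incidence graph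
between its support and the cells above it; each component has size comparable with the weight
of its piece of the cocycle. -/
theorem exists_cluster_decomposition (K : BasedComplex r) {V : Type} {G : SimpleGraph V}
    {ψ : K.Cell → V} {i w : ℕ}
    (hadj : ∀ c c', K.deg c = i → K.inc c c' ≠ 0 → G.Adj (ψ c) (ψ c'))
    (hup : ∀ c, {c' | K.inc c c' ≠ 0}.ncard ≤ w) {e : K.Cell → ZMod 2} (he : e ∈ K.cocycles i) :
    ∃ (ι : Type) (_ : Fintype ι) (E : ι → K.Cell → ZMod 2) (Z : ι → Finset V),
      (∀ j, E j ∈ K.cocycles i) ∧ e = ∑ j, E j ∧ (∀ j c, E j c ≠ 0 → e c ≠ 0 ∧ ψ c ∈ Z j) ∧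
      (∀ j k c, E j c ≠ 0 → E k c ≠ 0 → j = k) ∧ (∀ j, (G.induce (Z j : Set V)).Preconnected) ∧
      ∀ j, (Z j).card ≤ (1 + w) * hammingNorm (E j) := by
  classical
  have hlev := he.1
  have hker : K.coboundary e = 0 := he.2
  -- the pieces are the restrictions of `e` to the connected components of `H`
  set H : SimpleGraph K.Cell := SimpleGraph.fromRel fun c c' => e c ≠ 0 ∧ K.inc c c' ≠ 0 with hH
  have hincne : ∀ c c', K.inc c c' ≠ 0 → c ≠ c' := by
    rintro c c' h rfl
    have := K.inc_deg _ _ h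
    omega
  have hdeg : ∀ c, e c ≠ 0 → K.deg c = i := fun c hc => by
    by_contra h
    exact hc (hlev c h)
  have hHadj : ∀ c c', e c ≠ 0 → K.inc c c' ≠ 0 → H.Adj c c' := fun c c' h1 h2 =>
    (SimpleGraph.fromRel_adj _ _ _).2 ⟨hincne _ _ h2, Or.inl ⟨h1, h2⟩⟩
  have hHG : ∀ c c', H.Adj c c' → G.Adj (ψ c) (ψ c') := fun c c' h => by
    rcases ((SimpleGraph.fromRel_adj _ _ _).1 h).2 with ⟨h1, h2⟩ | ⟨h1, h2⟩
    · exact hadj _ _ (hdeg _ h1) h2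
    · exact (hadj _ _ (hdeg _ h1) h2).symm
  have hcomp : ∀ c c', e c ≠ 0 → K.inc c c' ≠ 0 →
      H.connectedComponentMk c = H.connectedComponentMk c' := fun c c' h1 h2 =>
    SimpleGraph.ConnectedComponent.eq.2 (hHadj _ _ h1 h2).reachable
  let E : H.ConnectedComponent → K.Cell → ZMod 2 := fun κ c =>
    if H.connectedComponentMk c = κ then e c else 0
  have hE : ∀ κ c, E κ c ≠ 0 → H.connectedComponentMk c = κ ∧ e c ≠ 0 := by
    intro κ c h
    by_cases h1 : H.connectedComponentMk c = κ
    · exact ⟨h1, by simpa [E, h1] using h⟩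
    · simp [E, h1] at h
  let Z : H.ConnectedComponent → Finset V := fun κ =>
    if E κ = 0 then ∅ else (Finset.univ.filter fun c => H.connectedComponentMk c = κ).image ψ
  refine ⟨H.ConnectedComponent, Fintype.ofFinite _, E, Z, ?_, ?_, ?_, ?_, ?_, ?_⟩
  · intro κ
    refine ⟨fun c hc => by simp [E, hlev c hc], ?_⟩
    change K.coboundary (E κ) = 0
    funext c''
    rw [coboundary_apply]
    by_cases h : H.connectedComponentMk c'' = κ
    · rw [← hker, coboundary_apply]
      refine Finset.sum_congr rfl fun c _ => ?_
      by_cases h1 : e c ≠ 0 ∧ K.inc c c'' ≠ 0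
      · have := (hcomp _ _ h1.1 h1.2).trans h
        simp [E, this]
      · by_cases h2 : e c = 0
        · simp [E, h2]
        · have h3 : K.inc c c'' = 0 := by
            by_contra h3
            exact h1 ⟨h2, h3⟩
          simp [h3]
    · refine Finset.sum_eq_zero fun c _ => ?_
      by_contra h1
      obtain ⟨h2, h3⟩ := hE κ c (left_ne_zero_of_mul h1)
      exact h ((hcomp _ _ h3 (right_ne_zero_of_mul h1)).symm.trans h2)
  · funext c
    rw [Finset.sum_apply]
    simp [E]
  · intro κ c h
    obtain ⟨h1, h2⟩ := hE κ c h
    refine ⟨h2, ?_⟩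
    have h3 : E κ ≠ 0 := fun h3 => h (congrFun h3 c)
    simp only [Z, h3, if_false]
    exact Finset.mem_image_of_mem _ (by simpa using h1)
  · intro j k c h1 h2
    exact (hE j c h1).1.symm.trans (hE k c h2).1
  · intro κ
    by_cases h3 : E κ = 0
    · rintro ⟨v, hv⟩
      simp [Z, h3] at hv
    have hZ : (Z κ : Set V) = ψ '' κ.supp := by
      simp only [Z, h3, if_false]
      ext v
      simp [SimpleGraph.ConnectedComponent.mem_supp_iff]
    rw [hZ]
    rintro ⟨_, u, hu, rfl⟩ ⟨_, v, hv, rfl⟩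
    have hr := κ.connected_toSimpleGraph.preconnected ⟨u, hu⟩ ⟨v, hv⟩
    let f : κ.toSimpleGraph →g G.induce (ψ '' κ.supp) :=
      ⟨fun x => ⟨ψ x.1, x.1, x.2, rfl⟩, fun {a b} hab => by
        have : H.Adj a.1 b.1 := hab
        exact hHG _ _ this⟩
    exact hr.map f
  · intro κ
    by_cases h3 : E κ = 0
    · simp [Z, h3]
    obtain ⟨c₀, hc₀⟩ : ∃ c, E κ c ≠ 0 := by
      by_contra h
      push Not at h
      exact h3 (funext h)
    have hsub : (Finset.univ.filter fun c => H.connectedComponentMk c = κ) ⊆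
        (Finset.univ.filter fun c => E κ c ≠ 0).biUnion
          fun c => insert c (Finset.univ.filter fun c' => K.inc c c' ≠ 0) := by
      intro v hv
      have hv' : H.connectedComponentMk v = κ := by simpa using hv
      have hr : H.Reachable c₀ v :=
        SimpleGraph.ConnectedComponent.eq.1 ((hE κ c₀ hc₀).1.trans hv'.symm)
      rw [SimpleGraph.reachable_iff_reflTransGen] at hr
      rw [Finset.mem_biUnion]
      rcases Relation.ReflTransGen.cases_tail hr with h | ⟨b, _, hbv⟩
      · exact ⟨c₀, by simpa using hc₀, by simp [h]⟩
      · rcases ((SimpleGraph.fromRel_adj _ _ _).1 hbv).2 with ⟨h1, h2⟩ | ⟨h1, h2⟩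
        · refine ⟨b, ?_, by simp [h2]⟩
          have := (hcomp _ _ h1 h2).trans hv'
          simp [E, this, h1]
        · refine ⟨v, ?_, by simp⟩
          simp [E, hv', h1]
    simp only [Z, h3, if_false]
    refine Finset.card_image_le.trans ((Finset.card_le_card hsub).trans ?_)
    refine Finset.card_biUnion_le.trans ?_
    have h4 : ∀ c ∈ Finset.univ.filter (fun c => E κ c ≠ 0),
        (insert c (Finset.univ.filter fun c' => K.inc c c' ≠ 0)).card ≤ 1 + w := by
      intro c _
      have h5 := Finset.card_insert_le c (Finset.univ.filter fun c' => K.inc c c' ≠ 0)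
      have h6 : (Finset.univ.filter fun c' => K.inc c c' ≠ 0).card ≤ w := by
        rw [← Set.ncard_coe_finset]
        simpa using hup c
      omega
    refine (Finset.sum_le_card_nsmul _ _ _ h4).trans ?_
    rw [smul_eq_mul, mul_comm]
    rfl

variable {K : BasedComplex r} {V : Type} {G : SimpleGraph V} {ψ : K.Cell → V} {i w : ℕ}
  {η γ : ℝ}

/-- The clusters of a sparse cocycle have weight below `η`. -/
theorem cluster_weight_lt {S : Set V} (hS : Sparse G η γ S) (hγ : γ * (1 + w) ≤ 1) (hη : 0 < η)
    {E : K.Cell → ZMod 2} {Z : Finset V} (hE : ∀ c, E c ≠ 0 → ψ c ∈ S ∧ ψ c ∈ Z)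
    (hψ : Function.Injective ψ) (hZ : (G.induce (Z : Set V)).Preconnected)
    (hcard : Z.card ≤ (1 + w) * hammingNorm E) : (hammingNorm E : ℝ) < η := by
  classical
  have hsub : (Finset.univ.filter fun c => E c ≠ 0).image ψ ⊆ Z := by
    intro v hv
    obtain ⟨c, hc, rfl⟩ := Finset.mem_image.1 hv
    exact (hE c (by simpa using hc)).2
  have hle : hammingNorm E ≤ Z.card := by
    rw [hammingNorm_eq_card, ← Finset.card_image_of_injective _ hψ]
    exact Finset.card_le_card hsub
  by_contra hlt
  rw [not_lt] at hlt
  have hpos : (0 : ℝ) < hammingNorm E := lt_of_lt_of_le hη hlt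
  have hpos' : 0 < hammingNorm E := by exact_mod_cast hpos
  have hle' : (hammingNorm E : ℝ) ≤ Z.card := by exact_mod_cast hle
  obtain ⟨v, hv⟩ := Finset.card_pos.1 (lt_of_lt_of_le hpos' hle)
  have : Nonempty (Z : Set V) := ⟨⟨v, hv⟩⟩
  have h1 := hS Z ⟨hZ⟩ (hlt.trans hle')
  have h2 : (hammingNorm E : ℝ) ≤ (S ∩ Z).ncard := by
    rw [hammingNorm_eq_card, ← Finset.card_image_of_injective _ hψ, ← Set.ncard_coe_finset]
    have : ((((Finset.univ.filter fun c => E c ≠ 0).image ψ : Finset V)) : Set V).ncard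
        ≤ (S ∩ Z).ncard := by
      refine Set.ncard_le_ncard (fun v hv => ?_) (Z.finite_toSet.inter_of_right _)
      obtain ⟨c, hc, rfl⟩ := Finset.mem_image.1 (Finset.mem_coe.1 hv)
      exact hE c (by simpa using hc)
    exact_mod_cast this
  have h3 : (Z.card : ℝ) ≤ (1 + w) * hammingNorm E := by exact_mod_cast hcard
  have hγ0 : 0 < γ := by
    by_contra hγ0
    have : γ * (Z.card : ℝ) ≤ 0 := mul_nonpos_of_nonpos_of_nonneg (not_lt.1 hγ0) (by positivity)
    linarith
  have h4 : γ * (Z.card : ℝ) ≤ γ * ((1 + w) * hammingNorm E) :=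
    mul_le_mul_of_nonneg_left h3 hγ0.le
  nlinarith

/-- A sparse cocycle is a coboundary if `η` is at most the cosystolic distance. -/
theorem mem_coboundaries_of_sparse (hψ : Function.Injective ψ)
    (hadj : ∀ c c', K.deg c = i → K.inc c c' ≠ 0 → G.Adj (ψ c) (ψ c'))
    (hup : ∀ c, {c' | K.inc c c' ≠ 0}.ncard ≤ w) (hη : 0 < η) (hγ : γ * (1 + w) ≤ 1)
    (hdist : K.LeCosystolicDistance i η) {e : K.Cell → ZMod 2} (he : e ∈ K.cocycles i)
    (hS : Sparse G η γ (ψ '' {c | e c ≠ 0})) : e ∈ K.coboundaries i := by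
  obtain ⟨ι, _, E, Z, h1, h2, h3, _, h5, h6⟩ := K.exists_cluster_decomposition hadj hup he
  rw [h2]
  refine Submodule.sum_mem _ fun j _ => ?_
  by_contra hj
  have := cluster_weight_lt hS hγ hη (fun c hc => ⟨⟨c, (h3 j c hc).1, rfl⟩, (h3 j c hc).2⟩) hψ
    (h5 j) (h6 j)
  linarith [hdist _ (h1 j) hj]

/-- Decoding a single cocycle by flips. The set `T` of cells touched stays connected to the support
of the cocycle. -/
theorem exists_local_preimage {m : ℕ} (hdec : K.HasErrorFlipDecoder m i)
    (hlink : ∀ b c c', K.deg b = 0 → K.Below b c → K.Below b c' → c ≠ c' → G.Adj (ψ c) (ψ c'))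
    (hsize : ∀ b, K.deg b = 0 → {c | K.Below b c}.ncard ≤ w) :
    ∀ (n : ℕ) (e : K.Cell → ZMod 2), e ∈ K.cocycles i → hammingNorm e ≤ n → n ≤ m →
      ∃ f ∈ K.level (i - 1), K.coboundary f = e ∧ ∃ T : Finset K.Cell, T.card ≤ w * n ∧
        (∀ c, f c ≠ 0 → c ∈ T) ∧ ∀ Z : Set V, (G.induce Z).Preconnected →
          (∀ c, e c ≠ 0 → ψ c ∈ Z) → (G.induce (Z ∪ ψ '' T)).Preconnected := by
  classical
  intro n
  induction n with
  | zero =>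
    intro e he hn _
    have h0 : e = 0 := hammingNorm_eq_zero.1 (Nat.le_zero.1 hn)
    refine ⟨0, Submodule.zero_mem _, by rw [map_zero, h0], ∅, by simp, by simp, ?_⟩
    intro Z hZ _
    rw [Finset.coe_empty, Set.image_empty, Set.union_empty]
    exact hZ
  | succ n ih =>
    intro e he hn hm
    by_cases h0 : e = 0
    · refine ⟨0, Submodule.zero_mem _, by rw [map_zero, h0], ∅, by simp, by simp, ?_⟩
      intro Z hZ _
      rw [Finset.coe_empty, Set.image_empty, Set.union_empty]
      exact hZ
    have hker : K.coboundary e = 0 := he.2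
    obtain ⟨b, hb, ⟨j, rfl, x, hx, hbx, hlt⟩ | ⟨x, hx, hbx, hlt⟩⟩ := hdec e he.1 h0 (hn.trans hm)
    -- the second kind of flip would lower the weight of the syndrome, which is zero
    swap
    · rw [hker, hammingNorm_zero] at hlt
      exact absurd hlt (Nat.not_lt_zero _)
    have hδδ : ∀ y, K.coboundary (K.coboundary y) = 0 := by
      intro y
      funext c''
      simp only [coboundary_apply, Finset.sum_mul, Pi.zero_apply]
      rw [Finset.sum_comm]
      refine Finset.sum_eq_zero fun c _ => ?_
      simp only [mul_assoc]
      rw [← Finset.mul_sum, K.inc_inc, mul_zero]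
    have hδb : ∀ c, K.coboundary x c ≠ 0 → K.Below b c := by
      intro c hc
      rw [coboundary_apply] at hc
      obtain ⟨c', _, hc'⟩ := Finset.exists_ne_zero_of_sum_ne_zero hc
      exact (hbx c' (left_ne_zero_of_mul hc')).tail (right_ne_zero_of_mul hc')
    have hδlev : K.coboundary x ∈ K.level (j + 1) := by
      intro c hc
      rw [coboundary_apply]
      refine Finset.sum_eq_zero fun c' _ => ?_
      by_contra h
      have h1 := K.inc_deg _ _ (right_ne_zero_of_mul h)
      have h2 : K.deg c' = j := by
        by_contra h2
        exact left_ne_zero_of_mul h (hx c' h2)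
      omega
    -- a flip which lowers the weight meets the support of `e`
    obtain ⟨c₀, hc₀, hc₀'⟩ : ∃ c, e c ≠ 0 ∧ K.coboundary x c ≠ 0 := by
      by_contra hno
      push Not at hno
      refine absurd hlt (not_lt.2 ?_)
      rw [hammingNorm_eq_card, hammingNorm_eq_card]
      refine Finset.card_le_card fun c hc => ?_
      simp only [Finset.mem_filter, Finset.mem_univ, true_and] at hc ⊢
      simpa [hno c hc] using hc
    obtain ⟨f, hf, hfe, T, hT, hfT, hconn⟩ := ih (e + K.coboundary x)
      ⟨Submodule.add_mem _ he.1 hδlev, by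
        change K.coboundary _ = 0
        rw [map_add, hker, hδδ, add_zero]⟩ (by omega) (by omega)
    have hxx : K.coboundary x + K.coboundary x = 0 := by
      funext c
      exact CharTwo.add_self_eq_zero _
    set U : Finset K.Cell := Finset.univ.filter fun c => K.Below b c with hU
    refine ⟨f + x, Submodule.add_mem _ hf hx, by rw [map_add, hfe, add_assoc, hxx, add_zero],
      T ∪ U, ?_, ?_, ?_⟩
    · refine (Finset.card_union_le _ _).trans ?_
      have : U.card ≤ w := by
        rw [← Set.ncard_coe_finset]
        simpa [hU] using hsize b hb
      rw [Nat.mul_succ]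
      omega
    · intro c hc
      by_cases h : f c = 0
      · have h1 : x c ≠ 0 := by simpa [h] using hc
        exact Finset.mem_union_right _ (by simpa [hU] using hbx c h1)
      · exact Finset.mem_union_left _ (hfT c h)
    · intro Z hZ hZe
      have hUc : (G.induce (ψ '' (U : Set K.Cell))).Preconnected := by
        rintro ⟨_, u, hu, rfl⟩ ⟨_, v, hv, rfl⟩
        by_cases huv : u = v
        · subst huv
          exact SimpleGraph.Reachable.refl _
        · refine SimpleGraph.Adj.reachable ?_
          exact hlink b u v hb (by simpa [hU] using hu) (by simpa [hU] using hv) huv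
      have h1 := SimpleGraph.induce_union_connected hZ hUc
        ⟨ψ c₀, hZe c₀ hc₀, c₀, by simpa [hU] using hδb c₀ hc₀', rfl⟩
      have h2 := hconn _ h1.preconnected ?_
      · have e1 : Z ∪ ψ '' (U : Set K.Cell) ∪ ψ '' (T : Set K.Cell)
            = Z ∪ ψ '' ((T ∪ U : Finset K.Cell) : Set K.Cell) := by
          rw [Finset.coe_union, Set.image_union, Set.union_assoc]
          congr 1
          exact Set.union_comm _ _
        rw [e1] at h2
        exact h2
      · intro c hc
        by_cases h : e c = 0
        · have h3 : K.coboundary x c ≠ 0 := by simpa [h] using hc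
          exact Or.inr ⟨c, by simpa [hU] using hδb c h3, rfl⟩
        · exact Or.inl (hZe c h)

/-- A sparse cocycle is the coboundary of a sparse cochain if small cochains can be decoded by
flips. -/
theorem exists_sparse_preimage {m u : ℕ} (hdec : K.HasErrorFlipDecoder m i)
    (hψ : Function.Injective ψ)
    (hadj : ∀ c c', K.deg c = i → K.inc c c' ≠ 0 → G.Adj (ψ c) (ψ c'))
    (hup : ∀ c, {c' | K.inc c c' ≠ 0}.ncard ≤ w)
    (hlink : ∀ b c c', K.deg b = 0 → K.Below b c → K.Below b c' → c ≠ c' → G.Adj (ψ c) (ψ c'))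
    (hsize : ∀ b, K.deg b = 0 → {c | K.Below b c}.ncard ≤ u)
    (hη : 0 < η) (hηm : η ≤ m) (hγ : γ * (1 + w) ≤ 1) {e : K.Cell → ZMod 2}
    (he : e ∈ K.cocycles i) (hS : Sparse G η γ (ψ '' {c | e c ≠ 0})) :
    ∃ f ∈ K.level (i - 1), K.coboundary f = e ∧
      Sparse G η (2 * (1 + w + u) * γ) (ψ '' {c | f c ≠ 0}) := by
  classical
  obtain ⟨ι, _, E, Z, h1, h2, h3, h4, h5, h6⟩ := K.exists_cluster_decomposition hadj hup he
  have hlt : ∀ j, (hammingNorm (E j) : ℝ) < η := fun j =>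
    cluster_weight_lt hS hγ hη (fun c hc => ⟨⟨c, (h3 j c hc).1, rfl⟩, (h3 j c hc).2⟩) hψ
      (h5 j) (h6 j)
  have hm : ∀ j, hammingNorm (E j) ≤ m := fun j => by
    have := (hlt j).trans_le hηm
    exact_mod_cast this.le
  choose f hf hfe T hT hfT hconn using fun j =>
    exists_local_preimage hdec hlink hsize _ (E j) (h1 j) le_rfl (hm j)
  refine ⟨∑ j, f j, Submodule.sum_mem _ fun j _ => hf j, ?_, ?_⟩
  · rw [map_sum, h2]
    exact Finset.sum_congr rfl fun j _ => hfe j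
  · refine hS.spread (ι := ι) (K := fun j => (Finset.univ.filter fun c => E j c ≠ 0).image ψ)
      (T := fun j => Z j ∪ (T j).image ψ) ?_ ?_ ?_ ?_ (by positivity) ?_ ?_
    · intro j v hv
      obtain ⟨c, hc, rfl⟩ := Finset.mem_image.1 (Finset.mem_coe.1 hv)
      exact ⟨c, (h3 j c (by simpa using hc)).1, rfl⟩
    · intro j k hjk
      rw [Finset.disjoint_left]
      intro v hv hv'
      obtain ⟨c, hc, rfl⟩ := Finset.mem_image.1 hv
      obtain ⟨c', hc', hcc⟩ := Finset.mem_image.1 hv'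
      obtain rfl := hψ hcc
      exact hjk (h4 j k _ (by simpa using hc) (by simpa using hc'))
    · intro j v hv
      obtain ⟨c, hc, rfl⟩ := Finset.mem_image.1 hv
      exact Finset.mem_union_left _ (h3 j c (by simpa using hc)).2
    · intro j
      have := hconn j (Z j) (h5 j) fun c hc => (h3 j c hc).2
      rw [Finset.coe_union, Finset.coe_image]
      exact this
    · intro j
      rw [Finset.card_image_of_injective _ hψ]
      have h7 : (Z j ∪ (T j).image ψ).card ≤ (1 + w + u) * hammingNorm (E j) := by
        refine (Finset.card_union_le _ _).trans ?_
        have h8 := (Finset.card_image_le (s := T j) (f := ψ)).trans (hT j)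
        have h9 := h6 j
        rw [add_mul]
        omega
      exact_mod_cast h7
    · rintro _ ⟨c, hc, rfl⟩
      rw [Set.mem_ofPred_eq, Finset.sum_apply] at hc
      obtain ⟨j, _, hj⟩ := Finset.exists_ne_zero_of_sum_ne_zero hc
      exact ⟨j, Finset.mem_union_right _ (Finset.mem_image_of_mem _ (hfT j c hj))⟩

end BasedComplex

/-! ### Geometry of the product complexes -/

namespace BasedComplex

variable {r s : ℕ}

theorem inc_self (K : BasedComplex r) (c : K.Cell) : K.inc c c = 0 := by
  by_contra h
  have := K.inc_deg _ _ h
  omega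

theorem dual_coboundary_apply (K : BasedComplex r) (f : K.Cell → ZMod 2) (c' : K.Cell) :
    K.dual.coboundary f c' = ∑ c, f c * K.inc c' c := rfl

theorem coboundary_coboundary (K : BasedComplex r) (y : K.Cell → ZMod 2) :
    K.coboundary (K.coboundary y) = 0 := by
  funext c''
  simp only [coboundary_apply, Finset.sum_mul, Pi.zero_apply]
  rw [Finset.sum_comm]
  refine Finset.sum_eq_zero fun c _ => ?_
  simp only [mul_assoc]
  rw [← Finset.mul_sum, K.inc_inc, mul_zero]

theorem coboundary_dotProduct (K : BasedComplex r) (x y : K.Cell → ZMod 2) :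
    K.coboundary x ⬝ᵥ y = x ⬝ᵥ K.dual.coboundary y := by
  simp only [dotProduct, coboundary_apply, dual_coboundary_apply, Finset.sum_mul, Finset.mul_sum]
  rw [Finset.sum_comm]
  exact Finset.sum_congr rfl fun _ _ => Finset.sum_congr rfl fun _ _ => by ring

theorem coboundary_mem_level (K : BasedComplex r) {j : ℕ} {x : K.Cell → ZMod 2}
    (hx : x ∈ K.level j) : K.coboundary x ∈ K.level (j + 1) := by
  intro c hc
  rw [coboundary_apply]
  refine Finset.sum_eq_zero fun c' _ => ?_
  by_contra h
  have h1 := K.inc_deg _ _ (right_ne_zero_of_mul h)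
  have h2 : K.deg c' = j := by
    by_contra h2
    exact left_ne_zero_of_mul h (hx c' h2)
  omega

theorem dual_below_iff (K : BasedComplex r) {c c' : K.Cell} : K.dual.Below c c' ↔ K.Below c' c := by
  change Relation.ReflTransGen (fun a b => K.inc b a ≠ 0) c c' ↔ _
  exact Relation.reflTransGen_swap

theorem tensor_inc (K : BasedComplex r) (K' : BasedComplex s) (c c' : K.Cell × K'.Cell) :
    (K.tensor K').inc c c' = (if c.2 = c'.2 then K.inc c.1 c'.1 else 0) +
      (if c.1 = c'.1 then K'.inc c.2 c'.2 else 0) := rfl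

theorem tensor_inc_left (K : BasedComplex r) (K' : BasedComplex s) (a a' : K.Cell) (b : K'.Cell) :
    (K.tensor K').inc (a, b) (a', b) = K.inc a a' := by
  simp [tensor_inc, inc_self]

theorem tensor_inc_right (K : BasedComplex r) (K' : BasedComplex s) (a : K.Cell) (b b' : K'.Cell) :
    (K.tensor K').inc (a, b) (a, b') = K'.inc b b' := by
  simp [tensor_inc, inc_self]

theorem tensor_inc_cases {K : BasedComplex r} {K' : BasedComplex s} {c c' : K.Cell × K'.Cell}
    (h : (K.tensor K').inc c c' ≠ 0) :
    (c.2 = c'.2 ∧ K.inc c.1 c'.1 ≠ 0) ∨ (c.1 = c'.1 ∧ K'.inc c.2 c'.2 ≠ 0) := by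
  rw [tensor_inc] at h
  by_cases h1 : c.2 = c'.2 ∧ K.inc c.1 c'.1 ≠ 0
  · exact Or.inl h1
  · right
    have e1 : (if c.2 = c'.2 then K.inc c.1 c'.1 else 0) = 0 := by
      split_ifs with h5
      · by_contra h6
        exact h1 ⟨h5, h6⟩
      · rfl
    rw [e1, zero_add] at h
    by_cases h2 : c.1 = c'.1
    · exact ⟨h2, by simpa [h2] using h⟩
    · simp [h2] at h

theorem tensor_below_left (K : BasedComplex r) (K' : BasedComplex s) {a a' : K.Cell} (b : K'.Cell)
    (h : K.Below a a') : (K.tensor K').Below (a, b) (a', b) := by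
  refine Relation.ReflTransGen.lift (fun x => ((x, b) : K.Cell × K'.Cell)) ?_ _ _ h
  intro x y hxy
  change (K.tensor K').inc (x, b) (y, b) ≠ 0
  rwa [tensor_inc_left]

theorem tensor_below_right (K : BasedComplex r) (K' : BasedComplex s) (a : K.Cell) {b b' : K'.Cell}
    (h : K'.Below b b') : (K.tensor K').Below (a, b) (a, b') := by
  refine Relation.ReflTransGen.lift (fun x => ((a, x) : K.Cell × K'.Cell)) ?_ _ _ h
  intro x y hxy
  change (K.tensor K').inc (a, x) (a, y) ≠ 0
  rwa [tensor_inc_right]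

theorem below_of_tensor_below {K : BasedComplex r} {K' : BasedComplex s} {c c' : K.Cell × K'.Cell}
    (h : (K.tensor K').Below c c') : K.Below c.1 c'.1 ∧ K'.Below c.2 c'.2 := by
  induction h with
  | refl => exact ⟨Relation.ReflTransGen.refl, Relation.ReflTransGen.refl⟩
  | tail _ h2 ih =>
    rcases tensor_inc_cases h2 with ⟨h3, h4⟩ | ⟨h3, h4⟩
    · exact ⟨ih.1.tail h4, h3 ▸ ih.2⟩
    · exact ⟨h3 ▸ ih.1, ih.2.tail h4⟩

/-- A cell which lies above a cell of level `0` or below a cell of top level. -/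
def Anchored (K : BasedComplex r) (c : K.Cell) : Prop :=
  (∃ b, K.deg b = 0 ∧ K.Below b c) ∨ ∃ t, K.deg t = r ∧ K.Below c t

theorem Linked.anchored {K : BasedComplex r} {c c' : K.Cell} (h : K.Linked c c') :
    K.Anchored c :=
  h.imp (fun ⟨b, h0, h1, _⟩ => ⟨b, h0, h1⟩) fun ⟨t, h0, h1, _⟩ => ⟨t, h0, h1⟩

/-- Where single-cell errors can be decoded by flips, every cell or one of the cells incident to it
from above lies above a cell of level `0`. -/
theorem HasErrorFlipDecoder.exists_below {K : BasedComplex r} {m i : ℕ}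
    (h : K.HasErrorFlipDecoder m i) (hm : 1 ≤ m) {c : K.Cell} (hc : K.deg c = i) :
    ∃ b, K.deg b = 0 ∧ (K.Below b c ∨ ∃ c', K.inc c c' ≠ 0 ∧ K.Below b c') := by
  classical
  set e : K.Cell → ZMod 2 := Pi.single c 1 with he
  have hec : ∀ c', e c' ≠ 0 → c' = c := fun c' h' => by
    by_contra hne
    exact h' (Pi.single_eq_of_ne hne _)
  have hnorm : hammingNorm e = 1 := by
    rw [hammingNorm_eq_card, Finset.card_eq_one]
    refine ⟨c, ?_⟩
    ext c'
    simp only [Finset.mem_filter, Finset.mem_univ, true_and, Finset.mem_singleton]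
    refine ⟨hec c', ?_⟩
    rintro rfl
    simp [he]
  have he0 : e ≠ 0 := by
    intro h0
    rw [h0, hammingNorm_zero] at hnorm
    exact zero_ne_one hnorm
  have hδe : ∀ c', K.coboundary e c' = K.inc c c' := fun c' => by
    rw [coboundary_apply, Finset.sum_eq_single c]
    · simp [he]
    · intro b _ hb
      rw [he, Pi.single_eq_of_ne hb, zero_mul]
    · simp
  obtain ⟨b, hb, ⟨j, _, x, _, hbx, hlt⟩ | ⟨x, _, hbx, hlt⟩⟩ := h e (fun c' hc' => by
    by_contra hne
    exact hc' (hec c' hne ▸ hc)) he0 (hnorm.trans_le hm)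
  all_goals
    have hδb : ∀ c, K.coboundary x c ≠ 0 → K.Below b c := by
      intro c hc
      rw [coboundary_apply] at hc
      obtain ⟨c', _, hc'⟩ := Finset.exists_ne_zero_of_sum_ne_zero hc
      exact (hbx c' (left_ne_zero_of_mul hc')).tail (right_ne_zero_of_mul hc')
    refine ⟨b, hb, ?_⟩
  · left
    refine hδb c fun h0 => ?_
    have h1 : (e + K.coboundary x) c = 1 := by
      rw [Pi.add_apply, h0]
      simp [he]
    rw [hnorm, Nat.lt_one_iff, hammingNorm_eq_zero] at hlt
    rw [hlt] at h1
    exact zero_ne_one h1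
  · right
    by_contra hno
    push Not at hno
    refine absurd hlt (not_lt.2 ?_)
    rw [hammingNorm_eq_card, hammingNorm_eq_card]
    refine Finset.card_le_card fun c' hc' => ?_
    simp only [Finset.mem_filter, Finset.mem_univ, true_and] at hc' ⊢
    have h1 : K.coboundary x c' = 0 := by
      by_contra h2
      rw [hδe] at hc'
      exact hno c' hc' (hδb c' h2)
    rw [map_add, Pi.add_apply, h1, add_zero]
    exact hc'

end BasedComplex

open BasedComplex

/-- The hypotheses under which the logical qubits of the copies, labelled by `L`, of the level-`j`
code of `A` can be switched into the level-`(j + 1)` code of `A ⊗ B`. -/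
structure IsSwitching {d : ℕ} (A : BasedComplex d) (B : BasedComplex 1) (L : Finset B.Cell)
    (w m j : ℕ) {V : Type} (G : SimpleGraph V) (φ : A.Cell × B.Cell → V) (η : ℝ) : Prop where
  linked : ∀ a a', A.inc a a' ≠ 0 → A.Linked a a'
  locality : (A.tensor B).HasLocality w
  one_le : 1 ≤ j
  succ_le : j + 1 ≤ d
  decC : (A.tensor B).dual.HasErrorFlipDecoder m (d + 1 - j)
  decD : (A.tensor B.dual).HasErrorFlipDecoder m (j + 1)
  decDL : (A.tensor (B.removeCells L).dual).dual.HasErrorFlipDecoder m (d + 1 - j)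
  inj : Function.Injective φ
  adjC : ∀ c c', (A.tensor B).connGraph.Adj c c' → G.Adj (φ c) (φ c')
  adjD : ∀ c c', (A.tensor B.dual).connGraph.Adj c c' → G.Adj (φ c) (φ c')
  eta_pos : 0 < η
  eta_le : η ≤ m
  syst : A.dual.LeCosystolicDistance (d - j) η
  cosyst : A.LeCosystolicDistance j η
  codeword : ∀ l ∈ L, ∃ c ∈ B.dual.cocycles 0, c l = 1 ∧ ∀ l' ∈ L, l' ≠ l → c l' = 0

/-- Incidence in either direction between cells of the product `A ⊗ B`. It is the same relation if
`B` is dualized. -/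
def Nbr {d : ℕ} (A : BasedComplex d) (B : BasedComplex 1) (c c' : A.Cell × B.Cell) : Prop :=
  (A.tensor B).inc c c' ≠ 0 ∨ (A.tensor B).inc c' c ≠ 0

section Nbr

variable {d : ℕ} {A : BasedComplex d} {B : BasedComplex 1}

theorem Nbr.symm {c c' : A.Cell × B.Cell} (h : Nbr A B c c') : Nbr A B c' c := Or.symm h

theorem nbr_left {a a' : A.Cell} (b : B.Cell) (h : A.inc a a' ≠ 0) : Nbr A B (a, b) (a', b) :=
  Or.inl (by rwa [tensor_inc_left])

theorem nbr_right (a : A.Cell) {b b' : B.Cell} (h : B.inc b b' ≠ 0) : Nbr A B (a, b) (a, b') :=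
  Or.inl (by rwa [tensor_inc_right])

theorem nbr_of_inc_dual {c c' : A.Cell × B.Cell} (h : (A.tensor B.dual).inc c c' ≠ 0) :
    Nbr A B c c' := by
  obtain ⟨a, b⟩ := c
  obtain ⟨a', b'⟩ := c'
  rcases tensor_inc_cases h with ⟨h1, h2⟩ | ⟨h1, h2⟩
  · obtain rfl : b = b' := h1
    exact nbr_left b h2
  · obtain rfl : a = a' := h1
    exact (nbr_right a (b := b') (b' := b) h2).symm

theorem Nbr.cases {c c' : A.Cell × B.Cell} (h : Nbr A B c c') :
    (c.2 = c'.2 ∧ (A.inc c.1 c'.1 ≠ 0 ∨ A.inc c'.1 c.1 ≠ 0)) ∨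
      (c.1 = c'.1 ∧ (B.inc c.2 c'.2 ≠ 0 ∨ B.inc c'.2 c.2 ≠ 0)) := by
  rcases h with h | h
  · rcases tensor_inc_cases h with ⟨h1, h2⟩ | ⟨h1, h2⟩
    · exact Or.inl ⟨h1, Or.inl h2⟩
    · exact Or.inr ⟨h1, Or.inl h2⟩
  · rcases tensor_inc_cases h with ⟨h1, h2⟩ | ⟨h1, h2⟩
    · exact Or.inl ⟨h1.symm, Or.inr h2⟩
    · exact Or.inr ⟨h1.symm, Or.inr h2⟩

theorem ncard_nbr_le {w : ℕ} (h : (A.tensor B).HasLocality w) (c : A.Cell × B.Cell) :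
    {c' | Nbr A B c c'}.ncard ≤ w := by
  refine (Set.ncard_le_ncard ?_ (Set.toFinite _)).trans (h c)
  rintro c' (h1 | h1)
  · exact Or.inr (Relation.ReflTransGen.single h1)
  · exact Or.inl (Relation.ReflTransGen.single h1)

theorem ncard_below_left_le {w : ℕ} (h : (A.tensor B).HasLocality w) (b : B.Cell) (a : A.Cell) :
    {a' | A.Below a' a ∨ A.Below a a'}.ncard ≤ w := by
  refine le_trans ?_ (h (a, b))
  refine Set.ncard_le_ncard_of_injOn (fun a' => ((a', b) : A.Cell × B.Cell)) ?_ ?_ (Set.toFinite _)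
  · rintro a' (h1 | h1)
    · exact Or.inl (tensor_below_left A B b h1)
    · exact Or.inr (tensor_below_left A B b h1)
  · intro x _ y _ hxy
    exact (Prod.mk.inj hxy).1

theorem ncard_below_right_le {w : ℕ} (h : (A.tensor B).HasLocality w) (a : A.Cell) (b : B.Cell) :
    {b' | B.Below b' b ∨ B.Below b b'}.ncard ≤ w := by
  refine le_trans ?_ (h (a, b))
  refine Set.ncard_le_ncard_of_injOn (fun b' => ((a, b') : A.Cell × B.Cell)) ?_ ?_ (Set.toFinite _)
  · rintro a' (h1 | h1)
    · exact Or.inl (tensor_below_right A B a h1)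
    · exact Or.inr (tensor_below_right A B a h1)
  · intro x _ y _ hxy
    exact (Prod.mk.inj hxy).2

theorem ncard_le_of_below {w : ℕ} (h : (A.tensor B).HasLocality w) (c : A.Cell × B.Cell)
    {S : Set (A.Cell × B.Cell)} (hS : ∀ x ∈ S, (A.Below x.1 c.1 ∨ A.Below c.1 x.1) ∧
      (B.Below x.2 c.2 ∨ B.Below c.2 x.2)) : S.ncard ≤ w * w := by
  refine (Set.ncard_le_ncard (t := {a' | A.Below a' c.1 ∨ A.Below c.1 a'} ×ˢ
    {b' | B.Below b' c.2 ∨ B.Below c.2 b'}) (fun x hx => hS x hx) (Set.toFinite _)).trans ?_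
  rw [Set.ncard_prod]
  exact Nat.mul_le_mul (ncard_below_left_le h c.2 c.1) (ncard_below_right_le h c.1 c.2)

end Nbr

namespace IsSwitching

variable {d : ℕ} {A : BasedComplex d} {B : BasedComplex 1} {L : Finset B.Cell} {w m j : ℕ}
  {V : Type} {G : SimpleGraph V} {φ : A.Cell × B.Cell → V} {η γ : ℝ}

theorem one_le_m (h : IsSwitching A B L w m j G φ η) : 1 ≤ m := by
  have h1 : (0 : ℝ) < m := h.eta_pos.trans_le h.eta_le
  exact_mod_cast h1

theorem adj_of_linked (h : IsSwitching A B L w m j G φ η) {a a' : A.Cell} (b : B.Cell)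
    (hne : a ≠ a') (hl : A.Linked a a') : G.Adj (φ (a, b)) (φ (a', b)) := by
  have hne' : ((a, b) : A.Cell × B.Cell) ≠ (a', b) := fun h' => hne (Prod.mk.inj h').1
  have hb : B.deg b = 0 ∨ B.deg b = 1 := by
    have := B.deg_le b
    omega
  rcases hl with ⟨a₀, h0, h1, h2⟩ | ⟨t, h0, h1, h2⟩ <;> rcases hb with hb | hb
  · refine h.adjC _ _ ⟨hne', Or.inl ⟨(a₀, b), ?_, tensor_below_left A B b h1,
      tensor_below_left A B b h2⟩⟩
    change A.deg a₀ + B.deg b = 0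
    omega
  · refine h.adjD _ _ ⟨hne', Or.inl ⟨(a₀, b), ?_, tensor_below_left A B.dual b h1,
      tensor_below_left A B.dual b h2⟩⟩
    change A.deg a₀ + (1 - B.deg b) = 0
    omega
  · refine h.adjD _ _ ⟨hne', Or.inr ⟨(t, b), ?_, tensor_below_left A B.dual b h1,
      tensor_below_left A B.dual b h2⟩⟩
    change A.deg t + (1 - B.deg b) = d + 1
    omega
  · refine h.adjC _ _ ⟨hne', Or.inr ⟨(t, b), ?_, tensor_below_left A B b h1,
      tensor_below_left A B b h2⟩⟩
    change A.deg t + B.deg b = d + 1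
    omega

theorem adj_of_inc_right (h : IsSwitching A B L w m j G φ η) {a : A.Cell} (ha : A.Anchored a)
    {b b' : B.Cell} (hb : B.inc b b' ≠ 0) : G.Adj (φ (a, b)) (φ (a, b')) := by
  have hd := B.inc_deg _ _ hb
  have hd' := B.deg_le b'
  have hne : ((a, b) : A.Cell × B.Cell) ≠ (a, b') := by
    intro h'
    obtain rfl := (Prod.mk.inj h').2
    omega
  have hbb : B.Below b b' := Relation.ReflTransGen.single hb
  rcases ha with ⟨a₀, h0, h1⟩ | ⟨t, h0, h1⟩
  · refine h.adjC _ _ ⟨hne, Or.inl ⟨(a₀, b), ?_, tensor_below_left A B b h1,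
      (tensor_below_left A B b h1).trans (tensor_below_right A B a hbb)⟩⟩
    change A.deg a₀ + B.deg b = 0
    omega
  · refine h.adjC _ _ ⟨hne, Or.inr ⟨(t, b'), ?_,
      (tensor_below_right A B a hbb).trans (tensor_below_left A B b' h1),
      tensor_below_left A B b' h1⟩⟩
    change A.deg t + B.deg b' = d + 1
    omega

theorem adj_of_nbr (h : IsSwitching A B L w m j G φ η) {c c' : A.Cell × B.Cell}
    (hc : Nbr A B c c') (ha : A.Anchored c.1 ∨ A.Anchored c'.1) : G.Adj (φ c) (φ c') := by
  obtain ⟨a, b⟩ := c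
  obtain ⟨a', b'⟩ := c'
  rcases hc.cases with ⟨h1, h2⟩ | ⟨h1, h2⟩
  · obtain rfl : b = b' := h1
    rcases h2 with h2 | h2
    · refine h.adj_of_linked b ?_ (h.linked _ _ h2)
      rintro rfl
      exact h2 (A.inc_self _)
    · refine (h.adj_of_linked b ?_ (h.linked _ _ h2)).symm
      rintro rfl
      exact h2 (A.inc_self _)
  · obtain rfl : a = a' := h1
    have ha' : A.Anchored a := ha.elim id id
    rcases h2 with h2 | h2
    · exact h.adj_of_inc_right ha' h2
    · exact (h.adj_of_inc_right ha' h2).symm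

theorem anchored_of_nbr_of_below (h : IsSwitching A B L w m j G φ η) {a a' : A.Cell}
    (h1 : a = a' ∨ A.inc a a' ≠ 0 ∨ A.inc a' a ≠ 0) (h2 : A.Anchored a') : A.Anchored a := by
  rcases h1 with rfl | h1 | h1
  · exact h2
  · exact (h.linked _ _ h1).anchored
  · exact (h.linked _ _ h1).imp (fun ⟨b, h0, _, h2⟩ => ⟨b, h0, h2⟩)
      fun ⟨t, h0, _, h2⟩ => ⟨t, h0, h2⟩

theorem anchored_D (h : IsSwitching A B L w m j G φ η) {c : A.Cell × B.Cell}
    (hc : (A.tensor B.dual).deg c = j + 1) : A.Anchored c.1 := by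
  obtain ⟨b, hb, h1 | ⟨c', h1, h2⟩⟩ := h.decD.exists_below h.one_le_m hc
  · exact Or.inl ⟨b.1, (Nat.add_eq_zero_iff.1 hb).1, (below_of_tensor_below h1).1⟩
  · refine h.anchored_of_nbr_of_below (a' := c'.1) ?_
      (Or.inl ⟨b.1, (Nat.add_eq_zero_iff.1 hb).1, (below_of_tensor_below h2).1⟩)
    rcases tensor_inc_cases h1 with h3 | h3
    · exact Or.inr (Or.inl h3.2)
    · exact Or.inl h3.1

theorem anchored_C (h : IsSwitching A B L w m j G φ η) {c : A.Cell × B.Cell}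
    (hc : (A.tensor B).deg c = j) : A.Anchored c.1 := by
  obtain ⟨b, hb, h1⟩ := h.decC.exists_below h.one_le_m (c := c) (by
    change d + 1 - (A.tensor B).deg c = _
    rw [hc])
  have hb' : A.deg b.1 = d := by
    have e1 : d + 1 - (A.deg b.1 + B.deg b.2) = 0 := hb
    have e2 := A.deg_le b.1
    have e3 := B.deg_le b.2
    omega
  rcases h1 with h1 | ⟨c', h1, h2⟩
  · exact Or.inr ⟨b.1, hb', (below_of_tensor_below ((dual_below_iff _).1 h1)).1⟩
  · refine h.anchored_of_nbr_of_below (a' := c'.1) ?_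
      (Or.inr ⟨b.1, hb', (below_of_tensor_below ((dual_below_iff _).1 h2)).1⟩)
    rcases tensor_inc_cases (K := A) (K' := B) h1 with h3 | h3
    · exact Or.inr (Or.inr h3.2)
    · exact Or.inl h3.1.symm

theorem anchored_DL (h : IsSwitching A B L w m j G φ η) {c : A.Cell × {b : B.Cell // b ∉ L}}
    (hc : (A.tensor (B.removeCells L).dual).deg c = j) : A.Anchored c.1 := by
  obtain ⟨b, hb, h1⟩ := h.decDL.exists_below h.one_le_m (c := c) (by
    change d + 1 - (A.tensor (B.removeCells L).dual).deg c = _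
    rw [hc])
  have hb' : A.deg b.1 = d := by
    have e1 : d + 1 - (A.deg b.1 + (1 - B.deg b.2.1)) = 0 := hb
    have e2 := A.deg_le b.1
    omega
  rcases h1 with h1 | ⟨c', h1, h2⟩
  · exact Or.inr ⟨b.1, hb', (below_of_tensor_below ((dual_below_iff _).1 h1)).1⟩
  · refine h.anchored_of_nbr_of_below (a' := c'.1) ?_
      (Or.inr ⟨b.1, hb', (below_of_tensor_below ((dual_below_iff _).1 h2)).1⟩)
    rcases tensor_inc_cases (K := A) (K' := (B.removeCells L).dual) h1 with h3 | h3
    · exact Or.inr (Or.inr h3.2)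
    · exact Or.inl h3.1.symm

theorem removeCells_below {c c' : {b : B.Cell // b ∉ L}} (h : (B.removeCells L).Below c c') :
    B.Below c.1 c'.1 :=
  Relation.ReflTransGen.lift (fun x : {b : B.Cell // b ∉ L} => x.1) (fun _ _ hxy => hxy) _ _ h

/-- Sparse cocycles of level `j + 1` of `A ⊗ B*` are coboundaries of sparse cochains. -/
theorem exists_preimage_D (h : IsSwitching A B L w m j G φ η) (hγ : γ * (1 + w) ≤ 1)
    {e : A.Cell × B.Cell → ZMod 2} (he : e ∈ (A.tensor B.dual).cocycles (j + 1))
    (hS : Sparse G η γ (φ '' {c | e c ≠ 0})) :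
    ∃ f ∈ (A.tensor B.dual).level j, (A.tensor B.dual).coboundary f = e ∧
      Sparse G η (2 * (1 + w + (w * w : ℕ)) * γ) (φ '' {c | f c ≠ 0}) := by
  refine exists_sparse_preimage h.decD h.inj ?_ ?_ ?_ ?_ h.eta_pos h.eta_le hγ he hS
  · intro c c' hc hcc
    exact h.adj_of_nbr (nbr_of_inc_dual hcc) (Or.inl (h.anchored_D hc))
  · intro c
    refine (Set.ncard_le_ncard ?_ (Set.toFinite _)).trans (ncard_nbr_le h.locality c)
    exact fun c' hc' => nbr_of_inc_dual hc'
  · intro b c c' hb h1 h2 hne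
    exact h.adjD _ _ ⟨hne, Or.inl ⟨b, hb, h1, h2⟩⟩
  · intro b _
    refine ncard_le_of_below h.locality b fun x hx => ?_
    have := below_of_tensor_below (K := A) (K' := B.dual) hx
    exact ⟨Or.inr this.1, Or.inl ((dual_below_iff B).1 this.2)⟩

/-- Sparse cycles of level `j` of `A ⊗ B` are boundaries of sparse chains. -/
theorem exists_preimage_C (h : IsSwitching A B L w m j G φ η) (hγ : γ * (1 + w) ≤ 1)
    {e : A.Cell × B.Cell → ZMod 2} (he : e ∈ (A.tensor B).dual.cocycles (d + 1 - j))
    (hS : Sparse G η γ (φ '' {c | e c ≠ 0})) :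
    ∃ f ∈ (A.tensor B).level (j + 1), (A.tensor B).dual.coboundary f = e ∧
      Sparse G η (2 * (1 + w + (w * w : ℕ)) * γ) (φ '' {c | f c ≠ 0}) := by
  have hj := h.succ_le
  suffices hs : ∃ f ∈ (A.tensor B).dual.level (d + 1 - j - 1), (A.tensor B).dual.coboundary f = e ∧
      Sparse G η (2 * (1 + w + (w * w : ℕ)) * γ) (φ '' {c | f c ≠ 0}) by
    obtain ⟨f, hf, hfe, hfS⟩ := hs
    refine ⟨f, fun c hc => hf c ?_, hfe, hfS⟩
    change d + 1 - (A.tensor B).deg c ≠ d + 1 - j - 1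
    have := (A.tensor B).deg_le c
    omega
  refine exists_sparse_preimage (u := w * w) h.decC h.inj ?_ ?_ ?_ ?_ h.eta_pos h.eta_le hγ he hS
  · intro c c' hc hcc
    refine h.adj_of_nbr (Or.inr hcc) (Or.inl (h.anchored_C ?_))
    have h1 : d + 1 - (A.tensor B).deg c = d + 1 - j := hc
    have := (A.tensor B).deg_le c
    omega
  · intro c
    refine (Set.ncard_le_ncard ?_ (Set.toFinite _)).trans (ncard_nbr_le h.locality c)
    exact fun c' hc' => Or.inr hc'
  · intro b c c' hb h1 h2 hne
    refine h.adjC _ _ ⟨hne, Or.inr ⟨b, ?_, (dual_below_iff _).1 h1, (dual_below_iff _).1 h2⟩⟩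
    have h3 : d + 1 - (A.tensor B).deg b = 0 := hb
    have := (A.tensor B).deg_le b
    omega
  · intro b _
    refine ncard_le_of_below h.locality b fun x hx => ?_
    have := below_of_tensor_below (K := A) (K' := B) ((dual_below_iff _).1 hx)
    exact ⟨Or.inl this.1, Or.inl this.2⟩

/-- Sparse cycles of level `j` of `A ⊗ B*` with the cells of `L` removed are boundaries of sparse
chains. -/
theorem exists_preimage_DL (h : IsSwitching A B L w m j G φ η) (hγ : γ * (1 + w) ≤ 1)
    {e : A.Cell × {b : B.Cell // b ∉ L} → ZMod 2}
    (he : e ∈ (A.tensor (B.removeCells L).dual).dual.cocycles (d + 1 - j))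
    (hS : Sparse G η γ ((fun c : A.Cell × {b : B.Cell // b ∉ L} => φ (c.1, c.2.1)) ''
      {c | e c ≠ 0})) :
    ∃ f ∈ (A.tensor (B.removeCells L).dual).level (j + 1),
      (A.tensor (B.removeCells L).dual).dual.coboundary f = e ∧
      Sparse G η (2 * (1 + w + (w * w : ℕ)) * γ)
        ((fun c : A.Cell × {b : B.Cell // b ∉ L} => φ (c.1, c.2.1)) '' {c | f c ≠ 0}) := by
  have hj := h.succ_le
  have hι : Function.Injective fun c : A.Cell × {b : B.Cell // b ∉ L} =>
      ((c.1, c.2.1) : A.Cell × B.Cell) := by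
    rintro ⟨a, b, hb⟩ ⟨a', b', hb'⟩ hh
    have := Prod.mk.inj hh
    exact Prod.ext this.1 (Subtype.ext this.2)
  have hnbr : ∀ c c' : A.Cell × {b : B.Cell // b ∉ L},
      (A.tensor (B.removeCells L).dual).inc c' c ≠ 0 → Nbr A B (c.1, c.2.1) (c'.1, c'.2.1) := by
    rintro ⟨a, b⟩ ⟨a', b'⟩ hcc
    rcases tensor_inc_cases (K := A) (K' := (B.removeCells L).dual) hcc with ⟨h1, h2⟩ | ⟨h1, h2⟩
    · obtain rfl : b' = b := h1
      exact (nbr_left b'.1 h2).symm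
    · obtain rfl : a' = a := h1
      exact nbr_right a' h2
  suffices hs : ∃ f ∈ (A.tensor (B.removeCells L).dual).dual.level (d + 1 - j - 1),
      (A.tensor (B.removeCells L).dual).dual.coboundary f = e ∧
      Sparse G η (2 * (1 + w + (w * w : ℕ)) * γ)
        ((fun c : A.Cell × {b : B.Cell // b ∉ L} => φ (c.1, c.2.1)) '' {c | f c ≠ 0}) by
    obtain ⟨f, hf, hfe, hfS⟩ := hs
    refine ⟨f, fun c hc => hf c ?_, hfe, hfS⟩
    change d + 1 - (A.tensor (B.removeCells L).dual).deg c ≠ d + 1 - j - 1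
    have := (A.tensor (B.removeCells L).dual).deg_le c
    omega
  refine exists_sparse_preimage (u := w * w) h.decDL (h.inj.comp hι) ?_ ?_ ?_ ?_
    h.eta_pos h.eta_le hγ he hS
  · intro c c' hc hcc
    refine h.adj_of_nbr (hnbr c c' hcc) (Or.inl (h.anchored_DL ?_))
    have h1 : d + 1 - (A.tensor (B.removeCells L).dual).deg c = d + 1 - j := hc
    have := (A.tensor (B.removeCells L).dual).deg_le c
    omega
  · intro c
    refine le_trans ?_ (ncard_nbr_le h.locality (c.1, c.2.1))
    exact Set.ncard_le_ncard_of_injOn (fun c' : A.Cell × {b : B.Cell // b ∉ L} =>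
      ((c'.1, c'.2.1) : A.Cell × B.Cell)) (fun c' hc' => hnbr c c' hc') hι.injOn (Set.toFinite _)
  · intro b c c' hb h1 h2 hne
    have key : ∀ c : A.Cell × {b : B.Cell // b ∉ L},
        (A.tensor (B.removeCells L).dual).dual.Below b c →
          (A.tensor B.dual).Below (c.1, c.2.1) (b.1, b.2.1) := by
      intro c hc
      obtain ⟨h3, h4⟩ := below_of_tensor_below (K := A) (K' := (B.removeCells L).dual)
        ((dual_below_iff _).1 hc)
      have h5 : B.dual.Below c.2.1 b.2.1 :=
        (dual_below_iff B).2 (removeCells_below ((dual_below_iff (B.removeCells L)).1 h4))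
      exact (tensor_below_left A B.dual c.2.1 h3).trans (tensor_below_right A B.dual b.1 h5)
    refine h.adjD _ _ ⟨fun hh => hne (hι hh), Or.inr ⟨(b.1, b.2.1), ?_, key c h1, key c' h2⟩⟩
    have h3 : d + 1 - (A.tensor (B.removeCells L).dual).deg b = 0 := hb
    have := (A.tensor (B.removeCells L).dual).deg_le b
    change (A.tensor (B.removeCells L).dual).deg b = d + 1
    omega
  · intro b _
    refine le_trans (Set.ncard_le_ncard_of_injOn (t := (fun c : A.Cell × {b : B.Cell // b ∉ L} =>
      ((c.1, c.2.1) : A.Cell × B.Cell)) '' {c |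
      (A.tensor (B.removeCells L).dual).dual.Below b c}) _
      (fun c hc => ⟨c, hc, rfl⟩) hι.injOn (Set.toFinite _)) ?_
    refine ncard_le_of_below h.locality (b.1, b.2.1) ?_
    rintro _ ⟨c, hc, rfl⟩
    have h3 := below_of_tensor_below (K := A) (K' := (B.removeCells L).dual)
      ((dual_below_iff _).1 hc)
    exact ⟨Or.inl h3.1, Or.inr (removeCells_below ((dual_below_iff (B.removeCells L)).1 h3.2))⟩

/-- Every copy of `A` in the product inherits the sparsity of a set. -/
theorem sparse_copy (h : IsSwitching A B L w m j G φ η) {S : Set (A.Cell × B.Cell)}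
    (hS : Sparse G η γ (φ '' S)) (b : B.Cell) : Sparse A.connGraph η γ {a | (a, b) ∈ S} := by
  classical
  intro W hW hη
  have hinj : Function.Injective fun a : A.Cell => φ (a, b) := fun a a' haa =>
    (Prod.mk.inj (h.inj haa)).1
  have h1 := hS (W.image fun a => φ (a, b)) ?_ (by rwa [Finset.card_image_of_injective _ hinj])
  · rw [Finset.card_image_of_injective _ hinj] at h1
    refine lt_of_le_of_lt ?_ h1
    have : ({a | (a, b) ∈ S} ∩ (W : Set A.Cell)).ncard ≤
        (φ '' S ∩ ((W.image fun a => φ (a, b) : Finset V) : Set V)).ncard := by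
      refine Set.ncard_le_ncard_of_injOn (fun a => φ (a, b)) ?_ hinj.injOn
        ((Finset.finite_toSet _).inter_of_right _)
      rintro a ⟨ha, haW⟩
      exact ⟨⟨_, ha, rfl⟩, Finset.mem_coe.2 (Finset.mem_image_of_mem _ haW)⟩
    exact_mod_cast this
  · let f : A.connGraph.induce (W : Set A.Cell) →g
        G.induce ((W.image fun a => φ (a, b) : Finset V) : Set V) :=
      ⟨fun x => ⟨φ (x.1, b), Finset.mem_coe.2 (Finset.mem_image_of_mem _ x.2)⟩, fun {x y} hxy => by
        have h2 : A.connGraph.Adj x.1 y.1 := hxy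
        exact h.adj_of_linked b h2.1 h2.2⟩
    have hf : Function.Surjective f := by
      rintro ⟨v, hv⟩
      obtain ⟨a, ha, rfl⟩ := Finset.mem_image.1 (Finset.mem_coe.1 hv)
      exact ⟨⟨a, ha⟩, rfl⟩
    exact hW.map f hf

theorem ncard_inc_le (h : IsSwitching A B L w m j G φ η) (b : B.Cell) (a : A.Cell) :
    {a' | A.inc a a' ≠ 0}.ncard ≤ w ∧ {a' | A.inc a' a ≠ 0}.ncard ≤ w := by
  refine ⟨(Set.ncard_le_ncard ?_ (Set.toFinite _)).trans (ncard_below_left_le h.locality b a),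
    (Set.ncard_le_ncard ?_ (Set.toFinite _)).trans (ncard_below_left_le h.locality b a)⟩
  · exact fun a' ha' => Or.inr (Relation.ReflTransGen.single ha')
  · exact fun a' ha' => Or.inl (Relation.ReflTransGen.single ha')

theorem adj_of_inc (h : IsSwitching A B L w m j G φ η) {a a' : A.Cell} (ha : A.inc a a' ≠ 0) :
    A.connGraph.Adj a a' := by
  refine ⟨?_, h.linked _ _ ha⟩
  rintro rfl
  exact ha (A.inc_self _)

theorem mem_coboundaries_A (h : IsSwitching A B L w m j G φ η) (b : B.Cell)
    (hγ : γ * (1 + w) ≤ 1) {e : A.Cell → ZMod 2} (he : e ∈ A.cocycles j)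
    (hS : Sparse A.connGraph η γ {a | e a ≠ 0}) : e ∈ A.coboundaries j := by
  refine mem_coboundaries_of_sparse (ψ := id) Function.injective_id
    (fun c c' _ hcc => h.adj_of_inc hcc) (fun a => (h.ncard_inc_le b a).1) h.eta_pos hγ h.cosyst he ?_
  rwa [Set.image_id]

theorem mem_boundaries_A (h : IsSwitching A B L w m j G φ η) (b : B.Cell)
    (hγ : γ * (1 + w) ≤ 1) {e : A.Cell → ZMod 2} (he : e ∈ A.dual.cocycles (d - j))
    (hS : Sparse A.connGraph η γ {a | e a ≠ 0}) : e ∈ A.dual.coboundaries (d - j) := by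
  refine mem_coboundaries_of_sparse (K := A.dual) (ψ := id) (G := A.connGraph)
    Function.injective_id
    (fun c c' _ hcc => (h.adj_of_inc hcc).symm) (fun a => (h.ncard_inc_le b a).2) h.eta_pos hγ
    h.syst he ?_
  have e1 : id '' {a : A.Cell | e a ≠ 0} = {a | e a ≠ 0} := Set.image_id _
  exact e1.symm ▸ hS

end IsSwitching

/-! ### Cochains on products of two sets of cells -/

section Product

variable {α β : Type}

/-- A linear map of the cochains on the first factor, applied to all columns. -/
def opLeft (T : (α → ZMod 2) →ₗ[ZMod 2] (α → ZMod 2)) :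
    (α × β → ZMod 2) →ₗ[ZMod 2] (α × β → ZMod 2) where
  toFun := fun f c => T (fun a => f (a, c.2)) c.1
  map_add' := fun f g => by
    funext c
    exact congrFun (T.map_add (fun a => f (a, c.2)) fun a => g (a, c.2)) c.1
  map_smul' := fun x f => by
    funext c
    exact congrFun (T.map_smul x fun a => f (a, c.2)) c.1

/-- A linear map of the cochains on the second factor, applied to all rows. -/
def opRight (T : (β → ZMod 2) →ₗ[ZMod 2] (β → ZMod 2)) :
    (α × β → ZMod 2) →ₗ[ZMod 2] (α × β → ZMod 2) where
  toFun := fun f c => T (fun b => f (c.1, b)) c.2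
  map_add' := fun f g => by
    funext c
    exact congrFun (T.map_add (fun b => f (c.1, b)) fun b => g (c.1, b)) c.2
  map_smul' := fun x f => by
    funext c
    exact congrFun (T.map_smul x fun b => f (c.1, b)) c.2

theorem opLeft_apply (T : (α → ZMod 2) →ₗ[ZMod 2] (α → ZMod 2)) (f : α × β → ZMod 2) (a : α)
    (b : β) : opLeft T f (a, b) = T (fun a => f (a, b)) a := rfl

theorem opRight_apply (T : (β → ZMod 2) →ₗ[ZMod 2] (β → ZMod 2)) (f : α × β → ZMod 2) (a : α)
    (b : β) : opRight T f (a, b) = T (fun b => f (a, b)) b := rfl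

/-- The restriction of a cochain to the cells over `L`, extended by zero. -/
def resL (L : Finset β) : (α × β → ZMod 2) →ₗ[ZMod 2] (α × β → ZMod 2) where
  toFun := fun f => Set.indicator {c | c.2 ∈ L} f
  map_add' := fun f g => Set.indicator_add _ f g
  map_smul' := fun x f => Set.indicator_const_smul _ x f

theorem resL_of_mem {L : Finset β} (f : α × β → ZMod 2) {c : α × β} (h : c.2 ∈ L) :
    resL L f c = f c := Set.indicator_of_mem (s := {c : α × β | c.2 ∈ L}) h f

theorem resL_of_notMem {L : Finset β} (f : α × β → ZMod 2) {c : α × β} (h : c.2 ∉ L) :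
    resL L f c = 0 := Set.indicator_of_notMem (s := {c : α × β | c.2 ∈ L}) h f

end Product

theorem add_self_fun {α : Type} (f : α → ZMod 2) : f + f = 0 := by
  funext a
  exact CharTwo.add_self_eq_zero _

theorem eq_of_add_eq_zero_fun {α : Type} {f g : α → ZMod 2} (h : f + g = 0) : f = g := by
  have h1 : f + g + g = g := by rw [h, zero_add]
  rwa [add_assoc, add_self_fun, add_zero] at h1

/-- The boundary map of the chain complex of `K`, that is, the coboundary map of `K.dual`. -/
def BasedComplex.boundary {r : ℕ} (K : BasedComplex r) :
    (K.Cell → ZMod 2) →ₗ[ZMod 2] (K.Cell → ZMod 2) := K.dual.coboundary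

theorem BasedComplex.boundary_apply {r : ℕ} (K : BasedComplex r) (f : K.Cell → ZMod 2)
    (c' : K.Cell) : K.boundary f c' = ∑ c, f c * K.inc c' c := rfl

theorem BasedComplex.coboundary_dot {r : ℕ} (K : BasedComplex r) (x y : K.Cell → ZMod 2) :
    K.coboundary x ⬝ᵥ y = x ⬝ᵥ K.boundary y := coboundary_dotProduct K x y

theorem BasedComplex.boundary_dot {r : ℕ} (K : BasedComplex r) (x y : K.Cell → ZMod 2) :
    K.boundary x ⬝ᵥ y = x ⬝ᵥ K.coboundary y := coboundary_dotProduct K.dual x y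

section Maps

variable {d : ℕ} (A : BasedComplex d) (B : BasedComplex 1)

/-- The coboundary map of `A ⊗ B`. -/
def delC : (A.Cell × B.Cell → ZMod 2) →ₗ[ZMod 2] (A.Cell × B.Cell → ZMod 2) :=
  (A.tensor B).coboundary

/-- The boundary map of `A ⊗ B`. -/
def bdC : (A.Cell × B.Cell → ZMod 2) →ₗ[ZMod 2] (A.Cell × B.Cell → ZMod 2) :=
  (A.tensor B).boundary

/-- The coboundary map of `A ⊗ B*`. -/
def delD : (A.Cell × B.Cell → ZMod 2) →ₗ[ZMod 2] (A.Cell × B.Cell → ZMod 2) :=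
  (A.tensor B.dual).coboundary

/-- The boundary map of `A ⊗ B*`. -/
def bdD : (A.Cell × B.Cell → ZMod 2) →ₗ[ZMod 2] (A.Cell × B.Cell → ZMod 2) :=
  (A.tensor B.dual).boundary

/-- The cochains of level `j` of `A ⊗ B`. -/
def levC (j : ℕ) : Submodule (ZMod 2) (A.Cell × B.Cell → ZMod 2) := (A.tensor B).level j

/-- The cochains of level `j` of `A ⊗ B*`. -/
def levD (j : ℕ) : Submodule (ZMod 2) (A.Cell × B.Cell → ZMod 2) := (A.tensor B.dual).level j

variable {A B} in
theorem mem_levC {j : ℕ} {f : A.Cell × B.Cell → ZMod 2} :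
    f ∈ levC A B j ↔ ∀ c, f c ≠ 0 → A.deg c.1 + B.deg c.2 = j :=
  forall_congr' fun _ => not_imp_comm

variable {A B} in
theorem mem_levD {j : ℕ} {f : A.Cell × B.Cell → ZMod 2} :
    f ∈ levD A B j ↔ ∀ c, f c ≠ 0 → A.deg c.1 + (1 - B.deg c.2) = j :=
  forall_congr' fun _ => not_imp_comm

theorem tensor_coboundary {r s : ℕ} (K : BasedComplex r) (K' : BasedComplex s)
    (f : K.Cell × K'.Cell → ZMod 2) :
    (K.tensor K').coboundary f = opLeft K.coboundary f + opRight K'.coboundary f := by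
  funext c
  obtain ⟨a, b⟩ := c
  rw [Pi.add_apply, opLeft_apply, opRight_apply, coboundary_apply, coboundary_apply]
  change ∑ c : K.Cell × K'.Cell, f c * (K.tensor K').inc c (a, b) = _
  rw [Fintype.sum_prod_type]
  simp only [tensor_inc, mul_add, Finset.sum_add_distrib, mul_ite, mul_zero, Finset.sum_ite_eq',
    Finset.sum_ite_irrel, Finset.sum_const_zero, Finset.mem_univ, if_true]

theorem tensor_boundary {r s : ℕ} (K : BasedComplex r) (K' : BasedComplex s)
    (f : K.Cell × K'.Cell → ZMod 2) :
    (K.tensor K').boundary f = opLeft K.boundary f + opRight K'.boundary f := by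
  funext c
  obtain ⟨a, b⟩ := c
  rw [Pi.add_apply, opLeft_apply, opRight_apply, boundary_apply, boundary_apply]
  change ∑ c : K.Cell × K'.Cell, f c * (K.tensor K').inc (a, b) c = _
  rw [Fintype.sum_prod_type]
  simp only [tensor_inc, mul_add, Finset.sum_add_distrib, mul_ite, mul_zero, Finset.sum_ite_eq,
    Finset.sum_ite_irrel, Finset.sum_const_zero, Finset.mem_univ, if_true]

theorem delC_eq (f : A.Cell × B.Cell → ZMod 2) :
    delC A B f = opLeft A.coboundary f + opRight B.coboundary f :=
  tensor_coboundary A B f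

theorem bdC_eq (f : A.Cell × B.Cell → ZMod 2) :
    bdC A B f = opLeft A.boundary f + opRight B.boundary f :=
  tensor_boundary A B f

theorem delD_eq (f : A.Cell × B.Cell → ZMod 2) :
    delD A B f = opLeft A.coboundary f + opRight B.boundary f :=
  tensor_coboundary A B.dual f

theorem bdD_eq (f : A.Cell × B.Cell → ZMod 2) :
    bdD A B f = opLeft A.boundary f + opRight B.coboundary f :=
  tensor_boundary A B.dual f

theorem delD_delD (f : A.Cell × B.Cell → ZMod 2) : delD A B (delD A B f) = 0 := by
  funext c
  exact congrFun (coboundary_coboundary (A.tensor B.dual) f) c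

theorem bdC_bdC (f : A.Cell × B.Cell → ZMod 2) : bdC A B (bdC A B f) = 0 := by
  funext c
  exact congrFun (coboundary_coboundary (A.tensor B).dual f) c

theorem bdC_dotProduct (f g : A.Cell × B.Cell → ZMod 2) :
    bdC A B f ⬝ᵥ g = f ⬝ᵥ delC A B g :=
  boundary_dot (A.tensor B) f g

theorem bdD_dotProduct (f g : A.Cell × B.Cell → ZMod 2) :
    bdD A B f ⬝ᵥ g = f ⬝ᵥ delD A B g :=
  boundary_dot (A.tensor B.dual) f g

variable {A B}

theorem bdC_mem_level {j : ℕ} {f : A.Cell × B.Cell → ZMod 2}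
    (hf : f ∈ levC A B (j + 1)) : bdC A B f ∈ levC A B j := by
  intro c hc
  change ∑ c' : A.Cell × B.Cell, f c' * (A.tensor B).inc c c' = 0
  refine Finset.sum_eq_zero fun c' _ => ?_
  by_contra h
  have h1 := (A.tensor B).inc_deg _ _ (right_ne_zero_of_mul h)
  have h2 : (A.tensor B).deg c' = j + 1 := by
    by_contra h2
    exact left_ne_zero_of_mul h (hf c' h2)
  omega

theorem bdD_mem_level {j : ℕ} {f : A.Cell × B.Cell → ZMod 2}
    (hf : f ∈ levD A B (j + 1)) : bdD A B f ∈ levD A B j := by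
  intro c hc
  change ∑ c' : A.Cell × B.Cell, f c' * (A.tensor B.dual).inc c c' = 0
  refine Finset.sum_eq_zero fun c' _ => ?_
  by_contra h
  have h1 := (A.tensor B.dual).inc_deg _ _ (right_ne_zero_of_mul h)
  have h2 : (A.tensor B.dual).deg c' = j + 1 := by
    by_contra h2
    exact left_ne_zero_of_mul h (hf c' h2)
  omega

theorem boundary_right_of_deg_one {f : B.Cell → ZMod 2} {b : B.Cell} (hb : B.deg b = 1) :
    B.boundary f b = 0 := by
  rw [boundary_apply]
  refine Finset.sum_eq_zero fun b' _ => ?_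
  by_contra h
  have h1 := B.inc_deg _ _ (right_ne_zero_of_mul h)
  have h2 := B.deg_le b'
  omega

theorem coboundary_right_eq_zero {f : B.Cell → ZMod 2} (hf : ∀ b, f b ≠ 0 → B.deg b = 1) :
    B.coboundary f = 0 := by
  funext b
  rw [coboundary_apply]
  refine Finset.sum_eq_zero fun b' _ => ?_
  by_contra h
  have h1 := B.inc_deg _ _ (right_ne_zero_of_mul h)
  have h2 := B.deg_le b
  have h3 := hf b' (left_ne_zero_of_mul h)
  omega

/-- The contraction of a cochain of the product with a vector on the cells of `B`. -/
def contract (c : B.Cell → ZMod 2) (f : A.Cell × B.Cell → ZMod 2) : A.Cell → ZMod 2 :=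
  fun a => ∑ b, c b * f (a, b)

theorem contract_add (c : B.Cell → ZMod 2) (f g : A.Cell × B.Cell → ZMod 2) :
    contract c (f + g) = contract c f + contract c g := by
  funext a
  simp [contract, mul_add, Finset.sum_add_distrib]

theorem contract_opLeft (c : B.Cell → ZMod 2) (T : (A.Cell → ZMod 2) →ₗ[ZMod 2] (A.Cell → ZMod 2))
    (f : A.Cell × B.Cell → ZMod 2) : contract c (opLeft T f) = T (contract c f) := by
  have e : contract c f = ∑ b, c b • fun a => f (a, b) := by
    funext a
    simp [contract, Finset.sum_apply]
  rw [e, map_sum]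
  funext a
  simp [contract, Finset.sum_apply, opLeft_apply]

/-- Contracting with a codeword of `ker ∂` kills the coboundary in the direction of `B`. -/
theorem contract_opRight {c : B.Cell → ZMod 2} (hc : c ∈ B.dual.cocycles 0)
    (f : A.Cell × B.Cell → ZMod 2) : contract c (opRight B.coboundary f) = 0 := by
  have hc' : B.boundary c = 0 := hc.2
  funext a
  have e : contract c (opRight B.coboundary f) a = B.coboundary (fun b => f (a, b)) ⬝ᵥ c := by
    simp only [contract, dotProduct, opRight_apply]
    exact Finset.sum_congr rfl fun _ _ => mul_comm _ _
  rw [e, coboundary_dot, hc', dotProduct_zero]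
  rfl

theorem deg_of_codeword {c : B.Cell → ZMod 2} (hc : c ∈ B.dual.cocycles 0) {b : B.Cell}
    (hb : c b ≠ 0) : B.deg b = 1 := by
  have h1 := hc.1 b
  have h2 := B.deg_le b
  by_contra h3
  refine hb (h1 ?_)
  change 1 - B.deg b ≠ 0
  omega

end Maps

/-! ### Decoding -/

section Decoding

variable {d : ℕ} {A : BasedComplex d} {B : BasedComplex 1} {L : Finset B.Cell} {w m j : ℕ}
  {V : Type} {G : SimpleGraph V} {φ : A.Cell × B.Cell → V} {η γ₀ γ₁ : ℝ}

/-- The cochain is supported on the input qubits, the copies labelled by `L` of level `j`. -/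
def OnInput (A : BasedComplex d) (B : BasedComplex 1) (L : Finset B.Cell) (j : ℕ)
    (f : A.Cell × B.Cell → ZMod 2) : Prop :=
  ∀ c, f c ≠ 0 → A.deg c.1 = j ∧ c.2 ∈ L

/-- The support of the cochain is sparse in every copy of `A` labelled by `L`. -/
def CopySparse (A : BasedComplex d) (B : BasedComplex 1) (L : Finset B.Cell) (η γ : ℝ)
    (f : A.Cell × B.Cell → ZMod 2) : Prop :=
  ∀ l ∈ L, Sparse A.connGraph η γ {a | f (a, l) ≠ 0}

theorem OnInput.add {f g : A.Cell × B.Cell → ZMod 2} (hf : OnInput A B L j f)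
    (hg : OnInput A B L j g) : OnInput A B L j (f + g) := by
  intro c hc
  by_cases h : f c = 0
  · exact hg c (by simpa [h] using hc)
  · exact hf c h

theorem support_add_subset {α : Type} (f g : α → ZMod 2) :
    {c | (f + g) c ≠ 0} ⊆ {c | f c ≠ 0} ∪ {c | g c ≠ 0} := by
  intro c hc
  by_cases h : f c = 0
  · exact Or.inr (by simpa [h] using hc)
  · exact Or.inl h

theorem CopySparse.add {γ γ' : ℝ} {f g : A.Cell × B.Cell → ZMod 2} (hf : CopySparse A B L η γ f)
    (hg : CopySparse A B L η γ' g) : CopySparse A B L η (γ + γ') (f + g) := fun l hl =>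
  ((hf l hl).union (hg l hl)).mono
    (support_add_subset (fun a => f (a, l)) fun a => g (a, l)) le_rfl

theorem sparse_add {γ γ' : ℝ} {X : Type} {ψ : X → V} {f g : X → ZMod 2}
    (hf : Sparse G η γ (ψ '' {c | f c ≠ 0})) (hg : Sparse G η γ' (ψ '' {c | g c ≠ 0})) :
    Sparse G η (γ + γ') (ψ '' {c | (f + g) c ≠ 0}) :=
  (hf.union hg).mono (by
    rw [← Set.image_union]
    exact Set.image_mono (support_add_subset f g)) le_rfl

namespace IsSwitching

theorem preimage_D (h : IsSwitching A B L w m j G φ η) {γ : ℝ} (hγ : γ * (1 + w) ≤ 1)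
    {e : A.Cell × B.Cell → ZMod 2} (he : e ∈ levD A B (j + 1)) (he' : delD A B e = 0)
    (hS : Sparse G η γ (φ '' {c | e c ≠ 0})) :
    ∃ f ∈ levD A B j, delD A B f = e ∧
      Sparse G η (2 * (1 + w + (w * w : ℕ)) * γ) (φ '' {c | f c ≠ 0}) :=
  h.exists_preimage_D hγ (e := e) ⟨he, he'⟩ hS

theorem preimage_C (h : IsSwitching A B L w m j G φ η) {γ : ℝ} (hγ : γ * (1 + w) ≤ 1)
    {e : A.Cell × B.Cell → ZMod 2} (he : e ∈ levC A B j) (he' : bdC A B e = 0)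
    (hS : Sparse G η γ (φ '' {c | e c ≠ 0})) :
    ∃ f ∈ levC A B (j + 1), bdC A B f = e ∧
      Sparse G η (2 * (1 + w + (w * w : ℕ)) * γ) (φ '' {c | f c ≠ 0}) := by
  refine h.exists_preimage_C hγ (e := e) ⟨fun c hc => he c fun hc' => hc ?_, he'⟩ hS
  change d + 1 - (A.tensor B).deg c = d + 1 - j
  rw [hc']

theorem deg_of_mem (h : IsSwitching A B L w m j G φ η) {l : B.Cell} (hl : l ∈ L) :
    B.deg l = 1 := by
  obtain ⟨c, hc, h1, _⟩ := h.codeword l hl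
  refine deg_of_codeword hc ?_
  rw [h1]
  exact one_ne_zero

theorem copySparse (h : IsSwitching A B L w m j G φ η) {γ : ℝ} {f : A.Cell × B.Cell → ZMod 2}
    (hf : Sparse G η γ (φ '' {c | f c ≠ 0})) : CopySparse A B L η γ f :=
  fun l _ => h.sparse_copy hf l

theorem coboundary_of_onInput (h : IsSwitching A B L w m j G φ η) {f : A.Cell × B.Cell → ZMod 2}
    (hf : ∀ c, f c ≠ 0 → c.2 ∈ L) : opRight B.coboundary f = 0 := by
  funext c
  obtain ⟨a, b⟩ := c
  rw [opRight_apply, coboundary_right_eq_zero fun b hb => h.deg_of_mem (hf (a, b) hb)]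
  rfl

theorem resL_onInput_D (h : IsSwitching A B L w m j G φ η) {f : A.Cell × B.Cell → ZMod 2}
    (hf : f ∈ levD A B j) : OnInput A B L j (resL L f) := by
  intro c hc
  by_cases hL : c.2 ∈ L
  · refine ⟨?_, hL⟩
    rw [resL_of_mem _ hL] at hc
    have h1 := mem_levD.1 hf c hc
    have h2 := h.deg_of_mem hL
    omega
  · exact absurd (resL_of_notMem _ hL) hc

theorem resL_onInput_C (h : IsSwitching A B L w m j G φ η) {f : A.Cell × B.Cell → ZMod 2}
    (hf : f ∈ levC A B (j + 1)) : OnInput A B L j (resL L f) := by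
  intro c hc
  by_cases hL : c.2 ∈ L
  · refine ⟨?_, hL⟩
    rw [resL_of_mem _ hL] at hc
    have h1 := mem_levC.1 hf c hc
    have h2 := h.deg_of_mem hL
    omega
  · exact absurd (resL_of_notMem _ hL) hc

theorem onInput_level_C (h : IsSwitching A B L w m j G φ η) {f : A.Cell × B.Cell → ZMod 2}
    (hf : OnInput A B L j f) : f ∈ levC A B (j + 1) := by
  intro c hc
  by_contra h1
  obtain ⟨h2, h3⟩ := hf c h1
  have h4 := h.deg_of_mem h3
  refine hc ?_
  change A.deg c.1 + B.deg c.2 = j + 1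
  omega

theorem sparse_resL {γ : ℝ} {f : A.Cell × B.Cell → ZMod 2}
    (hf : Sparse G η γ (φ '' {c | f c ≠ 0})) : Sparse G η γ (φ '' {c | resL L f c ≠ 0}) := by
  refine hf.mono (Set.image_mono fun c hc => ?_) le_rfl
  by_cases hL : c.2 ∈ L
  · exact (resL_of_mem f hL ▸ hc : f c ≠ 0)
  · exact absurd (resL_of_notMem _ hL) hc

/-- The rate of the errors that remain after decoding errors of rate `γ₁`. -/
def residualRate (w : ℕ) (γ₁ : ℝ) : ℝ := 2 * (1 + w + (w * w : ℕ)) * (2 * γ₁)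

/-- The errors of rate `γ₀` on the input and of rate `γ₁` in the circuit can be corrected. -/
def IsCorrectable (w : ℕ) (γ₀ γ₁ : ℝ) : Prop :=
  0 ≤ γ₀ ∧ 0 ≤ γ₁ ∧
    2 * (γ₀ + (residualRate w γ₁ + 2 * (1 + w) * residualRate w γ₁)) * (1 + w) ≤ 1

theorem IsCorrectable.two_mul_le (h : IsCorrectable w γ₀ γ₁) : 2 * γ₁ * (1 + w) ≤ 1 := by
  obtain ⟨h0, h1, h2⟩ := h
  refine le_trans (mul_le_mul_of_nonneg_right ?_ (by positivity)) h2
  have h3 : γ₁ ≤ residualRate w γ₁ := by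
    unfold residualRate
    have : (0 : ℝ) ≤ (w + (w * w : ℕ)) * γ₁ := by positivity
    nlinarith
  have h4 : 0 ≤ 2 * (1 + (w : ℝ)) * residualRate w γ₁ := by
    have := h1.trans h3
    positivity
  linarith

open Classical in
/-- A sparse preimage of a syndrome, if there is one. -/
def sparsePreimage {X Y : Type} (P : (X → ZMod 2) → Prop) (T : (X → ZMod 2) → Y → ZMod 2)
    (t : Y → ZMod 2) : X → ZMod 2 :=
  if h : ∃ n, P n ∧ T n = t then h.choose else 0

theorem sparsePreimage_spec {X Y : Type} {P : (X → ZMod 2) → Prop}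
    {T : (X → ZMod 2) → Y → ZMod 2} {t : Y → ZMod 2} (h : ∃ n, P n ∧ T n = t) :
    P (sparsePreimage P T t) ∧ T (sparsePreimage P T t) = t := by
  rw [sparsePreimage, dif_pos h]
  exact h.choose_spec

/-- Decoding of bit-flip errors. There is a correction, determined by the measured syndrome `s` of
the level-`j` code of `A ⊗ B*`, such that, for all input errors `ex` and measurement errors `n`,
the residual error is sparse, does not depend on the random outcome of the gauge
measurements and is known up to stabilizers of the input code. -/
theorem exists_correction_X (h : IsSwitching A B L w m j G φ η) (hγ : IsCorrectable w γ₀ γ₁) :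
    ∃ corr : (A.Cell × B.Cell → ZMod 2) → A.Cell × B.Cell → ZMod 2,
      (∀ s, OnInput A B L j (corr s)) ∧
      ∀ ex n, OnInput A B L j ex → CopySparse A B L η γ₀ ex →
        n ∈ levD A B (j + 1) → Sparse G η γ₁ (φ '' {c | n c ≠ 0}) →
        ∃ f, OnInput A B L j f ∧ Sparse G η (residualRate w γ₁) (φ '' {c | f c ≠ 0}) ∧
          ∀ s g, g ∈ levD A B j → (∀ c, g c ≠ 0 → c.2 ∉ L) →
            s + n + delD A B ex = delD A B g →
            ∃ x, (∀ c, x c ≠ 0 → A.deg c.1 + 1 = j ∧ c.2 ∈ L) ∧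
              corr s + ex + f = opLeft A.coboundary x := by
  classical
  have hγ1 := hγ.1
  set P : (A.Cell × B.Cell → ZMod 2) → Prop := fun n =>
    n ∈ levD A B (j + 1) ∧ Sparse G η γ₁ (φ '' {c | n c ≠ 0}) with hP
  set N : (A.Cell × B.Cell → ZMod 2) → A.Cell × B.Cell → ZMod 2 := fun t =>
    sparsePreimage P (delD A B) t with hN
  set γ₂ := residualRate w γ₁ with hγ₂
  -- the correction is any sparse input error which, with gauge qubits, explains the repaired syndrome
  let Q : (A.Cell × B.Cell → ZMod 2) → (A.Cell × B.Cell → ZMod 2) → Prop := fun s e =>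
    OnInput A B L j e ∧ CopySparse A B L η (γ₀ + γ₂) e ∧
      ∃ g, (∀ c, g c ≠ 0 → c.2 ∉ L) ∧ s + N (delD A B s) = delD A B (e + g)
  let corr : (A.Cell × B.Cell → ZMod 2) → A.Cell × B.Cell → ZMod 2 := fun s =>
    if hs : ∃ e, Q s e then hs.choose else 0
  have hcorr : ∀ s, (∃ e, Q s e) → Q s (corr s) := fun s hs => by
    change Q s (if hs : ∃ e, Q s e then hs.choose else 0)
    rw [dif_pos hs]
    exact hs.choose_spec
  refine ⟨corr, ?_, ?_⟩
  · intro s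
    by_cases hs : ∃ e, Q s e
    · exact (hcorr s hs).1
    · intro c hc
      refine absurd ?_ hc
      change (if hs : ∃ e, Q s e then hs.choose else 0 : A.Cell × B.Cell → ZMod 2) c = 0
      rw [dif_neg hs]
      rfl
  intro ex n hex hexs hn hns
  obtain ⟨⟨hN1, hN2⟩, hN3⟩ := sparsePreimage_spec (P := P) (T := delD A B) (t := delD A B n)
    ⟨n, ⟨hn, hns⟩, rfl⟩
  change N (delD A B n) ∈ _ at hN1
  change Sparse G η γ₁ (φ '' {c | N (delD A B n) c ≠ 0}) at hN2
  change delD A B (N (delD A B n)) = _ at hN3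
  obtain ⟨f, hf, hfe, hfS⟩ := h.preimage_D (γ := 2 * γ₁) hγ.two_mul_le
    (e := n + N (delD A B n)) (Submodule.add_mem _ hn hN1) (by
      rw [map_add, hN3, add_self_fun]) (by
      rw [two_mul]
      exact sparse_add hns hN2)
  change Sparse G η γ₂ _ at hfS
  refine ⟨resL L f, h.resL_onInput_D hf, sparse_resL hfS, ?_⟩
  intro s g _ hgL hsg
  have hs : delD A B s = delD A B n := by
    have h1 := congrArg (delD A B) hsg
    rw [map_add, map_add, delD_delD, delD_delD, add_zero] at h1
    exact eq_of_add_eq_zero_fun h1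
  have hs' : s = n + delD A B ex + delD A B g := by
    rw [← hsg]
    funext c
    simp only [Pi.add_apply]
    linear_combination (-(n c) - delD A B ex c) * (CharTwo.two_eq_zero (R := ZMod 2))
  -- the actual error is such an explanation
  have hQ : ∃ e, Q s e := by
    refine ⟨ex + resL L f, hex.add (h.resL_onInput_D hf),
      hexs.add (h.copySparse (sparse_resL hfS)), g + (f + resL L f), ?_, ?_⟩
    · intro c hc hcL
      refine hc ?_
      have h1 : g c = 0 := by
        by_contra h1
        exact hgL c h1 hcL
      rw [Pi.add_apply, Pi.add_apply, resL_of_mem _ hcL, h1, CharTwo.add_self_eq_zero, add_zero]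
    · have e1 : ex + resL L f + (g + (f + resL L f)) = ex + g + f := by
        funext c
        simp only [Pi.add_apply]
        linear_combination (resL L f c) * (CharTwo.two_eq_zero (R := ZMod 2))
      rw [e1, hs, map_add, map_add, hfe]
      nth_rewrite 1 [hs']
      funext c
      simp only [Pi.add_apply]
      ring
  obtain ⟨hc1, hc2, g', hg', hsg'⟩ := hcorr s hQ
  set e := corr s + ex + resL L f with he
  have heI : OnInput A B L j e := (hc1.add hex).add (h.resL_onInput_D hf)
  have heS : CopySparse A B L η (2 * (γ₀ + γ₂)) e := by
    intro l hl
    exact ((hc2.add hexs).add (h.copySparse (sparse_resL hfS)) l hl).mono subset_rfl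
      (by linarith)
  -- on a copy labelled by `l ∈ L`, the error `e` is a cocycle of `A`
  have hδ : delD A B e = delD A B (g' + (g + (f + resL L f))) := by
    have e1 : e = (corr s + g') + (ex + g + f) + (g' + (g + (f + resL L f))) := by
      funext c
      simp only [he, Pi.add_apply]
      linear_combination (-(g' c) - g c - f c) * (CharTwo.two_eq_zero (R := ZMod 2))
    rw [e1, map_add _ (corr s + g' + _), map_add _ (corr s + g'), ← hsg', map_add _ (ex + g),
      map_add _ ex, hfe, hs, hs']
    have e2 : n + delD A B ex + delD A B g + N (delD A B n) +
        (delD A B ex + delD A B g + (n + N (delD A B n))) = 0 := by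
      rw [← add_self_fun (n + delD A B ex + delD A B g + N (delD A B n))]
      abel
    rw [e2, zero_add]
  have hcyc : ∀ l ∈ L, A.coboundary (fun a => e (a, l)) = 0 := by
    intro l hl
    funext a
    have h1 := congrFun hδ (a, l)
    rw [delD_eq, delD_eq, Pi.add_apply, Pi.add_apply, opLeft_apply, opRight_apply, opLeft_apply,
      opRight_apply, boundary_right_of_deg_one (h.deg_of_mem hl),
      boundary_right_of_deg_one (h.deg_of_mem hl), add_zero, add_zero] at h1
    rw [h1]
    have e2 : (fun a => (g' + (g + (f + resL L f))) (a, l)) = 0 := by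
      funext a
      have h2 : g' (a, l) = 0 := by
        by_contra h2
        exact hg' _ h2 hl
      have h3 : g (a, l) = 0 := by
        by_contra h3
        exact hgL _ h3 hl
      rw [Pi.add_apply, Pi.add_apply, Pi.add_apply, resL_of_mem f (c := (a, l)) hl, h2, h3,
        CharTwo.add_self_eq_zero, add_zero]
      rfl
    rw [e2, map_zero]
  have hcob : ∀ l ∈ L, ∃ x ∈ A.level (j - 1), A.coboundary x = fun a => e (a, l) := by
    intro l hl
    have h1 : (fun a => e (a, l)) ∈ A.coboundaries j := by
      refine h.mem_coboundaries_A l (γ := 2 * (γ₀ + γ₂)) ?_ ⟨?_, hcyc l hl⟩ (heS l hl)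
      · refine le_trans (mul_le_mul_of_nonneg_right ?_ (by positivity)) hγ.2.2
        have : 0 ≤ 2 * (1 + (w : ℝ)) * γ₂ := by
          have := hγ.2.1
          rw [hγ₂, residualRate]
          positivity
        linarith
      · intro a ha
        by_contra h2
        exact ha (heI _ h2).1
    obtain ⟨k, rfl⟩ : ∃ k, j = k + 1 := ⟨j - 1, by have := h.one_le; omega⟩
    obtain ⟨x, hx, hxe⟩ := h1
    exact ⟨x, hx, hxe⟩
  choose! x hx hxe using hcob
  refine ⟨fun c => if c.2 ∈ L then x c.2 c.1 else 0, ?_, ?_⟩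
  · intro c hc
    by_cases hL : c.2 ∈ L
    · refine ⟨?_, hL⟩
      have h1 : x c.2 c.1 ≠ 0 := by simpa [hL] using hc
      have h2 : A.deg c.1 = j - 1 := by
        by_contra h2
        exact h1 (hx _ hL _ h2)
      have := h.one_le
      omega
    · simp [hL] at hc
  · funext c
    obtain ⟨a, b⟩ := c
    rw [opLeft_apply]
    by_cases hL : b ∈ L
    · simp only [hL, if_true]
      rw [hxe b hL]
    · have h1 : e (a, b) = 0 := by
        by_contra h1
        exact hL (heI _ h1).2
      simp only [hL, if_false]
      have h2 : A.coboundary (fun _ => 0) = 0 := map_zero _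
      rw [h2, h1]
      rfl

end IsSwitching

end Decoding

section Removed

variable {d : ℕ} (A : BasedComplex d) (B : BasedComplex 1) (L : Finset B.Cell)

/-- The boundary map of `A ⊗ B*` with the cells of `L` removed. -/
def bdDL : (A.Cell × {b : B.Cell // b ∉ L} → ZMod 2) →ₗ[ZMod 2]
    (A.Cell × {b : B.Cell // b ∉ L} → ZMod 2) :=
  (A.tensor (B.removeCells L).dual).boundary

/-- The cochains of level `j` of `A ⊗ B*` with the cells of `L` removed. -/
def levDL (j : ℕ) : Submodule (ZMod 2) (A.Cell × {b : B.Cell // b ∉ L} → ZMod 2) :=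
  (A.tensor (B.removeCells L).dual).level j

/-- The coboundary map of `B` with the cells of `L` removed. -/
def delRemoved : ({b : B.Cell // b ∉ L} → ZMod 2) →ₗ[ZMod 2] ({b : B.Cell // b ∉ L} → ZMod 2) :=
  (B.removeCells L).coboundary

variable {A B L}

theorem mem_levDL {j : ℕ} {f : A.Cell × {b : B.Cell // b ∉ L} → ZMod 2} :
    f ∈ levDL A B L j ↔ ∀ c, f c ≠ 0 → A.deg c.1 + (1 - B.deg c.2.1) = j :=
  forall_congr' fun _ => not_imp_comm

theorem bdDL_eq (f : A.Cell × {b : B.Cell // b ∉ L} → ZMod 2) :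
    bdDL A B L f = opLeft A.boundary f + opRight (delRemoved B L) f :=
  tensor_boundary A (B.removeCells L).dual f

/-- The restriction of a cochain to the cells that are not over `L`. -/
def restr (f : A.Cell × B.Cell → ZMod 2) : A.Cell × {b : B.Cell // b ∉ L} → ZMod 2 :=
  fun c => f (c.1, c.2.1)

open Classical in
/-- The extension by zero of a cochain on the cells that are not over `L`. -/
def lift (f : A.Cell × {b : B.Cell // b ∉ L} → ZMod 2) : A.Cell × B.Cell → ZMod 2 :=
  fun c => if h : c.2 ∉ L then f (c.1, ⟨c.2, h⟩) else 0

theorem lift_of_notMem (f : A.Cell × {b : B.Cell // b ∉ L} → ZMod 2) {c : A.Cell × B.Cell}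
    (h : c.2 ∉ L) : lift f c = f (c.1, ⟨c.2, h⟩) := dif_pos h

theorem lift_of_mem (f : A.Cell × {b : B.Cell // b ∉ L} → ZMod 2) {c : A.Cell × B.Cell}
    (h : c.2 ∈ L) : lift f c = 0 := dif_neg (not_not.2 h)

theorem restr_add (f g : A.Cell × B.Cell → ZMod 2) :
    restr (L := L) (f + g) = restr f + restr g := rfl

theorem restr_lift (f : A.Cell × {b : B.Cell // b ∉ L} → ZMod 2) : restr (lift f) = f := by
  funext c
  exact lift_of_notMem f c.2.2

theorem lift_mem_levD {j : ℕ} {f : A.Cell × {b : B.Cell // b ∉ L} → ZMod 2}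
    (hf : f ∈ levDL A B L j) : lift f ∈ levD A B j := by
  rw [mem_levD]
  intro c hc
  by_cases h : c.2 ∈ L
  · exact absurd (lift_of_mem f h) hc
  · rw [lift_of_notMem f h] at hc
    exact mem_levDL.1 hf _ hc

theorem restr_mem_levDL {j : ℕ} {f : A.Cell × B.Cell → ZMod 2} (hf : f ∈ levD A B j) :
    restr f ∈ levDL A B L j := by
  rw [mem_levDL]
  intro c hc
  exact mem_levD.1 hf _ hc

theorem image_restr {V : Type} (φ : A.Cell × B.Cell → V) (f : A.Cell × B.Cell → ZMod 2) :
    (fun c : A.Cell × {b : B.Cell // b ∉ L} => φ (c.1, c.2.1)) '' {c | restr f c ≠ 0} ⊆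
      φ '' {c | f c ≠ 0} := by
  rintro _ ⟨c, hc, rfl⟩
  exact ⟨_, hc, rfl⟩

theorem image_lift {V : Type} (φ : A.Cell × B.Cell → V)
    (f : A.Cell × {b : B.Cell // b ∉ L} → ZMod 2) :
    φ '' {c | lift f c ≠ 0} ⊆
      (fun c : A.Cell × {b : B.Cell // b ∉ L} => φ (c.1, c.2.1)) '' {c | f c ≠ 0} := by
  rintro _ ⟨c, hc, rfl⟩
  have hc' : lift f c ≠ 0 := hc
  by_cases h : c.2 ∈ L
  · exact absurd (lift_of_mem f h) hc'
  · rw [lift_of_notMem f h] at hc'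
    exact ⟨_, hc', rfl⟩

/-- Removing cells of level `1` from `B` commutes with the boundary map of `A ⊗ B*`. -/
theorem restr_bdD (hL : ∀ l ∈ L, B.deg l = 1) (y : A.Cell × B.Cell → ZMod 2) :
    restr (bdD A B y) = bdDL A B L (restr y) := by
  funext c
  obtain ⟨a, b, hb⟩ := c
  rw [bdDL_eq, Pi.add_apply, opLeft_apply, opRight_apply]
  change bdD A B y (a, b) = _
  rw [bdD_eq, Pi.add_apply, opLeft_apply, opRight_apply]
  congr 1
  change ∑ b', y (a, b') * B.inc b' b = ∑ b' : {b : B.Cell // b ∉ L}, y (a, b'.1) * B.inc b'.1 b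
  rw [← Finset.sum_subtype (Finset.univ.filter fun b' => b' ∉ L) (by simp)
    (fun b' => y (a, b') * B.inc b' b)]
  refine (Finset.sum_subset (Finset.filter_subset _ _) fun b' _ hb' => ?_).symm
  have h1 : b' ∈ L := by simpa using hb'
  have h2 : B.inc b' b = 0 := by
    by_contra h2
    have h3 := B.inc_deg _ _ h2
    have h4 := B.deg_le b
    have h5 := hL b' h1
    omega
  rw [h2, mul_zero]

end Removed

section Decoding

variable {d : ℕ} {A : BasedComplex d} {B : BasedComplex 1} {L : Finset B.Cell} {w m j : ℕ}
  {V : Type} {G : SimpleGraph V} {φ : A.Cell × B.Cell → V} {η γ₀ γ₁ : ℝ}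

namespace IsSwitching

theorem preimage_DL (h : IsSwitching A B L w m j G φ η) {γ : ℝ} (hγ : γ * (1 + w) ≤ 1)
    {e : A.Cell × {b : B.Cell // b ∉ L} → ZMod 2} (he : e ∈ levDL A B L j)
    (he' : bdDL A B L e = 0)
    (hS : Sparse G η γ ((fun c : A.Cell × {b : B.Cell // b ∉ L} => φ (c.1, c.2.1)) ''
      {c | e c ≠ 0})) :
    ∃ f ∈ levDL A B L (j + 1), bdDL A B L f = e ∧
      Sparse G η (2 * (1 + w + (w * w : ℕ)) * γ)
        ((fun c : A.Cell × {b : B.Cell // b ∉ L} => φ (c.1, c.2.1)) '' {c | f c ≠ 0}) := by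
  refine h.exists_preimage_DL hγ (e := e) ⟨fun c hc => he c fun hc' => hc ?_, he'⟩ hS
  change d + 1 - (A.tensor (B.removeCells L).dual).deg c = d + 1 - j
  rw [hc']

/-- The part on the copies labelled by `L` of the boundary of a chain of `A ⊗ B*`, which vanishes
elsewhere, is a boundary in every copy. Contraction with the codewords of `ker ∂` which
single out an element of `L` gives the preimages. -/
theorem exists_resL_bdD_eq (h : IsSwitching A B L w m j G φ η) {y : A.Cell × B.Cell → ZMod 2}
    (hy : y ∈ levD A B (j + 1)) (hy' : ∀ c : A.Cell × B.Cell, c.2 ∉ L → bdD A B y c = 0) :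
    ∃ x, OnInput A B L (j + 1) x ∧ resL L (bdD A B y) = opLeft A.boundary x := by
  classical
  have hcw : ∀ l ∈ L, ∃ c : B.Cell → ZMod 2, c ∈ B.dual.cocycles 0 ∧ c l = 1 ∧
      ∀ l' ∈ L, l' ≠ l → c l' = 0 := h.codeword
  choose! c hc hc1 hc2 using hcw
  have hcon : ∀ l ∈ L, contract (c l) (bdD A B y) = fun a => bdD A B y (a, l) := by
    intro l hl
    funext a
    change ∑ b, c l b * bdD A B y (a, b) = _
    rw [Finset.sum_eq_single l, hc1 l hl, one_mul]
    · intro b _ hb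
      by_cases hbL : b ∈ L
      · rw [hc2 l hl b hbL hb, zero_mul]
      · rw [hy' (a, b) hbL, mul_zero]
    · simp
  refine ⟨fun p => if p.2 ∈ L then contract (c p.2) y p.1 else 0, ?_, ?_⟩
  · intro p hp
    by_cases hL : p.2 ∈ L
    · refine ⟨?_, hL⟩
      simp only [hL, if_true] at hp
      obtain ⟨b, _, hb⟩ := Finset.exists_ne_zero_of_sum_ne_zero hp
      have h1 := deg_of_codeword (hc _ hL) (left_ne_zero_of_mul hb)
      have h2 := mem_levD.1 hy _ (right_ne_zero_of_mul hb)
      simp only at h2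
      omega
    · simp [hL] at hp
  · funext p
    obtain ⟨a, b⟩ := p
    rw [opLeft_apply]
    by_cases hL : b ∈ L
    · rw [resL_of_mem _ hL]
      simp only [hL, if_true]
      have h1 := congrFun (hcon b hL) a
      rw [bdD_eq, contract_add, contract_opLeft, contract_opRight (hc b hL), add_zero] at h1
      rw [bdD_eq]
      exact h1.symm
    · rw [resL_of_notMem _ hL]
      simp only [hL, if_false]
      exact (congrFun (map_zero A.boundary) a).symm

theorem sparse_resL_bdD (h : IsSwitching A B L w m j G φ η) {γ : ℝ}
    {f : A.Cell × B.Cell → ZMod 2} (hf : f ∈ levD A B (j + 1))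
    (hS : Sparse G η γ (φ '' {c | f c ≠ 0})) :
    Sparse G η (2 * (1 + w) * γ) (φ '' {c | bdD A B f c ≠ 0}) := by
  refine hS.neighbourhood h.inj (R := fun c c' => Nbr A B c c' ∧ A.Anchored c.1)
    (fun c c' hcc => Or.inr (h.adj_of_nbr hcc.1 (Or.inl hcc.2))) (Δ := w) ?_ ?_
  · intro c
    exact (Set.ncard_le_ncard (fun c' hc' => hc'.1) (Set.toFinite _)).trans
      (ncard_nbr_le h.locality c)
  · intro c hc
    right
    have hc' : ∑ c' : A.Cell × B.Cell, f c' * (A.tensor B.dual).inc c c' ≠ 0 := hc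
    obtain ⟨c', _, hcc⟩ := Finset.exists_ne_zero_of_sum_ne_zero hc'
    have h1 := left_ne_zero_of_mul hcc
    exact ⟨c', h1, (nbr_of_inc_dual (right_ne_zero_of_mul hcc)).symm,
      h.anchored_D (c := c') (mem_levD.1 hf _ h1)⟩

/-- Chains which vanish over `L` have boundary zero over `L`, in the direction of `A`, and
the other direction contributes nothing over `L` either. -/
theorem bdC_apply_of_mem (h : IsSwitching A B L w m j G φ η) (f : A.Cell × B.Cell → ZMod 2)
    (a : A.Cell) {l : B.Cell} (hl : l ∈ L) :
    bdC A B f (a, l) = A.boundary (fun a => f (a, l)) a := by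
  rw [bdC_eq, Pi.add_apply, opLeft_apply, opRight_apply,
    boundary_right_of_deg_one (h.deg_of_mem hl), add_zero]

/-- A cycle of `A ⊗ B`, whose part over `L` is sparse in every copy of `A`, is orthogonal to
the cocycles of the copies. -/
theorem dotProduct_eq_zero_of_copySparse (h : IsSwitching A B L w m j G φ η) {γ : ℝ}
    (hγ : γ * (1 + w) ≤ 1) {q v : A.Cell × B.Cell → ZMod 2} (hq : q ∈ levC A B (j + 1))
    (hq' : bdC A B q = 0) (hqS : CopySparse A B L η γ q) (hv : OnInput A B L j v)
    (hv' : opLeft A.coboundary v = 0) : q ⬝ᵥ v = 0 := by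
  classical
  have hsum : q ⬝ᵥ v = ∑ b, (fun a => q (a, b)) ⬝ᵥ fun a => v (a, b) := by
    simp only [dotProduct]
    rw [Fintype.sum_prod_type, Finset.sum_comm]
  rw [hsum]
  refine Finset.sum_eq_zero fun b _ => ?_
  by_cases hb : b ∈ L
  · have h1 : (fun a => q (a, b)) ∈ A.dual.coboundaries (d - j) := by
      refine h.mem_boundaries_A b hγ ⟨?_, ?_⟩ (hqS b hb)
      · intro a ha
        by_contra h2
        have h3 := mem_levC.1 hq _ h2
        have h4 := h.deg_of_mem hb
        simp only at h3
        refine ha ?_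
        change d - A.deg a = d - j
        omega
      · change A.boundary _ = 0
        funext a
        rw [← h.bdC_apply_of_mem q a hb, hq']
        rfl
    have hdj : d - j = (d - j - 1) + 1 := by
      have := h.succ_le
      omega
    rw [hdj] at h1
    obtain ⟨x, _, hx⟩ : ∃ x : A.Cell → ZMod 2, x ∈ A.dual.level (d - j - 1) ∧
        A.dual.coboundary x = fun a => q (a, b) := h1
    have hx' : A.boundary x = fun a => q (a, b) := hx
    have hv'' : A.coboundary (fun a => v (a, b)) = 0 := by
      funext a
      exact congrFun hv' (a, b)
    rw [← hx', boundary_dot, hv'', dotProduct_zero]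
  · refine Finset.sum_eq_zero fun a _ => ?_
    have h1 : v (a, b) = 0 := by
      by_contra h1
      exact hb (hv _ h1).2
    change q (a, b) * v (a, b) = 0
    rw [h1, mul_zero]

/-- Decoding of phase-flip errors. There is a correction, determined by the outcomes `z` of measuring
out the gauge qubits and the outcomes `k` of the new checks, such that, for all input errors `ez` and
measurement errors, the total phase operator is, up to a residual error which is sparse and
does not depend on the outcomes, a cycle that acts trivially on the encoded states. Here `y` and
`t` are chains explaining the actual outcomes. -/
theorem exists_correction_Z (h : IsSwitching A B L w m j G φ η) (hγ : IsCorrectable w γ₀ γ₁) :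
    ∃ corr : (A.Cell × B.Cell → ZMod 2) → (A.Cell × B.Cell → ZMod 2) → A.Cell × B.Cell → ZMod 2,
      (∀ z k, corr z k ∈ levC A B (j + 1)) ∧
      ∀ ez nz nk, OnInput A B L j ez → CopySparse A B L η γ₀ ez →
        nz ∈ levD A B j → Sparse G η γ₁ (φ '' {c | nz c ≠ 0}) →
        nk ∈ levC A B j → Sparse G η γ₁ (φ '' {c | nk c ≠ 0}) →
        ∃ f ∈ levC A B (j + 1), Sparse G η (residualRate w γ₁) (φ '' {c | f c ≠ 0}) ∧
          ∀ z k y t, y ∈ levD A B (j + 1) → (∀ c : A.Cell × B.Cell, c.2 ∉ L →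
              z c + nz c = bdD A B y c) → t ∈ levC A B (j + 1) → (∀ c, t c ≠ 0 → c.2 ∉ L) →
            k + nk + bdC A B (resL L (bdD A B y) + ez) = bdC A B t →
            bdC A B (corr z k + resL L (bdD A B y) + ez + t + f) = 0 ∧
            ∀ v, OnInput A B L j v → opLeft A.coboundary v = 0 →
              (corr z k + resL L (bdD A B y) + ez + t + f) ⬝ᵥ v = 0 := by
  classical
  have hdL : ∀ l ∈ L, B.deg l = 1 := fun l hl => h.deg_of_mem hl
  set γ₂ := residualRate w γ₁ with hγ₂
  set ψ : A.Cell × {b : B.Cell // b ∉ L} → V := fun c => φ (c.1, c.2.1) with hψ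
  set N₁ : (A.Cell × {b : B.Cell // b ∉ L} → ZMod 2) → A.Cell × {b : B.Cell // b ∉ L} → ZMod 2 :=
    fun t => sparsePreimage (fun n => n ∈ levDL A B L j ∧ Sparse G η γ₁ (ψ '' {c | n c ≠ 0}))
      (bdDL A B L) t with hN₁
  set N₂ : (A.Cell × B.Cell → ZMod 2) → A.Cell × B.Cell → ZMod 2 :=
    fun t => sparsePreimage (fun n => n ∈ levC A B j ∧ Sparse G η γ₁ (φ '' {c | n c ≠ 0}))
      (bdC A B) t with hN₂
  -- a chain explaining the corrected outcomes of the gauge qubits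
  let Y : (A.Cell × B.Cell → ZMod 2) → A.Cell × B.Cell → ZMod 2 := fun z =>
    sparsePreimage (fun y => y ∈ levD A B (j + 1)) (fun y => restr (L := L) (bdD A B y))
      (restr z + N₁ (bdDL A B L (restr z)))
  let K : (A.Cell × B.Cell → ZMod 2) → (A.Cell × B.Cell → ZMod 2) → A.Cell × B.Cell → ZMod 2 :=
    fun z k => k + bdC A B (resL L (bdD A B (Y z)))
  -- explanations of the repaired outcomes of the new checks: a sparse error on the copies and any
  -- chain elsewhere
  let Q : (A.Cell × B.Cell → ZMod 2) → (A.Cell × B.Cell → ZMod 2) →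
      (A.Cell × B.Cell → ZMod 2) × (A.Cell × B.Cell → ZMod 2) → Prop := fun z k p =>
    OnInput A B L j p.1 ∧ CopySparse A B L η (γ₀ + (γ₂ + 2 * (1 + w) * γ₂)) p.1 ∧
      p.2 ∈ levC A B (j + 1) ∧ (∀ c, p.2 c ≠ 0 → c.2 ∉ L) ∧
      K z k + N₂ (bdC A B (K z k)) = bdC A B (p.1 + p.2)
  let corr : (A.Cell × B.Cell → ZMod 2) → (A.Cell × B.Cell → ZMod 2) → A.Cell × B.Cell → ZMod 2 :=
    fun z k => if hs : ∃ p, Q z k p then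
      resL L (bdD A B (Y z)) + (hs.choose.1 + hs.choose.2) else 0
  have hYlev : ∀ z, Y z ∈ levD A B (j + 1) := by
    intro z
    by_cases hz : ∃ y, y ∈ levD A B (j + 1) ∧ restr (L := L) (bdD A B y) =
        restr z + N₁ (bdDL A B L (restr z))
    · exact (sparsePreimage_spec (P := fun y => y ∈ levD A B (j + 1))
        (T := fun y => restr (L := L) (bdD A B y)) hz).1
    · change sparsePreimage _ _ _ ∈ _
      rw [sparsePreimage, dif_neg hz]
      exact Submodule.zero_mem _
  have hθ : ∀ y ∈ levD A B (j + 1), resL L (bdD A B y) ∈ levC A B (j + 1) := fun y hy =>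
    h.onInput_level_C (h.resL_onInput_D (bdD_mem_level hy))
  refine ⟨corr, ?_, ?_⟩
  · intro z k
    change (if hs : ∃ p, Q z k p then resL L (bdD A B (Y z)) + (hs.choose.1 + hs.choose.2) else 0)
      ∈ levC A B (j + 1)
    by_cases hs : ∃ p, Q z k p
    · rw [dif_pos hs]
      exact Submodule.add_mem _ (hθ _ (hYlev z)) (Submodule.add_mem _
        (h.onInput_level_C hs.choose_spec.1) hs.choose_spec.2.2.1)
    · rw [dif_neg hs]
      exact Submodule.zero_mem _
  intro ez nz nk hez hezs hnz hnzs hnk hnks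
  -- the corrections of the measurement errors
  obtain ⟨⟨hn1, hn2⟩, hn3⟩ := sparsePreimage_spec
    (P := fun n => n ∈ levDL A B L j ∧ Sparse G η γ₁ (ψ '' {c | n c ≠ 0}))
    (T := bdDL A B L) (t := bdDL A B L (restr nz))
    ⟨restr nz, ⟨restr_mem_levDL hnz, hnzs.mono (image_restr φ nz) le_rfl⟩, rfl⟩
  set n₁ := N₁ (bdDL A B L (restr nz)) with hn₁
  change n₁ ∈ _ at hn1
  change Sparse G η γ₁ (ψ '' {c | n₁ c ≠ 0}) at hn2
  change bdDL A B L n₁ = _ at hn3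
  obtain ⟨⟨hm1, hm2⟩, hm3⟩ := sparsePreimage_spec
    (P := fun n => n ∈ levC A B j ∧ Sparse G η γ₁ (φ '' {c | n c ≠ 0}))
    (T := bdC A B) (t := bdC A B nk) ⟨nk, ⟨hnk, hnks⟩, rfl⟩
  set n₂ := N₂ (bdC A B nk) with hn₂
  change n₂ ∈ _ at hm1
  change Sparse G η γ₁ (φ '' {c | n₂ c ≠ 0}) at hm2
  change bdC A B n₂ = _ at hm3
  obtain ⟨f₁, hf₁, hfe₁, hfS₁⟩ := h.preimage_DL (γ := 2 * γ₁) hγ.two_mul_le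
    (e := restr nz + n₁) (Submodule.add_mem _ (restr_mem_levDL hnz) hn1) (by
      rw [map_add, hn3, add_self_fun]) (by
      rw [two_mul]
      exact sparse_add (hnzs.mono (image_restr φ nz) le_rfl) hn2)
  obtain ⟨f₂, hf₂, hfe₂, hfS₂⟩ := h.preimage_C (γ := 2 * γ₁) hγ.two_mul_le
    (e := nk + n₂) (Submodule.add_mem _ hnk hm1) (by
      rw [map_add, hm3, add_self_fun]) (by
      rw [two_mul]
      exact sparse_add hnks hm2)
  change Sparse G η γ₂ _ at hfS₁ hfS₂
  refine ⟨f₂, hf₂, hfS₂, ?_⟩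
  intro z k y t hy hz ht htL hk
  have hzr : restr z = restr nz + bdDL A B L (restr (L := L) y) := by
    rw [← restr_bdD hdL]
    funext c
    have := hz (c.1, c.2.1) c.2.2
    change z _ = nz _ + bdD A B y _
    rw [← this]
    linear_combination (-(nz (c.1, c.2.1))) * (CharTwo.two_eq_zero (R := ZMod 2))
  have hbb : ∀ g, bdDL A B L (bdDL A B L g) = 0 := fun g => by
    funext c
    exact congrFun (coboundary_coboundary (A.tensor (B.removeCells L).dual).dual g) c
  have hzn : N₁ (bdDL A B L (restr z)) = n₁ := by
    rw [hzr, map_add, hbb, add_zero]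
  obtain ⟨hY1, hY2⟩ := sparsePreimage_spec (P := fun y => y ∈ levD A B (j + 1))
    (T := fun y => restr (L := L) (bdD A B y)) (t := restr z + N₁ (bdDL A B L (restr z)))
    ⟨y + lift f₁, Submodule.add_mem _ hy (lift_mem_levD hf₁), by
      rw [hzn, restr_bdD hdL, restr_add, restr_lift, map_add, hfe₁, hzr]
      abel⟩
  set y' := Y z with hy'
  change y' ∈ _ at hY1
  change restr (L := L) (bdD A B y') = _ at hY2
  -- the two explanations of the outcomes of the gauge qubits differ by a sparse error and a cycle
  set σ₁ := resL L (bdD A B (lift f₁)) with hσ₁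
  have hσlev : OnInput A B L j σ₁ := h.resL_onInput_D (bdD_mem_level (lift_mem_levD hf₁))
  have hσS : Sparse G η (2 * (1 + w) * γ₂) (φ '' {c | σ₁ c ≠ 0}) :=
    sparse_resL (h.sparse_resL_bdD (lift_mem_levD hf₁) (hfS₁.mono (image_lift φ f₁) le_rfl))
  obtain ⟨x, hx, hxe⟩ := h.exists_resL_bdD_eq (y := y + y' + lift f₁)
    (Submodule.add_mem _ (Submodule.add_mem _ hy hY1) (lift_mem_levD hf₁)) (by
      intro c hc
      have h1 : restr (L := L) (bdD A B (y + y' + lift f₁)) = 0 := by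
        rw [map_add, map_add, restr_add, restr_add, hY2, hzn, restr_bdD hdL (lift f₁), restr_lift,
          hfe₁, hzr, restr_bdD hdL y,
          ← add_self_fun (bdDL A B L (restr y) + restr nz + n₁)]
        abel
      exact congrFun h1 (c.1, ⟨c.2, hc⟩))
  set θ := resL L (bdD A B y) with hθd
  set θ' := resL L (bdD A B y') with hθd'
  set β := opRight B.boundary x with hβ
  have hβlev : β ∈ levC A B (j + 1) := by
    rw [mem_levC]
    rintro ⟨a, b⟩ hab
    rw [hβ, opRight_apply, boundary_apply] at hab
    obtain ⟨b', _, hb'⟩ := Finset.exists_ne_zero_of_sum_ne_zero hab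
    have h1 := hx _ (left_ne_zero_of_mul hb')
    have h2 := B.inc_deg _ _ (right_ne_zero_of_mul hb')
    have h3 := B.deg_le b'
    simp only at h1 ⊢
    omega
  have hβL : ∀ c, β c ≠ 0 → c.2 ∉ L := by
    rintro ⟨a, b⟩ hab hb
    refine hab ?_
    rw [hβ, opRight_apply, boundary_right_of_deg_one (hdL b hb)]
  have hbx : bdC A B x = θ + θ' + σ₁ + β := by
    rw [bdC_eq, ← hxe, map_add, map_add, map_add, map_add]
  have hθθ : θ' = bdC A B x + (θ + σ₁ + β) := by
    rw [hbx]
    have := add_self_fun (θ + σ₁ + β)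
    calc θ' = θ' + ((θ + σ₁ + β) + (θ + σ₁ + β)) := by rw [this, add_zero]
      _ = _ := by abel
  have hbθ' : bdC A B θ' = bdC A B (θ + σ₁ + β) := by
    rw [hθθ, map_add, bdC_bdC, zero_add]
  have hk' : k = nk + bdC A B (θ + ez) + bdC A B t := by
    rw [← hk]
    have := add_self_fun (nk + bdC A B (θ + ez))
    calc k = k + ((nk + bdC A B (θ + ez)) + (nk + bdC A B (θ + ez))) := by rw [this, add_zero]
      _ = _ := by abel
  have hbK : bdC A B (K z k) = bdC A B nk := by
    change bdC A B (k + bdC A B θ') = _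
    rw [map_add, bdC_bdC, add_zero, hk', map_add, map_add, bdC_bdC, bdC_bdC, add_zero, add_zero]
  have hKn : K z k + N₂ (bdC A B (K z k)) = bdC A B (f₂ + ez + t + σ₁ + β) := by
    rw [hbK]
    change k + bdC A B θ' + n₂ = _
    rw [hk', hbθ']
    simp only [map_add, hfe₂]
    have := add_self_fun (bdC A B θ)
    calc _ = (nk + n₂) + bdC A B ez + bdC A B t + bdC A B σ₁ + bdC A B β +
          (bdC A B θ + bdC A B θ) := by abel
      _ = _ := by rw [this, add_zero]
  have hQ : ∃ p, Q z k p := by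
    refine ⟨(resL L f₂ + σ₁ + ez, (f₂ + resL L f₂) + t + β), ?_, ?_, ?_, ?_, ?_⟩
    · exact ((h.resL_onInput_C hf₂).add hσlev).add hez
    · intro l hl
      exact ((((h.copySparse (sparse_resL hfS₂)).add (h.copySparse hσS)).add hezs) l hl).mono
        subset_rfl (by linarith)
    · exact Submodule.add_mem _ (Submodule.add_mem _ (Submodule.add_mem _ hf₂
        (h.onInput_level_C (h.resL_onInput_C hf₂))) ht) hβlev
    · intro c hc hcL
      refine hc ?_
      have h1 : t c = 0 := by
        by_contra h1
        exact htL c h1 hcL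
      have h2 : β c = 0 := by
        by_contra h2
        exact hβL c h2 hcL
      change f₂ c + resL L f₂ c + t c + β c = 0
      rw [resL_of_mem _ hcL, h1, h2, CharTwo.add_self_eq_zero, add_zero, add_zero]
    · rw [hKn]
      congr 1
      have := add_self_fun (resL L f₂)
      calc f₂ + ez + t + σ₁ + β = f₂ + ez + t + σ₁ + β + (resL L f₂ + resL L f₂) := by
            rw [this, add_zero]
        _ = _ := by
            dsimp only
            abel
  obtain ⟨hp1, hp2, hp3, hp4, hp5⟩ := hQ.choose_spec
  have hcorr : corr z k = θ' + (hQ.choose.1 + hQ.choose.2) := dif_pos hQ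
  set p := hQ.choose
  set q := p.1 + p.2 + σ₁ + β + ez + t + f₂ with hq
  have htot : corr z k + θ + ez + t + f₂ = bdC A B x + q := by
    rw [hcorr, hθθ]
    have := add_self_fun θ
    calc _ = bdC A B x + q + (θ + θ) := by
          rw [hq]
          abel
      _ = _ := by rw [this, add_zero]
  have hq0 : bdC A B q = 0 := by
    have e1 : q = (p.1 + p.2) + (f₂ + ez + t + σ₁ + β) := by
      rw [hq]
      abel
    rw [e1, map_add, ← hp5, hKn, add_self_fun]
  have hqlev : q ∈ levC A B (j + 1) := by
    refine Submodule.add_mem _ (Submodule.add_mem _ (Submodule.add_mem _ (Submodule.add_mem _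
      (Submodule.add_mem _ (Submodule.add_mem _ (h.onInput_level_C hp1) hp3) ?_) hβlev) ?_) ht) hf₂
    · exact h.onInput_level_C hσlev
    · exact h.onInput_level_C hez
  have hqS : CopySparse A B L η (2 * (γ₀ + (γ₂ + 2 * (1 + w) * γ₂))) q := by
    intro l hl
    have h1 : CopySparse A B L η (2 * (γ₀ + (γ₂ + 2 * (1 + w) * γ₂))) (p.1 + σ₁ + ez + f₂) := by
      intro l hl
      exact ((((hp2.add (h.copySparse hσS)).add hezs).add (h.copySparse hfS₂)) l hl).mono
        subset_rfl (by linarith)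
    refine (h1 l hl).mono (fun a ha => ?_) le_rfl
    have h2 : p.2 (a, l) = 0 := by
      by_contra h2
      exact hp4 _ h2 hl
    have h3 : β (a, l) = 0 := by
      by_contra h3
      exact hβL _ h3 hl
    have h4 : t (a, l) = 0 := by
      by_contra h4
      exact htL _ h4 hl
    change p.1 (a, l) + p.2 (a, l) + σ₁ (a, l) + β (a, l) + ez (a, l) + t (a, l) + f₂ (a, l) ≠ 0
      at ha
    rw [h2, h3, h4, add_zero, add_zero, add_zero] at ha
    exact ha
  rw [htot]
  refine ⟨by rw [map_add, bdC_bdC, hq0, add_zero], ?_⟩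
  intro v hv hv'
  have hδv : delC A B v = 0 := by
    rw [delC_eq, hv', h.coboundary_of_onInput fun c hc => (hv c hc).2, add_zero]
  rw [add_dotProduct, bdC_dotProduct, hδv, dotProduct_zero, zero_add]
  exact h.dotProduct_eq_zero_of_copySparse hγ.2.2 hqlev hq0 hqS hv hv'

end IsSwitching

end Decoding

/-! ### The state after the measurements -/

/-- The sign `(-1) ^ a`. -/
def sgn (a : ZMod 2) : ℂ := if a = 0 then 1 else -1

theorem sgn_zero : sgn 0 = 1 := if_pos rfl

theorem sgn_one : sgn 1 = -1 := if_neg one_ne_zero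

theorem zmod_two_cases (a : ZMod 2) : a = 0 ∨ a = 1 := by
  revert a
  decide

theorem sgn_add (a b : ZMod 2) : sgn (a + b) = sgn a * sgn b := by
  rcases zmod_two_cases a with rfl | rfl <;> rcases zmod_two_cases b with rfl | rfl
  · simp [sgn_zero]
  · simp [sgn_zero]
  · simp [sgn_zero]
  · rw [CharTwo.add_self_eq_zero, sgn_zero, sgn_one]
    norm_num

/-- A linear functional which vanishes on the kernel of a linear map factors through it. -/
theorem exists_dotProduct_of_ker_le {X Y : Type} [Fintype X] [Fintype Y]
    (T : (X → ZMod 2) →ₗ[ZMod 2] (Y → ZMod 2)) (μ : (X → ZMod 2) →ₗ[ZMod 2] ZMod 2)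
    (h : ∀ x, T x = 0 → μ x = 0) : ∃ y : Y → ZMod 2, ∀ x, μ x = y ⬝ᵥ T x := by
  classical
  have h1 : μ ∈ LinearMap.range T.dualMap := by
    rw [LinearMap.range_dualMap_eq_dualAnnihilator_ker, Submodule.mem_dualAnnihilator]
    exact fun x hx => h x hx
  obtain ⟨f, hf⟩ := h1
  refine ⟨fun i => f (Pi.single i 1), fun x => ?_⟩
  rw [← hf, LinearMap.dualMap_apply, LinearMap.pi_apply_eq_sum_univ f (T x)]
  simp only [dotProduct, smul_eq_mul]
  refine Finset.sum_congr rfl fun i _ => ?_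
  rw [mul_comm]
  congr 2
  funext j
  simp [Pi.single_apply, eq_comm]

theorem sum_eq_zero_of_shift {X : Type} [Fintype X] (F : (X → ZMod 2) → ℂ) (x₀ : X → ZMod 2)
    [Fintype (X → ZMod 2)] (h : ∀ x, F (x + x₀) = -F x) : ∑ x, F x = 0 := by
  have h1 : ∑ x, F x = -∑ x, F x := by
    rw [← Finset.sum_neg_distrib, ← Equiv.sum_comp (Equiv.addRight x₀)]
    exact Finset.sum_congr rfl fun x _ => h x
  have h2 : (2 : ℂ) * ∑ x, F x = 0 := by linear_combination h1
  exact (mul_eq_zero.1 h2).resolve_left two_ne_zero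

section Amplitude

variable {Dt G S K : Type} [Fintype Dt] [DecidableEq Dt] [Fintype G] [DecidableEq G] [Fintype S]
  [DecidableEq S] [Fintype K] [DecidableEq K]

open Classical in
/-- The amplitude, at the basis state `x` of the data, of the encoded state with errors `ex` and `ez`,
where `v` encodes the logical state and `Bs` is the space of stabilizers. -/
def codeAmp (Bs : Submodule (ZMod 2) (Dt → ZMod 2)) (ex ez v x : Dt → ZMod 2) : ℂ :=
  if x + ex + v ∈ Bs then sgn (ez ⬝ᵥ x) else 0

open Classical in
/-- The amplitude, at the basis state `x` of the data, when checks with outcome `s` are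
measured between data (`σ`) and gauge qubits (`τ`), the gauge qubits are measured out in the `X` basis
with outcome `z`, and checks `γ` of the data are measured in the `X` basis with outcome `k`. -/
def measAmp (γ : (K → ZMod 2) →ₗ[ZMod 2] (Dt → ZMod 2)) (σ : (Dt → ZMod 2) →ₗ[ZMod 2] (S → ZMod 2))
    (τ : (G → ZMod 2) →ₗ[ZMod 2] (S → ZMod 2)) (ψ : (Dt → ZMod 2) → ℂ) (s : S → ZMod 2)
    (z : G → ZMod 2) (κ : K → ZMod 2) (x : Dt → ZMod 2) : ℂ :=
  ∑ g : G → ZMod 2, ∑ k : K → ZMod 2, sgn (z ⬝ᵥ g + κ ⬝ᵥ k) *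
    if s = σ (x + γ k) + τ g then ψ (x + γ k) else 0

theorem eq_add_iff {X : Type} {a b c : X → ZMod 2} : a = b + c ↔ a + b = c := by
  constructor
  · rintro rfl
    rw [add_comm, ← add_assoc, add_self_fun, zero_add]
  · rintro rfl
    rw [add_comm a b, ← add_assoc, add_self_fun, zero_add]

/-- Unless the outcomes have amplitude zero, the measurements leave a code state of the new
code, with the logical state unchanged, up to a phase operator which the outcomes determine. -/
theorem measAmp_codeAmp {U : Type} {γ : (K → ZMod 2) →ₗ[ZMod 2] (Dt → ZMod 2)}
    {σ : (Dt → ZMod 2) →ₗ[ZMod 2] (S → ZMod 2)} {τ : (G → ZMod 2) →ₗ[ZMod 2] (S → ZMod 2)}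
    {Bs : Submodule (ZMod 2) (Dt → ZMod 2)} {v : U → Dt → ZMod 2} {ex : Dt → ZMod 2}
    {P : Dt → Prop} (hv : ∀ u, σ (v u) ∈ LinearMap.range τ)
    (hBs : ∀ b ∈ Bs, σ b ∈ LinearMap.range τ)
    (hγ : ∀ k, (∀ q, ¬ P q → γ k q = 0) → γ k ∈ Bs) (hBsγ : Bs ≤ LinearMap.range γ)
    (hBsP : ∀ b ∈ Bs, ∀ q, ¬ P q → b q = 0) (hvP : ∀ u q, ¬ P q → v u q = 0)
    (hexP : ∀ q, ¬ P q → ex q = 0) (ez : Dt → ZMod 2) (s : S → ZMod 2) (z : G → ZMod 2)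
    (κ : K → ZMod 2) :
    (∀ u x, measAmp γ σ τ (codeAmp Bs ex ez (v u)) s z κ x = 0) ∨
      ∃ (C : ℂ) (y : S → ZMod 2) (ω : Dt → ZMod 2), (∀ g, z ⬝ᵥ g = y ⬝ᵥ τ g) ∧
        s + σ ex ∈ LinearMap.range τ ∧ (∀ q, P q → ω q = 0) ∧
        (∀ k, κ ⬝ᵥ k + y ⬝ᵥ σ (γ k) + ez ⬝ᵥ γ k = ω ⬝ᵥ γ k) ∧
        ∀ u x, measAmp γ σ τ (codeAmp Bs ex ez (v u)) s z κ x =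
          C * codeAmp (LinearMap.range γ) ex (0 : Dt → ZMod 2) (v u) x *
            sgn (y ⬝ᵥ σ x + ez ⬝ᵥ x + ω ⬝ᵥ x) := by
  classical
  -- a gauge operator without influence on the checks forces its outcome
  by_cases hz : ∀ g, τ g = 0 → z ⬝ᵥ g = 0
  swap
  · left
    push Not at hz
    obtain ⟨g₀, hg₀, hz₀⟩ := hz
    have hz₁ : z ⬝ᵥ g₀ = 1 := (zmod_two_cases _).resolve_left hz₀
    intro u x
    refine sum_eq_zero_of_shift _ g₀ fun g => ?_
    rw [← Finset.sum_neg_distrib]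
    refine Finset.sum_congr rfl fun k _ => ?_
    have e : z ⬝ᵥ (g + g₀) + κ ⬝ᵥ k = (z ⬝ᵥ g + κ ⬝ᵥ k) + 1 := by
      rw [dotProduct_add, hz₁]
      ring
    rw [map_add τ, hg₀, add_zero, e, sgn_add, sgn_one]
    ring
  obtain ⟨y, hy⟩ := exists_dotProduct_of_ker_le τ
    { toFun := fun g => z ⬝ᵥ g
      map_add' := fun a b => dotProduct_add _ _ _
      map_smul' := fun a b => dotProduct_smul _ _ _ } hz
  have hy' : ∀ g, z ⬝ᵥ g = y ⬝ᵥ τ g := hy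
  -- the number of gauge configurations with checks `t` depends only on `t` modulo the range of `τ`
  let n : (S → ZMod 2) → ℂ := fun t => ∑ g, if t = τ g then 1 else 0
  have hn : ∀ t g, n (t + τ g) = n t := by
    intro t g
    change ∑ g', _ = ∑ g', _
    rw [← Equiv.sum_comp (Equiv.addRight g)]
    refine Finset.sum_congr rfl fun g' _ => ?_
    simp only [Equiv.coe_addRight, map_add, add_left_inj]
  have hn' : ∀ t t', t' ∈ LinearMap.range τ → n (t + t') = n t := by
    rintro t _ ⟨g, rfl⟩
    exact hn t g
  have hn0 : ∀ t, n t ≠ 0 → t ∈ LinearMap.range τ := by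
    intro t ht
    obtain ⟨g, _, hg⟩ := Finset.exists_ne_zero_of_sum_ne_zero ht
    refine ⟨g, ?_⟩
    by_contra h
    rw [if_neg fun h' => h h'.symm] at hg
    exact hg rfl
  let μ : (K → ZMod 2) →ₗ[ZMod 2] ZMod 2 :=
    { toFun := fun k => κ ⬝ᵥ k + y ⬝ᵥ σ (γ k) + ez ⬝ᵥ γ k
      map_add' := fun a b => by
        simp only [map_add, dotProduct_add]
        ring
      map_smul' := fun a b => by
        simp only [map_smul, dotProduct_smul, smul_eq_mul, RingHom.id_apply]
        ring }
  have hσ : ∀ u x, x + ex + v u ∈ Bs → n (s + σ x) = n (s + σ ex) := by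
    intro u x hx
    have h1 : σ x = σ ex + (σ (v u) + σ (x + ex + v u)) := by
      rw [← map_add, ← map_add]
      congr 1
      funext q
      simp only [Pi.add_apply]
      linear_combination (-(ex q) - v u q) * (CharTwo.two_eq_zero (R := ZMod 2))
    rw [h1, ← add_assoc]
    exact hn' _ _ (Submodule.add_mem _ (hv u) (hBs _ hx))
  have key : ∀ u x, measAmp γ σ τ (codeAmp Bs ex ez (v u)) s z κ x =
      n (s + σ ex) * sgn (y ⬝ᵥ s) * sgn (y ⬝ᵥ σ x + ez ⬝ᵥ x) *
        ∑ k, if x + γ k + ex + v u ∈ Bs then sgn (μ k) else 0 := by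
    intro u x
    rw [measAmp, Finset.sum_comm, Finset.mul_sum]
    refine Finset.sum_congr rfl fun k _ => ?_
    by_cases hk : x + γ k + ex + v u ∈ Bs
    · have h1 : ∀ g, sgn (z ⬝ᵥ g + κ ⬝ᵥ k) * (if s = σ (x + γ k) + τ g then
          codeAmp Bs ex ez (v u) (x + γ k) else 0) =
          (sgn (y ⬝ᵥ (s + σ (x + γ k)) + κ ⬝ᵥ k) * sgn (ez ⬝ᵥ (x + γ k))) *
            if s + σ (x + γ k) = τ g then 1 else 0 := by
        intro g
        simp only [eq_add_iff]
        by_cases hg : s + σ (x + γ k) = τ g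
        · rw [if_pos hg, if_pos hg, mul_one, codeAmp, if_pos hk, hg, hy' g]
        · rw [if_neg hg, if_neg hg, mul_zero, mul_zero]
      rw [Finset.sum_congr rfl fun g _ => h1 g, ← Finset.mul_sum]
      change _ * n (s + σ (x + γ k)) = _
      rw [hσ u _ hk, if_pos hk]
      have h2 : sgn (μ k) = sgn (κ ⬝ᵥ k) * sgn (y ⬝ᵥ σ (γ k)) * sgn (ez ⬝ᵥ γ k) := by
        change sgn (κ ⬝ᵥ k + y ⬝ᵥ σ (γ k) + ez ⬝ᵥ γ k) = _
        rw [sgn_add, sgn_add]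
      rw [h2]
      simp only [map_add, dotProduct_add, sgn_add]
      ring
    · rw [if_neg hk, mul_zero]
      refine Finset.sum_eq_zero fun g _ => ?_
      rw [codeAmp, if_neg hk, ite_self, mul_zero]
  by_cases hn00 : n (s + σ ex) = 0
  · left
    intro u x
    rw [key, hn00]
    ring
  -- a product of the new checks which is an old stabilizer has a forced outcome
  by_cases hμ : ∀ k, γ k ∈ Bs → μ k = 0
  swap
  · left
    push Not at hμ
    obtain ⟨k₀, hk₀, hμ₀⟩ := hμ
    have hμ₁ : μ k₀ = 1 := (zmod_two_cases _).resolve_left hμ₀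
    intro u x
    have hs : (∑ k, if x + γ k + ex + v u ∈ Bs then sgn (μ k) else 0) = 0 := by
      refine sum_eq_zero_of_shift _ k₀ fun k => ?_
      have e1 : x + γ (k + k₀) + ex + v u = (x + γ k + ex + v u) + γ k₀ := by
        rw [map_add]
        abel
      rw [e1, Submodule.add_mem_iff_left _ hk₀, map_add, hμ₁, sgn_add, sgn_one]
      by_cases h : x + γ k + ex + v u ∈ Bs
      · rw [if_pos h, if_pos h]
        ring
      · rw [if_neg h, if_neg h, neg_zero]
    rw [key, hs, mul_zero]
  -- the outcomes of the new checks come from a phase operator off the support `P` of the old code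
  obtain ⟨ω', hω'⟩ := exists_dotProduct_of_ker_le
    ({ toFun := fun k q => if P q then 0 else γ k q
       map_add' := fun a b => by
        funext q
        by_cases hq : P q <;> simp [hq]
       map_smul' := fun a b => by
        funext q
        by_cases hq : P q <;> simp [hq] } : (K → ZMod 2) →ₗ[ZMod 2] (Dt → ZMod 2)) μ (by
    intro k hk
    refine hμ k (hγ k fun q hq => ?_)
    have := congrFun hk q
    simpa [hq] using this)
  set ω : Dt → ZMod 2 := fun q => if P q then 0 else ω' q with hω
  have hωP : ∀ q, P q → ω q = 0 := fun q hq => if_pos hq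
  have hωμ : ∀ k, μ k = ω ⬝ᵥ γ k := by
    intro k
    rw [hω' k]
    refine Finset.sum_congr rfl fun q _ => ?_
    by_cases hq : P q <;> simp [hω, hq]
  have hω0 : ∀ x : Dt → ZMod 2, (∀ q, ¬ P q → x q = 0) → ω ⬝ᵥ x = 0 := by
    intro x hx
    refine Finset.sum_eq_zero fun q _ => ?_
    by_cases hq : P q
    · rw [hωP q hq, zero_mul]
    · rw [hx q hq, mul_zero]
  right
  refine ⟨n (s + σ ex) * sgn (y ⬝ᵥ s) * ∑ k, if γ k ∈ Bs then 1 else 0, y, ω, hy', hn0 _ hn00, hωP,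
    hωμ, fun u x => ?_⟩
  have hsum : (∑ k, if x + γ k + ex + v u ∈ Bs then sgn (μ k) else 0) =
      codeAmp (LinearMap.range γ) ex (0 : Dt → ZMod 2) (v u) x * sgn (ω ⬝ᵥ x) *
        ∑ k, if γ k ∈ Bs then 1 else 0 := by
    by_cases hx : x + ex + v u ∈ LinearMap.range γ
    · obtain ⟨k₁, hk₁⟩ := hx
      rw [codeAmp, if_pos ⟨k₁, hk₁⟩, zero_dotProduct, sgn_zero, one_mul, Finset.mul_sum,
        ← Equiv.sum_comp (Equiv.addRight k₁)]
      refine Finset.sum_congr rfl fun k _ => ?_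
      have e1 : x + γ ((Equiv.addRight k₁) k) + ex + v u = γ k := by
        rw [Equiv.coe_addRight, map_add, hk₁]
        have := add_self_fun (x + ex + v u)
        calc _ = γ k + ((x + ex + v u) + (x + ex + v u)) := by abel
          _ = _ := by rw [this, add_zero]
      rw [e1]
      by_cases hk : γ k ∈ Bs
      · rw [if_pos hk, if_pos hk, mul_one, Equiv.coe_addRight, hωμ, map_add, hk₁]
        congr 1
        rw [dotProduct_add, dotProduct_add, dotProduct_add, hω0 _ (hBsP _ hk), hω0 _ hexP,
          hω0 _ (hvP u), zero_add, add_zero, add_zero]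
      · rw [if_neg hk, if_neg hk, mul_zero]
    · rw [codeAmp, if_neg hx, zero_mul, zero_mul]
      refine Finset.sum_eq_zero fun k _ => if_neg fun hk => hx ?_
      have e1 : x + ex + v u = (x + γ k + ex + v u) + γ k := by
        have := add_self_fun (γ k)
        calc x + ex + v u = x + ex + v u + (γ k + γ k) := by rw [this, add_zero]
          _ = _ := by abel
      rw [e1]
      exact Submodule.add_mem _ (hBsγ hk) ⟨k, rfl⟩
  rw [key, hsum, sgn_add _ (ω ⬝ᵥ x)]
  ring

end Amplitude

/-! ### Pauli operators and controlled NOT operators -/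

section Operators

variable {Q : Type} [Fintype Q] [DecidableEq Q]

/-- The tensor product of one-qubit operators. -/
def tensorMat (U : Q → Matrix (ZMod 2) (ZMod 2) ℂ) : Matrix (Bits Q) (Bits Q) ℂ :=
  fun x y => ∏ q, U q (x q) (y q)

theorem tensorMat_mul (U W : Q → Matrix (ZMod 2) (ZMod 2) ℂ) :
    tensorMat U * tensorMat W = tensorMat fun q => U q * W q := by
  ext x y
  simp only [tensorMat, Matrix.mul_apply, ← Finset.prod_mul_distrib]
  exact (Fintype.prod_sum fun q b => U q (x q) b * W q b (y q)).symm

theorem tensorMat_one : tensorMat (fun _ : Q => 1) = 1 := by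
  ext x y
  simp only [tensorMat, Matrix.one_apply]
  by_cases h : x = y
  · simp [h]
  · rw [if_neg h]
    obtain ⟨q, hq⟩ := Function.ne_iff.1 h
    exact Finset.prod_eq_zero (Finset.mem_univ q) (if_neg hq)

theorem onQubit_eq_tensorMat (q : Q) (U : Matrix (ZMod 2) (ZMod 2) ℂ) :
    onQubit q U = tensorMat (Function.update (fun _ => 1) q U) := by
  ext x y
  simp only [onQubit, tensorMat]
  rw [← Finset.mul_prod_erase _ _ (Finset.mem_univ q), Function.update_self]
  by_cases h : ∀ p, p ≠ q → x p = y p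
  · rw [if_pos h, Finset.prod_eq_one, mul_one]
    intro p hp
    have hp' := Finset.ne_of_mem_erase hp
    rw [Function.update_of_ne hp', h p hp', Matrix.one_apply_eq]
  · rw [if_neg h]
    push Not at h
    obtain ⟨p, hp, hne⟩ := h
    rw [Finset.prod_eq_zero (i := p), mul_zero]
    · exact Finset.mem_erase.2 ⟨hp, Finset.mem_univ p⟩
    · rw [Function.update_of_ne hp, Matrix.one_apply_ne hne]

theorem onQubit_one (q : Q) : onQubit q 1 = 1 := by
  rw [onQubit_eq_tensorMat, Function.update_eq_self_iff.2 rfl, tensorMat_one]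

theorem onQubit_mul_tensorMat (q : Q) (U : Matrix (ZMod 2) (ZMod 2) ℂ)
    (W : Q → Matrix (ZMod 2) (ZMod 2) ℂ) (hW : W q = 1) :
    onQubit q U * tensorMat W = tensorMat (Function.update W q U) := by
  rw [onQubit_eq_tensorMat, tensorMat_mul]
  congr 1
  funext p
  by_cases h : p = q
  · subst h
    simp [hW]
  · simp [h]

/-- The `X` part of a Pauli. -/
def Pauli.xBit : Pauli → ZMod 2
  | .I => 0
  | .X => 1
  | .Y => 1
  | .Z => 0

/-- The `Z` part of a Pauli. -/
def Pauli.zBit : Pauli → ZMod 2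
  | .I => 0
  | .X => 0
  | .Y => 1
  | .Z => 1

/-- The Pauli with the given `X` and `Z` parts. -/
def Pauli.ofBits (a b : ZMod 2) : Pauli :=
  if a = 0 then (if b = 0 then .I else .Z) else (if b = 0 then .X else .Y)

/-- The one-qubit operator `X ^ a * Z ^ b`. -/
def xzOne (a b : ZMod 2) : Matrix (ZMod 2) (ZMod 2) ℂ :=
  fun x y => if x = y + a then sgn (b * y) else 0

theorem Pauli.mat_eq_xzOne (P : Pauli) : ∃ c : ℂ, P.mat = c • xzOne P.xBit P.zBit := by
  have h2 : ∀ x : ZMod 2, x + 1 = 0 ↔ x = 1 := by decide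
  have h3 : ((1 : ZMod 2) = 1 + 1) = False := by decide
  cases P
  · refine ⟨1, ?_⟩
    ext x y
    simp [Pauli.mat, xzOne, Pauli.xBit, Pauli.zBit, Matrix.one_apply, sgn_zero]
  · refine ⟨1, ?_⟩
    ext x y
    rcases zmod_two_cases x with rfl | rfl <;> rcases zmod_two_cases y with rfl | rfl <;>
      simp [Pauli.mat, xzOne, Pauli.xBit, Pauli.zBit, sgn_zero, CharTwo.add_self_eq_zero]
  · refine ⟨Complex.I, ?_⟩
    ext x y
    rcases zmod_two_cases x with rfl | rfl <;> rcases zmod_two_cases y with rfl | rfl <;>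
      simp [Pauli.mat, xzOne, Pauli.xBit, Pauli.zBit, sgn_zero, sgn_one, CharTwo.add_self_eq_zero]
  · refine ⟨1, ?_⟩
    ext x y
    rcases zmod_two_cases x with rfl | rfl <;> rcases zmod_two_cases y with rfl | rfl <;>
      simp [Pauli.mat, xzOne, Pauli.xBit, Pauli.zBit, sgn_zero, sgn_one]

theorem xzOne_eq_ofBits (a b : ZMod 2) : ∃ c : ℂ, xzOne a b = c • (Pauli.ofBits a b).mat := by
  rcases zmod_two_cases a with rfl | rfl <;> rcases zmod_two_cases b with rfl | rfl
  · refine ⟨1, ?_⟩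
    ext x y
    rw [Matrix.smul_apply]
    simp [Pauli.mat, xzOne, Pauli.ofBits, Matrix.one_apply, sgn_zero]
  · refine ⟨1, ?_⟩
    ext x y
    rw [Matrix.smul_apply]
    rcases zmod_two_cases x with rfl | rfl <;> rcases zmod_two_cases y with rfl | rfl <;>
      simp [Pauli.mat, xzOne, Pauli.ofBits, sgn_zero, sgn_one]
  · refine ⟨1, ?_⟩
    ext x y
    rw [Matrix.smul_apply]
    rcases zmod_two_cases x with rfl | rfl <;> rcases zmod_two_cases y with rfl | rfl <;>
      simp [Pauli.mat, xzOne, Pauli.ofBits, sgn_zero, CharTwo.add_self_eq_zero]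
  · refine ⟨-Complex.I, ?_⟩
    ext x y
    rw [Matrix.smul_apply]
    rcases zmod_two_cases x with rfl | rfl <;> rcases zmod_two_cases y with rfl | rfl <;>
      simp [Pauli.mat, xzOne, Pauli.ofBits, sgn_zero, sgn_one, CharTwo.add_self_eq_zero]

theorem Pauli.ofBits_ne_I {a b : ZMod 2} (h : Pauli.ofBits a b ≠ .I) : a ≠ 0 ∨ b ≠ 0 := by
  by_contra h'
  push Not at h'
  exact h (by rw [h'.1, h'.2]; rfl)

theorem Pauli.ne_I_of_bit {P : Pauli} (h : P.xBit ≠ 0 ∨ P.zBit ≠ 0) : P ≠ .I := by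
  rintro rfl
  exact h.elim (fun h => h rfl) fun h => h rfl

/-- The Pauli operator `X ^ a * Z ^ b` on the qubits `Q`. -/
def xz (a b : Bits Q) : Matrix (Bits Q) (Bits Q) ℂ :=
  fun x y => if x = y + a then sgn (b ⬝ᵥ y) else 0

theorem sgn_sum {ι : Type} (s : Finset ι) (f : ι → ZMod 2) : sgn (∑ i ∈ s, f i) = ∏ i ∈ s, sgn (f i) := by
  classical
  induction s using Finset.induction_on with
  | empty => simp [sgn_zero]
  | insert i s hi ih => rw [Finset.sum_insert hi, Finset.prod_insert hi, sgn_add, ih]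

theorem xz_eq_tensorMat (a b : Bits Q) : xz a b = tensorMat fun q => xzOne (a q) (b q) := by
  ext x y
  simp only [xz, tensorMat, xzOne]
  by_cases h : x = y + a
  · rw [if_pos h, dotProduct, sgn_sum]
    exact Finset.prod_congr rfl fun q _ => (if_pos (congrFun h q)).symm
  · rw [if_neg h]
    obtain ⟨q, hq⟩ := Function.ne_iff.1 h
    exact (Finset.prod_eq_zero (Finset.mem_univ q) (if_neg hq)).symm

theorem tensorMat_smul (c : Q → ℂ) (U : Q → Matrix (ZMod 2) (ZMod 2) ℂ) :
    (tensorMat fun q => c q • U q) = (∏ q, c q) • tensorMat U := by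
  ext x y
  simp [tensorMat, Finset.prod_mul_distrib]

theorem pauliString_eq_xz (P : Q → Pauli) :
    ∃ c : ℂ, pauliString P = c • xz (fun q => (P q).xBit) fun q => (P q).zBit := by
  choose c hc using fun q => (P q).mat_eq_xzOne
  refine ⟨∏ q, c q, ?_⟩
  rw [xz_eq_tensorMat, ← tensorMat_smul]
  ext x y
  simp only [pauliString, tensorMat, hc]

theorem xz_eq_pauliString (a b : Bits Q) :
    ∃ c : ℂ, xz a b = c • pauliString fun q => Pauli.ofBits (a q) (b q) := by
  choose c hc using fun q => xzOne_eq_ofBits (a q) (b q)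
  refine ⟨∏ q, c q, ?_⟩
  rw [xz_eq_tensorMat]
  simp only [hc]
  exact tensorMat_smul _ _

theorem xz_mul_apply {β : Type} (a b : Bits Q) (A : Matrix (Bits Q) β ℂ) (y : Bits Q) (u : β) :
    (xz a b * A) y u = sgn (b ⬝ᵥ (y + a)) * A (y + a) u := by
  rw [Matrix.mul_apply, Finset.sum_eq_single (y + a)]
  · rw [xz, if_pos]
    rw [add_assoc, add_self_fun, add_zero]
  · intro z _ hz
    rw [xz, if_neg, zero_mul]
    rintro rfl
    exact hz (by rw [add_assoc, add_self_fun, add_zero])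
  · intro h
    exact absurd (Finset.mem_univ _) h

theorem xz_mul_xz (a b a' b' : Bits Q) : ∃ c : ℂ, xz a b * xz a' b' = c • xz (a + a') (b + b') := by
  refine ⟨sgn (b ⬝ᵥ a'), ?_⟩
  ext x y
  rw [xz_mul_apply, Matrix.smul_apply]
  simp only [xz]
  have e : x + a = y + a' ↔ x = y + (a + a') := by
    constructor
    · intro h
      rw [add_comm a, ← add_assoc, ← h, add_assoc, add_self_fun, add_zero]
    · rintro rfl
      rw [add_comm a, add_assoc, add_assoc, add_self_fun, add_zero]
  by_cases h : x + a = y + a'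
  · rw [if_pos h, if_pos (e.1 h), h, dotProduct_add, sgn_add, add_dotProduct, sgn_add, smul_eq_mul]
    ring
  · rw [if_neg h, if_neg fun h' => h (e.2 h'), mul_zero, smul_zero]

theorem Pauli.conjTranspose_mat (P : Pauli) : P.mat.conjTranspose = P.mat := by
  ext x y
  rw [Matrix.conjTranspose_apply]
  cases P <;> rcases zmod_two_cases x with rfl | rfl <;> rcases zmod_two_cases y with rfl | rfl <;>
    simp [Pauli.mat]

theorem conjTranspose_pauliString (P : Q → Pauli) :
    (pauliString P).conjTranspose = pauliString P := by
  ext x y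
  simp only [Matrix.conjTranspose_apply, pauliString, star_prod]
  refine Finset.prod_congr rfl fun q _ => ?_
  conv_rhs => rw [← Pauli.conjTranspose_mat, Matrix.conjTranspose_apply]

/-- The linear operator which permutes the basis states by `f`. -/
def permMat (f : Bits Q → Bits Q) : Matrix (Bits Q) (Bits Q) ℂ :=
  fun x y => if x = f y then 1 else 0

theorem permMat_mul (f g : Bits Q → Bits Q) : permMat f * permMat g = permMat (f ∘ g) := by
  ext x y
  simp only [Matrix.mul_apply, permMat, Function.comp_apply, mul_ite, mul_one, mul_zero,
    Finset.sum_ite_eq', Finset.mem_univ, if_true]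

theorem permMat_mul_apply {β : Type} {f : Bits Q → Bits Q} (hf : ∀ y, f (f y) = y)
    (A : Matrix (Bits Q) β ℂ) (y : Bits Q) (u : β) : (permMat f * A) y u = A (f y) u := by
  rw [Matrix.mul_apply, Finset.sum_eq_single (f y)]
  · rw [permMat, hf, if_pos rfl, one_mul]
  · intro z _ hz
    rw [permMat, if_neg, zero_mul]
    rintro rfl
    exact hz (hf z).symm
  · intro h
    exact absurd (Finset.mem_univ _) h

/-- The action on basis states of controlled NOTs with the controls and targets given by `m`. -/
def shear (m : Matrix Q Q (ZMod 2)) (y : Bits Q) : Bits Q := y + Matrix.vecMul y m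

theorem shear_comp {m m' : Matrix Q Q (ZMod 2)} (h : m' * m = 0) :
    shear m ∘ shear m' = shear (m + m') := by
  funext y
  simp only [shear, Function.comp_apply, Matrix.add_vecMul, Matrix.vecMul_vecMul, h,
    Matrix.vecMul_zero, add_zero, Matrix.vecMul_add]
  rw [add_assoc, add_comm (Matrix.vecMul y m')]

theorem shear_shear {m : Matrix Q Q (ZMod 2)} (h : m * m = 0) (y : Bits Q) :
    shear m (shear m y) = y := by
  have := congrFun (shear_comp h) y
  rw [Function.comp_apply] at this
  rw [this, shear, Matrix.vecMul_add, add_self_fun, add_zero]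

/-- Pauli operators propagate through controlled NOTs. -/
theorem permMat_shear_mul_xz {m : Matrix Q Q (ZMod 2)} (h : m * m = 0) (a b : Bits Q) :
    permMat (shear m) * xz a b = xz (shear m a) (b + Matrix.mulVec m b) * permMat (shear m) := by
  ext x y
  rw [permMat_mul_apply (shear_shear h), xz_mul_apply]
  simp only [xz, permMat]
  have e : shear m x = y + a ↔ x + shear m a = shear m y := by
    have hadd : ∀ y z, shear m (y + z) = shear m y + shear m z := by
      intro y z
      simp only [shear, Matrix.add_vecMul]
      abel
    constructor
    · intro h'
      have := congrArg (shear m) h'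
      rw [shear_shear h, hadd] at this
      rw [this, add_assoc, add_self_fun, add_zero]
    · intro h'
      have := congrArg (shear m) h'
      rw [hadd, shear_shear h, shear_shear h] at this
      rw [← this, add_assoc, add_self_fun, add_zero]
  by_cases hx : shear m x = y + a
  · rw [if_pos hx, if_pos (e.1 hx), mul_one, e.1 hx]
    congr 1
    simp only [shear, add_dotProduct, dotProduct_add]
    have h1 : b ⬝ᵥ Matrix.vecMul y m = Matrix.mulVec m b ⬝ᵥ y := by
      rw [dotProduct_comm, ← Matrix.dotProduct_mulVec, dotProduct_comm]
    have h2 : Matrix.mulVec m b ⬝ᵥ Matrix.vecMul y m = 0 := by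
      rw [dotProduct_comm, ← Matrix.dotProduct_mulVec, Matrix.mulVec_mulVec, h, Matrix.zero_mulVec,
        dotProduct_zero]
    rw [h1, h2, add_zero, add_assoc, CharTwo.add_self_eq_zero, add_zero]
  · rw [if_neg hx, if_neg fun h' => hx (e.2 h'), mul_zero]

theorem cnotMat_eq {p q : Q} :
    cnotMat p q = permMat (shear (Matrix.single p q (1 : ZMod 2))) := by
  ext x y
  simp only [cnotMat, permMat]
  congr 2
  funext t
  by_cases ht : t = q
  · subst ht
    simp [shear, Matrix.vecMul, dotProduct, Matrix.single_apply]
  · simp [shear, Matrix.vecMul, dotProduct, Ne.symm ht, ht]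

end Operators

/-! ### Circuits acting on tracked states -/

section Tracking

variable {Q R Λ : Type} [Fintype Q] [DecidableEq Q] [Fintype R] [DecidableEq R] [Fintype Λ]
  [DecidableEq Λ] {M : ℕ}

/-- The operator `(A ⊗ 1) ρ (B ⊗ 1)ᴴ`. -/
def sandwich (ρ : Matrix (Λ × R) (Λ × R) ℂ) (A B : Matrix (Bits Q) Λ ℂ) :
    Matrix (Bits Q × R) (Bits Q × R) ℂ :=
  (A ⊗ₖ (1 : Matrix R R ℂ)) * ρ * (B ⊗ₖ (1 : Matrix R R ℂ)).conjTranspose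

/-- For every value `x` of the classical register, the state is proportional to the result of
applying the operators `A x` and `B x` to the two sides of `ρ`. The two sides differ, because the two
sides of a Pauli superoperator may differ; each of them evolves on its own. -/
def Tracks (ρ : Matrix (Λ × R) (Λ × R) ℂ) (A B : Bits (Fin M) → Matrix (Bits Q) Λ ℂ)
    (σ : HybridState Q R M) : Prop :=
  ∀ x, ∃ c : ℂ, σ x = c • sandwich ρ (A x) (B x)

theorem sandwich_mul {Q' : Type} [Fintype Q'] [DecidableEq Q'] (ρ : Matrix (Λ × R) (Λ × R) ℂ)
    (A B : Matrix (Bits Q) Λ ℂ) (U W : Matrix (Bits Q') (Bits Q) ℂ) :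
    (U ⊗ₖ (1 : Matrix R R ℂ)) * sandwich ρ A B * (W ⊗ₖ (1 : Matrix R R ℂ)).conjTranspose =
      sandwich ρ (U * A) (W * B) := by
  have h : ∀ (U : Matrix (Bits Q') (Bits Q) ℂ) (A : Matrix (Bits Q) Λ ℂ),
      ((U * A) ⊗ₖ (1 : Matrix R R ℂ)) = (U ⊗ₖ (1 : Matrix R R ℂ)) * (A ⊗ₖ (1 : Matrix R R ℂ)) := by
    intro U A
    rw [← Matrix.mul_kronecker_mul, Matrix.mul_one]
  simp only [sandwich, h, Matrix.conjTranspose_mul, Matrix.mul_assoc]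

theorem kraus_smul_sandwich (ρ : Matrix (Λ × R) (Λ × R) ℂ) (A B : Matrix (Bits Q) Λ ℂ)
    (U : Matrix (Bits Q) (Bits Q) ℂ) (c : ℂ) :
    kraus U (c • sandwich ρ A B) = c • sandwich ρ (U * A) (U * B) := by
  rw [kraus, Matrix.mul_smul, Matrix.smul_mul, sandwich_mul]

theorem sandwich_smul (ρ : Matrix (Λ × R) (Λ × R) ℂ) (A B : Matrix (Bits Q) Λ ℂ) (a b : ℂ) :
    sandwich ρ (a • A) (b • B) = (a * star b) • sandwich ρ A B := by
  simp only [sandwich, Matrix.smul_kronecker, Matrix.conjTranspose_smul, Matrix.smul_mul,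
    Matrix.mul_smul, smul_smul]
  rw [mul_comm]

variable {ρ : Matrix (Λ × R) (Λ × R) ℂ} {A B A' B' : Bits (Fin M) → Matrix (Bits Q) Λ ℂ}
  {σ : HybridState Q R M}

theorem Tracks.classicalAct (h : Tracks ρ A B σ) (f : Bits (Fin M) → Bits (Fin M))
    (hA : ∀ y, ∃ c : ℂ, A y = c • A' (f y)) (hB : ∀ y, ∃ c : ℂ, B y = c • B' (f y)) :
    Tracks ρ A' B' (classicalAct f σ) := by
  intro x
  choose c hc using h
  choose a ha using hA
  choose b hb using hB
  refine ⟨∑ y, if f y = x then c y * (a y * star (b y)) else 0, ?_⟩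
  rw [QEC.classicalAct, Finset.sum_smul]
  refine Finset.sum_congr rfl fun y _ => ?_
  by_cases hy : f y = x
  · rw [if_pos hy, if_pos hy, hc, ha, hb, sandwich_smul, smul_smul, hy]
  · rw [if_neg hy, if_neg hy, zero_smul]

theorem Tracks.congr (h : Tracks ρ A B σ) (hA : ∀ x, ∃ c : ℂ, A x = c • A' x)
    (hB : ∀ x, ∃ c : ℂ, B x = c • B' x) : Tracks ρ A' B' σ := by
  intro x
  obtain ⟨c, hc⟩ := h x
  obtain ⟨a, ha⟩ := hA x
  obtain ⟨b, hb⟩ := hB x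
  exact ⟨c * (a * star b), by rw [hc, ha, hb, sandwich_smul, smul_smul]⟩

theorem Tracks.faultAct (h : Tracks ρ A B σ) (F : PauliPair Q) :
    Tracks ρ (fun x => pauliString F.1 * A x) (fun x => pauliString F.2 * B x) (faultAct F σ) := by
  intro x
  obtain ⟨c, hc⟩ := h x
  refine ⟨c, ?_⟩
  have e : (pauliString F.2 ⊗ₖ (1 : Matrix R R ℂ)) =
      (pauliString F.2 ⊗ₖ (1 : Matrix R R ℂ)).conjTranspose := by
    rw [Matrix.conjTranspose_kronecker, conjTranspose_pauliString, Matrix.conjTranspose_one]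
  rw [QEC.faultAct, hc, e, Matrix.mul_smul, Matrix.smul_mul, sandwich_mul]

/-- The operations on a single qubit which are used after the initialization. -/
inductive LocalOp
  | pauli (P : Pauli)
  | measure (P : Axis)

/-- The gate which performs a local operation on the qubit `q`. -/
def LocalOp.gate : LocalOp → Q → CliffordGate Q
  | .pauli P, q => .pauli P q
  | .measure P, q => .measure P q

/-- The operator applied when the classical bit is `b` (after the gate). -/
def LocalOp.mat : LocalOp → ZMod 2 → Matrix (ZMod 2) (ZMod 2) ℂ
  | .pauli P, b => if b = 1 then P.mat else 1
  | .measure P, b => P.proj b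

theorem LocalOp.gate_support (k : LocalOp) (q : Q) : (k.gate q).support = {q} := by
  cases k <;> rfl

theorem Tracks.localOp (h : Tracks ρ A B σ) (k : LocalOp) (q : Q) (i : Fin M)
    (hA : ∀ P, k = .measure P → ∀ x b, A (Function.update x i b) = A x)
    (hB : ∀ P, k = .measure P → ∀ x b, B (Function.update x i b) = B x) :
    Tracks ρ (fun x => onQubit q (k.mat (x i)) * A x) (fun x => onQubit q (k.mat (x i)) * B x)
      ((k.gate q).act i σ) := by
  intro x
  cases k with
  | pauli P =>
    obtain ⟨c, hc⟩ := h x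
    refine ⟨c, ?_⟩
    change (if x i = 1 then kraus (onQubit q P.mat) (σ x) else σ x) = _
    by_cases hx : x i = 1
    · simp only [LocalOp.mat, if_pos hx, hc, kraus_smul_sandwich]
    · simp only [LocalOp.mat, if_neg hx, hc, onQubit_one, Matrix.one_mul]
  | measure P =>
    choose c hc using h
    refine ⟨∑ b, c (Function.update x i b), ?_⟩
    change ∑ b : ZMod 2, kraus (onQubit q (P.proj (x i))) (σ (Function.update x i b)) = _
    rw [Finset.sum_smul]
    refine Finset.sum_congr rfl fun b _ => ?_
    rw [hc, kraus_smul_sandwich, hA P rfl, hB P rfl]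
    rfl

theorem Tracks.cnot (h : Tracks ρ A B σ) (p q : Q) (hpq : p ≠ q) (i : Fin M) :
    Tracks ρ (fun x => (if x i = 1 then cnotMat p q else 1) * A x)
      (fun x => (if x i = 1 then cnotMat p q else 1) * B x)
      ((CliffordGate.cnot p q hpq).act i σ) := by
  intro x
  obtain ⟨c, hc⟩ := h x
  refine ⟨c, ?_⟩
  change (if x i = 1 then kraus (cnotMat p q) (σ x) else σ x) = _
  by_cases hx : x i = 1
  · simp only [if_pos hx, hc, kraus_smul_sandwich]
  · simp only [if_neg hx, hc, Matrix.one_mul]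

end Tracking

theorem fin_foldl_induction {β : Type*} {n : ℕ} (f : β → Fin n → β) (P : ℕ → β → Prop) {x : β}
    (h0 : P 0 x) (hs : ∀ (i : Fin n) s, P i s → P (i + 1) (f s i)) : P n (Fin.foldl n f x) := by
  induction n with
  | zero => simpa using h0
  | succ n ih =>
    rw [Fin.foldl_succ_last]
    exact hs (Fin.last n) _ (ih (fun s i => f s i.castSucc) fun i s h => hs i.castSucc s h)

/-- One time step of an adaptive circuit. -/
structure Layer (N : ℕ) where
  classical : Bits (Fin N) → Bits (Fin N)
  count : ℕ
  count_le : count ≤ N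
  gate : Fin count → CliffordGate (Fin N)
  disjoint : Pairwise fun i j => Disjoint (gate i).support (gate j).support

section Layers

variable {N : ℕ} {R Λ : Type} [Fintype R] [DecidableEq R] [Fintype Λ] [DecidableEq Λ]

/-- The action of a layer. -/
def Layer.act (l : Layer N) (σ : HybridState (Fin N) R N) : HybridState (Fin N) R N :=
  Fin.foldl l.count (fun τ i => (l.gate i).act (Fin.castLE l.count_le i) τ)
    (classicalAct l.classical σ)

/-- The circuit with the given layers. -/
def circuitOfLayers (l : ℕ → Layer N) (T : ℕ) : AdaptiveCircuit N N T where
  space_le := le_rfl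
  classical := fun t => (l t).classical
  gateCount := fun t => (l t).count
  gateCount_le := fun t => (l t).count_le
  gate := fun t => (l t).gate
  disjoint_support := fun t => (l t).disjoint

/-- The state after `t` of the layers, with the fault `F`. -/
def runLayers (l : ℕ → Layer N) (F : ℕ → PauliPair (Fin N)) (σ : HybridState (Fin N) R N) :
    ℕ → HybridState (Fin N) R N
  | 0 => σ
  | t + 1 => faultAct (F t) ((l t).act (runLayers l F σ t))

theorem run_circuitOfLayers (l : ℕ → Layer N) {T : ℕ} (F : ℕ → PauliPair (Fin N))
    (σ : HybridState (Fin N) R N) :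
    (circuitOfLayers l T).run (fun t => F t) σ = runLayers l F σ T := by
  refine fin_foldl_induction _ (fun n s => s = runLayers l F σ n) rfl ?_
  rintro i s rfl
  rfl

theorem runLayers_add (l : ℕ → Layer N) (F : ℕ → PauliPair (Fin N)) (σ : HybridState (Fin N) R N)
    (s t : ℕ) : runLayers l F σ (s + t) =
      runLayers (fun n => l (s + n)) (fun n => F (s + n)) (runLayers l F σ s) t := by
  induction t with
  | zero => rfl
  | succ t ih => rw [← add_assoc, runLayers, ih, runLayers]

theorem runLayers_congr {l l' : ℕ → Layer N} {F : ℕ → PauliPair (Fin N)}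
    {σ : HybridState (Fin N) R N} {t : ℕ} (h : ∀ n < t, l n = l' n) :
    runLayers l F σ t = runLayers l' F σ t := by
  induction t with
  | zero => rfl
  | succ t ih =>
    rw [runLayers, runLayers, h t t.lt_succ_self, ih fun n hn => h n (hn.trans t.lt_succ_self)]

variable {ρ : Matrix (Λ × R) (Λ × R) ℂ} {σ : HybridState (Fin N) R N}

/-- A layer in which the `i`-th gate acts on the `i`-th qubit. -/
def localLayer (f : Bits (Fin N) → Bits (Fin N)) (k : Fin N → LocalOp) : Layer N where
  classical := f
  count := N
  count_le := le_rfl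
  gate := fun i => (k i).gate i
  disjoint := fun i j hij => by
    change Disjoint ((k i).gate i).support ((k j).gate j).support
    rw [LocalOp.gate_support, LocalOp.gate_support, Set.disjoint_singleton]
    exact hij

theorem Tracks.localLayer {A B A' B' : Bits (Fin N) → Matrix (Bits (Fin N)) Λ ℂ}
    (h : Tracks ρ A B σ) (f : Bits (Fin N) → Bits (Fin N)) (k : Fin N → LocalOp)
    (hA : ∀ y, ∃ c : ℂ, A y = c • A' (f y)) (hB : ∀ y, ∃ c : ℂ, B y = c • B' (f y))
    (hA' : ∀ i P, k i = .measure P → ∀ x b, A' (Function.update x i b) = A' x)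
    (hB' : ∀ i P, k i = .measure P → ∀ x b, B' (Function.update x i b) = B' x) :
    Tracks ρ (fun x => tensorMat (fun i => (k i).mat (x i)) * A' x)
      (fun x => tensorMat (fun i => (k i).mat (x i)) * B' x) ((localLayer f k).act σ) := by
  let U : ℕ → Bits (Fin N) → Matrix (Bits (Fin N)) (Bits (Fin N)) ℂ :=
    fun n x => tensorMat fun i => if (i : ℕ) < n then (k i).mat (x i) else 1
  have hU : ∀ (i : Fin N) x, onQubit i ((k i).mat (x i)) * U i x = U (i + 1) x := by
    intro i x
    refine (onQubit_mul_tensorMat i _ (fun j : Fin N => if (j : ℕ) < i then (k j).mat (x j) else 1)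
      (if_neg (lt_irrefl _))).trans (congrArg tensorMat (funext fun j => ?_))
    by_cases hj : j = i
    · subst hj
      rw [Function.update_self, if_pos (Nat.lt_succ_self _)]
    · have hj' : (j : ℕ) ≠ i := fun h => hj (Fin.ext h)
      rw [Function.update_of_ne hj]
      by_cases hlt : (j : ℕ) < i
      · rw [if_pos hlt, if_pos (hlt.trans (Nat.lt_succ_self _))]
      · rw [if_neg hlt, if_neg (by omega)]
  have hU' : ∀ (i : Fin N) x b, U i (Function.update x i b) = U i x := by
    intro i x b
    refine congrArg tensorMat (funext fun j => ?_)
    by_cases hlt : (j : ℕ) < i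
    · have hj : j ≠ i := by
        rintro rfl
        exact lt_irrefl _ hlt
      rw [if_pos hlt, if_pos hlt, Function.update_of_ne hj]
    · rw [if_neg hlt, if_neg hlt]
  have key : Tracks ρ (fun x => U N x * A' x) (fun x => U N x * B' x)
      ((QEC.localLayer f k).act σ) := by
    refine fin_foldl_induction (n := N) _
      (fun n s => Tracks ρ (fun x => U n x * A' x) (fun x => U n x * B' x) s) ?_ ?_
    · have h0 : ∀ x, U 0 x = 1 := fun x => tensorMat_one
      simp only [h0, Matrix.one_mul]
      exact h.classicalAct f hA hB
    · intro i s hs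
      have h1 := hs.localOp (k i) i i
        (fun P hP x b => by rw [hU', hA' i P hP]) (fun P hP x b => by rw [hU', hB' i P hP])
      simp only [← Matrix.mul_assoc, hU] at h1
      exact h1
  have e : ∀ x, U N x = tensorMat fun i => (k i).mat (x i) := fun x =>
    congrArg tensorMat (funext fun i => if_pos i.2)
  simpa only [e] using key

/-- A layer of controlled NOTs, applied unconditionally. -/
def cnotLayer (s : Finset (Fin N × Fin N)) (h1 : ∀ e ∈ s, e.1 ≠ e.2)
    (h2 : ∀ e ∈ s, ∀ e' ∈ s, e ≠ e' → Disjoint ({e.1, e.2} : Set (Fin N)) {e'.1, e'.2}) :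
    Layer N where
  classical := fun _ => 1
  count := s.card
  count_le := by
    have h : Set.InjOn Prod.fst (s : Set (Fin N × Fin N)) := by
      intro e he e' he' hee
      by_contra hne
      exact Set.disjoint_left.1 (h2 e he e' he' hne) (Or.inl rfl) (Or.inl hee)
    rw [← Finset.card_image_of_injOn h]
    exact (Finset.card_le_univ _).trans (Fintype.card_fin N).le
  gate := fun i => .cnot (s.equivFin.symm i).1.1 (s.equivFin.symm i).1.2
    (h1 _ (s.equivFin.symm i).2)
  disjoint := fun i j hij => h2 _ (s.equivFin.symm i).2 _ (s.equivFin.symm j).2 fun h =>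
    hij (s.equivFin.symm.injective (Subtype.ext h))

/-- The matrix over `ZMod 2` with ones at the positions in `s`. -/
def edgeMat (s : Finset (Fin N × Fin N)) : Matrix (Fin N) (Fin N) (ZMod 2) :=
  fun p q => if (p, q) ∈ s then 1 else 0

theorem edgeMat_mul_edgeMat {s s' : Finset (Fin N × Fin N)} (h : ∀ e ∈ s, ∀ e' ∈ s', e.2 ≠ e'.1) :
    edgeMat s * edgeMat s' = 0 := by
  ext p q
  rw [Matrix.mul_apply]
  refine Finset.sum_eq_zero fun r _ => ?_
  by_contra hne
  have h1 : (p, r) ∈ s := by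
    by_contra h'
    exact left_ne_zero_of_mul hne (if_neg h')
  have h2 : (r, q) ∈ s' := by
    by_contra h'
    exact right_ne_zero_of_mul hne (if_neg h')
  exact h _ h1 _ h2 rfl

theorem edgeMat_insert {s : Finset (Fin N × Fin N)} {e : Fin N × Fin N} (h : e ∉ s) :
    edgeMat (insert e s) = Matrix.single e.1 e.2 1 + edgeMat s := by
  ext p q
  simp only [edgeMat, Matrix.add_apply, Matrix.single_apply, Finset.mem_insert, Prod.ext_iff]
  by_cases hs : (p, q) ∈ s
  · have hne : ¬ (e.1 = p ∧ e.2 = q) := by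
      rintro ⟨rfl, rfl⟩
      exact h hs
    simp [hs, hne]
  · simp only [hs, or_false, if_false, add_zero]
    exact if_congr ⟨fun h => ⟨h.1.symm, h.2.symm⟩, fun h => ⟨h.1.symm, h.2.symm⟩⟩ rfl rfl

theorem Tracks.cnotLayer {A B : Matrix (Bits (Fin N)) Λ ℂ}
    (h : Tracks ρ (fun _ => A) (fun _ => B) σ) {s : Finset (Fin N × Fin N)}
    (h1 : ∀ e ∈ s, e.1 ≠ e.2)
    (h2 : ∀ e ∈ s, ∀ e' ∈ s, e ≠ e' → Disjoint ({e.1, e.2} : Set (Fin N)) {e'.1, e'.2}) :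
    Tracks ρ (fun _ => permMat (shear (edgeMat s)) * A) (fun _ => permMat (shear (edgeMat s)) * B)
      ((cnotLayer s h1 h2).act σ) := by
  have h3 : ∀ e ∈ s, ∀ e' ∈ s, e.2 ≠ e'.1 := by
    intro e he e' he' hee
    by_cases hne : e = e'
    · subst hne
      exact h1 e he hee.symm
    · exact Set.disjoint_left.1 (h2 e he e' he' hne) (Or.inr rfl) (Or.inl hee)
  let S : ℕ → Finset (Fin N × Fin N) :=
    fun n => s.filter fun e => ∃ h : e ∈ s, ((s.equivFin ⟨e, h⟩ : Fin _) : ℕ) < n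
  let U : ℕ → Matrix (Bits (Fin N)) (Bits (Fin N)) ℂ := fun n => permMat (shear (edgeMat (S n)))
  have hU : ∀ i : Fin s.card, cnotMat (s.equivFin.symm i).1.1 (s.equivFin.symm i).1.2 * U i =
      U (i + 1) := by
    intro i
    have hi : (s.equivFin.symm i).1 ∉ S i := by
      intro hmem
      obtain ⟨h', hlt⟩ := (Finset.mem_filter.1 hmem).2
      rw [Subtype.coe_eta, Equiv.apply_symm_apply] at hlt
      exact lt_irrefl _ hlt
    have hS : S (i + 1) = insert (s.equivFin.symm i).1 (S i) := by
      ext e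
      simp only [S, Finset.mem_filter, Finset.mem_insert]
      constructor
      · rintro ⟨he, h', hlt⟩
        rcases Nat.lt_succ_iff_lt_or_eq.1 hlt with hlt | heq
        · exact Or.inr ⟨he, h', hlt⟩
        · left
          have : s.equivFin ⟨e, h'⟩ = i := Fin.ext heq
          rw [← this, Equiv.symm_apply_apply]
      · rintro (rfl | ⟨he, h', hlt⟩)
        · refine ⟨(s.equivFin.symm i).2, (s.equivFin.symm i).2, ?_⟩
          rw [Subtype.coe_eta, Equiv.apply_symm_apply]
          exact Nat.lt_succ_self _
        · exact ⟨he, h', hlt.trans (Nat.lt_succ_self _)⟩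
    have hz : edgeMat (S i) * Matrix.single (s.equivFin.symm i).1.1 (s.equivFin.symm i).1.2 1 = 0 := by
      have : Matrix.single (s.equivFin.symm i).1.1 (s.equivFin.symm i).1.2 (1 : ZMod 2) =
          edgeMat {(s.equivFin.symm i).1} := by
        have := edgeMat_insert (N := N) (Finset.notMem_empty (s.equivFin.symm i).1)
        rw [insert_empty_eq] at this
        rw [this]
        ext p q
        simp [edgeMat]
      rw [this]
      refine edgeMat_mul_edgeMat fun e he e' he' => ?_
      rw [Finset.mem_singleton] at he'
      subst he'
      exact h3 _ (Finset.mem_filter.1 he).1 _ (s.equivFin.symm i).2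
    rw [cnotMat_eq, permMat_mul, shear_comp hz, ← edgeMat_insert hi, ← hS]
  have key : Tracks ρ (fun x => if x = 1 then U s.card * A else 0)
      (fun x => if x = 1 then U s.card * B else 0) ((QEC.cnotLayer s h1 h2).act σ) := by
    refine fin_foldl_induction (n := s.card) _
      (fun n t => Tracks ρ (fun x => if x = 1 then U n * A else 0)
        (fun x => if x = 1 then U n * B else 0) t) ?_ ?_
    · have h0 : U 0 = 1 := by
        have e : edgeMat (S 0) = 0 := by
          ext p q
          simp [edgeMat, S]
        ext x y
        simp [U, e, permMat, shear, Matrix.one_apply]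
      simp only [h0, Matrix.one_mul]
      refine h.classicalAct _ (fun y => ⟨1, ?_⟩) fun y => ⟨1, ?_⟩
      · simp [QEC.cnotLayer]
      · simp [QEC.cnotLayer]
    · intro i t ht
      refine (ht.cnot _ _ (h1 _ (s.equivFin.symm i).2) _).congr (fun x => ⟨1, ?_⟩) fun x => ⟨1, ?_⟩
      · by_cases hx : x = 1
        · subst hx
          rw [one_smul, if_pos rfl, if_pos rfl, if_pos (by simp), ← Matrix.mul_assoc, hU]
        · rw [one_smul, if_neg hx, if_neg hx, Matrix.mul_zero]
      · by_cases hx : x = 1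
        · subst hx
          rw [one_smul, if_pos rfl, if_pos rfl, if_pos (by simp), ← Matrix.mul_assoc, hU]
        · rw [one_smul, if_neg hx, if_neg hx, Matrix.mul_zero]
  have hs : S s.card = s := by
    ext e
    simp only [S, Finset.mem_filter]
    exact ⟨fun h => h.1, fun h => ⟨h, h, Fin.is_lt _⟩⟩
  have e : U s.card = permMat (shear (edgeMat s)) := by rw [← hs]; simp only [U, hs]
  rw [e] at key
  refine key.congr (fun x => ?_) fun x => ?_
  · by_cases hx : x = 1
    · exact ⟨1, by rw [if_pos hx, one_smul]⟩
    · exact ⟨0, by rw [if_neg hx, zero_smul]⟩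
  · by_cases hx : x = 1
    · exact ⟨1, by rw [if_pos hx, one_smul]⟩
    · exact ⟨0, by rw [if_neg hx, zero_smul]⟩

end Layers

/-! ### Initialization -/

/-- The one-qubit state `|+⟩` or `|0⟩`, as a real vector. -/
def initAmp (plus : Prop) [Decidable plus] (b : ZMod 2) : ℝ :=
  if plus then (Real.sqrt 2)⁻¹ else if b = 0 then 1 else 0

/-- The matrix `|φ⟩⟨b|`. -/
def ketMat (φ : ZMod 2 → ℝ) (b : ZMod 2) : Matrix (ZMod 2) (ZMod 2) ℂ :=
  fun x z => if z = b then (φ x : ℂ) else 0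

section Reset

variable {N : ℕ} {R : Type} [Fintype R] [DecidableEq R]

theorem kraus_onQubit_ket (q : Fin N) (φ : ZMod 2 → ℝ) (b : ZMod 2)
    (ρ : Matrix (Bits (Fin N) × R) (Bits (Fin N) × R) ℂ) (y y' : Bits (Fin N) × R) :
    kraus (onQubit q (ketMat φ b)) ρ y y' =
      φ (y.1 q) * φ (y'.1 q) * ρ (Function.update y.1 q b, y.2) (Function.update y'.1 q b, y'.2) := by
  have h : ∀ {β : Type} (X : Matrix (Bits (Fin N) × R) β ℂ) (y : Bits (Fin N) × R) (z : β),
      (((onQubit q (ketMat φ b)) ⊗ₖ (1 : Matrix R R ℂ)) * X) y z =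
        φ (y.1 q) * X (Function.update y.1 q b, y.2) z := by
    intro β X y z
    rw [Matrix.mul_apply, Finset.sum_eq_single (Function.update y.1 q b, y.2)]
    · rw [Matrix.kroneckerMap_apply, Matrix.one_apply_eq, mul_one, onQubit, if_pos, ketMat, if_pos]
      · exact Function.update_self _ _ _
      · intro p hp
        exact (Function.update_of_ne hp _ _).symm
    · rintro ⟨v, r⟩ _ hne
      rw [Matrix.kroneckerMap_apply]
      by_cases hr : y.2 = r
      · subst hr
        rw [onQubit]
        simp only [ketMat]
        split_ifs with h1 h2
        · exfalso
          apply hne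
          refine Prod.ext (funext fun p => ?_) rfl
          by_cases hp : p = q
          · subst hp
            simpa using h2
          · simpa [hp] using (h1 p hp).symm
        · simp
        · simp
      · rw [Matrix.one_apply_ne hr, mul_zero, zero_mul]
    · intro h'
      exact absurd (Finset.mem_univ _) h'
  have h' : ∀ (X : Matrix (Bits (Fin N) × R) (Bits (Fin N) × R) ℂ) (y y' : Bits (Fin N) × R),
      (X * ((onQubit q (ketMat φ b)) ⊗ₖ
        (1 : Matrix R R ℂ)).conjTranspose) y y' =
        φ (y'.1 q) * X y (Function.update y'.1 q b, y'.2) := by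
    intro X y y'
    have h1 := h X.conjTranspose y' y
    have h2 := congrArg star h1
    rw [← Matrix.conjTranspose_apply, Matrix.conjTranspose_mul, Matrix.conjTranspose_conjTranspose,
      star_mul', Matrix.conjTranspose_apply, star_star] at h2
    rw [h2, Complex.star_def, Complex.conj_ofReal]
  rw [kraus, h', h]
  ring

/-- The layer which resets the qubits outside `inp` to `|+⟩` or `|0⟩`. -/
def resetLayer (inp plus : Fin N → Prop) [DecidablePred inp] [DecidablePred plus] : Layer N where
  classical := fun _ => 1
  count := N
  count_le := le_rfl
  gate := fun i => if inp i then .pauli .I i else if plus i then .resetPlus i else .resetZero i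
  disjoint := fun i j hij => by
    have h : ∀ i : Fin N, CliffordGate.support (if inp i then .pauli .I i else
        if plus i then .resetPlus i else .resetZero i) = {i} := by
      intro i
      split_ifs <;> rfl
    change Disjoint (CliffordGate.support _) (CliffordGate.support _)
    rw [h, h, Set.disjoint_singleton]
    exact hij

/-- The operator which adjoins the qubits outside the range of `e`, in the states `|+⟩` or `|0⟩`. -/
def initMat {P : Type} [Fintype P] [DecidableEq P] (e : P ↪ Fin N) (plus : Fin N → Prop)
    [DecidablePred plus] [DecidablePred (· ∈ Set.range e)] : Matrix (Bits (Fin N)) (Bits P) ℂ :=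
  fun y u => if y ∘ e = u then
    ((∏ i, if i ∈ Set.range e then 1 else initAmp (plus i) (y i) : ℝ) : ℂ) else 0

/-- The amplitude of the qubits of `D` in their initial states. -/
def resetAmp (plus : Fin N → Prop) [DecidablePred plus] (D : Finset (Fin N)) (y : Bits (Fin N)) : ℝ :=
  ∏ i, if i ∈ D then initAmp (plus i) (y i) else 1

/-- The matrix entries, indexed by `v` and `v'`, which contribute to the entry indexed by `y` and
`y'` when the qubits of `D` have been reset. -/
def ResetRel (D : Finset (Fin N)) (y y' v v' : Bits (Fin N)) : Prop :=
  ∀ i, (i ∈ D → v i = v' i) ∧ (i ∉ D → y i = v i ∧ y' i = v' i)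

open Classical in
/-- The state `ρ` after the qubits of `D` have been reset. -/
def resetState (plus : Fin N → Prop) [DecidablePred plus] (D : Finset (Fin N))
    (ρ : Matrix (Bits (Fin N) × R) (Bits (Fin N) × R) ℂ) :
    Matrix (Bits (Fin N) × R) (Bits (Fin N) × R) ℂ :=
  fun y y' => resetAmp plus D y.1 * resetAmp plus D y'.1 *
    ∑ v, ∑ v', if ResetRel D y.1 y'.1 v v' then ρ (v, y.2) (v', y'.2) else 0

theorem resetState_empty (plus : Fin N → Prop) [DecidablePred plus]
    (ρ : Matrix (Bits (Fin N) × R) (Bits (Fin N) × R) ℂ) : resetState plus ∅ ρ = ρ := by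
  ext y y'
  have hW0 : ∀ v v', ResetRel ∅ y.1 y'.1 v v' ↔ y.1 = v ∧ y'.1 = v' := by
    intro v v'
    refine ⟨fun h => ⟨funext fun i => ((h i).2 (Finset.notMem_empty i)).1,
      funext fun i => ((h i).2 (Finset.notMem_empty i)).2⟩, ?_⟩
    rintro ⟨h1, h2⟩ i
    exact ⟨fun h => absurd h (Finset.notMem_empty i), fun _ => ⟨congrFun h1 i, congrFun h2 i⟩⟩
  simp only [resetState, resetAmp, hW0, Finset.notMem_empty, if_false, Finset.prod_const_one,
    Complex.ofReal_one, one_mul, ite_and, Finset.sum_ite_irrel, Finset.sum_const_zero,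
    Finset.sum_ite_eq, Finset.mem_univ, if_true]

theorem resetState_insert (plus : Fin N → Prop) [DecidablePred plus] {D : Finset (Fin N)}
    {i : Fin N} (hi : i ∉ D) (ρ : Matrix (Bits (Fin N) × R) (Bits (Fin N) × R) ℂ) :
    ∑ b, kraus (onQubit i (ketMat (initAmp (plus i)) b)) (resetState plus D ρ) =
      resetState plus (insert i D) ρ := by
  have hcu : ∀ y b, resetAmp plus (insert i D) y =
      initAmp (plus i) (y i) * resetAmp plus D (Function.update y i b) := by
    intro y b
    rw [resetAmp, resetAmp, ← Finset.mul_prod_erase _ _ (Finset.mem_univ i),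
      ← Finset.mul_prod_erase _ (fun j => if j ∈ D then _ else _) (Finset.mem_univ i),
      if_pos (Finset.mem_insert_self _ _), if_neg hi, one_mul]
    congr 1
    refine Finset.prod_congr rfl fun j hj => ?_
    have hj' := Finset.ne_of_mem_erase hj
    rw [Function.update_of_ne hj']
    exact if_congr ⟨fun h => (Finset.mem_insert.1 h).resolve_left hj', Finset.mem_insert_of_mem⟩
      rfl rfl
  have hW : ∀ y y' v v' b,
      ResetRel D (Function.update y i b) (Function.update y' i b) v v' ↔
        b = v i ∧ ResetRel (insert i D) y y' v v' := by
    intro y y' v v' b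
    constructor
    · intro h
      have h0 := (h i).2 hi
      rw [Function.update_self, Function.update_self] at h0
      refine ⟨h0.1, fun j => ?_⟩
      by_cases hj : j = i
      · subst hj
        exact ⟨fun _ => h0.1.symm.trans h0.2, fun h' => absurd (Finset.mem_insert_self _ _) h'⟩
      · have := h j
        rw [Function.update_of_ne hj, Function.update_of_ne hj] at this
        rwa [Finset.mem_insert, or_iff_right hj]
    · rintro ⟨hb, h⟩ j
      by_cases hj : j = i
      · subst hj
        rw [Function.update_self, Function.update_self]
        exact ⟨fun h' => absurd h' hi,
          fun _ => ⟨hb, hb.trans ((h j).1 (Finset.mem_insert_self _ _))⟩⟩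
      · have := h j
        rw [Finset.mem_insert, or_iff_right hj] at this
        rwa [Function.update_of_ne hj, Function.update_of_ne hj]
  ext y y'
  classical
  have h1 : ∀ b, kraus (onQubit i (ketMat (initAmp (plus i)) b)) (resetState plus D ρ) y y' =
      (resetAmp plus (insert i D) y.1 * resetAmp plus (insert i D) y'.1) *
        ∑ v, ∑ v', if b = v i ∧ ResetRel (insert i D) y.1 y'.1 v v' then
          ρ (v, y.2) (v', y'.2) else 0 := by
    intro b
    rw [kraus_onQubit_ket, resetState, ← mul_assoc]
    refine congrArg₂ (· * ·) ?_ (Finset.sum_congr rfl fun v _ => Finset.sum_congr rfl fun v' _ =>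
      if_congr (hW _ _ _ _ _) rfl rfl)
    rw [hcu y.1 b, hcu y'.1 b, Complex.ofReal_mul, Complex.ofReal_mul]
    ring
  rw [Matrix.sum_apply, Finset.sum_congr rfl fun b _ => h1 b, resetState]
  rw [← Finset.mul_sum, Finset.sum_comm]
  congr 1
  refine Finset.sum_congr rfl fun v _ => ?_
  rw [Finset.sum_comm]
  refine Finset.sum_congr rfl fun v' _ => ?_
  simp only [ite_and, Finset.sum_ite_eq', Finset.mem_univ, if_true]

theorem sum_kraus_reset (plus : Prop) [Decidable plus] (q : Fin N)
    (ρ : Matrix (Bits (Fin N) × R) (Bits (Fin N) × R) ℂ) :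
    ∑ b, kraus (onQubit q (ketMat (initAmp plus) b)) ρ =
      if plus then ∑ b, kraus (onQubit q (plusKet b)) ρ else
        ∑ b, kraus (onQubit q (zeroKet b)) ρ := by
  split_ifs with hp
  · have h1 : ∀ b : ZMod 2, ketMat (initAmp plus) b = plusKet b := by
      intro b
      funext x z
      simp only [ketMat, plusKet, initAmp, if_pos hp]
    simp only [h1]
  · have h1 : ∀ b : ZMod 2, ketMat (initAmp plus) b = zeroKet b := by
      intro b
      funext x z
      by_cases hz : z = b <;> by_cases hx : x = 0 <;>
        simp [ketMat, zeroKet, initAmp, hp, hz, hx]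
    simp only [h1]

theorem resetState_eq_sandwich {P : Type} [Fintype P] [DecidableEq P] (e : P ↪ Fin N)
    (plus : Fin N → Prop) [DecidablePred plus] [DecidablePred (· ∈ Set.range e)]
    (σ : HybridState (Fin N) R N) {D : Finset (Fin N)} (hD : ∀ i, i ∈ D ↔ i ∉ Set.range e) :
    resetState plus D (∑ x, σ x) =
      sandwich (partialTrace e σ) (initMat e plus) (initMat e plus) := by
  classical
  have hc : ∀ y, resetAmp plus D y =
      ∏ i, if i ∈ Set.range e then 1 else initAmp (plus i) (y i) := by
    intro y
    refine Finset.prod_congr rfl fun i _ => ?_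
    by_cases hi : i ∈ Set.range e
    · rw [if_pos hi, if_neg fun h => (hD i).1 h hi]
    · rw [if_neg hi, if_pos ((hD i).2 hi)]
  have hl : ∀ {β : Type} (X : Matrix (Bits P × R) β ℂ) (y : Bits (Fin N) × R) (z : β),
      ((initMat e plus ⊗ₖ (1 : Matrix R R ℂ)) * X) y z =
        resetAmp plus D y.1 * X (y.1 ∘ e, y.2) z := by
    intro β X y z
    rw [Matrix.mul_apply, Finset.sum_eq_single (y.1 ∘ e, y.2)]
    · rw [Matrix.kroneckerMap_apply, Matrix.one_apply_eq, mul_one, initMat, if_pos rfl, hc]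
    · rintro ⟨v, r⟩ _ hne
      rw [Matrix.kroneckerMap_apply]
      by_cases hr : y.2 = r
      · subst hr
        rw [initMat, if_neg, zero_mul, zero_mul]
        rintro rfl
        exact hne rfl
      · rw [Matrix.one_apply_ne hr, mul_zero, zero_mul]
    · intro h'
      exact absurd (Finset.mem_univ _) h'
  have hr : ∀ (X : Matrix (Bits (Fin N) × R) (Bits P × R) ℂ) (y y' : Bits (Fin N) × R),
      (X * (initMat e plus ⊗ₖ (1 : Matrix R R ℂ)).conjTranspose) y y' =
        resetAmp plus D y'.1 * X y (y'.1 ∘ e, y'.2) := by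
    intro X y y'
    have h1 := hl X.conjTranspose y' y
    have h2 := congrArg star h1
    rw [← Matrix.conjTranspose_apply, Matrix.conjTranspose_mul, Matrix.conjTranspose_conjTranspose,
      star_mul', Matrix.conjTranspose_apply, star_star] at h2
    rw [h2, Complex.star_def, Complex.conj_ofReal]
  ext y y'
  rw [sandwich, hr, hl, ← mul_assoc, mul_comm (resetAmp plus D y'.1 : ℂ), resetState]
  congr 1
  have e1 : ∀ v v', (if ResetRel D y.1 y'.1 v v' then (∑ x, σ x) (v, y.2) (v', y'.2) else 0) =
      ∑ x, if v ∘ e = y.1 ∘ e ∧ v' ∘ e = y'.1 ∘ e ∧ ∀ q ∉ Set.range e, v q = v' q then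
        σ x (v, y.2) (v', y'.2) else 0 := by
    intro v v'
    have hiff : ResetRel D y.1 y'.1 v v' ↔
        (v ∘ e = y.1 ∘ e ∧ v' ∘ e = y'.1 ∘ e ∧ ∀ q ∉ Set.range e, v q = v' q) := by
      constructor
      · intro h
        refine ⟨funext fun p => ?_, funext fun p => ?_, fun q hq => (h q).1 ((hD q).2 hq)⟩
        · exact (((h (e p)).2 fun h' => (hD _).1 h' ⟨p, rfl⟩).1).symm
        · exact (((h (e p)).2 fun h' => (hD _).1 h' ⟨p, rfl⟩).2).symm
      · rintro ⟨h1, h2, h3⟩ q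
        refine ⟨fun h => h3 q ((hD q).1 h), fun h => ?_⟩
        rw [hD, not_not] at h
        obtain ⟨p, rfl⟩ := h
        exact ⟨(congrFun h1 p).symm, (congrFun h2 p).symm⟩
    by_cases h : ResetRel D y.1 y'.1 v v'
    · simp only [if_pos h, if_pos (hiff.1 h), Matrix.sum_apply]
    · simp only [if_neg h, if_neg fun h' => h (hiff.2 h'), Finset.sum_const_zero]
  simp only [e1, partialTrace]
  rw [Finset.sum_congr rfl fun v _ => Finset.sum_comm, Finset.sum_comm]

/-- After the reset, the state is that of the input qubits with the other qubits adjoined. -/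
theorem resetLayer_act {P : Type} [Fintype P] [DecidableEq P] (e : P ↪ Fin N) (plus : Fin N → Prop)
    [DecidablePred plus] [DecidablePred (· ∈ Set.range e)] (σ : HybridState (Fin N) R N) :
    (resetLayer (· ∈ Set.range e) plus).act σ = fun x => if x = 1 then
      sandwich (partialTrace e σ) (initMat e plus) (initMat e plus) else 0 := by
  let D : ℕ → Finset (Fin N) := fun n => Finset.univ.filter fun i => (i : ℕ) < n ∧ i ∉ Set.range e
  have hDi : ∀ i : Fin N, i ∉ D i := fun i h => lt_irrefl _ (Finset.mem_filter.1 h).2.1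
  have hDs : ∀ i : Fin N, D (i + 1) = if i ∈ Set.range e then D i else insert i (D i) := by
    intro i
    ext j
    have hj : (j : ℕ) = i ↔ j = i := ⟨fun h => Fin.ext h, fun h => congrArg _ h⟩
    by_cases hi : i ∈ Set.range e
    · simp only [D, if_pos hi, Finset.mem_filter, Finset.mem_univ, true_and, Nat.lt_succ_iff_lt_or_eq]
      refine ⟨fun h => ⟨h.1.resolve_right fun h' => ?_, h.2⟩, fun h => ⟨Or.inl h.1, h.2⟩⟩
      rw [hj] at h'
      subst h'
      exact h.2 hi
    · simp only [D, if_neg hi, Finset.mem_filter, Finset.mem_univ, true_and,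
        Nat.lt_succ_iff_lt_or_eq, Finset.mem_insert, hj]
      constructor
      · rintro ⟨h1 | h1, h2⟩
        · exact Or.inr ⟨h1, h2⟩
        · exact Or.inl h1
      · rintro (rfl | ⟨h1, h2⟩)
        · exact ⟨Or.inr rfl, hi⟩
        · exact ⟨Or.inl h1, h2⟩
  have key : (resetLayer (· ∈ Set.range e) plus).act σ =
      fun x => if x = 1 then resetState plus (D N) (∑ x, σ x) else 0 := by
    refine fin_foldl_induction (n := N) _
      (fun n s => s = fun x => if x = 1 then resetState plus (D n) (∑ x, σ x) else 0) ?_ ?_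
    · funext x
      have hD0 : D 0 = ∅ := by
        ext i
        simp [D]
      change ∑ y, (if 1 = x then σ y else 0) = _
      rw [hD0, resetState_empty]
      by_cases hx : x = 1
      · simp [hx]
      · rw [if_neg hx]
        exact Finset.sum_eq_zero fun y _ => if_neg fun h => hx h.symm
    · rintro i s rfl
      funext x
      rw [hDs]
      by_cases hi : i ∈ Set.range e
      · have hg : (resetLayer (· ∈ Set.range e) plus).gate i = .pauli .I i := if_pos hi
        rw [hg, if_pos hi]
        have h1 : ∀ X : Matrix (Bits (Fin N) × R) (Bits (Fin N) × R) ℂ,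
            kraus (onQubit (i : Fin N) Pauli.I.mat) X = X := by
          intro X
          rw [Pauli.mat, onQubit_one, kraus, Matrix.one_kronecker_one, Matrix.one_mul,
            Matrix.conjTranspose_one, Matrix.mul_one]
        change (if x _ = 1 then kraus _ _ else _) = _
        rw [h1, ite_self]
      · have h0 : ∀ U, kraus U (0 : Matrix (Bits (Fin N) × R) (Bits (Fin N) × R) ℂ) = 0 := by
          intro U
          rw [kraus, Matrix.mul_zero, Matrix.zero_mul]
        have hs := resetState_insert plus (hDi i) (∑ x, σ x)
        rw [sum_kraus_reset] at hs
        rw [if_neg hi]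
        by_cases hp : plus i
        · have hg : (resetLayer (· ∈ Set.range e) plus).gate i = .resetPlus i :=
            (if_neg hi).trans (if_pos hp)
          rw [if_pos hp] at hs
          rw [hg]
          change (if x _ = 1 then ∑ b, kraus _ (if x = 1 then _ else _) else
            (if x = 1 then _ else _)) = _
          by_cases hx : x = 1
          · subst hx
            rw [if_pos (Pi.one_apply _), if_pos rfl, if_pos rfl, hs]
          · simp only [if_neg hx, h0, Finset.sum_const_zero, ite_self]
        · have hg : (resetLayer (· ∈ Set.range e) plus).gate i = .resetZero i :=
            (if_neg hi).trans (if_neg hp)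
          rw [if_neg hp] at hs
          rw [hg]
          change (if x _ = 1 then ∑ b, kraus _ (if x = 1 then _ else _) else
            (if x = 1 then _ else _)) = _
          by_cases hx : x = 1
          · subst hx
            rw [if_pos (Pi.one_apply _), if_pos rfl, if_pos rfl, hs]
          · simp only [if_neg hx, h0, Finset.sum_const_zero, ite_self]
  rw [key, resetState_eq_sandwich e plus σ (D := D N)]
  intro i
  simp [D]

end Reset

/-! ### Stages of controlled NOTs -/

/-- A bipartite graph with degrees at most `w` has a proper edge colouring with `2 * w` colours. -/
theorem exists_edge_colouring {α : Type} [DecidableEq α] (E : Finset (α × α)) (w : ℕ)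
    (h1 : ∀ p, (E.filter fun e => e.1 = p).card ≤ w)
    (h2 : ∀ q, (E.filter fun e => e.2 = q).card ≤ w) :
    ∃ col : α × α → ℕ, (∀ e ∈ E, col e < 2 * w) ∧
      ∀ e ∈ E, ∀ e' ∈ E, e ≠ e' → col e = col e' → e.1 ≠ e'.1 ∧ e.2 ≠ e'.2 := by
  suffices H : ∀ s ⊆ E, ∃ col : α × α → ℕ, (∀ e ∈ s, col e < 2 * w) ∧
      ∀ e ∈ s, ∀ e' ∈ s, e ≠ e' → col e = col e' → e.1 ≠ e'.1 ∧ e.2 ≠ e'.2 from H E subset_rfl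
  intro s
  induction s using Finset.induction_on with
  | empty => exact fun _ => ⟨fun _ => 0, by simp, by simp⟩
  | insert e s he ih =>
    intro hs
    obtain ⟨col, hc1, hc2⟩ := ih fun x hx => hs (Finset.mem_insert_of_mem hx)
    have heE : e ∈ E := hs (Finset.mem_insert_self _ _)
    have hlt1 : (s.filter fun x => x.1 = e.1).card < w := by
      refine lt_of_lt_of_le (Finset.card_lt_card ?_) (h1 e.1)
      refine (Finset.ssubset_iff_of_subset ?_).2 ⟨e, by simp [heE], by simp [he]⟩
      exact Finset.filter_subset_filter _ fun x hx => hs (Finset.mem_insert_of_mem hx)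
    have hlt2 : (s.filter fun x => x.2 = e.2).card < w := by
      refine lt_of_lt_of_le (Finset.card_lt_card ?_) (h2 e.2)
      refine (Finset.ssubset_iff_of_subset ?_).2 ⟨e, by simp [heE], by simp [he]⟩
      exact Finset.filter_subset_filter _ fun x hx => hs (Finset.mem_insert_of_mem hx)
    have hcard : (((s.filter fun x => x.1 = e.1) ∪ (s.filter fun x => x.2 = e.2)).image col).card <
        (Finset.range (2 * w)).card := by
      rw [Finset.card_range]
      have := Finset.card_image_le (s := (s.filter fun x => x.1 = e.1) ∪
        (s.filter fun x => x.2 = e.2)) (f := col)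
      have := Finset.card_union_le (s.filter fun x => x.1 = e.1) (s.filter fun x => x.2 = e.2)
      omega
    obtain ⟨k, hk, hk'⟩ := Finset.exists_mem_notMem_of_card_lt_card hcard
    have hk'' : ∀ x ∈ s, col x = k → e.1 ≠ x.1 ∧ e.2 ≠ x.2 := by
      intro x hx hxk
      constructor
      · intro h
        exact hk' (Finset.mem_image.2 ⟨x, Finset.mem_union_left _ (Finset.mem_filter.2 ⟨hx, h.symm⟩),
          hxk⟩)
      · intro h
        exact hk' (Finset.mem_image.2 ⟨x, Finset.mem_union_right _ (Finset.mem_filter.2 ⟨hx, h.symm⟩),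
          hxk⟩)
    have hne : ∀ x ∈ s, x ≠ e := by
      rintro x hx rfl
      exact he hx
    refine ⟨Function.update col e k, ?_, ?_⟩
    · intro x hx
      rcases Finset.mem_insert.1 hx with rfl | hx
      · rw [Function.update_self]
        exact Finset.mem_range.1 hk
      · rw [Function.update_of_ne (hne x hx)]
        exact hc1 x hx
    · intro x hx x' hx' hxx
      rcases Finset.mem_insert.1 hx with hxe | hx <;>
        rcases Finset.mem_insert.1 hx' with hxe' | hx'
      · exact absurd (hxe.trans hxe'.symm) hxx
      · rw [hxe, Function.update_self, Function.update_of_ne (hne x' hx')]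
        exact fun h => hk'' x' hx' h.symm
      · rw [hxe', Function.update_self, Function.update_of_ne (hne x hx)]
        exact fun h => ⟨(hk'' x hx h).1.symm, (hk'' x hx h).2.symm⟩
      · rw [Function.update_of_ne (hne x hx), Function.update_of_ne (hne x' hx')]
        exact hc2 x hx x' hx' hxx

/-- Controlled NOTs between disjoint sets of controls and targets, scheduled so that those of the
same colour act on disjoint pairs of qubits. -/
structure CnotStage (N : ℕ) where
  edges : Finset (Fin N × Fin N)
  colour : Fin N × Fin N → ℕ
  bipartite : ∀ e ∈ edges, ∀ e' ∈ edges, e.2 ≠ e'.1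
  proper : ∀ e ∈ edges, ∀ e' ∈ edges, e ≠ e' → colour e = colour e' → e.1 ≠ e'.1 ∧ e.2 ≠ e'.2

/-- One-sided evolution of a state through layers with the operators `U` and the faults `S`. -/
def ketRun {N : ℕ} {Λ : Type} (U : ℕ → Matrix (Bits (Fin N)) (Bits (Fin N)) ℂ)
    (S : ℕ → Fin N → Pauli) (A : Matrix (Bits (Fin N)) Λ ℂ) : ℕ → Matrix (Bits (Fin N)) Λ ℂ
  | 0 => A
  | n + 1 => pauliString (S n) * (U n * ketRun U S A n)

namespace CnotStage

variable {N : ℕ} {R Λ : Type} [Fintype R] [DecidableEq R] [Fintype Λ] [DecidableEq Λ]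
  (C : CnotStage N)

/-- The controlled NOTs of the colour `n`. -/
def edgesOf (n : ℕ) : Finset (Fin N × Fin N) := C.edges.filter fun e => C.colour e = n

/-- The layer of the controlled NOTs of the colour `n`. -/
def layer (n : ℕ) : Layer N :=
  cnotLayer (C.edgesOf n)
    (fun e he h => C.bipartite e (Finset.mem_filter.1 he).1 e (Finset.mem_filter.1 he).1 h.symm)
    (fun e he e' he' hne => by
      obtain ⟨h1, h2⟩ := Finset.mem_filter.1 he
      obtain ⟨h1', h2'⟩ := Finset.mem_filter.1 he'
      have h3 := C.proper e h1 e' h1' hne (h2.trans h2'.symm)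
      rw [Set.disjoint_left]
      rintro x (rfl | rfl) (h | h)
      · exact h3.1 h
      · exact C.bipartite e' h1' e h1 h.symm
      · exact C.bipartite e h1 e' h1' h
      · exact h3.2 h)

theorem edgeMat_mul {s s' : Finset (Fin N × Fin N)} (hs : s ⊆ C.edges) (hs' : s' ⊆ C.edges) :
    edgeMat s * edgeMat s' = 0 :=
  edgeMat_mul_edgeMat fun _ he _ he' => C.bipartite _ (hs he) _ (hs' he')

theorem sum_edgeMat {n : ℕ} (h : ∀ e ∈ C.edges, C.colour e < n) :
    ∑ t ∈ Finset.range n, edgeMat (C.edgesOf t) = edgeMat C.edges := by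
  ext p q
  rw [Matrix.sum_apply]
  simp only [edgeMat, edgesOf, Finset.mem_filter]
  by_cases hpq : (p, q) ∈ C.edges
  · simp [hpq, h _ hpq]
  · simp [hpq]

theorem tracks {ρ : Matrix (Λ × R) (Λ × R) ℂ} {σ : HybridState (Fin N) R N}
    {A B : Matrix (Bits (Fin N)) Λ ℂ} (h : Tracks ρ (fun _ => A) (fun _ => B) σ)
    (F : ℕ → PauliPair (Fin N)) (n : ℕ) :
    Tracks ρ
      (fun _ => ketRun (fun t => permMat (shear (edgeMat (C.edgesOf t)))) (fun t => (F t).1) A n)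
      (fun _ => ketRun (fun t => permMat (shear (edgeMat (C.edgesOf t)))) (fun t => (F t).2) B n)
      (runLayers C.layer F σ n) := by
  induction n with
  | zero => exact h
  | succ n ih => exact (ih.cnotLayer _ _).faultAct (F n)

/-- Errors of the faults and of the initial state spread to neighbouring qubits at most. -/
theorem exists_ketRun_eq {Nb : Fin N → Fin N → Prop}
    (hNb : ∀ e ∈ C.edges, Nb e.1 e.2 ∧ Nb e.2 e.1) {E : Set (Fin N)} {S : ℕ → Fin N → Pauli}
    (hS : ∀ n q, S n q ≠ .I → q ∈ E) {a b : Bits (Fin N)} (hab : ∀ q, a q ≠ 0 ∨ b q ≠ 0 → q ∈ E)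
    (n : ℕ) : ∃ a' b' : Bits (Fin N), (∀ q, a' q ≠ 0 ∨ b' q ≠ 0 → q ∈ E ∨ ∃ p ∈ E, Nb p q) ∧
      ∀ A : Matrix (Bits (Fin N)) Λ ℂ, ∃ c : ℂ,
        ketRun (fun t => permMat (shear (edgeMat (C.edgesOf t)))) S (xz a b * A) n =
          c • (xz a' b' *
            (permMat (shear (∑ t ∈ Finset.range n, edgeMat (C.edgesOf t))) * A)) := by
  suffices H : ∃ a' b' : Bits (Fin N), ((∀ q, a' q ≠ 0 ∨ b' q ≠ 0 → q ∈ E ∨ ∃ p ∈ E, Nb p q) ∧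
      (∀ e ∈ C.edges, a' e.1 ≠ 0 → e.1 ∈ E) ∧ (∀ e ∈ C.edges, b' e.2 ≠ 0 → e.2 ∈ E)) ∧
      ∀ A : Matrix (Bits (Fin N)) Λ ℂ, ∃ c : ℂ,
        ketRun (fun t => permMat (shear (edgeMat (C.edgesOf t)))) S (xz a b * A) n =
          c • (xz a' b' *
            (permMat (shear (∑ t ∈ Finset.range n, edgeMat (C.edgesOf t))) * A)) by
    obtain ⟨a', b', h1, h2⟩ := H
    exact ⟨a', b', h1.1, h2⟩
  induction n with
  | zero =>
    refine ⟨a, b, ⟨fun q hq => Or.inl (hab q hq), fun e _ h => hab _ (Or.inl h),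
      fun e _ h => hab _ (Or.inr h)⟩, fun A => ⟨1, ?_⟩⟩
    have e : permMat (shear (0 : Matrix (Fin N) (Fin N) (ZMod 2))) = 1 := by
      ext x y
      simp [permMat, shear, Matrix.one_apply]
    rw [Finset.sum_range_zero, e, Matrix.one_mul, one_smul]
    rfl
  | succ n ih =>
    obtain ⟨a', b', ⟨h1, h2, h3⟩, h4⟩ := ih
    set m := edgeMat (C.edgesOf n) with hm
    have hsub : C.edgesOf n ⊆ C.edges := Finset.filter_subset _ _
    have hmm : m * m = 0 := C.edgeMat_mul hsub hsub
    have hm1 : ∀ p q, m p q ≠ 0 → (p, q) ∈ C.edges := by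
      intro p q hpq
      by_contra h
      exact hpq (if_neg fun h' => h (hsub h'))
    have hsum : (∑ t ∈ Finset.range n, edgeMat (C.edgesOf t)) * m = 0 := by
      rw [Finset.sum_mul]
      exact Finset.sum_eq_zero fun t _ => C.edgeMat_mul (Finset.filter_subset _ _) hsub
    have hvec : ∀ q, Matrix.vecMul a' m q ≠ 0 → ∃ p, a' p ≠ 0 ∧ (p, q) ∈ C.edges := by
      intro q hq
      obtain ⟨p, _, hp⟩ := Finset.exists_ne_zero_of_sum_ne_zero (show ∑ p, a' p * m p q ≠ 0 from hq)
      exact ⟨p, left_ne_zero_of_mul hp, hm1 _ _ (right_ne_zero_of_mul hp)⟩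
    have hvec' : ∀ p, Matrix.mulVec m b' p ≠ 0 → ∃ q, b' q ≠ 0 ∧ (p, q) ∈ C.edges := by
      intro p hp
      obtain ⟨q, _, hq⟩ := Finset.exists_ne_zero_of_sum_ne_zero (show ∑ q, m p q * b' q ≠ 0 from hp)
      exact ⟨q, right_ne_zero_of_mul hq, hm1 _ _ (left_ne_zero_of_mul hq)⟩
    have hadd : ∀ x y : ZMod 2, x + y ≠ 0 → x ≠ 0 ∨ y ≠ 0 := by decide
    refine ⟨(fun q => (S n q).xBit) + shear m a', (fun q => (S n q).zBit) + (b' + Matrix.mulVec m b'),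
      ⟨?_, ?_, ?_⟩, ?_⟩
    · rintro q (hq | hq)
      · rcases hadd _ _ hq with hq | hq
        · exact Or.inl (hS n q (Pauli.ne_I_of_bit (Or.inl hq)))
        rcases hadd _ _ hq with hq | hq
        · exact h1 q (Or.inl hq)
        · obtain ⟨p, hp, hpq⟩ := hvec q hq
          exact Or.inr ⟨p, h2 _ hpq hp, (hNb _ hpq).1⟩
      · rcases hadd _ _ hq with hq | hq
        · exact Or.inl (hS n q (Pauli.ne_I_of_bit (Or.inr hq)))
        rcases hadd _ _ hq with hq | hq
        · exact h1 q (Or.inr hq)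
        · obtain ⟨p, hp, hpq⟩ := hvec' q hq
          exact Or.inr ⟨p, h3 _ hpq hp, (hNb _ hpq).2⟩
    · rintro e he hq
      rcases hadd _ _ hq with hq | hq
      · exact hS n _ (Pauli.ne_I_of_bit (Or.inl hq))
      rcases hadd _ _ hq with hq | hq
      · exact h2 e he hq
      · obtain ⟨p, _, hpq⟩ := hvec _ hq
        exact absurd rfl (C.bipartite _ hpq _ he)
    · rintro e he hq
      rcases hadd _ _ hq with hq | hq
      · exact hS n _ (Pauli.ne_I_of_bit (Or.inr hq))
      rcases hadd _ _ hq with hq | hq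
      · exact h3 e he hq
      · obtain ⟨p, _, hpq⟩ := hvec' _ hq
        exact absurd rfl (C.bipartite _ he _ hpq)
    · intro A
      obtain ⟨c, hc⟩ := h4 A
      obtain ⟨c1, hc1⟩ := pauliString_eq_xz (S n)
      obtain ⟨c2, hc2⟩ := xz_mul_xz (fun q => (S n q).xBit) (fun q => (S n q).zBit) (shear m a')
        (b' + Matrix.mulVec m b')
      refine ⟨c * c1 * c2, ?_⟩
      rw [ketRun, hc, hc1, Finset.sum_range_succ, add_comm (∑ t ∈ Finset.range n, _),
        ← shear_comp hsum, ← permMat_mul, Matrix.mul_smul, ← Matrix.mul_assoc (permMat _) (xz _ _),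
        ← hm, permMat_shear_mul_xz hmm, Matrix.mul_smul, Matrix.smul_mul, Matrix.mul_assoc (xz _ _),
        ← Matrix.mul_assoc (xz _ _) (xz _ _), hc2, Matrix.smul_mul, smul_smul, smul_smul,
        Matrix.mul_assoc (permMat _)]

end CnotStage

/-! ### The registers of the circuit -/

section Registers

variable {Dt G S K : Type} [Fintype Dt] [DecidableEq Dt] [Fintype G] [DecidableEq G] [Fintype S]
  [DecidableEq S] [Fintype K] [DecidableEq K] {N : ℕ} (e : Dt ⊕ G ⊕ S ⊕ K ≃ Fin N)

/-- The bits of the data qubits. -/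
def partD (y : Bits (Fin N)) : Bits Dt := fun d => y (e (.inl d))

/-- The bits of the gauge qubits. -/
def partG (y : Bits (Fin N)) : Bits G := fun g => y (e (.inr (.inl g)))

/-- The bits of the qubits of the `Z` checks. -/
def partS (y : Bits (Fin N)) : Bits S := fun s => y (e (.inr (.inr (.inl s))))

/-- The bits of the qubits of the `X` checks. -/
def partK (y : Bits (Fin N)) : Bits K := fun k => y (e (.inr (.inr (.inr k))))

/-- The bits with given parts on the four registers. -/
def glue (d : Bits Dt) (g : Bits G) (s : Bits S) (k : Bits K) : Bits (Fin N) :=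
  fun i => Sum.elim d (Sum.elim g (Sum.elim s k)) (e.symm i)

@[simp] theorem partD_glue (d : Bits Dt) (g : Bits G) (s : Bits S) (k : Bits K) :
    partD e (glue e d g s k) = d := by
  funext i
  simp [partD, glue]

@[simp] theorem partG_glue (d : Bits Dt) (g : Bits G) (s : Bits S) (k : Bits K) :
    partG e (glue e d g s k) = g := by
  funext i
  simp [partG, glue]

@[simp] theorem partS_glue (d : Bits Dt) (g : Bits G) (s : Bits S) (k : Bits K) :
    partS e (glue e d g s k) = s := by
  funext i
  simp [partS, glue]

@[simp] theorem partK_glue (d : Bits Dt) (g : Bits G) (s : Bits S) (k : Bits K) :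
    partK e (glue e d g s k) = k := by
  funext i
  simp [partK, glue]

@[simp] theorem partD_add (y z : Bits (Fin N)) : partD e (y + z) = partD e y + partD e z := rfl
@[simp] theorem partG_add (y z : Bits (Fin N)) : partG e (y + z) = partG e y + partG e z := rfl
@[simp] theorem partS_add (y z : Bits (Fin N)) : partS e (y + z) = partS e y + partS e z := rfl
@[simp] theorem partK_add (y z : Bits (Fin N)) : partK e (y + z) = partK e y + partK e z := rfl

theorem glue_parts (y : Bits (Fin N)) : glue e (partD e y) (partG e y) (partS e y) (partK e y) = y := by
  funext i
  obtain ⟨j, rfl⟩ := e.surjective i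
  rcases j with d | g | s | k <;> simp [glue, partD, partG, partS, partK]

/-- The bits of the four registers. -/
def glueEquiv : (Bits Dt × Bits G) × (Bits S × Bits K) ≃ Bits (Fin N) where
  toFun := fun p => glue e p.1.1 p.1.2 p.2.1 p.2.2
  invFun := fun y => ((partD e y, partG e y), (partS e y, partK e y))
  left_inv := fun p => by simp
  right_inv := glue_parts e

theorem sum_bits {β : Type} [AddCommMonoid β] (f : Bits (Fin N) → β) :
    ∑ y, f y = ∑ d, ∑ g, ∑ s, ∑ k, f (glue e d g s k) := by
  rw [← (glueEquiv e).sum_comp]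
  simp only [Fintype.sum_prod_type]
  rfl

theorem prod_qubits {β : Type} [CommMonoid β] (f : Fin N → β) :
    ∏ i, f i = (∏ d, f (e (.inl d))) * ((∏ g, f (e (.inr (.inl g)))) *
      ((∏ s, f (e (.inr (.inr (.inl s))))) * ∏ k, f (e (.inr (.inr (.inr k)))))) := by
  rw [← e.prod_comp]
  simp only [Fintype.prod_sum_type]

theorem dotProduct_parts (y z : Bits (Fin N)) : y ⬝ᵥ z = partD e y ⬝ᵥ partD e z +
    (partG e y ⬝ᵥ partG e z + (partS e y ⬝ᵥ partS e z + partK e y ⬝ᵥ partK e z)) := by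
  rw [dotProduct, ← e.sum_comp]
  simp only [Fintype.sum_sum_type]
  rfl

/-- The incidences of the `Z` checks with data and gauge qubits. -/
def weightZ (mσ : Matrix Dt S (ZMod 2)) (mτ : Matrix G S (ZMod 2)) :
    Dt ⊕ G ⊕ S ⊕ K → Dt ⊕ G ⊕ S ⊕ K → ZMod 2
  | .inl d, .inr (.inr (.inl s)) => mσ d s
  | .inr (.inl g), .inr (.inr (.inl s)) => mτ g s
  | _, _ => 0

/-- The incidences of the `X` checks with data qubits. -/
def weightX (mγ : Matrix K Dt (ZMod 2)) : Dt ⊕ G ⊕ S ⊕ K → Dt ⊕ G ⊕ S ⊕ K → ZMod 2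
  | .inr (.inr (.inr k)), .inl d => mγ k d
  | _, _ => 0

/-- The pairs of qubits at which a weight does not vanish. -/
def edgesOfWeight (W : Dt ⊕ G ⊕ S ⊕ K → Dt ⊕ G ⊕ S ⊕ K → ZMod 2) : Finset (Fin N × Fin N) :=
  Finset.univ.filter fun p => W (e.symm p.1) (e.symm p.2) ≠ 0

theorem edgeMat_edgesOfWeight (W : Dt ⊕ G ⊕ S ⊕ K → Dt ⊕ G ⊕ S ⊕ K → ZMod 2) (p q : Fin N) :
    edgeMat (edgesOfWeight e W) p q = W (e.symm p) (e.symm q) := by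
  rw [edgeMat, edgesOfWeight]
  by_cases h : W (e.symm p) (e.symm q) = 0
  · rw [if_neg (by simp [h]), h]
  · rw [if_pos (by simp [h])]
    exact ((zmod_two_cases _).resolve_left h).symm

theorem vecMul_edgesOfWeight (W : Dt ⊕ G ⊕ S ⊕ K → Dt ⊕ G ⊕ S ⊕ K → ZMod 2) (y : Bits (Fin N))
    (q : Dt ⊕ G ⊕ S ⊕ K) : Matrix.vecMul y (edgeMat (edgesOfWeight e W)) (e q) =
      (∑ d, partD e y d * W (.inl d) q) + ((∑ g, partG e y g * W (.inr (.inl g)) q) +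
      ((∑ s, partS e y s * W (.inr (.inr (.inl s))) q) +
        ∑ k, partK e y k * W (.inr (.inr (.inr k))) q)) := by
  rw [Matrix.vecMul, dotProduct, ← e.sum_comp]
  simp only [Fintype.sum_sum_type, edgeMat_edgesOfWeight, Equiv.symm_apply_apply]
  rfl

theorem shear_weightZ (mσ : Matrix Dt S (ZMod 2)) (mτ : Matrix G S (ZMod 2)) (d : Bits Dt)
    (g : Bits G) (s : Bits S) (k : Bits K) :
    shear (edgeMat (edgesOfWeight e (weightZ mσ mτ))) (glue e d g s k) =
      glue e d g (s + (Matrix.vecMul d mσ + Matrix.vecMul g mτ)) k := by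
  funext i
  obtain ⟨q, rfl⟩ := e.surjective i
  rw [shear, Pi.add_apply, vecMul_edgesOfWeight]
  rcases q with q | q | q | q <;> simp [weightZ, glue, Matrix.vecMul, dotProduct]

theorem shear_weightX (mγ : Matrix K Dt (ZMod 2)) (d : Bits Dt)
    (g : Bits G) (s : Bits S) (k : Bits K) :
    shear (edgeMat (edgesOfWeight e (weightX mγ))) (glue e d g s k) =
      glue e (d + Matrix.vecMul k mγ) g s k := by
  funext i
  obtain ⟨q, rfl⟩ := e.surjective i
  rw [shear, Pi.add_apply, vecMul_edgesOfWeight]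
  rcases q with q | q | q | q <;> simp [weightX, glue, Matrix.vecMul, dotProduct]

/-- The `Z` checks are measured in the `Z` basis, the gauge qubits and the `X` checks in the `X`
basis, the data qubits are left alone. -/
def measureOp : Dt ⊕ G ⊕ S ⊕ K → LocalOp
  | .inl _ => .pauli .I
  | .inr (.inl _) => .measure .X
  | .inr (.inr (.inl _)) => .measure .Z
  | .inr (.inr (.inr _)) => .measure .X

/-- The Pauli `P`, controlled by the classical bit, on each data qubit. -/
def dataOp (P : Pauli) : Dt ⊕ G ⊕ S ⊕ K → LocalOp
  | .inl _ => .pauli P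
  | .inr _ => .pauli .I

theorem projX_apply (b x y : ZMod 2) : Axis.X.proj b x y = 1 / 2 * sgn (b * (x + y)) := by
  rw [Axis.proj, Matrix.smul_apply, Matrix.add_apply, Matrix.smul_apply]
  rcases zmod_two_cases b with rfl | rfl <;> rcases zmod_two_cases x with rfl | rfl <;>
    rcases zmod_two_cases y with rfl | rfl <;>
    simp [Axis.pauli, Pauli.mat, sgn_zero, sgn_one, CharTwo.add_self_eq_zero]

theorem projZ_apply (b x y : ZMod 2) : Axis.Z.proj b x y = if x = b ∧ y = b then 1 else 0 := by
  rw [Axis.proj, Matrix.smul_apply, Matrix.add_apply, Matrix.smul_apply]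
  rcases zmod_two_cases b with rfl | rfl <;> rcases zmod_two_cases x with rfl | rfl <;>
    rcases zmod_two_cases y with rfl | rfl <;>
    norm_num [Axis.pauli, Pauli.mat]

theorem tensorMat_dataX (f : Bits (Fin N)) :
    tensorMat (fun i => (dataOp (G := G) (S := S) (K := K) .X (e.symm i)).mat (f i)) =
      xz (glue e (partD e f) 0 0 0) 0 := by
  rw [xz_eq_tensorMat]
  refine congrArg tensorMat (funext fun i => ?_)
  obtain ⟨q, rfl⟩ := e.surjective i
  rw [Equiv.symm_apply_apply]
  have h : ∀ b : ZMod 2, (if b = 1 then Pauli.X.mat else 1) = xzOne b 0 := by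
    intro b
    ext x y
    rcases zmod_two_cases b with rfl | rfl <;> rcases zmod_two_cases x with rfl | rfl <;>
      rcases zmod_two_cases y with rfl | rfl <;>
      simp [Pauli.mat, xzOne, sgn_zero, CharTwo.add_self_eq_zero]
  have h' : ∀ b : ZMod 2, (if b = 1 then Pauli.I.mat else 1) = xzOne 0 0 := by
    intro b
    rw [← h 0]
    simp [Pauli.mat]
  rcases q with q | q | q | q
  · simpa [dataOp, LocalOp.mat, glue, partD] using h _
  · simpa [dataOp, LocalOp.mat, glue, partD] using h' _
  · simpa [dataOp, LocalOp.mat, glue, partD] using h' _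
  · simpa [dataOp, LocalOp.mat, glue, partD] using h' _

theorem tensorMat_dataZ (f : Bits (Fin N)) :
    tensorMat (fun i => (dataOp (G := G) (S := S) (K := K) .Z (e.symm i)).mat (f i)) =
      xz 0 (glue e (partD e f) 0 0 0) := by
  rw [xz_eq_tensorMat]
  refine congrArg tensorMat (funext fun i => ?_)
  obtain ⟨q, rfl⟩ := e.surjective i
  rw [Equiv.symm_apply_apply]
  have h : ∀ b : ZMod 2, (if b = 1 then Pauli.Z.mat else 1) = xzOne 0 b := by
    intro b
    ext x y
    rcases zmod_two_cases b with rfl | rfl <;> rcases zmod_two_cases x with rfl | rfl <;>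
      rcases zmod_two_cases y with rfl | rfl <;>
      simp [Pauli.mat, xzOne, sgn_zero, sgn_one]
  have h' : ∀ b : ZMod 2, (if b = 1 then Pauli.I.mat else 1) = xzOne 0 0 := by
    intro b
    rw [← h 0]
    simp [Pauli.mat]
  rcases q with q | q | q | q
  · simpa [dataOp, LocalOp.mat, glue, partD] using h _
  · simpa [dataOp, LocalOp.mat, glue, partD] using h' _
  · simpa [dataOp, LocalOp.mat, glue, partD] using h' _
  · simpa [dataOp, LocalOp.mat, glue, partD] using h' _

theorem prod_proj_X {ι : Type} [Fintype ι] (b x y : ι → ZMod 2) :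
    ∏ i, Axis.X.proj (b i) (x i) (y i) = (1 / 2) ^ Fintype.card ι * (sgn (b ⬝ᵥ x) * sgn (b ⬝ᵥ y)) := by
  simp only [projX_apply, Finset.prod_mul_distrib, Finset.prod_const, Finset.card_univ]
  rw [← sgn_add, ← dotProduct_add, dotProduct, sgn_sum]
  rfl

theorem prod_proj_Z {ι : Type} [Fintype ι] [DecidableEq ι] (b x y : ι → ZMod 2) :
    ∏ i, Axis.Z.proj (b i) (x i) (y i) = if x = b ∧ y = b then 1 else 0 := by
  simp only [projZ_apply]
  by_cases h : x = b ∧ y = b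
  · rw [if_pos h, h.1, h.2]
    simp
  · rw [if_neg h]
    have : ∃ i, ¬ (x i = b i ∧ y i = b i) := by
      by_contra h'
      push Not at h'
      exact h ⟨funext fun i => (h' i).1, funext fun i => (h' i).2⟩
    obtain ⟨i, hi⟩ := this
    exact Finset.prod_eq_zero (Finset.mem_univ i) (if_neg hi)

/-- The amplitudes after the measurement with outcomes `x`. -/
theorem measure_mul_apply {β : Type} (x : Bits (Fin N)) (B : Matrix (Bits (Fin N)) β ℂ)
    (y : Bits (Fin N)) (u : β) :
    (tensorMat (fun i => (measureOp (e.symm i)).mat (x i)) * B) y u =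
      if partS e y = partS e x then
        ((1 / 2) ^ Fintype.card G * (1 / 2) ^ Fintype.card K *
          sgn (partG e x ⬝ᵥ partG e y + partK e x ⬝ᵥ partK e y)) *
        ∑ g, ∑ k, sgn (partG e x ⬝ᵥ g + partK e x ⬝ᵥ k) *
          B (glue e (partD e y) g (partS e x) k) u else 0 := by
  have hM : ∀ d g s k, tensorMat (fun i => (measureOp (e.symm i)).mat (x i)) y (glue e d g s k) =
      (if partD e y = d then 1 else 0) * (((1 / 2) ^ Fintype.card G *
        (sgn (partG e x ⬝ᵥ partG e y) * sgn (partG e x ⬝ᵥ g))) *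
        ((if partS e y = partS e x ∧ s = partS e x then 1 else 0) * ((1 / 2) ^ Fintype.card K *
        (sgn (partK e x ⬝ᵥ partK e y) * sgn (partK e x ⬝ᵥ k))))) := by
    intro d g s k
    rw [tensorMat, prod_qubits e]
    simp only [Equiv.symm_apply_apply, measureOp, LocalOp.mat]
    refine congrArg₂ (· * ·) ?_ (congrArg₂ (· * ·) ?_ (congrArg₂ (· * ·) ?_ ?_))
    · have h1 : ∀ b : ZMod 2, (if b = 1 then Pauli.I.mat else 1) = 1 := by
        intro b
        split_ifs <;> rfl
      simp only [h1, Matrix.one_apply, glue, Equiv.symm_apply_apply, Sum.elim_inl]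
      by_cases h : partD e y = d
      · subst h
        simp [partD]
      · rw [if_neg h]
        obtain ⟨i, hi⟩ := Function.ne_iff.1 h
        exact Finset.prod_eq_zero (Finset.mem_univ i) (if_neg hi)
    · rw [← prod_proj_X]
      simp [glue, partG]
    · rw [← prod_proj_Z]
      simp [glue, partS]
    · rw [← prod_proj_X]
      simp [glue, partK]
  rw [Matrix.mul_apply, sum_bits e]
  simp only [hM]
  by_cases hs : partS e y = partS e x
  · rw [if_pos hs, Finset.sum_eq_single (partD e y), Finset.mul_sum]
    · refine Finset.sum_congr rfl fun g _ => ?_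
      rw [Finset.sum_eq_single (partS e x), Finset.mul_sum]
      · refine Finset.sum_congr rfl fun k _ => ?_
        rw [if_pos rfl, if_pos ⟨hs, rfl⟩, sgn_add, sgn_add]
        ring
      · intro s _ hne
        simp [hne]
      · simp
    · intro d _ hne
      simp [Ne.symm hne]
    · simp
  · rw [if_neg hs]
    simp [hs]

end Registers

/-! ### The corrected state -/

section Corrected

variable {Dt G S K : Type} [Fintype Dt] [DecidableEq Dt] [Fintype G] [DecidableEq G] [Fintype S]
  [DecidableEq S] [Fintype K] [DecidableEq K] {N : ℕ} (e : Dt ⊕ G ⊕ S ⊕ K ≃ Fin N)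
  (mσ : Matrix Dt S (ZMod 2)) (mτ : Matrix G S (ZMod 2)) (mγ : Matrix K Dt (ZMod 2))

theorem edgeMat_weightZ_sq : edgeMat (edgesOfWeight e (weightZ (K := K) mσ mτ)) *
    edgeMat (edgesOfWeight e (weightZ mσ mτ)) = 0 := by
  refine edgeMat_mul_edgeMat fun p hp p' hp' h => ?_
  have h1 := (Finset.mem_filter.1 hp).2
  have h2 := (Finset.mem_filter.1 hp').2
  rw [h] at h1
  rcases hq : e.symm p'.1 with q | q | q | q <;> rcases hr : e.symm p.1 with r | r | r | r <;>
    simp [hq, hr, weightZ] at h1 h2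

theorem edgeMat_weightX_sq : edgeMat (edgesOfWeight e (weightX (G := G) (S := S) mγ)) *
    edgeMat (edgesOfWeight e (weightX mγ)) = 0 := by
  refine edgeMat_mul_edgeMat fun p hp p' hp' h => ?_
  have h1 := (Finset.mem_filter.1 hp).2
  have h2 := (Finset.mem_filter.1 hp').2
  rw [h] at h1
  rcases hq : e.symm p'.1 with q | q | q | q <;> rcases hr : e.symm p.1 with r | r | r | r <;>
    simp [hq, hr, weightX] at h1 h2

/-- The operator applied by the two stages of controlled NOTs. -/
def stagesMat : Matrix (Bits (Fin N)) (Bits (Fin N)) ℂ :=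
  permMat (shear (edgeMat (edgesOfWeight e (weightX mγ)))) *
    permMat (shear (edgeMat (edgesOfWeight e (weightZ mσ mτ))))

variable {Λ : Type}

theorem stagesMat_mul_apply (A : Matrix (Bits (Fin N)) Λ ℂ) (d : Bits Dt) (g : Bits G) (s : Bits S)
    (k : Bits K) (u : Λ) : (stagesMat e mσ mτ mγ * A) (glue e d g s k) u =
      A (glue e (d + Matrix.vecMul k mγ) g
        (s + (Matrix.vecMul (d + Matrix.vecMul k mγ) mσ + Matrix.vecMul g mτ)) k) u := by
  rw [stagesMat, Matrix.mul_assoc, permMat_mul_apply (shear_shear (edgeMat_weightX_sq e mγ)),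
    shear_weightX, permMat_mul_apply (shear_shear (edgeMat_weightZ_sq e mσ mτ)), shear_weightZ]

theorem glue_add (d : Bits Dt) (g : Bits G) (s : Bits S) (k : Bits K) (a : Bits (Fin N)) :
    glue e d g s k + a = glue e (d + partD e a) (g + partG e a) (s + partS e a) (k + partK e a) := by
  rw [← glue_parts e (glue e d g s k + a)]
  simp

/-- The amplitudes after the measurement, in terms of those of the state of the data before the
stages of controlled NOTs. -/
theorem measured_apply {A : Matrix (Bits (Fin N)) Λ ℂ} {ψ : Λ → Bits Dt → ℂ}
    (hA : ∀ d g s k u, A (glue e d g s k) u = if s = 0 then ψ u d else 0)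
    (a b x y : Bits (Fin N)) (u : Λ) :
    (tensorMat (fun i => (measureOp (e.symm i)).mat (x i)) *
      (xz a b * (stagesMat e mσ mτ mγ * A))) y u =
      if partS e y = partS e x then
        ((1 / 2) ^ Fintype.card G * (1 / 2) ^ Fintype.card K *
          sgn (partG e x ⬝ᵥ partG e y + partK e x ⬝ᵥ partK e y) *
          sgn (partG e x ⬝ᵥ partG e a + partK e x ⬝ᵥ partK e a) *
          sgn (partS e b ⬝ᵥ (partS e x + partS e a))) *
        (sgn (partD e b ⬝ᵥ (partD e y + partD e a)) *
        measAmp (Matrix.vecMulLinear mγ) (Matrix.vecMulLinear mσ) (Matrix.vecMulLinear mτ) (ψ u)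
          (partS e x + partS e a) (partG e x + partG e b) (partK e x + partK e b)
          (partD e y + partD e a)) else 0 := by
  rw [measure_mul_apply]
  refine if_congr Iff.rfl ?_ rfl
  simp only [xz_mul_apply, glue_add, stagesMat_mul_apply, hA]
  have hm : measAmp (Matrix.vecMulLinear mγ) (Matrix.vecMulLinear mσ) (Matrix.vecMulLinear mτ) (ψ u)
      (partS e x + partS e a) (partG e x + partG e b) (partK e x + partK e b)
      (partD e y + partD e a) = ∑ g, ∑ k,
      sgn ((partG e x + partG e b) ⬝ᵥ (g + partG e a) + (partK e x + partK e b) ⬝ᵥ (k + partK e a)) *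
        if partS e x + partS e a = Matrix.vecMul (partD e y + partD e a +
          Matrix.vecMul (k + partK e a) mγ) mσ + Matrix.vecMul (g + partG e a) mτ then
          ψ u (partD e y + partD e a + Matrix.vecMul (k + partK e a) mγ) else 0 := by
    unfold measAmp
    rw [← Equiv.sum_comp (Equiv.addRight (partG e a))]
    refine Finset.sum_congr rfl fun g _ => ?_
    rw [← Equiv.sum_comp (Equiv.addRight (partK e a))]
    refine Finset.sum_congr rfl fun k _ => ?_
    simp only [Equiv.coe_addRight, Matrix.vecMulLinear_apply]
    exact congrArg₂ (· * ·) rfl (if_congr Iff.rfl rfl rfl)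
  rw [hm]
  simp only [Finset.mul_sum]
  refine Finset.sum_congr rfl fun g _ => Finset.sum_congr rfl fun k _ => ?_
  rw [dotProduct_parts e]
  simp only [partD_glue, partG_glue, partS_glue, partK_glue]
  have hiff : (partS e x + partS e a + (Matrix.vecMul (partD e y + partD e a +
      Matrix.vecMul (k + partK e a) mγ) mσ + Matrix.vecMul (g + partG e a) mτ) = 0) ↔
      partS e x + partS e a = Matrix.vecMul (partD e y + partD e a +
      Matrix.vecMul (k + partK e a) mγ) mσ + Matrix.vecMul (g + partG e a) mτ :=
    ⟨eq_of_add_eq_zero_fun, fun h => by rw [h, add_self_fun]⟩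
  simp only [hiff]
  split_ifs
  · have h1 : ∀ t : ZMod 2, sgn t * sgn t = 1 := by
      intro t
      rw [← sgn_add, CharTwo.add_self_eq_zero, sgn_zero]
    have h2 : sgn ((partG e x + partG e b) ⬝ᵥ (g + partG e a) +
        (partK e x + partK e b) ⬝ᵥ (k + partK e a)) =
        sgn (partG e x ⬝ᵥ partG e a + partK e x ⬝ᵥ partK e a) *
        (sgn (partG e x ⬝ᵥ g + partK e x ⬝ᵥ k) *
          sgn (partG e b ⬝ᵥ (g + partG e a) + partK e b ⬝ᵥ (k + partK e a))) := by
      rw [← sgn_add, ← sgn_add]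
      congr 1
      simp only [add_dotProduct, dotProduct_add]
      ring
    have h3 : sgn (partD e b ⬝ᵥ (partD e y + partD e a) + (partG e b ⬝ᵥ (g + partG e a) +
        (partS e b ⬝ᵥ (partS e x + partS e a) + partK e b ⬝ᵥ (k + partK e a)))) =
        sgn (partD e b ⬝ᵥ (partD e y + partD e a)) *
        sgn (partS e b ⬝ᵥ (partS e x + partS e a)) *
          sgn (partG e b ⬝ᵥ (g + partG e a) + partK e b ⬝ᵥ (k + partK e a)) := by
      rw [← sgn_add, ← sgn_add]
      congr 1
      ring
    rw [h2, h3]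
    linear_combination (-((1 / 2) ^ Fintype.card G * (1 / 2) ^ Fintype.card K *
      sgn (partG e x ⬝ᵥ partG e y + partK e x ⬝ᵥ partK e y) *
      sgn (partG e x ⬝ᵥ g + partK e x ⬝ᵥ k) * sgn (partD e b ⬝ᵥ (partD e y + partD e a)) *
      sgn (partS e b ⬝ᵥ (partS e x + partS e a)) *
      sgn (partG e b ⬝ᵥ (g + partG e a) + partK e b ⬝ᵥ (k + partK e a)) *
      ψ u (partD e y + partD e a + Matrix.vecMul (k + partK e a) mγ))) *
      h1 (partG e x ⬝ᵥ partG e a + partK e x ⬝ᵥ partK e a)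
  · ring

open Classical in
/-- The encoded states of the new code: uniform superpositions of the cosets of `Bs`. -/
def cosetMat (Bs : Submodule (ZMod 2) (Bits Dt)) (v : Λ → Bits Dt) : Matrix (Bits Dt) Λ ℂ :=
  fun d u => if d + v u ∈ Bs then 1 else 0

/-- If the corrections computed from the outcomes are correct, then the data are left in the encoded
state up to an error which does not depend on the outcomes. -/
theorem exists_corrected_apply {A : Matrix (Bits (Fin N)) Λ ℂ} {Bs : Submodule (ZMod 2) (Bits Dt)}
    {v : Λ → Bits Dt} {ex ez : Bits Dt} {P : Dt → Prop}
    (hA : ∀ d g s k u, A (glue e d g s k) u = if s = 0 then codeAmp Bs ex ez (v u) d else 0)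
    (hv : ∀ u, Matrix.vecMulLinear mσ (v u) ∈ LinearMap.range (Matrix.vecMulLinear mτ))
    (hBs : ∀ b ∈ Bs, Matrix.vecMulLinear mσ b ∈ LinearMap.range (Matrix.vecMulLinear mτ))
    (hγ : ∀ k, (∀ q, ¬ P q → Matrix.vecMulLinear mγ k q = 0) → Matrix.vecMulLinear mγ k ∈ Bs)
    (hBsγ : Bs ≤ LinearMap.range (Matrix.vecMulLinear mγ))
    (hBsP : ∀ b ∈ Bs, ∀ q, ¬ P q → b q = 0) (hvP : ∀ u q, ¬ P q → v u q = 0)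
    (hexP : ∀ q, ¬ P q → ex q = 0)
    {a b p q : Bits (Fin N)} {corrX : Bits S → Bits Dt} {corrZ : Bits G → Bits K → Bits Dt}
    {fX fZ : Bits Dt}
    (hX : ∀ s, s + partS e a + Matrix.vecMulLinear mσ ex ∈ LinearMap.range (Matrix.vecMulLinear mτ) →
      corrX s + ex + fX ∈ LinearMap.range (Matrix.vecMulLinear mγ))
    (hZ : ∀ z κ (y : Bits S) (ω : Bits Dt),
      (∀ g, (z + partG e b) ⬝ᵥ g = y ⬝ᵥ Matrix.vecMulLinear mτ g) → (∀ q, P q → ω q = 0) →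
      (∀ k, (κ + partK e b) ⬝ᵥ k + y ⬝ᵥ Matrix.vecMulLinear mσ (Matrix.vecMulLinear mγ k) +
        ez ⬝ᵥ Matrix.vecMulLinear mγ k = ω ⬝ᵥ Matrix.vecMulLinear mγ k) →
      (∀ k, y ⬝ᵥ Matrix.vecMulLinear mσ (Matrix.vecMulLinear mγ k) +
        (corrZ z κ + ez + ω + fZ) ⬝ᵥ Matrix.vecMulLinear mγ k = 0) ∧
      ∀ u, y ⬝ᵥ Matrix.vecMulLinear mσ (v u) + (corrZ z κ + ez + ω + fZ) ⬝ᵥ v u = 0)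
    (x : Bits (Fin N)) :
    ∃ χ : Bits G → Bits S → Bits K → ℂ, ∀ y u,
      (xz (p + glue e (corrX (partS e x)) 0 0 0) (q + glue e (corrZ (partG e x) (partK e x)) 0 0 0) *
        (tensorMat (fun i => (measureOp (e.symm i)).mat (x i)) *
          (xz a b * (stagesMat e mσ mτ mγ * A)))) y u =
      χ (partG e y) (partS e y) (partK e y) *
        (xz (partD e a + partD e p + fX) (partD e b + partD e q + fZ) *
          cosetMat (LinearMap.range (Matrix.vecMulLinear mγ)) v) (partD e y) u := by
  classical
  have hmeas := measured_apply e mσ mτ mγ (ψ := fun u => codeAmp Bs ex ez (v u)) hA a b x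
  rcases measAmp_codeAmp hv hBs hγ hBsγ hBsP hvP hexP ez (partS e x + partS e a)
    (partG e x + partG e b) (partK e x + partK e b) with h0 | ⟨C, w, ω, h1, h2, h3, h4, h5⟩
  · refine ⟨0, fun y u => ?_⟩
    rw [xz_mul_apply, hmeas, h0]
    simp
  have h2' : partS e x + partS e a + Matrix.vecMulLinear mσ ex ∈
      LinearMap.range (Matrix.vecMulLinear mτ) := h2
  have hX' := hX _ h2'
  obtain ⟨hR1, hR2⟩ := hZ _ _ w ω h1 h3 h4
  set cX := corrX (partS e x) with hcX
  set cZ := corrZ (partG e x) (partK e x) with hcZ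
  -- the total phase operator `R` acts trivially on the code, up to a constant
  let R : Bits Dt → ZMod 2 := fun d => w ⬝ᵥ Matrix.vecMulLinear mσ d + (cZ + ez + ω + fZ) ⬝ᵥ d
  have hRadd : ∀ d d', R (d + d') = R d + R d' := by
    intro d d'
    simp only [R, map_add, dotProduct_add]
    ring
  have hRc : ∀ d u, d + ex + v u ∈ LinearMap.range (Matrix.vecMulLinear mγ) → R d = R ex := by
    rintro d u ⟨k, hk⟩
    have h6 : d = Matrix.vecMulLinear mγ k + ex + v u := by
      rw [hk]
      calc d = d + (ex + ex) + (v u + v u) := by simp [add_self_fun]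
        _ = _ := by abel
    have h7 : R (v u) = 0 := hR2 u
    have h8 : R (Matrix.vecMulLinear mγ k) = 0 := hR1 k
    rw [h6, hRadd, hRadd, h7, h8, zero_add, add_zero]
  have hmem : ∀ (d : Bits Dt) (u : Λ), d + (partD e p + cX) + partD e a + ex + v u ∈
      LinearMap.range (Matrix.vecMulLinear mγ) ↔ d + (partD e a + partD e p + fX) + v u ∈
      LinearMap.range (Matrix.vecMulLinear mγ) := by
    intro d u
    have h6 : d + (partD e p + cX) + partD e a + ex + v u =
        (d + (partD e a + partD e p + fX) + v u) + (cX + ex + fX) := by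
      calc d + (partD e p + cX) + partD e a + ex + v u =
          d + (partD e p + cX) + partD e a + ex + v u + (fX + fX) := by rw [add_self_fun, add_zero]
        _ = _ := by abel
    rw [h6, Submodule.add_mem_iff_left _ hX']
  let c₀ : ℂ := C * sgn (R ex) * (sgn ((cZ + fZ) ⬝ᵥ (partD e p + cX + partD e a)) *
    sgn (partD e b ⬝ᵥ partD e a) * sgn (cZ ⬝ᵥ (partD e p + cX)) *
    sgn (partD e q ⬝ᵥ (partD e p + cX)) * sgn (partD e b ⬝ᵥ (partD e p + cX)) *
    sgn ((partD e b + partD e q + fZ) ⬝ᵥ (partD e a + partD e p + fX)))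
  let pre : Bits G → Bits S → Bits K → ℂ := fun g s k =>
    sgn (partG e q ⬝ᵥ (g + partG e p) + (partS e q ⬝ᵥ (s + partS e p) +
      partK e q ⬝ᵥ (k + partK e p))) *
    (if s + partS e p = partS e x then ((1 / 2) ^ Fintype.card G * (1 / 2) ^ Fintype.card K *
          sgn (partG e x ⬝ᵥ (g + partG e p) + partK e x ⬝ᵥ (k + partK e p)) *
          sgn (partG e x ⬝ᵥ partG e a + partK e x ⬝ᵥ partK e a) *
          sgn (partS e b ⬝ᵥ (partS e x + partS e a))) else 0)
  refine ⟨fun g s k => pre g s k * c₀, fun y u => ?_⟩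
  rw [xz_mul_apply, hmeas, xz_mul_apply, dotProduct_parts e]
  simp only [partD_add, partG_add, partS_add, partK_add, partD_glue, partG_glue, partS_glue,
    partK_glue, add_zero]
  rw [h5]
  by_cases hs : partS e y + partS e p = partS e x
  swap
  · simp only [pre, if_neg hs, mul_zero, zero_mul]
  rw [if_pos hs]
  simp only [pre, if_pos hs, codeAmp, cosetMat, zero_dotProduct, sgn_zero, hmem]
  by_cases hd : partD e y + (partD e a + partD e p + fX) + v u ∈
      LinearMap.range (Matrix.vecMulLinear mγ)
  swap
  · simp only [if_neg hd, mul_zero, zero_mul]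
  simp only [if_pos hd, mul_one]
  have hR := hRc _ u ((hmem _ u).2 hd)
  set D' := partD e y + (partD e p + cX) + partD e a with hD'
  have h9 : w ⬝ᵥ Matrix.vecMulLinear mσ D' + ez ⬝ᵥ D' + ω ⬝ᵥ D' = R ex + (cZ + fZ) ⬝ᵥ D' := by
    rw [← hR]
    simp only [R, add_dotProduct]
    have h10 := CharTwo.add_self_eq_zero (cZ ⬝ᵥ D')
    have h11 := CharTwo.add_self_eq_zero (fZ ⬝ᵥ D')
    linear_combination (-1 : ZMod 2) * h10 - h11
  rw [h9]
  have h12 : sgn ((partD e q + cZ) ⬝ᵥ (partD e y + (partD e p + cX)) +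
        (partG e q ⬝ᵥ (partG e y + partG e p) + (partS e q ⬝ᵥ partS e x +
          partK e q ⬝ᵥ (partK e y + partK e p)))) =
      sgn ((partD e q + cZ) ⬝ᵥ (partD e y + (partD e p + cX))) *
        sgn (partG e q ⬝ᵥ (partG e y + partG e p) + (partS e q ⬝ᵥ partS e x +
          partK e q ⬝ᵥ (partK e y + partK e p))) := sgn_add _ _
  have h13 : sgn ((partD e q + cZ) ⬝ᵥ (partD e y + (partD e p + cX))) * (sgn (partD e b ⬝ᵥ D') *
      sgn ((cZ + fZ) ⬝ᵥ D')) = (sgn ((cZ + fZ) ⬝ᵥ (partD e p + cX + partD e a)) *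
    sgn (partD e b ⬝ᵥ partD e a) * sgn (cZ ⬝ᵥ (partD e p + cX)) *
    sgn (partD e q ⬝ᵥ (partD e p + cX)) * sgn (partD e b ⬝ᵥ (partD e p + cX)) *
    sgn ((partD e b + partD e q + fZ) ⬝ᵥ (partD e a + partD e p + fX))) *
    sgn ((partD e b + partD e q + fZ) ⬝ᵥ (partD e y + (partD e a + partD e p + fX))) := by
    simp only [← sgn_add]
    congr 1
    simp only [hD', add_dotProduct, dotProduct_add]
    have h2 := CharTwo.two_eq_zero (R := ZMod 2)
    linear_combination (cZ ⬝ᵥ partD e y - (partD e b ⬝ᵥ partD e a + partD e b ⬝ᵥ partD e p +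
      partD e b ⬝ᵥ fX + partD e q ⬝ᵥ partD e a + partD e q ⬝ᵥ partD e p + partD e q ⬝ᵥ fX +
      fZ ⬝ᵥ partD e a + fZ ⬝ᵥ partD e p + fZ ⬝ᵥ fX)) * h2
  rw [hs, h12, sgn_add (R ex)]
  simp only [c₀]
  linear_combination (sgn (partG e q ⬝ᵥ (partG e y + partG e p) + (partS e q ⬝ᵥ partS e x +
      partK e q ⬝ᵥ (partK e y + partK e p))) * ((1 / 2) ^ Fintype.card G * (1 / 2) ^ Fintype.card K *
          sgn (partG e x ⬝ᵥ (partG e y + partG e p) + partK e x ⬝ᵥ (partK e y + partK e p)) *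
          sgn (partG e x ⬝ᵥ partG e a + partK e x ⬝ᵥ partK e a) *
          sgn (partS e b ⬝ᵥ (partS e x + partS e a))) * C * sgn (R ex)) * h13

end Corrected

/-! ### The circuit -/

section Gadget

variable {Dt G S K : Type} [Fintype Dt] [DecidableEq Dt] [Fintype G] [DecidableEq G] [Fintype S]
  [DecidableEq S] [Fintype K] [DecidableEq K] {N : ℕ} (e : Dt ⊕ G ⊕ S ⊕ K ≃ Fin N)
  (mσ : Matrix Dt S (ZMod 2)) (mτ : Matrix G S (ZMod 2)) (mγ : Matrix K Dt (ZMod 2))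
  {P : Type} [Fintype P] [DecidableEq P]

/-- The gauge qubits and the qubits of the `X` checks are initialized to `|+⟩`. -/
def StartsPlus : Dt ⊕ G ⊕ S ⊕ K → Prop
  | .inl _ => False
  | .inr (.inl _) => True
  | .inr (.inr (.inl _)) => False
  | .inr (.inr (.inr _)) => True

instance : DecidablePred (StartsPlus (Dt := Dt) (G := G) (S := S) (K := K))
  | .inl _ => isFalse id
  | .inr (.inl _) => isTrue trivial
  | .inr (.inr (.inl _)) => isFalse id
  | .inr (.inr (.inr _)) => isTrue trivial

/-- The data qubits in the circuit. -/
def dataQubits : Dt ↪ Fin N := ⟨fun d => e (.inl d), fun _ _ h => Sum.inl.inj (e.injective h)⟩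

/-- Overwriting the classical bits of the data qubits by corrections computed from the outcomes. -/
def writeData (corr : Bits G → Bits S → Bits K → Bits Dt) (x : Bits (Fin N)) : Bits (Fin N) :=
  glue e (corr (partG e x) (partS e x) (partK e x)) (partG e x) (partS e x) (partK e x)

/-- The layers of the circuit: initialization, controlled NOTs for the `Z` checks, controlled NOTs
for the `X` checks, measurement of all qubits except the data, and corrections. -/
def gadgetLayers (inp : P ↪ Dt) [DecidablePred (· ∈ Set.range (inp.trans (dataQubits e)))]
    (C₁ C₂ : CnotStage N) (corrX : Bits S → Bits Dt) (corrZ : Bits G → Bits K → Bits Dt)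
    (n : ℕ) (t : ℕ) : Layer N :=
  if t = 0 then
    resetLayer (· ∈ Set.range (inp.trans (dataQubits e))) fun i => StartsPlus (e.symm i)
  else if t < 1 + n then C₁.layer (t - 1)
  else if t < 1 + n + n then C₂.layer (t - (1 + n))
  else if t = 1 + n + n then localLayer (fun _ => 1) fun i => measureOp (e.symm i)
  else if t = 1 + n + n + 1 then
    localLayer (writeData e fun _ s _ => corrX s) fun i => dataOp .X (e.symm i)
  else localLayer (writeData e fun g _ k => corrZ g k) fun i => dataOp .Z (e.symm i)

/-- One side of the state at the end of the circuit, for each value of the classical register. -/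
def finalKet {Λ : Type} (C₁ C₂ : CnotStage N) (corrX : Bits S → Bits Dt)
    (corrZ : Bits G → Bits K → Bits Dt) (n : ℕ) (F : ℕ → Fin N → Pauli)
    (A : Matrix (Bits (Fin N)) Λ ℂ) (x : Bits (Fin N)) : Matrix (Bits (Fin N)) Λ ℂ :=
  pauliString (F (1 + n + n + 1 + 1)) *
    (xz 0 (glue e (corrZ (partG e x) (partK e x)) 0 0 0) *
    (pauliString (F (1 + n + n + 1)) * (xz (glue e (corrX (partS e x)) 0 0 0) 0 *
    (pauliString (F (1 + n + n)) * (tensorMat (fun i => (measureOp (e.symm i)).mat (x i)) *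
    ketRun (fun t => permMat (shear (edgeMat (C₂.edgesOf t)))) (fun t => F (1 + n + t))
    (ketRun (fun t => permMat (shear (edgeMat (C₁.edgesOf t)))) (fun t => F (1 + t))
    (pauliString (F 0) * A) n) n)))))

variable {R Λ : Type} [Fintype R] [DecidableEq R] [Fintype Λ] [DecidableEq Λ]
  {ρ : Matrix (Λ × R) (Λ × R) ℂ} {σ : HybridState (Fin N) R N}

/-- A correction layer whose corrections are computed from the outcomes. -/
theorem Tracks.correction {A B : Bits (Fin N) → Matrix (Bits (Fin N)) Λ ℂ} (h : Tracks ρ A B σ)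
    (corr : Bits G → Bits S → Bits K → Bits Dt) (Q : Pauli)
    (hA : ∀ x, A (writeData e corr x) = A x) (hB : ∀ x, B (writeData e corr x) = B x) :
    Tracks ρ
      (fun x => tensorMat (fun i => (dataOp (G := G) (S := S) (K := K) Q (e.symm i)).mat
        (writeData e corr x i)) * A x)
      (fun x => tensorMat (fun i => (dataOp (G := G) (S := S) (K := K) Q (e.symm i)).mat
        (writeData e corr x i)) * B x)
      ((QEC.localLayer (writeData e corr) fun i => dataOp Q (e.symm i)).act σ) := by
  classical
  have hw : ∀ x, writeData e corr (writeData e corr x) = writeData e corr x := by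
    intro x
    simp [writeData]
  have hno : ∀ (q : Dt ⊕ G ⊕ S ⊕ K) (P : Axis), dataOp Q q ≠ .measure P := by
    intro q P
    rcases q with q | q <;> exact LocalOp.noConfusion
  have h1 := h.localLayer (writeData e corr) (fun i => dataOp Q (e.symm i))
    (A' := fun x => if writeData e corr x = x then A x else 0)
    (B' := fun x => if writeData e corr x = x then B x else 0)
    (fun y => ⟨1, by rw [one_smul, if_pos (hw y), hA]⟩)
    (fun y => ⟨1, by rw [one_smul, if_pos (hw y), hB]⟩)
    (fun i P hP => absurd hP (hno _ _)) (fun i P hP => absurd hP (hno _ _))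
  refine h1.congr (fun x => ?_) fun x => ?_
  · by_cases hx : writeData e corr x = x
    · exact ⟨1, by rw [one_smul, if_pos hx, hx]⟩
    · exact ⟨0, by rw [if_neg hx, Matrix.mul_zero, zero_smul]⟩
  · by_cases hx : writeData e corr x = x
    · exact ⟨1, by rw [one_smul, if_pos hx, hx]⟩
    · exact ⟨0, by rw [if_neg hx, Matrix.mul_zero, zero_smul]⟩

theorem measureOp_writeData (corr : Bits G → Bits S → Bits K → Bits Dt) (x : Bits (Fin N)) :
    tensorMat (fun i => (measureOp (e.symm i)).mat (writeData e corr x i)) =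
      tensorMat fun i => (measureOp (e.symm i)).mat (x i) := by
  refine congrArg tensorMat (funext fun i => ?_)
  obtain ⟨q, rfl⟩ := e.surjective i
  rw [Equiv.symm_apply_apply]
  rcases q with q | q | q | q
  · have h1 : ∀ b, (measureOp (.inl q : Dt ⊕ G ⊕ S ⊕ K)).mat b = 1 := by
      intro b
      change (if b = 1 then Pauli.I.mat else 1) = 1
      split_ifs <;> rfl
    rw [h1, h1]
  · simp [writeData, glue, partG]
  · simp [writeData, glue, partS]
  · simp [writeData, glue, partK]

/-- The state at the end of the circuit. -/
theorem tracks_gadget (inp : P ↪ Dt) [DecidablePred (· ∈ Set.range (inp.trans (dataQubits e)))]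
    (C₁ C₂ : CnotStage N) (corrX : Bits S → Bits Dt) (corrZ : Bits G → Bits K → Bits Dt)
    (n : ℕ) (F : ℕ → PauliPair (Fin N)) {A B : Matrix (Bits P) Λ ℂ}
    (hσ : ∃ c : ℂ, partialTrace (inp.trans (dataQubits e)) σ = c • sandwich ρ A B) :
    Tracks ρ
      (finalKet e C₁ C₂ corrX corrZ n (fun t => (F t).1)
        (initMat (inp.trans (dataQubits e)) (fun i => StartsPlus (e.symm i)) * A))
      (finalKet e C₁ C₂ corrX corrZ n (fun t => (F t).2)
        (initMat (inp.trans (dataQubits e)) (fun i => StartsPlus (e.symm i)) * B))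
      (runLayers (gadgetLayers e inp C₁ C₂ corrX corrZ n) F σ (1 + n + n + 1 + 1 + 1)) := by
  set l := gadgetLayers e inp C₁ C₂ corrX corrZ n with hl
  set V := initMat (inp.trans (dataQubits e)) (fun i => StartsPlus (e.symm i)) with hV
  have h1 : Tracks ρ (fun _ => pauliString (F 0).1 * (V * A)) (fun _ => pauliString (F 0).2 * (V * B))
      (runLayers l F σ 1) := by
    refine Tracks.faultAct (σ := (l 0).act σ) (A := fun _ => V * A) (B := fun _ => V * B) ?_ (F 0)
    have h0 : l 0 = resetLayer (· ∈ Set.range (inp.trans (dataQubits e)))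
        (fun i => StartsPlus (e.symm i)) := if_pos rfl
    rw [h0, resetLayer_act]
    obtain ⟨c, hc⟩ := hσ
    intro x
    by_cases hx : x = 1
    · refine ⟨c, ?_⟩
      change (if x = 1 then _ else _) = _
      rw [if_pos hx, hc]
      rw [sandwich, Matrix.mul_smul, Matrix.smul_mul, sandwich_mul]
    · exact ⟨0, (if_neg hx).trans (zero_smul _ _).symm⟩
  have h2 := C₁.tracks h1 (fun t => F (1 + t)) n
  rw [← runLayers_congr (l := fun t => l (1 + t)) (t := n)] at h2
  swap
  · intro t ht
    simp only [hl, gadgetLayers]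
    rw [if_neg (by omega), if_pos (by omega)]
    congr 1
    omega
  rw [← runLayers_add] at h2
  have h3 := C₂.tracks h2 (fun t => F (1 + n + t)) n
  rw [← runLayers_congr (l := fun t => l (1 + n + t)) (t := n)] at h3
  swap
  · intro t ht
    simp only [hl, gadgetLayers]
    rw [if_neg (by omega), if_neg (by omega), if_pos (by omega)]
    congr 1
    omega
  rw [← runLayers_add] at h3
  have h4 := (h3.localLayer (A' := fun _ => _) (B' := fun _ => _) (fun _ => 1) (fun i => measureOp (e.symm i)) (fun _ => ⟨1, (one_smul _ _).symm⟩)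
    (fun _ => ⟨1, (one_smul _ _).symm⟩) (fun _ _ _ _ _ => rfl) (fun _ _ _ _ _ => rfl)).faultAct
    (F (1 + n + n))
  have hl4 : l (1 + n + n) = localLayer (fun _ => 1) fun i => measureOp (e.symm i) := by
    simp only [hl, gadgetLayers]
    rw [if_neg (by omega), if_neg (by omega), if_neg (by omega), if_pos trivial]
  rw [← hl4] at h4
  have h5 := (Tracks.correction e (σ := runLayers l F σ (1 + n + n + 1)) h4 (fun _ s _ => corrX s) .X
    (fun x => by simp only [measureOp_writeData]) (fun x => by simp only [measureOp_writeData])).faultAct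
    (F (1 + n + n + 1))
  have hl5 : l (1 + n + n + 1) = localLayer (writeData e fun _ s _ => corrX s)
      fun i => dataOp .X (e.symm i) := by
    simp only [hl, gadgetLayers]
    rw [if_neg (by omega), if_neg (by omega), if_neg (by omega), if_neg (by omega), if_pos trivial]
  rw [← hl5] at h5
  have hwS : ∀ corr x, partS e (writeData e corr x) = partS e x := fun corr x => by simp [writeData]
  have hwD : ∀ corr x, partD e (writeData e corr x) = corr (partG e x) (partS e x) (partK e x) :=
    fun corr x => by simp [writeData]
  simp only [tensorMat_dataX, hwD] at h5
  have h6 := (Tracks.correction e (σ := runLayers l F σ (1 + n + n + 1 + 1)) h5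
    (fun g _ k => corrZ g k) .Z
    (fun x => by simp only [measureOp_writeData, hwS])
    (fun x => by simp only [measureOp_writeData, hwS])).faultAct (F (1 + n + n + 1 + 1))
  have hl6 : l (1 + n + n + 1 + 1) = localLayer (writeData e fun g _ k => corrZ g k)
      fun i => dataOp .Z (e.symm i) := by
    simp only [hl, gadgetLayers]
    rw [if_neg (by omega), if_neg (by omega), if_neg (by omega), if_neg (by omega),
      if_neg (by omega)]
  rw [← hl6] at h6
  simp only [tensorMat_dataZ, hwD] at h6
  exact h6

end Gadget

/-! ### The output of the circuit -/

section Output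

variable {Dt G S K : Type} [Fintype Dt] [DecidableEq Dt] [Fintype G] [DecidableEq G] [Fintype S]
  [DecidableEq S] [Fintype K] [DecidableEq K] {N : ℕ} (e : Dt ⊕ G ⊕ S ⊕ K ≃ Fin N)
  (mσ : Matrix Dt S (ZMod 2)) (mτ : Matrix G S (ZMod 2)) (mγ : Matrix K Dt (ZMod 2))
  {P : Type} [Fintype P] [DecidableEq P] {Λ : Type} [Fintype Λ] [DecidableEq Λ]

/-- The errors at the end of the circuit: `a` and `b` before the measurement, `p` and `q` after it. -/
theorem exists_finalKet_eq {C₁ C₂ : CnotStage N}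
    (hC₁ : C₁.edges = edgesOfWeight e (weightZ mσ mτ)) (hC₂ : C₂.edges = edgesOfWeight e (weightX mγ))
    {n : ℕ} (hn₁ : ∀ p ∈ C₁.edges, C₁.colour p < n) (hn₂ : ∀ p ∈ C₂.edges, C₂.colour p < n)
    {Nb : Fin N → Fin N → Prop} (hNb₁ : ∀ p ∈ C₁.edges, Nb p.1 p.2 ∧ Nb p.2 p.1)
    (hNb₂ : ∀ p ∈ C₂.edges, Nb p.1 p.2 ∧ Nb p.2 p.1) {E : Set (Fin N)} {F : ℕ → Fin N → Pauli}
    (hF : ∀ t q, F t q ≠ .I → q ∈ E) :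
    ∃ a b p q : Bits (Fin N),
      (∀ i, a i ≠ 0 ∨ b i ≠ 0 →
        i ∈ {i | i ∈ E ∨ ∃ j ∈ E, Nb j i} ∨ ∃ j ∈ {i | i ∈ E ∨ ∃ j ∈ E, Nb j i}, Nb j i) ∧
      (∀ i, p i ≠ 0 ∨ q i ≠ 0 → i ∈ E) ∧
      ∀ (corrX : Bits S → Bits Dt) (corrZ : Bits G → Bits K → Bits Dt)
        (A : Matrix (Bits (Fin N)) Λ ℂ) (x : Bits (Fin N)), ∃ c : ℂ,
        finalKet e C₁ C₂ corrX corrZ n F A x = c •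
          (xz (p + glue e (corrX (partS e x)) 0 0 0)
            (q + glue e (corrZ (partG e x) (partK e x)) 0 0 0) *
          (tensorMat (fun i => (measureOp (e.symm i)).mat (x i)) *
            (xz a b * (stagesMat e mσ mτ mγ * A)))) := by
  have hadd : ∀ x y : ZMod 2, x + y ≠ 0 → x ≠ 0 ∨ y ≠ 0 := by decide
  let fx : ℕ → Bits (Fin N) := fun t i => (F t i).xBit
  let fz : ℕ → Bits (Fin N) := fun t i => (F t i).zBit
  have hfx : ∀ t i, fx t i ≠ 0 → i ∈ E := fun t i h => hF t i (Pauli.ne_I_of_bit (Or.inl h))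
  have hfz : ∀ t i, fz t i ≠ 0 → i ∈ E := fun t i h => hF t i (Pauli.ne_I_of_bit (Or.inr h))
  obtain ⟨a₁, b₁, h1, h1'⟩ := C₁.exists_ketRun_eq (Λ := Λ) hNb₁ (S := fun t => F (1 + t))
    (fun t q h => hF _ q h) (a := fx 0) (b := fz 0) (fun i h => h.elim (hfx 0 i) (hfz 0 i)) n
  obtain ⟨a₂, b₂, h2, h2'⟩ := C₂.exists_ketRun_eq (Λ := Λ) hNb₂ (S := fun t => F (1 + n + t))
    (E := {i | i ∈ E ∨ ∃ j ∈ E, Nb j i}) (fun t q h => Or.inl (hF _ q h)) (a := a₁) (b := b₁) h1 n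
  let s := 1 + n + n
  refine ⟨a₂, b₂, fx s + (fx (s + 1) + fx (s + 1 + 1)), fz s + (fz (s + 1) + fz (s + 1 + 1)), h2, ?_,
    fun corrX corrZ A x => ?_⟩
  · rintro i (h | h)
    · rcases hadd _ _ h with h | h
      · exact hfx _ i h
      rcases hadd _ _ h with h | h
      · exact hfx _ i h
      · exact hfx _ i h
    · rcases hadd _ _ h with h | h
      · exact hfz _ i h
      rcases hadd _ _ h with h | h
      · exact hfz _ i h
      · exact hfz _ i h
  set cX := glue e (corrX (partS e x)) 0 0 0 with hcX
  set cZ := glue e (corrZ (partG e x) (partK e x)) 0 0 0 with hcZ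
  obtain ⟨k₀, hk₀⟩ := pauliString_eq_xz (F 0)
  obtain ⟨k₁, hk₁⟩ := h1' A
  obtain ⟨k₂, hk₂⟩ := h2' (permMat (shear (∑ t ∈ Finset.range n, edgeMat (C₁.edgesOf t))) * A)
  rw [C₁.sum_edgeMat hn₁, hC₁] at hk₁ hk₂
  rw [C₂.sum_edgeMat hn₂, hC₂] at hk₂
  have hlin : ∀ (C : CnotStage N) (S : ℕ → Fin N → Pauli) (c : ℂ) (B : Matrix (Bits (Fin N)) Λ ℂ) (m : ℕ),
      ketRun (fun t => permMat (shear (edgeMat (C.edgesOf t)))) S (c • B) m =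
        c • ketRun (fun t => permMat (shear (edgeMat (C.edgesOf t)))) S B m := by
    intro C S c B m
    induction m with
    | zero => rfl
    | succ m ih => rw [ketRun, ih, ketRun, Matrix.mul_smul, Matrix.mul_smul]
  have hket : ketRun (fun t => permMat (shear (edgeMat (C₂.edgesOf t)))) (fun t => F (1 + n + t))
      (ketRun (fun t => permMat (shear (edgeMat (C₁.edgesOf t)))) (fun t => F (1 + t))
      (pauliString (F 0) * A) n) n = (k₀ * k₁ * k₂) • (xz a₂ b₂ * (stagesMat e mσ mτ mγ * A)) := by
    rw [hk₀, Matrix.smul_mul, hlin, hk₁, hlin, hlin, hk₂, smul_smul, smul_smul, stagesMat,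
      Matrix.mul_assoc (permMat _) (permMat _)]
  obtain ⟨l₁, hl₁⟩ := pauliString_eq_xz (F s)
  obtain ⟨l₂, hl₂⟩ := pauliString_eq_xz (F (s + 1))
  obtain ⟨l₃, hl₃⟩ := pauliString_eq_xz (F (s + 1 + 1))
  obtain ⟨m₁, hm₁⟩ := xz_mul_xz cX 0 (fx s) (fz s)
  obtain ⟨m₂, hm₂⟩ := xz_mul_xz (fx (s + 1)) (fz (s + 1)) (cX + fx s) (0 + fz s)
  obtain ⟨m₃, hm₃⟩ := xz_mul_xz 0 cZ (fx (s + 1) + (cX + fx s)) (fz (s + 1) + (0 + fz s))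
  obtain ⟨m₄, hm₄⟩ := xz_mul_xz (fx (s + 1 + 1)) (fz (s + 1 + 1))
    (0 + (fx (s + 1) + (cX + fx s))) (cZ + (fz (s + 1) + (0 + fz s)))
  refine ⟨k₀ * k₁ * k₂ * (l₁ * l₂ * l₃ * (m₁ * m₂ * m₃ * m₄)), ?_⟩
  have hP : pauliString (F (s + 1 + 1)) * (xz 0 cZ * (pauliString (F (s + 1)) * (xz cX 0 *
      pauliString (F s)))) = (l₁ * l₂ * l₃ * (m₁ * m₂ * m₃ * m₄)) •
      xz (fx s + (fx (s + 1) + fx (s + 1 + 1)) + cX) (fz s + (fz (s + 1) + fz (s + 1 + 1)) + cZ) := by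
    rw [hl₁, hl₂, hl₃]
    change l₃ • xz (fx (s + 1 + 1)) (fz (s + 1 + 1)) * (xz 0 cZ *
      (l₂ • xz (fx (s + 1)) (fz (s + 1)) * (xz cX 0 * l₁ • xz (fx s) (fz s)))) = _
    simp only [Matrix.mul_smul, Matrix.smul_mul, hm₁, hm₂, hm₃, hm₄, smul_smul]
    have ea : fx (s + 1 + 1) + (0 + (fx (s + 1) + (cX + fx s))) =
        fx s + (fx (s + 1) + fx (s + 1 + 1)) + cX := by abel
    have eb : fz (s + 1 + 1) + (cZ + (fz (s + 1) + (0 + fz s))) =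
        fz s + (fz (s + 1) + fz (s + 1 + 1)) + cZ := by abel
    rw [ea, eb]
    congr 1
    ring
  rw [finalKet, hket]
  rw [← hcX, ← hcZ]
  simp only [Matrix.mul_smul]
  have hP' := congrArg (· * (tensorMat (fun i => (measureOp (e.symm i)).mat (x i)) *
    (xz a₂ b₂ * (stagesMat e mσ mτ mγ * A)))) hP
  simp only [Matrix.mul_assoc, Matrix.smul_mul] at hP'
  rw [← smul_smul (k₀ * k₁ * k₂), ← hP']

variable {R : Type} [Fintype R] [DecidableEq R]
  {ρ : Matrix (Λ × R) (Λ × R) ℂ} {σ : HybridState (Fin N) R N}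

theorem sandwich_apply {Q : Type} [Fintype Q] [DecidableEq Q] (ρ : Matrix (Λ × R) (Λ × R) ℂ)
    (A B : Matrix (Bits Q) Λ ℂ) (y y' : Bits Q × R) :
    sandwich ρ A B y y' = ∑ l, ∑ l', A y.1 l * ρ (l, y.2) (l', y'.2) * star (B y'.1 l') := by
  have h1 : ∀ {β : Type} (X : Matrix (Λ × R) β ℂ) (A : Matrix (Bits Q) Λ ℂ) (y : Bits Q × R) (z : β),
      ((A ⊗ₖ (1 : Matrix R R ℂ)) * X) y z = ∑ l, A y.1 l * X (l, y.2) z := by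
    intro β X A y z
    rw [Matrix.mul_apply, Fintype.sum_prod_type]
    refine Finset.sum_congr rfl fun l _ => ?_
    rw [Finset.sum_eq_single y.2]
    · rw [Matrix.kroneckerMap_apply, Matrix.one_apply_eq, mul_one]
    · intro r _ hr
      rw [Matrix.kroneckerMap_apply, Matrix.one_apply_ne hr.symm, mul_zero, zero_mul]
    · intro h
      exact absurd (Finset.mem_univ _) h
  have h2 : ∀ (X : Matrix (Bits Q × R) (Λ × R) ℂ) (y y' : Bits Q × R),
      (X * (B ⊗ₖ (1 : Matrix R R ℂ)).conjTranspose) y y' =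
        ∑ l, X y (l, y'.2) * star (B y'.1 l) := by
    intro X y y'
    have h3 := congrArg star (h1 X.conjTranspose B y' y)
    rw [← Matrix.conjTranspose_apply, Matrix.conjTranspose_mul, Matrix.conjTranspose_conjTranspose,
      star_sum] at h3
    rw [h3]
    refine Finset.sum_congr rfl fun l _ => ?_
    rw [star_mul', Matrix.conjTranspose_apply, star_star, mul_comm]
  rw [sandwich, h2, Finset.sum_comm]
  refine Finset.sum_congr rfl fun l' _ => ?_
  rw [h1, Finset.sum_mul]

/-- The partial trace of a tracked state which is a product of a state of the data with a state of the
other qubits. -/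
theorem Tracks.exists_partialTrace_eq {A B : Bits (Fin N) → Matrix (Bits (Fin N)) Λ ℂ}
    (h : Tracks ρ A B σ) {X Y : Matrix (Bits Dt) Λ ℂ}
    (hA : ∀ x, ∃ χ : Bits G → Bits S → Bits K → ℂ, ∀ y u,
      A x y u = χ (partG e y) (partS e y) (partK e y) * X (partD e y) u)
    (hB : ∀ x, ∃ χ : Bits G → Bits S → Bits K → ℂ, ∀ y u,
      B x y u = χ (partG e y) (partS e y) (partK e y) * Y (partD e y) u) :
    ∃ c : ℂ, partialTrace (dataQubits e) σ = c • sandwich ρ X Y := by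
  classical
  choose c hc using h
  choose χ hχ using hA
  choose χ' hχ' using hB
  refine ⟨∑ x, ∑ g, ∑ s, ∑ k, c x * (χ x g s k * star (χ' x g s k)), ?_⟩
  ext v v'
  have hs : ∀ x (y y' : Bits (Fin N)), σ x (y, v.2) (y', v'.2) =
      c x * (χ x (partG e y) (partS e y) (partK e y) *
        star (χ' x (partG e y') (partS e y') (partK e y'))) *
        sandwich ρ X Y (partD e y, v.2) (partD e y', v'.2) := by
    intro x y y'
    rw [hc, Matrix.smul_apply, smul_eq_mul, sandwich_apply, sandwich_apply, mul_assoc]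
    refine congrArg (c x * ·) ?_
    rw [Finset.mul_sum]
    refine Finset.sum_congr rfl fun l _ => ?_
    rw [Finset.mul_sum]
    refine Finset.sum_congr rfl fun l' _ => ?_
    rw [hχ, hχ', star_mul']
    ring
  have hcond : ∀ y y' : Bits (Fin N), (y ∘ dataQubits e = v.1 ∧ y' ∘ dataQubits e = v'.1 ∧
      ∀ q ∉ Set.range (dataQubits e), y q = y' q) ↔
      (partD e y = v.1 ∧ partD e y' = v'.1 ∧ partG e y = partG e y' ∧ partS e y = partS e y' ∧
        partK e y = partK e y') := by
    intro y y'
    refine and_congr Iff.rfl (and_congr Iff.rfl ⟨fun h => ⟨?_, ?_, ?_⟩, ?_⟩)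
    · refine funext fun i => h _ ?_
      rintro ⟨d, hd⟩
      exact Sum.inl_ne_inr (e.injective hd)
    · refine funext fun i => h _ ?_
      rintro ⟨d, hd⟩
      exact Sum.inl_ne_inr (e.injective hd)
    · refine funext fun i => h _ ?_
      rintro ⟨d, hd⟩
      exact Sum.inl_ne_inr (e.injective hd)
    · rintro ⟨h1, h2, h3⟩ q hq
      obtain ⟨q, rfl⟩ := e.surjective q
      rcases q with q | q | q | q
      · exact absurd ⟨q, rfl⟩ hq
      · exact congrFun h1 q
      · exact congrFun h2 q
      · exact congrFun h3 q
  simp only [partialTrace, hcond, hs]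
  rw [Matrix.smul_apply, smul_eq_mul, Finset.sum_mul]
  refine Finset.sum_congr rfl fun x _ => ?_
  rw [sum_bits e]
  simp only [partD_glue, partG_glue, partS_glue, partK_glue]
  rw [Finset.sum_eq_single v.1]
  rotate_left
  · intro d _ hd
    simp [hd]
  · intro h
    exact absurd (Finset.mem_univ _) h
  rw [Finset.sum_mul]
  refine Finset.sum_congr rfl fun g _ => ?_
  rw [Finset.sum_mul]
  refine Finset.sum_congr rfl fun s _ => ?_
  rw [Finset.sum_mul]
  refine Finset.sum_congr rfl fun k _ => ?_
  rw [Finset.sum_eq_single (glue e v'.1 g s k)]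
  · simp
  · intro y' _ hy'
    rw [if_neg]
    rintro ⟨_, h1, h2, h3, h4⟩
    refine hy' ?_
    rw [← glue_parts e y', h1, ← h2, ← h3, ← h4]
  · intro h
    exact absurd (Finset.mem_univ _) h

/-- The state of the data and of the other qubits after the initialization. -/
theorem exists_initMat_mul_eq (inp : P ↪ Dt)
    [DecidablePred (· ∈ Set.range (inp.trans (dataQubits e)))] {enc : Matrix (Bits P) Λ ℂ}
    {Bs : Submodule (ZMod 2) (Bits Dt)} {v : Λ → Bits Dt} {c₀ : ℂ} [DecidablePred (· ∈ Bs)]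
    (hBsP : ∀ b ∈ Bs, ∀ q, q ∉ Set.range inp → b q = 0)
    (hvP : ∀ u q, q ∉ Set.range inp → v u q = 0)
    (henc : ∀ d u, (∀ q, q ∉ Set.range inp → d q = 0) →
      enc (d ∘ inp) u = if d + v u ∈ Bs then c₀ else 0) (F : P → Pauli) :
    ∃ c : ℂ, ∃ A : Matrix (Bits (Fin N)) Λ ℂ,
      (∀ d g s k u, A (glue e d g s k) u = if s = 0 then
        codeAmp Bs (fun q => if h : ∃ i, inp i = q then (F h.choose).xBit else 0)
          (fun q => if h : ∃ i, inp i = q then (F h.choose).zBit else 0) (v u) d else 0) ∧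
      initMat (inp.trans (dataQubits e)) (fun i => StartsPlus (e.symm i)) * (pauliString F * enc) =
        c • A := by
  classical
  set ex : Bits Dt := fun q => if h : ∃ i, inp i = q then (F h.choose).xBit else 0 with hex
  set ez : Bits Dt := fun q => if h : ∃ i, inp i = q then (F h.choose).zBit else 0 with hez
  have hch : ∀ i (h : ∃ j, inp j = inp i), h.choose = i := fun i h => inp.injective h.choose_spec
  have hexi : ∀ i, ex (inp i) = (F i).xBit := by
    intro i
    rw [hex]
    simp only
    rw [dif_pos ⟨i, rfl⟩, hch]
  have hezi : ∀ i, ez (inp i) = (F i).zBit := by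
    intro i
    rw [hez]
    simp only
    rw [dif_pos ⟨i, rfl⟩, hch]
  have hexP : ∀ q, q ∉ Set.range inp → ex q = 0 := fun q hq => dif_neg hq
  have hezP : ∀ q, q ∉ Set.range inp → ez q = 0 := fun q hq => dif_neg hq
  obtain ⟨c₁, hc₁⟩ := pauliString_eq_xz F
  let h₀ : ℂ := ((Real.sqrt 2)⁻¹ : ℝ)
  let A : Matrix (Bits (Fin N)) Λ ℂ := fun y u =>
    if partS e y = 0 then codeAmp Bs ex ez (v u) (partD e y) else 0
  refine ⟨h₀ ^ Fintype.card G * h₀ ^ Fintype.card K * (c₁ * (sgn (ez ⬝ᵥ ex) * c₀)), A,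
    fun d g s k u => by simp only [A, partS_glue, partD_glue], ?_⟩
  have hrange : ∀ q : Dt ⊕ G ⊕ S ⊕ K, e q ∈ Set.range (inp.trans (dataQubits e)) ↔
      ∃ i, q = .inl (inp i) := by
    intro q
    constructor
    · rintro ⟨i, hi⟩
      exact ⟨i, (e.injective hi).symm⟩
    · rintro ⟨i, rfl⟩
      exact ⟨i, rfl⟩
  have hamp : ∀ y : Bits (Fin N), ((∏ i, if i ∈ Set.range (inp.trans (dataQubits e)) then 1 else
      initAmp (StartsPlus (e.symm i)) (y i) : ℝ) : ℂ) =
      h₀ ^ Fintype.card G * h₀ ^ Fintype.card K *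
        if partS e y = 0 ∧ ∀ q, q ∉ Set.range inp → partD e y q = 0 then 1 else 0 := by
    intro y
    have e1 : ∀ g : G, (if e (.inr (.inl g)) ∈ Set.range (inp.trans (dataQubits e)) then (1 : ℝ) else
        initAmp (StartsPlus (e.symm (e (.inr (.inl g))))) (y (e (.inr (.inl g))))) =
        (Real.sqrt 2)⁻¹ := by
      intro g
      rw [if_neg (by simp [hrange])]
      simp [initAmp, StartsPlus]
    have e2 : ∀ k : K, (if e (.inr (.inr (.inr k))) ∈ Set.range (inp.trans (dataQubits e)) then (1 : ℝ)
        else initAmp (StartsPlus (e.symm (e (.inr (.inr (.inr k)))))) (y (e (.inr (.inr (.inr k)))))) =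
        (Real.sqrt 2)⁻¹ := by
      intro k
      rw [if_neg (by simp [hrange])]
      simp [initAmp, StartsPlus]
    have e3 : (∏ s : S, if e (.inr (.inr (.inl s))) ∈ Set.range (inp.trans (dataQubits e)) then (1 : ℝ)
        else initAmp (StartsPlus (e.symm (e (.inr (.inr (.inl s)))))) (y (e (.inr (.inr (.inl s)))))) =
        if partS e y = 0 then 1 else 0 := by
      have : ∀ s : S, (if e (.inr (.inr (.inl s))) ∈ Set.range (inp.trans (dataQubits e)) then (1 : ℝ)
          else initAmp (StartsPlus (e.symm (e (.inr (.inr (.inl s)))))) (y (e (.inr (.inr (.inl s)))))) =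
          if partS e y s = 0 then 1 else 0 := by
        intro s
        rw [if_neg (by simp [hrange])]
        simp [initAmp, StartsPlus, partS]
        exact if_congr Iff.rfl rfl rfl
      simp only [this, Finset.prod_ite_zero, Finset.prod_const_one, Finset.mem_univ, true_implies]
      exact if_congr funext_iff.symm rfl rfl
    have e4 : (∏ d : Dt, if e (.inl d) ∈ Set.range (inp.trans (dataQubits e)) then (1 : ℝ)
        else initAmp (StartsPlus (e.symm (e (.inl d)))) (y (e (.inl d)))) =
        if ∀ q, q ∉ Set.range inp → partD e y q = 0 then 1 else 0 := by
      have : ∀ d : Dt, (if e (.inl d) ∈ Set.range (inp.trans (dataQubits e)) then (1 : ℝ)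
          else initAmp (StartsPlus (e.symm (e (.inl d)))) (y (e (.inl d)))) =
          if d ∉ Set.range inp → partD e y d = 0 then 1 else 0 := by
        intro d
        have hd : e (.inl d) ∈ Set.range (inp.trans (dataQubits e)) ↔ d ∈ Set.range inp := by
          rw [hrange]
          exact ⟨fun ⟨i, hi⟩ => ⟨i, (Sum.inl.inj hi).symm⟩, fun ⟨i, hi⟩ => ⟨i, by rw [hi]⟩⟩
        by_cases hd' : d ∈ Set.range inp
        · rw [if_pos (hd.2 hd'), if_pos fun h => absurd hd' h]
        · rw [if_neg fun h => hd' (hd.1 h)]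
          simp only [hd', not_false_eq_true, true_implies]
          simp [initAmp, StartsPlus, partD]
          exact if_congr Iff.rfl rfl rfl
      simp only [this, Finset.prod_ite_zero, Finset.prod_const_one, Finset.mem_univ, true_implies]
    rw [prod_qubits e, e3, e4]
    simp only [e1, e2, Finset.prod_const, Finset.card_univ]
    by_cases h1 : partS e y = 0 <;> by_cases h2 : ∀ q, q ∉ Set.range inp → partD e y q = 0
    · rw [if_pos h1, if_pos h2, if_pos ⟨h1, h2⟩]
      simp only [h₀]
      push_cast
      ring
    · rw [if_pos h1, if_neg h2, if_neg fun h => h2 h.2]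
      push_cast
      ring
    · rw [if_neg h1, if_neg (c := _ ∧ _) fun h => h1 h.1]
      push_cast
      ring
    · rw [if_neg h1, if_neg (c := _ ∧ _) fun h => h1 h.1]
      push_cast
      ring
  ext y u
  have hmul : (initMat (inp.trans (dataQubits e)) (fun i => StartsPlus (e.symm i)) *
      (pauliString F * enc)) y u = ((∏ i, if i ∈ Set.range (inp.trans (dataQubits e)) then 1 else
      initAmp (StartsPlus (e.symm i)) (y i) : ℝ) : ℂ) * (pauliString F * enc) (partD e y ∘ inp) u := by
    rw [Matrix.mul_apply, Finset.sum_eq_single (partD e y ∘ inp)]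
    · rw [initMat, if_pos]
      rfl
    · intro z _ hz
      rw [initMat, if_neg, zero_mul]
      rintro rfl
      exact hz rfl
    · intro h
      exact absurd (Finset.mem_univ _) h
  rw [hmul, hamp, hc₁, Matrix.smul_mul, Matrix.smul_apply, xz_mul_apply, Matrix.smul_apply,
    smul_eq_mul, smul_eq_mul]
  simp only [A]
  by_cases hS : partS e y = 0
  swap
  · rw [if_neg hS, if_neg fun h => hS h.1]
    ring
  rw [if_pos hS]
  by_cases hD : ∀ q, q ∉ Set.range inp → partD e y q = 0
  · rw [if_pos ⟨hS, hD⟩]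
    have e1 : partD e y ∘ inp + (fun q => (F q).xBit) = (partD e y + ex) ∘ inp := by
      funext i
      simp [hexi]
    have e2 : ∀ z : Bits Dt, (fun q => (F q).zBit) ⬝ᵥ (z ∘ inp) = ez ⬝ᵥ z := by
      intro z
      simp only [dotProduct]
      rw [← Finset.sum_subset (Finset.subset_univ (Finset.univ.map inp)), Finset.sum_map]
      · refine Finset.sum_congr rfl fun i _ => ?_
        rw [hezi]
        rfl
      · intro q _ hq
        rw [hezP, zero_mul]
        rintro ⟨i, hi⟩
        exact hq (Finset.mem_map.2 ⟨i, Finset.mem_univ i, hi⟩)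
    rw [e1, e2, henc _ _ fun q hq => by simp [hD q hq, hexP q hq], codeAmp, dotProduct_add, sgn_add]
    split_ifs
    · ring
    · ring
  · rw [if_neg fun h => hD h.2, codeAmp, if_neg]
    · ring
    · intro hmem
      apply hD
      intro q hq
      have := hBsP _ hmem q hq
      simpa [hexP q hq, hvP u q hq] using this

end Output

/-! ### Extension by zero and restriction -/

section Extension

variable {X : Type} [Fintype X] [DecidableEq X] (p q : X → Prop) [DecidablePred p] [DecidablePred q]

/-- Extension by zero. -/
def extendZero : (Subtype p → ZMod 2) →ₗ[ZMod 2] (X → ZMod 2) where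
  toFun := fun f c => if h : p c then f ⟨c, h⟩ else 0
  map_add' := fun f g => by
    funext c
    by_cases h : p c <;> simp [h]
  map_smul' := fun a f => by
    funext c
    by_cases h : p c <;> simp [h]

/-- Restriction to the elements with a property. -/
def restrictTo : (X → ZMod 2) →ₗ[ZMod 2] (Subtype p → ZMod 2) :=
  LinearMap.funLeft (ZMod 2) (ZMod 2) Subtype.val

variable {p q}

theorem restrictTo_apply (f : X → ZMod 2) (c : Subtype p) : restrictTo p f c = f c.1 := rfl

theorem extendZero_of_pos (f : Subtype p → ZMod 2) {c : X} (h : p c) :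
    extendZero p f c = f ⟨c, h⟩ := dif_pos h

theorem extendZero_of_neg (f : Subtype p → ZMod 2) {c : X} (h : ¬ p c) : extendZero p f c = 0 :=
  dif_neg h

theorem of_extendZero_ne_zero {f : Subtype p → ZMod 2} {c : X} (h : extendZero p f c ≠ 0) : p c :=
  by_contra fun h' => h (extendZero_of_neg f h')

theorem restrictTo_extendZero (f : Subtype p → ZMod 2) : restrictTo p (extendZero p f) = f :=
  funext fun c => extendZero_of_pos f c.2

theorem extendZero_restrictTo {f : X → ZMod 2} (hf : ∀ c, f c ≠ 0 → p c) :
    extendZero p (restrictTo p f) = f := by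
  funext c
  by_cases h : p c
  · rw [extendZero_of_pos _ h, restrictTo_apply]
  · rw [extendZero_of_neg _ h]
    by_contra h'
    exact h (hf c (Ne.symm h'))

theorem extendZero_dotProduct (f : Subtype p → ZMod 2) (g : X → ZMod 2) :
    extendZero p f ⬝ᵥ g = f ⬝ᵥ restrictTo p g := by
  simp only [dotProduct]
  rw [← Finset.sum_subset (Finset.subset_univ (Finset.univ.filter p))]
  · rw [Finset.sum_subtype (p := p) (Finset.univ.filter p) (by simp)]
    exact Finset.sum_congr rfl fun c _ => by rw [extendZero_of_pos f c.2]; rfl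
  · intro c _ hc
    rw [extendZero_of_neg f (by simpa using hc), zero_mul]

theorem extendZero_dotProduct_extendZero (f g : Subtype p → ZMod 2) :
    extendZero p f ⬝ᵥ extendZero p g = f ⬝ᵥ g := by
  rw [extendZero_dotProduct, restrictTo_extendZero]

theorem vecMulLinear_eq_restrictTo {M : X → X → ZMod 2} (f : Subtype p → ZMod 2) :
    Matrix.vecMulLinear (Matrix.of fun (c : Subtype p) (c' : Subtype q) => M c.1 c'.1) f =
      restrictTo q fun c' => ∑ c, extendZero p f c * M c c' := by
  funext c'
  exact (extendZero_dotProduct f fun c => M c c'.1).symm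

end Extension

/-! ### The cells of the registers -/

section Cells

variable {d : ℕ} (A : BasedComplex d) (B : BasedComplex 1) (L : Finset B.Cell) (j : ℕ)

/-- The cells of the output qubits. -/
def IsDataCell (c : A.Cell × B.Cell) : Prop := A.deg c.1 + B.deg c.2 = j + 1

/-- The cells of the gauge qubits: the cells of level `j` of `A ⊗ B*` which do not lie over `L`. Those
over level `0` of `B` are needed only if they have coboundaries in both directions. -/
def IsGaugeCell (c : A.Cell × B.Cell) : Prop :=
  A.deg c.1 + (1 - B.deg c.2) = j ∧ c.2 ∉ L ∧
    (B.deg c.2 = 1 ∨ (∃ a, A.inc c.1 a ≠ 0) ∧ ∃ b, B.inc c.2 b ≠ 0)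

/-- The cells of the `Z` checks: the cells of level `j + 1` of `A ⊗ B*`, except for isolated ones. -/
def IsZCheckCell (c : A.Cell × B.Cell) : Prop :=
  A.deg c.1 + (1 - B.deg c.2) = j + 1 ∧
    (B.deg c.2 = 0 ∧ (∃ b, B.inc c.2 b ≠ 0) ∨ B.deg c.2 = 1 ∧ ∃ a, A.inc a c.1 ≠ 0)

/-- The cells of the `X` checks: the cells of level `j` of `A ⊗ B`, except for isolated ones. -/
def IsXCheckCell (c : A.Cell × B.Cell) : Prop :=
  A.deg c.1 + B.deg c.2 = j ∧ ∃ c', (A.tensor B).inc c c' ≠ 0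

instance : DecidablePred (IsDataCell A B j) :=
  fun c => inferInstanceAs (Decidable (A.deg c.1 + B.deg c.2 = j + 1))
instance : DecidablePred (IsGaugeCell A B L j) := Classical.decPred _
instance : DecidablePred (IsZCheckCell A B j) := Classical.decPred _
instance : DecidablePred (IsXCheckCell A B j) := Classical.decPred _

/-- The incidences of the `Z` checks with the input qubits. -/
def matInput : Matrix (Subtype (IsDataCell A B j)) (Subtype (IsZCheckCell A B j)) (ZMod 2) :=
  Matrix.of fun c c' => if c.1.2 ∈ L then (A.tensor B.dual).inc c.1 c'.1 else 0

/-- The incidences of the `Z` checks with the gauge qubits. -/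
def matGauge : Matrix (Subtype (IsGaugeCell A B L j)) (Subtype (IsZCheckCell A B j)) (ZMod 2) :=
  Matrix.of fun c c' => (A.tensor B.dual).inc c.1 c'.1

/-- The incidences of the `X` checks with the data qubits. -/
def matXCheck : Matrix (Subtype (IsXCheckCell A B j)) (Subtype (IsDataCell A B j)) (ZMod 2) :=
  Matrix.of fun c c' => (A.tensor B).inc c.1 c'.1

variable {A B L j}

theorem vecMul_matInput (f : Subtype (IsDataCell A B j) → ZMod 2) :
    Matrix.vecMulLinear (matInput A B L j) f =
      restrictTo _ (delD A B (resL L (extendZero _ f))) := by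
  refine (vecMulLinear_eq_restrictTo (p := IsDataCell A B j) (q := IsZCheckCell A B j)
    (M := fun (c c' : A.Cell × B.Cell) => if c.2 ∈ L then (A.tensor B.dual).inc c c' else 0) f).trans ?_
  refine congrArg (restrictTo _) (funext fun c' => ?_)
  refine Finset.sum_congr rfl fun c _ => ?_
  by_cases h : c.2 ∈ L
  · rw [if_pos h, resL_of_mem _ h]
  · rw [if_neg h, resL_of_notMem _ h, mul_zero, zero_mul]

theorem vecMul_matGauge (f : Subtype (IsGaugeCell A B L j) → ZMod 2) :
    Matrix.vecMulLinear (matGauge A B L j) f = restrictTo _ (delD A B (extendZero _ f)) :=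
  vecMulLinear_eq_restrictTo (p := IsGaugeCell A B L j) (q := IsZCheckCell A B j)
    (M := (A.tensor B.dual).inc) f

theorem vecMul_matXCheck (f : Subtype (IsXCheckCell A B j) → ZMod 2) :
    Matrix.vecMulLinear (matXCheck A B j) f = restrictTo _ (delC A B (extendZero _ f)) :=
  vecMulLinear_eq_restrictTo (p := IsXCheckCell A B j) (q := IsDataCell A B j)
    (M := (A.tensor B).inc) f

theorem extendZero_data_mem (f : Subtype (IsDataCell A B j) → ZMod 2) :
    extendZero _ f ∈ levC A B (j + 1) := mem_levC.2 fun _ hc => of_extendZero_ne_zero (p := IsDataCell A B j) hc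

theorem isDataCell_of_mem {f : A.Cell × B.Cell → ZMod 2} (hf : f ∈ levC A B (j + 1))
    (c : A.Cell × B.Cell) (hc : f c ≠ 0) : IsDataCell A B j c := mem_levC.1 hf c hc

theorem extendZero_gauge_mem (f : Subtype (IsGaugeCell A B L j) → ZMod 2) :
    extendZero _ f ∈ levD A B j := mem_levD.2 fun _ hc => (of_extendZero_ne_zero (p := IsGaugeCell A B L j) hc).1

theorem extendZero_zCheck_mem (f : Subtype (IsZCheckCell A B j) → ZMod 2) :
    extendZero _ f ∈ levD A B (j + 1) := mem_levD.2 fun _ hc => (of_extendZero_ne_zero (p := IsZCheckCell A B j) hc).1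

theorem extendZero_xCheck_mem (f : Subtype (IsXCheckCell A B j) → ZMod 2) :
    extendZero _ f ∈ levC A B j := mem_levC.2 fun _ hc => (of_extendZero_ne_zero (p := IsXCheckCell A B j) hc).1

theorem delC_mem_level {f : A.Cell × B.Cell → ZMod 2} (hf : f ∈ levC A B j) :
    delC A B f ∈ levC A B (j + 1) := coboundary_mem_level (A.tensor B) hf

theorem exists_of_delD_ne_zero {f : A.Cell × B.Cell → ZMod 2} {c : A.Cell × B.Cell}
    (h : delD A B f c ≠ 0) : ∃ c', f c' ≠ 0 ∧ (A.tensor B.dual).inc c' c ≠ 0 := by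
  by_contra h'
  push Not at h'
  refine h (Finset.sum_eq_zero fun c' _ => ?_)
  by_cases hc : f c' = 0
  · rw [hc, zero_mul]
  · rw [h' c' hc, mul_zero]

theorem exists_of_bdD_ne_zero {f : A.Cell × B.Cell → ZMod 2} {c : A.Cell × B.Cell}
    (h : bdD A B f c ≠ 0) : ∃ c', f c' ≠ 0 ∧ (A.tensor B.dual).inc c c' ≠ 0 := by
  by_contra h'
  push Not at h'
  refine h (Finset.sum_eq_zero fun c' _ => ?_)
  by_cases hc : f c' = 0
  · rw [hc, zero_mul]
  · change f c' * (A.tensor B.dual).inc c c' = 0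
    rw [h' c' hc, mul_zero]

theorem exists_of_bdC_ne_zero {f : A.Cell × B.Cell → ZMod 2} {c : A.Cell × B.Cell}
    (h : bdC A B f c ≠ 0) : ∃ c', f c' ≠ 0 ∧ (A.tensor B).inc c c' ≠ 0 := by
  by_contra h'
  push Not at h'
  refine h (Finset.sum_eq_zero fun c' _ => ?_)
  by_cases hc : f c' = 0
  · rw [hc, zero_mul]
  · change f c' * (A.tensor B).inc c c' = 0
    rw [h' c' hc, mul_zero]

/-- The checks of the input and gauge qubits are not isolated. -/
theorem isZCheckCell_of_inc {c c' : A.Cell × B.Cell} (hlev : A.deg c.1 + (1 - B.deg c.2) = j)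
    (hc : B.deg c.2 = 1 ∨ (∃ a, A.inc c.1 a ≠ 0) ∧ ∃ b, B.inc c.2 b ≠ 0)
    (h : (A.tensor B.dual).inc c c' ≠ 0) : IsZCheckCell A B j c' := by
  have hlev' : A.deg c'.1 + (1 - B.deg c'.2) = A.deg c.1 + (1 - B.deg c.2) + 1 :=
    (A.tensor B.dual).inc_deg _ _ h
  have hb := B.deg_le c.2
  refine ⟨by omega, ?_⟩
  rcases tensor_inc_cases h with ⟨h1, h2⟩ | ⟨h1, h2⟩
  · have h1' : c.2 = c'.2 := h1
    rcases hc with hc | ⟨_, b, hb'⟩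
    · exact Or.inr ⟨h1' ▸ hc, c.1, h2⟩
    · have h3 := B.inc_deg _ _ hb'
      have h4 := B.deg_le b
      exact Or.inl ⟨h1' ▸ (by omega : B.deg c.2 = 0), h1' ▸ ⟨b, hb'⟩⟩
  · have h2' : B.inc c'.2 c.2 ≠ 0 := h2
    have h3 := B.inc_deg _ _ h2'
    exact Or.inl ⟨by omega, c.2, h2'⟩

/-- The cells off `L` incident to a `Z` check carry gauge qubits. -/
theorem isGaugeCell_of_inc {c c' : A.Cell × B.Cell} (hc : IsZCheckCell A B j c') (hL : c.2 ∉ L)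
    (h : (A.tensor B.dual).inc c c' ≠ 0) : IsGaugeCell A B L j c := by
  have hlev' : A.deg c'.1 + (1 - B.deg c'.2) = A.deg c.1 + (1 - B.deg c.2) + 1 :=
    (A.tensor B.dual).inc_deg _ _ h
  have hb := B.deg_le c.2
  have hlev := hc.1
  refine ⟨by omega, hL, ?_⟩
  rcases tensor_inc_cases h with ⟨h1, h2⟩ | ⟨h1, h2⟩
  · have h1' : c.2 = c'.2 := h1
    rcases hc.2 with ⟨_, h3⟩ | ⟨h3, _⟩
    · exact Or.inr ⟨⟨_, h2⟩, h1' ▸ h3⟩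
    · exact Or.inl (h1' ▸ h3)
  · have h2' : B.inc c'.2 c.2 ≠ 0 := h2
    have h3 := B.inc_deg _ _ h2'
    exact Or.inl (by omega)

end Cells

/-! ### The stabilizers of the circuit -/

section Stabilizers

variable {d : ℕ} {A : BasedComplex d} {B : BasedComplex 1} {L : Finset B.Cell} {w m j : ℕ}
  {V : Type} {G : SimpleGraph V} {φ : A.Cell × B.Cell → V} {η γ₀ γ₁ : ℝ}

theorem isZCheckCell_of_delD {f : A.Cell × B.Cell → ZMod 2}
    (hf : ∀ c, f c ≠ 0 → A.deg c.1 + (1 - B.deg c.2) = j ∧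
      (B.deg c.2 = 1 ∨ (∃ a, A.inc c.1 a ≠ 0) ∧ ∃ b, B.inc c.2 b ≠ 0))
    (c : A.Cell × B.Cell) (hc : delD A B f c ≠ 0) : IsZCheckCell A B j c := by
  obtain ⟨c', h1, h2⟩ := exists_of_delD_ne_zero hc
  exact isZCheckCell_of_inc (hf c' h1).1 (hf c' h1).2 h2

theorem isZCheckCell_of_delD_gauge {f : A.Cell × B.Cell → ZMod 2}
    (hf : ∀ c, f c ≠ 0 → IsGaugeCell A B L j c)
    (c : A.Cell × B.Cell) (hc : delD A B f c ≠ 0) : IsZCheckCell A B j c :=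
  isZCheckCell_of_delD (fun c hc => ⟨(hf c hc).1, (hf c hc).2.2⟩) c hc

variable (A B L j) in
/-- The stabilizers of bit-flip type of the copies of the input code, on the data qubits. -/
def inputCoboundaries : Submodule (ZMod 2) (Subtype (IsDataCell A B j) → ZMod 2) where
  carrier := {f | ∃ x : A.Cell × B.Cell → ZMod 2, (∀ c, x c ≠ 0 → A.deg c.1 + 1 = j ∧ c.2 ∈ L) ∧
    f = restrictTo _ (opLeft A.coboundary x)}
  add_mem' := by
    rintro _ _ ⟨x, hx, rfl⟩ ⟨y, hy, rfl⟩
    refine ⟨x + y, fun c hc => ?_, by rw [map_add, map_add]⟩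
    rcases support_add_subset x y hc with h | h
    · exact hx c h
    · exact hy c h
  zero_mem' := ⟨0, fun c hc => absurd rfl hc, by rw [map_zero, map_zero]⟩
  smul_mem' := by
    rintro a _ ⟨x, hx, rfl⟩
    refine ⟨a • x, fun c hc => hx c fun h => hc ?_, by rw [map_smul, map_smul]⟩
    rw [Pi.smul_apply, h, smul_zero]

theorem coboundary_ne_zero {f : A.Cell → ZMod 2} {a : A.Cell} (h : A.coboundary f a ≠ 0) :
    ∃ a', f a' ≠ 0 ∧ A.inc a' a ≠ 0 := by
  by_contra h'
  push Not at h'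
  rw [coboundary_apply] at h
  refine h (Finset.sum_eq_zero fun c' _ => ?_)
  by_cases hc : f c' = 0
  · rw [hc, zero_mul]
  · rw [h' c' hc, mul_zero]

theorem onInput_opLeft {x : A.Cell × B.Cell → ZMod 2}
    (hx : ∀ c, x c ≠ 0 → A.deg c.1 + 1 = j ∧ c.2 ∈ L) :
    OnInput A B L j (opLeft A.coboundary x) := by
  rintro ⟨a, b⟩ hc
  rw [opLeft_apply] at hc
  obtain ⟨a', h1, h2⟩ := coboundary_ne_zero hc
  have h3 := hx (a', b) h1
  have h4 := A.inc_deg _ _ h2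
  exact ⟨h4.trans h3.1, h3.2⟩

theorem opLeft_opLeft (x : A.Cell × B.Cell → ZMod 2) :
    opLeft A.coboundary (opLeft A.coboundary x) = 0 := by
  funext c
  obtain ⟨a, b⟩ := c
  rw [opLeft_apply]
  exact congrFun (coboundary_coboundary A fun a => x (a, b)) a

namespace IsSwitching

theorem resL_onInput {f : A.Cell × B.Cell → ZMod 2} (hf : OnInput A B L j f) : resL L f = f := by
  funext c
  by_cases hc : c.2 ∈ L
  · exact resL_of_mem f hc
  · rw [resL_of_notMem f hc]
    by_contra h
    exact hc (hf c (Ne.symm h)).2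

theorem extendZero_onInput (h : IsSwitching A B L w m j G φ η) {f : A.Cell × B.Cell → ZMod 2}
    (hf : OnInput A B L j f) : extendZero (IsDataCell A B j) (restrictTo _ f) = f :=
  extendZero_restrictTo (isDataCell_of_mem (h.onInput_level_C hf))

theorem exists_codewords (h : IsSwitching A B L w m j G φ η) :
    ∃ cw : B.Cell → B.Cell → ZMod 2, (∀ l ∈ L, cw l ∈ B.dual.cocycles 0) ∧
      (∀ l ∈ L, cw l l = 1) ∧ ∀ l ∈ L, ∀ l' ∈ L, l' ≠ l → cw l l' = 0 := by
  choose! cw hcw hcw1 hcw0 using h.codeword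
  exact ⟨cw, hcw, hcw1, hcw0⟩

/-- The `Z` checks of a cocycle of the copies can be cancelled by gauge qubits: continue the cocycle
along the codewords of `ker ∂` which extend the basis vectors of `L`. -/
theorem exists_delD_eq (h : IsSwitching A B L w m j G φ η) {f : A.Cell × B.Cell → ZMod 2}
    (hf : OnInput A B L j f) (hf' : opLeft A.coboundary f = 0) :
    ∃ g : A.Cell × B.Cell → ZMod 2, (∀ c, g c ≠ 0 → IsGaugeCell A B L j c) ∧
      delD A B f = delD A B g := by
  obtain ⟨cw, hcw, hcw1, hcw0⟩ := h.exists_codewords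
  let X : A.Cell × B.Cell → ZMod 2 := fun c => ∑ l ∈ L, f (c.1, l) * cw l c.2
  have hXL : ∀ c : A.Cell × B.Cell, c.2 ∈ L → X c = f c := by
    rintro ⟨a, l⟩ hl
    change ∑ l' ∈ L, f (a, l') * cw l' l = f (a, l)
    rw [Finset.sum_eq_single_of_mem l hl, hcw1 l hl, mul_one]
    intro l' hl' hne
    rw [hcw0 l' hl' l hl hne.symm, mul_zero]
  have hX : delD A B X = 0 := by
    rw [delD_eq]
    have h1 : opLeft A.coboundary X = 0 := by
      funext c
      obtain ⟨a, b⟩ := c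
      have e : (fun a => X (a, b)) = ∑ l ∈ L, cw l b • fun a => f (a, l) := by
        funext a
        simp [X, Finset.sum_apply, mul_comm]
      rw [opLeft_apply, e, map_sum, Finset.sum_apply]
      refine Finset.sum_eq_zero fun l _ => ?_
      have h2 : A.coboundary (fun a => f (a, l)) a = 0 := congrFun hf' (a, l)
      rw [map_smul, Pi.smul_apply, h2, smul_zero]
    have h2 : opRight B.boundary X = 0 := by
      funext c
      obtain ⟨a, b⟩ := c
      have e : (fun b => X (a, b)) = ∑ l ∈ L, f (a, l) • cw l := by
        funext b
        simp [X]
      rw [opRight_apply, e, map_sum, Finset.sum_apply]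
      refine Finset.sum_eq_zero fun l hl => ?_
      have h3 : B.boundary (cw l) = 0 := (hcw l hl).2
      rw [map_smul, h3, smul_zero]
      rfl
    rw [h1, h2, add_zero]
  refine ⟨X + f, fun c hc => ?_, by rw [map_add, hX, zero_add]⟩
  have hcL : c.2 ∉ L := by
    intro hcL
    refine hc ?_
    rw [Pi.add_apply, hXL c hcL, CharTwo.add_self_eq_zero]
  have hfc : f c = 0 := by
    by_contra h1
    exact hcL (hf c h1).2
  rw [Pi.add_apply, hfc, add_zero] at hc
  obtain ⟨l, hl, h1⟩ := Finset.exists_ne_zero_of_sum_ne_zero hc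
  have h2 := deg_of_codeword (hcw l hl) (right_ne_zero_of_mul h1)
  have h3 := hf _ (left_ne_zero_of_mul h1)
  exact ⟨by simpa [h2] using h3.1, hcL, Or.inl h2⟩

theorem vecMul_matInput_mem_range (h : IsSwitching A B L w m j G φ η)
    {f : A.Cell × B.Cell → ZMod 2} (hf : OnInput A B L j f) (hf' : opLeft A.coboundary f = 0) :
    Matrix.vecMulLinear (matInput A B L j) (restrictTo _ f) ∈
      LinearMap.range (Matrix.vecMulLinear (matGauge A B L j)) := by
  obtain ⟨g, hg, hfg⟩ := h.exists_delD_eq hf hf'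
  refine ⟨restrictTo _ g, ?_⟩
  rw [vecMul_matGauge, vecMul_matInput, extendZero_restrictTo hg, h.extendZero_onInput hf,
    resL_onInput hf, hfg]

theorem vecMul_matInput_of_mem (h : IsSwitching A B L w m j G φ η)
    {b : Subtype (IsDataCell A B j) → ZMod 2} (hb : b ∈ inputCoboundaries A B L j) :
    Matrix.vecMulLinear (matInput A B L j) b ∈
      LinearMap.range (Matrix.vecMulLinear (matGauge A B L j)) := by
  obtain ⟨x, hx, rfl⟩ := hb
  exact h.vecMul_matInput_mem_range (onInput_opLeft hx) (opLeft_opLeft x)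

/-- A product of `X` checks which acts on input qubits only is a product of stabilizers of the input
code, by contraction with codewords of `ker ∂`. -/
theorem vecMul_matXCheck_mem (h : IsSwitching A B L w m j G φ η)
    (k : Subtype (IsXCheckCell A B j) → ZMod 2)
    (hk : ∀ q : Subtype (IsDataCell A B j), q.1.2 ∉ L →
      Matrix.vecMulLinear (matXCheck A B j) k q = 0) :
    Matrix.vecMulLinear (matXCheck A B j) k ∈ inputCoboundaries A B L j := by
  classical
  obtain ⟨cw, hcw, hcw1, hcw0⟩ := h.exists_codewords
  set f := extendZero (IsXCheckCell A B j) k with hf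
  have hflev : f ∈ levC A B j := extendZero_xCheck_mem k
  have hδ := delC_mem_level hflev
  have hoff : ∀ c : A.Cell × B.Cell, c.2 ∉ L → delC A B f c = 0 := by
    intro c hc
    by_contra h1
    refine h1 ?_
    have h2 := hk ⟨c, isDataCell_of_mem hδ c h1⟩ hc
    rwa [vecMul_matXCheck] at h2
  let x : A.Cell × B.Cell → ZMod 2 := fun c => if c.2 ∈ L then contract (cw c.2) f c.1 else 0
  refine ⟨x, ?_, ?_⟩
  · intro c hc
    by_cases hcL : c.2 ∈ L
    swap
    · exact absurd (if_neg hcL) hc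
    have h1 : contract (cw c.2) f c.1 ≠ 0 := fun h1 => hc ((if_pos hcL).trans h1)
    obtain ⟨b, _, h2⟩ := Finset.exists_ne_zero_of_sum_ne_zero h1
    have h3 := deg_of_codeword (hcw _ hcL) (left_ne_zero_of_mul h2)
    have h4 := mem_levC.1 hflev _ (right_ne_zero_of_mul h2)
    rw [h3] at h4
    exact ⟨h4, hcL⟩
  · rw [vecMul_matXCheck]
    refine congrArg (restrictTo _) (funext fun c => ?_)
    obtain ⟨a, b⟩ := c
    by_cases hb : b ∈ L
    · have e : (fun a => x (a, b)) = contract (cw b) f := by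
        funext a
        exact if_pos hb
      rw [← hf, opLeft_apply, e, ← contract_opLeft, ← add_zero (contract (cw b) (opLeft A.coboundary f)),
        ← contract_opRight (hcw b hb) f, ← contract_add, ← delC_eq]
      change _ = ∑ b', cw b b' * delC A B f (a, b')
      rw [Finset.sum_eq_single b, hcw1 b hb, one_mul]
      · intro b' _ hne
        by_cases hb' : b' ∈ L
        · rw [hcw0 b hb b' hb' hne, zero_mul]
        · rw [hoff (a, b') hb', mul_zero]
      · intro h1
        exact absurd (Finset.mem_univ _) h1
    · have e : (fun a => x (a, b)) = 0 := by
        funext a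
        exact if_neg hb
      rw [hoff (a, b) hb, opLeft_apply, e, map_zero]
      rfl

theorem delC_restrict {x : A.Cell × B.Cell → ZMod 2} (hx : x ∈ levC A B j) :
    delC A B (extendZero (IsXCheckCell A B j) (restrictTo _ x)) = delC A B x := by
  funext c
  refine Finset.sum_congr rfl fun (c' : A.Cell × B.Cell) _ => ?_
  by_cases h1 : (A.tensor B).inc c' c = 0
  · rw [h1, mul_zero, mul_zero]
  · by_cases h2 : x c' = 0
    · have h3 : extendZero (IsXCheckCell A B j) (restrictTo _ x) c' = 0 := by
        by_cases h4 : IsXCheckCell A B j c'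
        · rw [extendZero_of_pos _ h4]
          exact h2
        · exact extendZero_of_neg _ h4
      rw [h2, h3]
    · rw [extendZero_of_pos (p := IsXCheckCell A B j) _ ⟨mem_levC.1 hx c' h2, c, h1⟩]
      rfl

theorem mem_range_matXCheck {x : A.Cell × B.Cell → ZMod 2} (hx : x ∈ levC A B j) :
    restrictTo _ (delC A B x) ∈ LinearMap.range (Matrix.vecMulLinear (matXCheck A B j)) :=
  ⟨restrictTo _ x, by rw [vecMul_matXCheck, delC_restrict hx]⟩

theorem inputCoboundaries_le (h : IsSwitching A B L w m j G φ η) :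
    inputCoboundaries A B L j ≤ LinearMap.range (Matrix.vecMulLinear (matXCheck A B j)) := by
  rintro _ ⟨x, hx, rfl⟩
  have h1 : opLeft A.coboundary x = delC A B x := by
    rw [delC_eq, h.coboundary_of_onInput fun c hc => (hx c hc).2, add_zero]
  rw [h1]
  refine mem_range_matXCheck (mem_levC.2 fun c hc => ?_)
  rw [h.deg_of_mem (hx c hc).2]
  exact (hx c hc).1

theorem inputCoboundaries_apply {b : Subtype (IsDataCell A B j) → ZMod 2}
    (hb : b ∈ inputCoboundaries A B L j) (q : Subtype (IsDataCell A B j)) (hq : q.1.2 ∉ L) :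
    b q = 0 := by
  obtain ⟨x, hx, rfl⟩ := hb
  by_contra h1
  exact hq (onInput_opLeft hx q.1 h1).2

/-! ### The decoder of the circuit -/

theorem exists_decoder_X (h : IsSwitching A B L w m j G φ η) (hγ : IsCorrectable w γ₀ γ₁) :
    ∃ corr : (Subtype (IsZCheckCell A B j) → ZMod 2) → Subtype (IsDataCell A B j) → ZMod 2,
      ∀ (ex : Subtype (IsDataCell A B j) → ZMod 2) (n : Subtype (IsZCheckCell A B j) → ZMod 2),
        OnInput A B L j (extendZero _ ex) → CopySparse A B L η γ₀ (extendZero _ ex) →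
        Sparse G η γ₁ (φ '' {c | extendZero _ n c ≠ 0}) →
        ∃ f : Subtype (IsDataCell A B j) → ZMod 2,
          Sparse G η (residualRate w γ₁) (φ '' {c | extendZero _ f c ≠ 0}) ∧
          ∀ s, s + n + Matrix.vecMulLinear (matInput A B L j) ex ∈
              LinearMap.range (Matrix.vecMulLinear (matGauge A B L j)) →
            corr s + ex + f ∈ LinearMap.range (Matrix.vecMulLinear (matXCheck A B j)) := by
  obtain ⟨corr, hcorr, hc⟩ := h.exists_correction_X hγ
  refine ⟨fun s => restrictTo _ (corr (extendZero _ s)), fun ex n hex hexS hn => ?_⟩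
  obtain ⟨f, hf, hfS, hfc⟩ := hc _ _ hex hexS (extendZero_zCheck_mem n) hn
  refine ⟨restrictTo _ f, by rwa [h.extendZero_onInput hf], fun s hs => ?_⟩
  obtain ⟨g, hg⟩ := hs
  rw [vecMul_matGauge, vecMul_matInput, resL_onInput hex] at hg
  have h1 : extendZero _ s + extendZero _ n + delD A B (extendZero _ ex) =
      delD A B (extendZero (IsGaugeCell A B L j) g) := by
    have h2 := congrArg (extendZero (IsZCheckCell A B j)) hg
    rw [map_add, map_add, extendZero_restrictTo, extendZero_restrictTo] at h2
    · exact h2.symm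
    · refine isZCheckCell_of_delD fun c hc => ?_
      have h3 := h.deg_of_mem (hex c hc).2
      exact ⟨by rw [h3]; exact (hex c hc).1, Or.inl h3⟩
    · exact isZCheckCell_of_delD_gauge fun c hc => of_extendZero_ne_zero hc
  obtain ⟨x, hx, hx'⟩ := hfc _ _ (extendZero_gauge_mem g)
    (fun c hc => (of_extendZero_ne_zero (p := IsGaugeCell A B L j) hc).2.1) h1
  refine h.inputCoboundaries_le ⟨x, hx, ?_⟩
  rw [← hx', map_add, map_add, restrictTo_extendZero]

theorem exists_decoder_Z (h : IsSwitching A B L w m j G φ η) (hγ : IsCorrectable w γ₀ γ₁) :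
    ∃ corr : (Subtype (IsGaugeCell A B L j) → ZMod 2) → (Subtype (IsXCheckCell A B j) → ZMod 2) →
        Subtype (IsDataCell A B j) → ZMod 2,
      ∀ (ez : Subtype (IsDataCell A B j) → ZMod 2) (nz : Subtype (IsGaugeCell A B L j) → ZMod 2)
        (nk : Subtype (IsXCheckCell A B j) → ZMod 2),
        OnInput A B L j (extendZero _ ez) → CopySparse A B L η γ₀ (extendZero _ ez) →
        Sparse G η γ₁ (φ '' {c | extendZero _ nz c ≠ 0}) →
        Sparse G η γ₁ (φ '' {c | extendZero _ nk c ≠ 0}) →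
        ∃ f : Subtype (IsDataCell A B j) → ZMod 2,
          Sparse G η (residualRate w γ₁) (φ '' {c | extendZero _ f c ≠ 0}) ∧
          ∀ z κ y (ω : Subtype (IsDataCell A B j) → ZMod 2),
            (∀ g, (z + nz) ⬝ᵥ g = y ⬝ᵥ Matrix.vecMulLinear (matGauge A B L j) g) →
            (∀ q, q.1.2 ∈ L → ω q = 0) →
            (∀ k, (κ + nk) ⬝ᵥ k + y ⬝ᵥ Matrix.vecMulLinear (matInput A B L j)
                (Matrix.vecMulLinear (matXCheck A B j) k) +
              ez ⬝ᵥ Matrix.vecMulLinear (matXCheck A B j) k =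
                ω ⬝ᵥ Matrix.vecMulLinear (matXCheck A B j) k) →
            (∀ k, y ⬝ᵥ Matrix.vecMulLinear (matInput A B L j)
                (Matrix.vecMulLinear (matXCheck A B j) k) +
              (corr z κ + ez + ω + f) ⬝ᵥ Matrix.vecMulLinear (matXCheck A B j) k = 0) ∧
            ∀ v : Subtype (IsDataCell A B j) → ZMod 2, OnInput A B L j (extendZero _ v) →
              opLeft A.coboundary (extendZero _ v) = 0 →
              y ⬝ᵥ Matrix.vecMulLinear (matInput A B L j) v + (corr z κ + ez + ω + f) ⬝ᵥ v = 0 := by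
  obtain ⟨corr, hcorr, hc⟩ := h.exists_correction_Z hγ
  refine ⟨fun z κ => restrictTo _ (corr (extendZero _ z) (extendZero _ κ)),
    fun ez nz nk hez hezS hnz hnk => ?_⟩
  obtain ⟨f, hf, hfS, hfc⟩ := hc _ _ _ hez hezS (extendZero_gauge_mem nz) hnz
    (extendZero_xCheck_mem nk) hnk
  refine ⟨restrictTo _ f, by rwa [extendZero_restrictTo (isDataCell_of_mem hf)], ?_⟩
  intro z κ y ω hy hω hk
  set Y := extendZero (IsZCheckCell A B j) y with hY
  have hYlev : Y ∈ levD A B (j + 1) := extendZero_zCheck_mem y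
  have hbd : resL L (bdD A B Y) ∈ levC A B (j + 1) :=
    h.onInput_level_C (h.resL_onInput_D (bdD_mem_level hYlev))
  have hezlev : extendZero _ ez ∈ levC A B (j + 1) := extendZero_data_mem ez
  -- transposing the matrices of the checks
  have hσ : ∀ v : Subtype (IsDataCell A B j) → ZMod 2,
      y ⬝ᵥ Matrix.vecMulLinear (matInput A B L j) v = resL L (bdD A B Y) ⬝ᵥ extendZero _ v := by
    intro v
    have hadj : ∀ f g : A.Cell × B.Cell → ZMod 2, resL L f ⬝ᵥ g = f ⬝ᵥ resL L g := by
      intro f g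
      refine Finset.sum_congr rfl fun c _ => ?_
      by_cases hc : c.2 ∈ L
      · rw [resL_of_mem _ hc, resL_of_mem _ hc]
      · rw [resL_of_notMem _ hc, resL_of_notMem _ hc, zero_mul, mul_zero]
    rw [vecMul_matInput, ← extendZero_dotProduct, hadj, bdD_dotProduct]
  have hγk : ∀ k : Subtype (IsXCheckCell A B j) → ZMod 2,
      extendZero (IsDataCell A B j) (Matrix.vecMulLinear (matXCheck A B j) k) =
        delC A B (extendZero _ k) := by
    intro k
    rw [vecMul_matXCheck,
      extendZero_restrictTo (isDataCell_of_mem (delC_mem_level (extendZero_xCheck_mem k)))]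
  have hdot : ∀ (u : Subtype (IsDataCell A B j) → ZMod 2) (k : Subtype (IsXCheckCell A B j) → ZMod 2),
      u ⬝ᵥ Matrix.vecMulLinear (matXCheck A B j) k =
        bdC A B (extendZero _ u) ⬝ᵥ extendZero _ k := by
    intro u k
    rw [bdC_dotProduct, ← hγk, extendZero_dotProduct_extendZero]
  have hyk : ∀ k : Subtype (IsXCheckCell A B j) → ZMod 2,
      y ⬝ᵥ Matrix.vecMulLinear (matInput A B L j) (Matrix.vecMulLinear (matXCheck A B j) k) =
        bdC A B (resL L (bdD A B Y)) ⬝ᵥ extendZero _ k := by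
    intro k
    rw [hσ, bdC_dotProduct, hγk]
  have h1 : ∀ c : A.Cell × B.Cell, c.2 ∉ L →
      extendZero _ z c + extendZero _ nz c = bdD A B Y c := by
    intro c hcL
    by_cases hcg : IsGaugeCell A B L j c
    · have h2 := hy (Pi.single ⟨c, hcg⟩ 1)
      rw [vecMul_matGauge, ← extendZero_dotProduct, ← bdD_dotProduct, dotProduct_single_one] at h2
      rw [extendZero_of_pos _ hcg, extendZero_of_pos _ hcg]
      refine h2.trans ?_
      rw [dotProduct_comm, extendZero_dotProduct, single_one_dotProduct]
      rfl
    · rw [extendZero_of_neg _ hcg, extendZero_of_neg _ hcg, add_zero]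
      by_contra h2
      obtain ⟨c', h3, h4⟩ := exists_of_bdD_ne_zero (Ne.symm h2)
      exact hcg (isGaugeCell_of_inc (of_extendZero_ne_zero h3) hcL h4)
  have h2 : extendZero _ κ + extendZero _ nk +
      bdC A B (resL L (bdD A B Y) + extendZero (IsDataCell A B j) ez) =
        bdC A B (extendZero _ ω) := by
    have hK : ∀ f ∈ levC A B (j + 1), ∀ c, ¬ IsXCheckCell A B j c → bdC A B f c = 0 := by
      intro f hf c hc
      by_contra h3
      obtain ⟨c', h4, h5⟩ := exists_of_bdC_ne_zero h3
      exact hc ⟨mem_levC.1 (bdC_mem_level hf) c h3, c', h5⟩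
    funext c
    by_cases hck : IsXCheckCell A B j c
    · have hs : ∀ f : A.Cell × B.Cell → ZMod 2,
          f ⬝ᵥ extendZero _ (Pi.single (⟨c, hck⟩ : Subtype (IsXCheckCell A B j)) 1) = f c := by
        intro f
        rw [dotProduct_comm, extendZero_dotProduct, single_one_dotProduct]
        rfl
      have h3 := hk (Pi.single ⟨c, hck⟩ 1)
      rw [hyk, hdot, hdot, hs, hs, hs, dotProduct_single_one] at h3
      rw [map_add, Pi.add_apply, Pi.add_apply, Pi.add_apply, extendZero_of_pos _ hck,
        extendZero_of_pos _ hck, ← h3]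
      simp only [Pi.add_apply]
      ring
    · rw [Pi.add_apply, Pi.add_apply, extendZero_of_neg _ hck, extendZero_of_neg _ hck,
        hK _ (Submodule.add_mem _ hbd hezlev) c hck, hK _ (extendZero_data_mem ω) c hck]
      simp
  obtain ⟨h3, h4⟩ := hfc _ _ Y (extendZero _ ω) hYlev h1 (extendZero_data_mem ω) (fun c hc hcL => by
    by_cases hcd : IsDataCell A B j c
    · rw [extendZero_of_pos _ hcd] at hc
      exact hc (hω _ hcL)
    · exact hc (extendZero_of_neg _ hcd)) h2
  set R := corr (extendZero _ z) (extendZero _ κ) + resL L (bdD A B Y) + extendZero _ ez +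
    extendZero _ ω + f with hR
  have hRv : ∀ v : Subtype (IsDataCell A B j) → ZMod 2,
      y ⬝ᵥ Matrix.vecMulLinear (matInput A B L j) v +
        (restrictTo _ (corr (extendZero _ z) (extendZero _ κ)) + ez + ω + restrictTo _ f) ⬝ᵥ v =
      R ⬝ᵥ extendZero _ v := by
    intro v
    have h5 : extendZero (IsDataCell A B j)
        (restrictTo _ (corr (extendZero _ z) (extendZero _ κ)) + ez + ω + restrictTo _ f) =
        corr (extendZero _ z) (extendZero _ κ) + extendZero _ ez + extendZero _ ω + f := by
      rw [map_add, map_add, map_add, extendZero_restrictTo (isDataCell_of_mem hf),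
        extendZero_restrictTo (isDataCell_of_mem (hcorr _ _))]
    rw [hσ, ← extendZero_dotProduct_extendZero, h5, ← add_dotProduct, hR]
    congr 1
    abel
  refine ⟨fun k => ?_, fun v hv hv' => ?_⟩
  · rw [hRv, hγk, ← bdC_dotProduct, h3, zero_dotProduct]
  · rw [hRv]
    exact h4 _ hv hv'

end IsSwitching

end Stabilizers

/-! ### The geometry of the circuit -/

section Geometry

variable {d : ℕ} (A : BasedComplex d) (B : BasedComplex 1) (L : Finset B.Cell) (j : ℕ)

/-- The qubits of the circuit. -/
abbrev Qubit : Type := Subtype (IsDataCell A B j) ⊕ Subtype (IsGaugeCell A B L j) ⊕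
  Subtype (IsZCheckCell A B j) ⊕ Subtype (IsXCheckCell A B j)

variable {A B L j}

/-- The cell at which a qubit is located. -/
def Qubit.cell : Qubit A B L j → A.Cell × B.Cell :=
  Sum.elim Subtype.val (Sum.elim Subtype.val (Sum.elim Subtype.val Subtype.val))

/-- The block to which a qubit belongs. -/
def Qubit.block : Qubit A B L j → Fin 4 :=
  Sum.elim (fun _ => 0) (Sum.elim (fun _ => 1) (Sum.elim (fun _ => 2) fun _ => 3))

theorem Qubit.ext {q q' : Qubit A B L j} (h : q.cell = q'.cell) (h' : q.block = q'.block) :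
    q = q' := by
  rcases q with q | q | q | q <;> rcases q' with q' | q' | q' | q' <;>
    first
    | obtain rfl : q = q' := Subtype.ext h
      rfl
    | exact absurd h' (by simp [Qubit.block])

/-- The locations of the qubits in four blocks. -/
def qubitLocation {N : ℕ} (e : Qubit A B L j ≃ Fin N) : Fin N ↪ (A.Cell × B.Cell) × Fin 4 :=
  ⟨fun i => ((e.symm i).cell, (e.symm i).block), fun _ _ h =>
    e.symm.injective (Qubit.ext (Prod.mk.inj h).1 (Prod.mk.inj h).2)⟩

/-- Incidence of cells which is visible in the connectivity graph. -/
def NearBy (A : BasedComplex d) (B : BasedComplex 1) (c c' : A.Cell × B.Cell) : Prop :=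
  Nbr A B c c' ∧ (A.Anchored c.1 ∨ A.Anchored c'.1)

theorem NearBy.symm {c c' : A.Cell × B.Cell} (h : NearBy A B c c') : NearBy A B c' c :=
  ⟨h.1.symm, h.2.symm⟩

theorem card_subtype_le {w : ℕ} (hw : (A.tensor B).HasLocality w)
    {p q : A.Cell × B.Cell → Prop} [DecidablePred p] [DecidablePred q]
    (hpq : ∀ c, p c → ∃ c', q c' ∧ ((A.tensor B).Below c c' ∨ (A.tensor B).Below c' c)) :
    Fintype.card (Subtype p) ≤ Fintype.card (Subtype q) * w := by
  classical
  choose f hf hf' using hpq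
  let g : Subtype p → Subtype q := fun c => ⟨f c.1 c.2, hf c.1 c.2⟩
  rw [← Finset.card_univ, ← Finset.card_univ, mul_comm]
  refine Finset.card_le_mul_card_image_of_maps_to (f := g) (fun _ _ => Finset.mem_univ _) w ?_
  intro c' _
  refine le_trans ?_ (hw c'.1)
  rw [← Set.ncard_coe_finset]
  refine Set.ncard_le_ncard_of_injOn Subtype.val ?_ Subtype.val_injective.injOn (Set.toFinite _)
  intro c hc
  obtain rfl : g c = c' := by simpa using hc
  exact hf' c.1 c.2

theorem isGaugeCell_comparable {c : A.Cell × B.Cell} (hc : IsGaugeCell A B L j c) :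
    ∃ c', IsDataCell A B j c' ∧ ((A.tensor B).Below c c' ∨ (A.tensor B).Below c' c) := by
  obtain ⟨h1, _, h2 | ⟨⟨a, ha⟩, b, hb⟩⟩ := hc
  · exact ⟨c, by rw [IsDataCell]; omega, Or.inl Relation.ReflTransGen.refl⟩
  · obtain ⟨a₀, b₀⟩ := c
    refine ⟨(a, b), ?_, Or.inl ((tensor_below_left A B b₀ (Relation.ReflTransGen.single ha)).trans
      (tensor_below_right A B a (Relation.ReflTransGen.single hb)))⟩
    have h3 := A.inc_deg _ _ ha
    have h4 := B.inc_deg _ _ hb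
    have h5 := B.deg_le b
    simp only at h1 h3 h4
    simp only [IsDataCell]
    omega

theorem isZCheckCell_comparable {c : A.Cell × B.Cell} (hc : IsZCheckCell A B j c) :
    ∃ c', IsDataCell A B j c' ∧ ((A.tensor B).Below c c' ∨ (A.tensor B).Below c' c) := by
  obtain ⟨a₀, b₀⟩ := c
  obtain ⟨h1, ⟨h2, b, hb⟩ | ⟨h2, a, ha⟩⟩ := hc
  · refine ⟨(a₀, b), ?_, Or.inl (tensor_below_right A B a₀ (Relation.ReflTransGen.single hb))⟩
    have h4 := B.inc_deg _ _ hb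
    simp only at h1 h2 h4
    simp only [IsDataCell]
    omega
  · refine ⟨(a, b₀), ?_, Or.inr (tensor_below_left A B b₀ (Relation.ReflTransGen.single ha))⟩
    have h4 := A.inc_deg _ _ ha
    simp only at h1 h2 h4
    simp only [IsDataCell]
    omega

theorem isXCheckCell_comparable {c : A.Cell × B.Cell} (hc : IsXCheckCell A B j c) :
    ∃ c', IsDataCell A B j c' ∧ ((A.tensor B).Below c c' ∨ (A.tensor B).Below c' c) := by
  obtain ⟨h1, c', h2⟩ := hc
  refine ⟨c', ?_, Or.inl (Relation.ReflTransGen.single h2)⟩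
  have h3 : A.deg c'.1 + B.deg c'.2 = A.deg c.1 + B.deg c.2 + 1 := (A.tensor B).inc_deg _ _ h2
  simp only [IsDataCell]
  omega

theorem card_qubit_le {w : ℕ} (hw : (A.tensor B).HasLocality w) (hw1 : 1 ≤ w) :
    Fintype.card (Qubit A B L j) ≤ 8 * (Fintype.card (Subtype (IsDataCell A B j)) * w) := by
  have h1 := card_subtype_le hw fun c hc => isGaugeCell_comparable (L := L) (j := j) hc
  have h2 := card_subtype_le hw fun c hc => isZCheckCell_comparable (j := j) hc
  have h3 := card_subtype_le hw fun c hc => isXCheckCell_comparable (j := j) hc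
  rw [Fintype.card_sum, Fintype.card_sum, Fintype.card_sum]
  have h4 : Fintype.card (Subtype (IsDataCell A B j)) * 1 ≤
    Fintype.card (Subtype (IsDataCell A B j)) * w := Nat.mul_le_mul_left _ hw1
  omega

theorem nearBy_of_weightZ {w m : ℕ} {V : Type} {G : SimpleGraph V} {φ : A.Cell × B.Cell → V} {η : ℝ}
    (h : IsSwitching A B L w m j G φ η) {q q' : Qubit A B L j}
    (hq : weightZ (matInput A B L j) (matGauge A B L j) q q' ≠ 0) :
    NearBy A B q.cell q'.cell := by
  rcases q with q | q | q | q <;> rcases q' with q' | q' | q' | q' <;>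
    first
    | exact absurd rfl hq
    | skip
  · have h1 : (if q.1.2 ∈ L then (A.tensor B.dual).inc q.1 q'.1 else 0) ≠ 0 := hq
    have h2 : (A.tensor B.dual).inc q.1 q'.1 ≠ 0 := by
      intro h2
      rw [h2, ite_self] at h1
      exact h1 rfl
    exact ⟨nbr_of_inc_dual h2, Or.inr (h.anchored_D q'.2.1)⟩
  · exact ⟨nbr_of_inc_dual hq, Or.inr (h.anchored_D q'.2.1)⟩

theorem nearBy_of_weightX {w m : ℕ} {V : Type} {G : SimpleGraph V} {φ : A.Cell × B.Cell → V} {η : ℝ}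
    (h : IsSwitching A B L w m j G φ η) {q q' : Qubit A B L j}
    (hq : weightX (matXCheck A B j) q q' ≠ 0) :
    NearBy A B q.cell q'.cell := by
  rcases q with q | q | q | q <;> rcases q' with q' | q' | q' | q' <;>
    first
    | exact absurd rfl hq
    | skip
  exact ⟨Or.inl hq, Or.inl (h.anchored_C q.2.1)⟩

/-- The controlled NOTs between neighbouring cells can be scheduled in `2 * w` layers. -/
theorem exists_cnotStage {w N : ℕ} (hw : (A.tensor B).HasLocality w) (e : Qubit A B L j ≃ Fin N)
    {W : Qubit A B L j → Qubit A B L j → ZMod 2}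
    (hW : ∀ q q', W q q' ≠ 0 → Nbr A B q.cell q'.cell)
    (hinj : ∀ p q q', W p q ≠ 0 → W p q' ≠ 0 → q.cell = q'.cell → q = q')
    (hinj' : ∀ p q q', W q p ≠ 0 → W q' p ≠ 0 → q.cell = q'.cell → q = q')
    (hbip : ∀ p q r, W p q ≠ 0 → W q r = 0) :
    ∃ C : CnotStage N, C.edges = edgesOfWeight e W ∧ ∀ p ∈ C.edges, C.colour p < 2 * w := by
  classical
  have hmem : ∀ p : Fin N × Fin N, p ∈ edgesOfWeight e W ↔ W (e.symm p.1) (e.symm p.2) ≠ 0 :=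
    fun p => by rw [edgesOfWeight, Finset.mem_filter]; simp
  have hout : ∀ p, ((edgesOfWeight e W).filter fun q => q.1 = p).card ≤ w := by
    intro p
    refine le_trans ?_ (ncard_nbr_le hw (e.symm p).cell)
    rw [← Set.ncard_coe_finset]
    refine Set.ncard_le_ncard_of_injOn (fun q => (e.symm q.2).cell) ?_ ?_ (Set.toFinite _)
    · intro q hq
      obtain ⟨hq1, rfl⟩ := Finset.mem_filter.1 (Finset.mem_coe.1 hq)
      exact hW _ _ ((hmem q).1 hq1)
    · intro q hq q' hq' hqq
      obtain ⟨hq1, hq2⟩ := Finset.mem_filter.1 (Finset.mem_coe.1 hq)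
      obtain ⟨hq1', hq2'⟩ := Finset.mem_filter.1 (Finset.mem_coe.1 hq')
      have h3 := (hmem q).1 hq1
      have h4 := (hmem q').1 hq1'
      rw [hq2] at h3
      rw [hq2'] at h4
      exact Prod.ext (hq2.trans hq2'.symm) (e.symm.injective (hinj _ _ _ h3 h4 hqq))
  have hin : ∀ p, ((edgesOfWeight e W).filter fun q => q.2 = p).card ≤ w := by
    intro p
    refine le_trans ?_ (ncard_nbr_le hw (e.symm p).cell)
    rw [← Set.ncard_coe_finset]
    refine Set.ncard_le_ncard_of_injOn (fun q => (e.symm q.1).cell) ?_ ?_ (Set.toFinite _)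
    · intro q hq
      obtain ⟨hq1, rfl⟩ := Finset.mem_filter.1 (Finset.mem_coe.1 hq)
      exact (hW _ _ ((hmem q).1 hq1)).symm
    · intro q hq q' hq' hqq
      obtain ⟨hq1, hq2⟩ := Finset.mem_filter.1 (Finset.mem_coe.1 hq)
      obtain ⟨hq1', hq2'⟩ := Finset.mem_filter.1 (Finset.mem_coe.1 hq')
      have h3 := (hmem q).1 hq1
      have h4 := (hmem q').1 hq1'
      rw [hq2] at h3
      rw [hq2'] at h4
      exact Prod.ext (e.symm.injective (hinj' _ _ _ h3 h4 hqq)) (hq2.trans hq2'.symm)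
  obtain ⟨col, h1, h2⟩ := exists_edge_colouring (edgesOfWeight e W) w hout hin
  refine ⟨⟨edgesOfWeight e W, col, fun p hp p' hp' h3 => ?_, h2⟩, rfl, h1⟩
  rw [hmem] at hp hp'
  rw [h3] at hp
  exact hp' (hbip _ _ _ hp)

theorem IsSwitching.exists_stageZ {w m N : ℕ} {V : Type} {G : SimpleGraph V}
    {φ : A.Cell × B.Cell → V} {η : ℝ} (h : IsSwitching A B L w m j G φ η)
    (e : Qubit A B L j ≃ Fin N) : ∃ C : CnotStage N,
      C.edges = edgesOfWeight e (weightZ (matInput A B L j) (matGauge A B L j)) ∧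
        ∀ p ∈ C.edges, C.colour p < 2 * w := by
  refine exists_cnotStage h.locality e (fun q q' hq => (nearBy_of_weightZ h hq).1) ?_ ?_ ?_
  · intro p q q' hq hq' hqq
    rcases p with p | p | p | p <;> rcases q with q | q | q | q <;>
      rcases q' with q' | q' | q' | q' <;>
      first
      | exact absurd rfl hq
      | exact absurd rfl hq'
      | obtain rfl : q = q' := Subtype.ext hqq
        rfl
  · intro p q q' hq hq' hqq
    have hin : ∀ (c : Subtype (IsDataCell A B j)) (s : Subtype (IsZCheckCell A B j)),
        matInput A B L j c s ≠ 0 → c.1.2 ∈ L := fun c s hc => by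
      by_contra h1
      exact hc (if_neg h1)
    rcases p with p | p | p | p <;> rcases q with q | q | q | q <;>
      rcases q' with q' | q' | q' | q' <;>
      first
      | exact absurd rfl hq
      | exact absurd rfl hq'
      | obtain rfl : q = q' := Subtype.ext hqq
        rfl
      | skip
    · have hqq' : q.1 = q'.1 := hqq
      exact absurd (hqq' ▸ hin q p hq) q'.2.2.1
    · have hqq' : q.1 = q'.1 := hqq
      exact absurd (hqq' ▸ hin q' p hq') q.2.2.1
  · intro p q r hq
    rcases p with p | p | p | p <;> rcases q with q | q | q | q <;>
      first
      | exact absurd rfl hq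
      | rfl

theorem IsSwitching.exists_stageX {w m N : ℕ} {V : Type} {G : SimpleGraph V}
    {φ : A.Cell × B.Cell → V} {η : ℝ} (h : IsSwitching A B L w m j G φ η)
    (e : Qubit A B L j ≃ Fin N) : ∃ C : CnotStage N,
      C.edges = edgesOfWeight e (weightX (matXCheck A B j)) ∧
        ∀ p ∈ C.edges, C.colour p < 2 * w := by
  refine exists_cnotStage h.locality e (fun q q' hq => (nearBy_of_weightX h hq).1) ?_ ?_ ?_
  · intro p q q' hq hq' hqq
    rcases p with p | p | p | p <;> rcases q with q | q | q | q <;>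
      rcases q' with q' | q' | q' | q' <;>
      first
      | exact absurd rfl hq
      | exact absurd rfl hq'
      | obtain rfl : q = q' := Subtype.ext hqq
        rfl
  · intro p q q' hq hq' hqq
    rcases p with p | p | p | p <;> rcases q with q | q | q | q <;>
      rcases q' with q' | q' | q' | q' <;>
      first
      | exact absurd rfl hq
      | exact absurd rfl hq'
      | obtain rfl : q = q' := Subtype.ext hqq
        rfl
  · intro p q r hq
    rcases p with p | p | p | p <;> rcases q with q | q | q | q <;>
      first
      | exact absurd rfl hq
      | rfl

/-- The rate of the errors caused in a circuit of time `T` on four blocks by faults of rate `γ` which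
spread to neighbouring cells during each of two stages. -/
def circuitRate (w T : ℕ) (γ : ℝ) : ℝ := 2 * (1 + w) * (2 * (1 + w) * ((T * 4 : ℕ) * γ))

/-- The cells to which faults spread during two stages are sparse. -/
theorem IsSwitching.sparse_spread {w m N T : ℕ} {V : Type} {G : SimpleGraph V}
    {φ : A.Cell × B.Cell ↪ V} {η γ : ℝ} (h : IsSwitching A B L w m j G φ η)
    (e : Qubit A B L j ≃ Fin N) (hγ : 0 < γ) (hT : 0 < T) {F : Fin T → PauliPair (Fin N)}
    (hF : Avoids (disjPow (disjPow (badSets G η γ) (Fin 4)) (Fin T))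
      {p | ∃ q, ((qubitLocation e).trans (φ.prodMap (Function.Embedding.refl (Fin 4)))) q = p.1 ∧
        q ∈ (F p.2).support}) {E E₁ E₂ : Set (Fin N)}
    (hE : ∀ i ∈ E, ∃ t, i ∈ (F t).support)
    (hE₁ : ∀ i ∈ E₁, i ∈ E ∨ ∃ k ∈ E, NearBy A B (e.symm k).cell (e.symm i).cell)
    (hE₂ : ∀ i ∈ E₂, i ∈ E₁ ∨ ∃ k ∈ E₁, NearBy A B (e.symm k).cell (e.symm i).cell) :
    Sparse G η (circuitRate w T γ) (φ '' ((fun i => (e.symm i).cell) '' E₂)) := by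
  have hR : ∀ x y, NearBy A B x y → x = y ∨ G.Adj (φ x) (φ y) :=
    fun x y hxy => Or.inr (h.adj_of_nbr hxy.1 hxy.2)
  have hΔ : ∀ x, {y | NearBy A B x y}.ncard ≤ w := fun x =>
    (Set.ncard_le_ncard (fun y hy => hy.1) (Set.toFinite _)).trans (ncard_nbr_le h.locality x)
  have h0 : Sparse G η ((T * 4 : ℕ) * γ) (φ '' ((fun i => (e.symm i).cell) '' E)) := by
    let S : Fin T × Fin 4 → Set V := fun p => {v | ∃ q, φ (e.symm q).cell = v ∧
      (e.symm q).block = p.2 ∧ q ∈ (F p.1).support}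
    have hS : ∀ p, Sparse G η γ (S p) := by
      intro p
      rw [← avoids_badSets_iff]
      have h1 := avoids_disjPow_iff.1 (avoids_disjPow_iff.1 hF p.1) p.2
      convert h1 using 1
      ext v
      constructor
      · rintro ⟨q, rfl, h2, h3⟩
        exact ⟨q, Prod.ext rfl h2, h3⟩
      · rintro ⟨q, h2, h3⟩
        exact ⟨q, (Prod.mk.inj h2).1, (Prod.mk.inj h2).2, h3⟩
    have hpos : (0 : ℝ) < (T * 4 : ℕ) := by exact_mod_cast Nat.mul_pos hT (by norm_num)
    refine (Sparse.iUnion (γ' := (T * 4 : ℕ) * γ) hS (by simp) (mul_pos hpos hγ)).mono ?_ le_rfl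
    rintro _ ⟨_, ⟨i, hi, rfl⟩, rfl⟩
    obtain ⟨t, ht⟩ := hE i hi
    exact Set.mem_iUnion.2 ⟨(t, (e.symm i).block), i, rfl, rfl, ht⟩
  have h1 := Sparse.neighbourhood φ.injective hR hΔ h0
    (E' := (fun i => (e.symm i).cell) '' E₁) (by
      rintro _ ⟨i, hi, rfl⟩
      rcases hE₁ i hi with h2 | ⟨k, hk, h2⟩
      · exact Or.inl ⟨i, h2, rfl⟩
      · exact Or.inr ⟨_, ⟨k, hk, rfl⟩, h2⟩)
  exact Sparse.neighbourhood φ.injective hR hΔ h1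
    (E' := (fun i => (e.symm i).cell) '' E₂) (by
      rintro _ ⟨i, hi, rfl⟩
      rcases hE₂ i hi with h2 | ⟨k, hk, h2⟩
      · exact Or.inl ⟨i, h2, rfl⟩
      · exact Or.inr ⟨_, ⟨k, hk, rfl⟩, h2⟩)

end Geometry

/-! ### Pauli deviations -/

section Deviations

variable {V Q R : Type} [Fintype Q] [DecidableEq Q] [Fintype R] [DecidableEq R] {M : ℕ}

theorem isPauliDeviation_iff {D : DecoratedCode V} {e : D.Phys ↪ Q}
    {ρ : Matrix (Bits D.Log × R) (Bits D.Log × R) ℂ} {σ : HybridState Q R M} :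
    IsPauliDeviation D e ρ σ ↔ ∃ F : PauliPair D.Phys, Avoids D.bad (D.loc '' F.support) ∧
      ∃ c : ℂ, partialTrace e σ =
        c • sandwich ρ (pauliString F.1 * D.enc) (pauliString F.2 * D.enc) := by
  have key : ∀ P : D.Phys → Pauli, (D.enc.conjTranspose * pauliString P) ⊗ₖ (1 : Matrix R R ℂ) =
      ((pauliString P * D.enc) ⊗ₖ (1 : Matrix R R ℂ)).conjTranspose := by
    intro P
    rw [Matrix.conjTranspose_kronecker, Matrix.conjTranspose_one, Matrix.conjTranspose_mul,
      conjTranspose_pauliString]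
  simp only [IsPauliDeviation, key, sandwich]

/-- The isometry padding by further qubits in the state `|0⟩`. -/
def padMat {P P' : Type} (e : P ↪ P') : Matrix (Bits P') (Bits P) ℂ := by
  classical
  exact fun y u => if (∀ q ∉ Set.range e, y q = 0) ∧ y ∘ e = u then 1 else 0

theorem onLeft_padZero {P P' : Type} [Fintype P] [DecidableEq P] [Fintype P'] [DecidableEq P']
    (e : P ↪ P') (ρ : Matrix (Bits P × R) (Bits P × R) ℂ) :
    onLeft (padZero e) ρ = sandwich ρ (padMat e) (padMat e) := by
  classical
  ext a b
  rw [sandwich_apply]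
  have h1 : onLeft (padZero e) ρ a b = if ∀ q ∉ Set.range e, a.1 q = 0 ∧ b.1 q = 0 then
      ρ (a.1 ∘ e, a.2) (b.1 ∘ e, b.2) else 0 := by
    by_cases h : ∀ q ∉ Set.range e, a.1 q = 0 ∧ b.1 q = 0
    · exact (if_pos h).trans (if_pos h).symm
    · exact (if_neg h).trans (if_neg h).symm
  rw [h1, Finset.sum_eq_single (a.1 ∘ e), Finset.sum_eq_single (b.1 ∘ e)]
  · simp only [padMat, and_true]
    by_cases ha : ∀ q ∉ Set.range e, a.1 q = 0
    · by_cases hb : ∀ q ∉ Set.range e, b.1 q = 0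
      · rw [if_pos fun q hq => ⟨ha q hq, hb q hq⟩, if_pos ha, if_pos hb]
        simp
      · rw [if_neg fun h => hb fun q hq => (h q hq).2, if_neg hb]
        simp
    · rw [if_neg fun h => ha fun q hq => (h q hq).1, if_neg ha]
      simp
  · intro u _ hu
    have h2 : padMat e b.1 u = 0 := if_neg fun h => hu h.2.symm
    rw [h2, star_zero, mul_zero]
  · intro h
    exact absurd (Finset.mem_univ _) h
  · intro u _ hu
    have h2 : padMat e a.1 u = 0 := if_neg fun h => hu h.2.symm
    simp [h2]
  · intro h
    exact absurd (Finset.mem_univ _) h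

theorem mul_padMat_apply {P P' β : Type} [Fintype P] [DecidableEq P] [Fintype P'] [DecidableEq P']
    (e : P ↪ P') (X : Matrix β (Bits P') ℂ) (y : β) {u : Bits P} {y₀ : Bits P'}
    (h0 : ∀ q ∉ Set.range e, y₀ q = 0) (h1 : y₀ ∘ e = u) : (X * padMat e) y u = X y y₀ := by
  classical
  rw [Matrix.mul_apply, Finset.sum_eq_single y₀]
  · have h2 : padMat e y₀ u = 1 := if_pos ⟨h0, h1⟩
    rw [h2, mul_one]
  · intro z _ hz
    have h2 : padMat e z u = 0 := if_neg fun h => hz (funext fun q => by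
      by_cases hq : q ∈ Set.range e
      · obtain ⟨p, rfl⟩ := hq
        exact (congrFun h.2 p).trans (congrFun h1 p).symm
      · rw [h.1 q hq, h0 q hq])
    rw [h2, mul_zero]
  · intro h
    exact absurd (Finset.mem_univ _) h

/-- States which are Pauli deviations of an encoded padded state. -/
theorem isPauliDeviation_of_xz {D : DecoratedCode V} {e : D.Phys ↪ Q} {P : Type} [Fintype P]
    [DecidableEq P] {i : P ↪ D.Log} {ρ : Matrix (Bits P × R) (Bits P × R) ℂ}
    {σ : HybridState Q R M} {C : Matrix (Bits D.Phys) (Bits P) ℂ} {k c : ℂ} (hk : k ≠ 0)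
    (hC : D.enc * padMat i = k • C) {α β α' β' : Bits D.Phys}
    (hσ : partialTrace e σ = c • sandwich ρ (xz α β * C) (xz α' β' * C))
    (hbad : Avoids D.bad (D.loc '' {q | α q ≠ 0 ∨ β q ≠ 0 ∨ α' q ≠ 0 ∨ β' q ≠ 0})) :
    IsPauliDeviation D e (onLeft (padZero i) ρ) σ := by
  rw [isPauliDeviation_iff]
  refine ⟨(fun q => Pauli.ofBits (α q) (β q), fun q => Pauli.ofBits (α' q) (β' q)), ?_, ?_⟩
  · intro S hS hS'
    refine hbad S hS (hS'.trans (Set.image_mono ?_))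
    rintro q (h | h)
    · rcases Pauli.ofBits_ne_I h with h | h
      · exact Or.inl h
      · exact Or.inr (Or.inl h)
    · rcases Pauli.ofBits_ne_I h with h | h
      · exact Or.inr (Or.inr (Or.inl h))
      · exact Or.inr (Or.inr (Or.inr h))
  · obtain ⟨s, hs⟩ := xz_eq_pauliString α β
    obtain ⟨s', hs'⟩ := xz_eq_pauliString α' β'
    have hC' : C = k⁻¹ • (D.enc * padMat i) := by rw [hC, smul_smul, inv_mul_cancel₀ hk, one_smul]
    refine ⟨c * (s * k⁻¹ * star (s' * k⁻¹)), ?_⟩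
    have h1 := sandwich_mul ρ (padMat i) (padMat i)
      (pauliString (fun q => Pauli.ofBits (α q) (β q)) * D.enc)
      (pauliString (fun q => Pauli.ofBits (α' q) (β' q)) * D.enc)
    rw [hσ, onLeft_padZero, hC', hs, hs', Matrix.smul_mul, Matrix.smul_mul, Matrix.mul_smul,
      Matrix.mul_smul, smul_smul, smul_smul, sandwich_smul, smul_smul]
    congr 1
    rw [Matrix.mul_assoc (pauliString _), Matrix.mul_assoc (pauliString _) D.enc] at h1
    exact h1.symm

end Deviations

/-! ### The encoding maps of the two codes -/

section Encodings

variable {d : ℕ} {A : BasedComplex d} {B : BasedComplex 1} {L : Finset B.Cell} {w m j : ℕ}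
  {V : Type} {G : SimpleGraph V} {φ : A.Cell × B.Cell → V} {η : ℝ} (EA : EncMap A)

variable (L) in
/-- The cocycles of the copies, labelled by `L`, of level `j` of `A` which encode given bits. -/
def copiesEncode (j : ℕ) (u : Bits (EA.LevelIdx j × L)) : A.Cell × B.Cell → ZMod 2 :=
  fun c => if h : c.2 ∈ L then EA.encode j (fun q => u (q, ⟨c.2, h⟩)) c.1 else 0

theorem copiesEncode_of_mem (u : Bits (EA.LevelIdx j × L)) (a : A.Cell) {b : B.Cell} (h : b ∈ L) :
    copiesEncode L EA j u (a, b) = EA.encode j (fun q => u (q, ⟨b, h⟩)) a := dif_pos h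

theorem onInput_copiesEncode (u : Bits (EA.LevelIdx j × L)) :
    OnInput A B L j (copiesEncode L EA j u) := by
  rintro ⟨a, b⟩ hc
  by_cases h : b ∈ L
  · rw [copiesEncode_of_mem EA u a h] at hc
    refine ⟨?_, h⟩
    by_contra h'
    exact hc ((EA.encode_mem j _).1 a h')
  · exact absurd (dif_neg h) hc

theorem opLeft_copiesEncode (u : Bits (EA.LevelIdx j × L)) :
    opLeft A.coboundary (copiesEncode L EA j u) = 0 := by
  funext c
  obtain ⟨a, b⟩ := c
  rw [opLeft_apply]
  by_cases h : b ∈ L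
  · have e : (fun a => copiesEncode L EA j u (a, b)) = EA.encode j (fun q => u (q, ⟨b, h⟩)) :=
      funext fun a => copiesEncode_of_mem EA u a h
    rw [e]
    exact congrFun (EA.encode_mem j _).2 a
  · have e : (fun a => copiesEncode L EA j u (a, b)) = 0 := funext fun a => dif_neg h
    rw [e, map_zero]
    rfl

namespace IsSwitching

/-- The qubits of the copies of the input code among the data qubits. -/
def inputCells (h : IsSwitching A B L w m j G φ η) :
    A.LevelCell j × L ↪ Subtype (IsDataCell A B j) where
  toFun := fun p => ⟨(p.1.1, p.2.1), by
    have h1 := h.deg_of_mem p.2.2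
    have h2 := p.1.2
    simp only [IsDataCell]
    omega⟩
  inj' := by
    rintro ⟨a, l⟩ ⟨a', l'⟩ hp
    have h1 := Prod.mk.inj (congrArg Subtype.val hp)
    exact Prod.ext (Subtype.ext h1.1) (Subtype.ext h1.2)

theorem notMem_range_inputCells (h : IsSwitching A B L w m j G φ η)
    (q : Subtype (IsDataCell A B j)) : q ∉ Set.range h.inputCells ↔ q.1.2 ∉ L := by
  refine not_congr ⟨?_, fun hq => ?_⟩
  · rintro ⟨p, rfl⟩
    exact p.2.2
  · have h1 := h.deg_of_mem hq
    have h2 : A.deg q.1.1 + B.deg q.1.2 = j + 1 := q.2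
    exact ⟨(⟨q.1.1, by omega⟩, ⟨q.1.2, hq⟩), rfl⟩

/-- The encoding isometry of the copies, in terms of stabilizers on the data qubits. -/
theorem isometry_copies (h : IsSwitching A B L w m j G φ η)
    [DecidablePred (· ∈ inputCoboundaries A B L j)]
    {y : Bits (Subtype (IsDataCell A B j))} {u : Bits (EA.LevelIdx j × L)}
    (hy : ∀ q, q ∉ Set.range h.inputCells → y q = 0) :
    ∏ l, EA.isometry j (fun p => (y ∘ h.inputCells) (p, l)) (fun q => u (q, l)) =
      if y + restrictTo _ (copiesEncode L EA j u) ∈ inputCoboundaries A B L j then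
        (((Real.sqrt (Nat.card (A.coboundaries j)))⁻¹ : ℝ) : ℂ) ^ Fintype.card L else 0 := by
  classical
  have hj : j = (j - 1) + 1 := by
    have := h.one_le
    omega
  set D : A.Cell × B.Cell → ZMod 2 := extendZero _ y + copiesEncode L EA j u with hD
  have hslice : ∀ l : L, A.extend j (fun p => (y ∘ h.inputCells) (p, l)) -
      EA.encode j (fun q => u (q, l)) = fun a => D (a, l.1) := by
    intro l
    funext a
    rw [Pi.sub_apply, CharTwo.sub_eq_add, hD, Pi.add_apply, copiesEncode_of_mem EA u a l.2]
    congr 1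
    have hl := h.deg_of_mem l.2
    by_cases ha : A.deg a = j
    · rw [extend, dif_pos ha, extendZero_of_pos (p := IsDataCell A B j) y (c := (a, l.1))
        (by simp only [IsDataCell]; omega)]
      rfl
    · rw [extend, dif_neg ha, extendZero_of_neg (p := IsDataCell A B j) y (c := (a, l.1))
        (by simp only [IsDataCell]; omega)]
  have hcob : ∀ f, f ∈ A.coboundaries j ↔ ∃ x ∈ A.level (j - 1), A.coboundary x = f := by
    intro f
    rw [hj]
    rfl
  have hiff : (∀ l : L, A.extend j (fun p => (y ∘ h.inputCells) (p, l)) -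
      EA.encode j (fun q => u (q, l)) ∈ A.coboundaries j) ↔
      y + restrictTo _ (copiesEncode L EA j u) ∈ inputCoboundaries A B L j := by
    simp only [hslice, hcob]
    constructor
    · intro hx
      choose x hx hx' using hx
      let X : A.Cell × B.Cell → ZMod 2 := fun c => if hc : c.2 ∈ L then x ⟨c.2, hc⟩ c.1 else 0
      have hX : ∀ c, X c ≠ 0 → A.deg c.1 + 1 = j ∧ c.2 ∈ L := by
        intro c hc
        by_cases hcL : c.2 ∈ L
        · refine ⟨?_, hcL⟩
          have h1 : X c = x ⟨c.2, hcL⟩ c.1 := dif_pos hcL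
          rw [h1] at hc
          have h2 : A.deg c.1 = j - 1 := by
            by_contra h2
            exact hc (hx _ _ h2)
          omega
        · exact absurd (dif_neg hcL) hc
      refine ⟨X, hX, funext fun q => ?_⟩
      obtain ⟨⟨a, b⟩, hq⟩ := q
      by_cases hb : b ∈ L
      · have e : (fun a => X (a, b)) = x ⟨b, hb⟩ := funext fun a => dif_pos hb
        rw [restrictTo_apply, opLeft_apply, e, hx', Pi.add_apply, restrictTo_apply, hD]
        change _ = extendZero _ y (a, b) + _
        rw [extendZero_of_pos y hq]
      · have h1 := onInput_opLeft hX (a, b)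
        rw [Pi.add_apply, hy _ ((h.notMem_range_inputCells _).2 hb), restrictTo_apply,
          restrictTo_apply, zero_add]
        have h2 : copiesEncode L EA j u (a, b) = 0 := dif_neg hb
        rw [h2]
        by_contra h3
        exact hb (h1 (Ne.symm h3)).2
    · rintro ⟨x, hx, hx'⟩ l
      refine ⟨fun a => x (a, l.1), fun a ha => ?_, funext fun a => ?_⟩
      · by_contra h1
        have h2 := (hx _ h1).1
        simp only at h2
        omega
      · rw [← opLeft_apply A.coboundary x a l.1]
        have hl := h.deg_of_mem l.2
        by_cases ha : IsDataCell A B j (a, l.1)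
        · have h1 := congrFun hx' ⟨_, ha⟩
          rw [restrictTo_apply] at h1
          rw [← h1, hD, Pi.add_apply, Pi.add_apply, extendZero_of_pos y ha, restrictTo_apply]
        · have ha' : A.deg a ≠ j := fun h1 => ha (by simp only [IsDataCell]; omega)
          have h1 : opLeft A.coboundary x (a, l.1) = 0 := by
            by_contra h1
            exact ha' (onInput_opLeft hx _ h1).1
          have h2 : copiesEncode L EA j u (a, l.1) = 0 := by
            by_contra h2
            exact ha' (onInput_copiesEncode EA u _ h2).1
          rw [h1, hD, Pi.add_apply, extendZero_of_neg y ha, h2, add_zero]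
  simp only [EncMap.isometry]
  rw [Finset.prod_ite_zero]
  simp only [Finset.mem_univ, true_implies, Finset.prod_const, Finset.card_univ]
  exact if_congr hiff rfl rfl

/-- The encoding isometry of the new code on padded states. -/
theorem exists_isometry_mul_padMat (h : IsSwitching A B L w m j G φ η) {E : EncMap (A.tensor B)}
    (i : EA.LevelIdx j × L ↪ E.LevelIdx (j + 1)) (hi : ∀ p (c : A.Cell × B.Cell),
      E.rep (i p).1 c = EA.rep p.1.1 c.1 * (Pi.single p.2.1 1 : B.Cell → ZMod 2) c.2) :
    ∃ k : ℂ, k ≠ 0 ∧ E.isometry (j + 1) * padMat i =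
      k • cosetMat (Dt := Subtype (IsDataCell A B j))
        (LinearMap.range (Matrix.vecMulLinear (matXCheck A B j)))
        fun u => restrictTo _ (copiesEncode L EA j u) := by
  classical
  refine ⟨(((Real.sqrt (Nat.card ((A.tensor B).coboundaries (j + 1))))⁻¹ : ℝ) : ℂ), ?_, ?_⟩
  · have : 0 < Nat.card ((A.tensor B).coboundaries (j + 1)) := Nat.card_pos
    have h2 : Real.sqrt (Nat.card ((A.tensor B).coboundaries (j + 1))) ≠ 0 :=
      (Real.sqrt_pos.2 (by exact_mod_cast this)).ne'
    exact_mod_cast inv_ne_zero h2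
  ext y u
  let y₀ : Bits (E.LevelIdx (j + 1)) := fun q => if hq : ∃ p, i p = q then u hq.choose else 0
  have hy₀ : ∀ p, y₀ (i p) = u p := by
    intro p
    have hp : ∃ p', i p' = i p := ⟨p, rfl⟩
    have h1 : y₀ (i p) = u hp.choose := dif_pos hp
    rw [h1, i.injective hp.choose_spec]
  have hy₀' : ∀ q ∉ Set.range i, y₀ q = 0 := fun q hq => dif_neg hq
  have henc : E.encode (j + 1) y₀ = copiesEncode L EA j u := by
    funext c
    obtain ⟨a, b⟩ := c
    have h1 : E.encode (j + 1) y₀ (a, b) = ∑ q, y₀ q * E.rep q.1 (a, b) :=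
      Finset.sum_apply (a, b) _ _
    rw [h1, ← Finset.sum_subset (Finset.subset_univ (Finset.univ.map i)), Finset.sum_map,
      Fintype.sum_prod_type]
    swap
    · intro q _ hq
      rw [hy₀', zero_mul]
      rintro ⟨p, hp⟩
      exact hq (Finset.mem_map.2 ⟨p, Finset.mem_univ p, hp⟩)
    have h2 : ∀ (q : EA.LevelIdx j) (l : L), y₀ (i (q, l)) * E.rep (i (q, l)).1 (a, b) =
        if l.1 = b then u (q, l) * EA.rep q.1 a else 0 := by
      intro q l
      have h3 : E.rep (i (q, l)).1 (a, b) =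
          EA.rep q.1 a * (Pi.single l.1 1 : B.Cell → ZMod 2) b := hi _ _
      rw [hy₀, h3]
      by_cases hlb : l.1 = b
      · rw [if_pos hlb, hlb, Pi.single_eq_same, mul_one]
      · rw [if_neg hlb, Pi.single_eq_of_ne (Ne.symm hlb), mul_zero, mul_zero]
    simp only [h2]
    by_cases hb : b ∈ L
    · rw [copiesEncode_of_mem EA u a hb, EncMap.encode, Finset.sum_apply]
      refine Finset.sum_congr rfl fun q _ => ?_
      rw [Finset.sum_eq_single ⟨b, hb⟩, if_pos rfl]
      · rfl
      · intro l _ hl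
        exact if_neg fun h3 => hl (Subtype.ext h3)
      · intro h3
        exact absurd (Finset.mem_univ _) h3
    · have h3 : copiesEncode L EA j u (a, b) = 0 := dif_neg hb
      rw [h3]
      refine Finset.sum_eq_zero fun q _ => Finset.sum_eq_zero fun l _ => if_neg ?_
      rintro rfl
      exact hb l.2
  rw [mul_padMat_apply i _ y hy₀' (funext hy₀)]
  have hiff : ∀ y : Subtype (IsDataCell A B j) → ZMod 2, (A.tensor B).extend (j + 1) y - E.encode (j + 1) y₀ ∈
      (A.tensor B).coboundaries (j + 1) ↔
      y + restrictTo _ (copiesEncode L EA j u) ∈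
        LinearMap.range (Matrix.vecMulLinear (matXCheck A B j)) := by
    intro y
    have h1 : (A.tensor B).extend (j + 1) y - E.encode (j + 1) y₀ =
        extendZero (IsDataCell A B j) (y + restrictTo _ (copiesEncode L EA j u)) := by
      rw [map_add, h.extendZero_onInput (onInput_copiesEncode EA u), henc]
      funext c
      exact CharTwo.sub_eq_add _ _
    rw [h1]
    constructor
    · rintro ⟨x, hx, hx'⟩
      have h2 := mem_range_matXCheck (A := A) (B := B) hx
      have h3 : delC A B x = extendZero (IsDataCell A B j)
        (y + restrictTo _ (copiesEncode L EA j u)) := hx'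
      rwa [h3, restrictTo_extendZero] at h2
    · rintro ⟨k, hk⟩
      refine ⟨extendZero (X := A.Cell × B.Cell) (IsXCheckCell A B j) k, extendZero_xCheck_mem k, ?_⟩
      rw [← hk, vecMul_matXCheck, extendZero_restrictTo
        (isDataCell_of_mem (delC_mem_level (extendZero_xCheck_mem k)))]
      rfl
  change (if _ then _ else _) = _ * (if _ then (1 : ℂ) else 0)
  rw [mul_ite, mul_one, mul_zero]
  exact if_congr (hiff y) rfl rfl

end IsSwitching

end Encodings

/-! ### Fault tolerance of the circuit -/

section FaultTolerance

variable {d : ℕ} {A : BasedComplex d} {B : BasedComplex 1} {L : Finset B.Cell} {w m j : ℕ}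
  {V : Type} {G : SimpleGraph V} {η γ₀ γ₁ : ℝ} (EA : EncMap A)

/-- The qubits with an error after faults in `E` have spread during two stages of controlled NOTs. -/
def spreadTwice {N : ℕ} (e : Qubit A B L j ≃ Fin N) (E : Set (Fin N)) : Set (Fin N) :=
  {i | i ∈ {i | i ∈ E ∨ ∃ k ∈ E, NearBy A B (e.symm k).cell (e.symm i).cell} ∨
    ∃ k ∈ {i | i ∈ E ∨ ∃ k ∈ E, NearBy A B (e.symm k).cell (e.symm i).cell},
      NearBy A B (e.symm k).cell (e.symm i).cell}

theorem subset_spreadTwice {N : ℕ} (e : Qubit A B L j ≃ Fin N) (E : Set (Fin N)) :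
    E ⊆ spreadTwice e E := fun _ hi => Or.inl (Or.inl hi)

namespace IsSwitching

/-- There are corrections for which one side of the final state is, up to a sparse Pauli error, the
encoded state. -/
theorem exists_corrections {φ : A.Cell × B.Cell → V} (h : IsSwitching A B L w m j G φ η)
    (hγ : IsCorrectable w γ₀ γ₁) {N : ℕ} (e : Qubit A B L j ≃ Fin N)
    [DecidablePred (· ∈ Set.range (h.inputCells.trans (dataQubits e)))] {C₁ C₂ : CnotStage N}
    (hC₁ : C₁.edges = edgesOfWeight e (weightZ (matInput A B L j) (matGauge A B L j)))
    (hC₂ : C₂.edges = edgesOfWeight e (weightX (matXCheck A B j)))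
    {n : ℕ} (hn₁ : ∀ p ∈ C₁.edges, C₁.colour p < n) (hn₂ : ∀ p ∈ C₂.edges, C₂.colour p < n)
    {enc : Matrix (Bits (A.LevelCell j × L)) (Bits (EA.LevelIdx j × L)) ℂ}
    (henc : ∀ y u, enc y u =
      ∏ l, EA.isometry j (fun p => y (p, l)) (fun q => u (q, l))) :
    ∃ (corrX : Bits (Subtype (IsZCheckCell A B j)) → Bits (Subtype (IsDataCell A B j)))
      (corrZ : Bits (Subtype (IsGaugeCell A B L j)) → Bits (Subtype (IsXCheckCell A B j)) →
        Bits (Subtype (IsDataCell A B j))),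
      ∀ (E : Set (Fin N)) (F : ℕ → Fin N → Pauli) (Q : A.LevelCell j × L → Pauli),
        (∀ t q, F t q ≠ .I → q ∈ E) →
        Sparse G η γ₁ (φ '' ((fun i => (e.symm i).cell) '' spreadTwice e E)) →
        (∀ l : L, Sparse A.connGraph η γ₀ {a | ∃ ha, Q (⟨a, ha⟩, l) ≠ .I}) →
        ∃ α β : Bits (Subtype (IsDataCell A B j)),
          Sparse G η (γ₁ + (residualRate w γ₁ + residualRate w γ₁))
            (φ '' (Subtype.val '' {q | α q ≠ 0 ∨ β q ≠ 0})) ∧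
          ∀ x, ∃ χ : Bits (Subtype (IsGaugeCell A B L j)) → Bits (Subtype (IsZCheckCell A B j)) →
              Bits (Subtype (IsXCheckCell A B j)) → ℂ, ∀ y u,
            finalKet e C₁ C₂ corrX corrZ n F
              (initMat (h.inputCells.trans (dataQubits e)) (fun i => StartsPlus (e.symm i)) *
                (pauliString Q * enc)) x y u =
            χ (partG e y) (partS e y) (partK e y) *
              (xz α β * cosetMat (LinearMap.range (Matrix.vecMulLinear (matXCheck A B j)))
                fun u => restrictTo _ (copiesEncode L EA j u)) (partD e y) u := by
  classical
  obtain ⟨corrX, hX⟩ := h.exists_decoder_X hγ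
  obtain ⟨corrZ, hZ⟩ := h.exists_decoder_Z hγ
  refine ⟨corrX, corrZ, fun E F Q hF hS hQ => ?_⟩
  have hmem : ∀ (W : Qubit A B L j → Qubit A B L j → ZMod 2) (p : Fin N × Fin N),
      p ∈ edgesOfWeight e W → W (e.symm p.1) (e.symm p.2) ≠ 0 :=
    fun W p hp => (Finset.mem_filter.1 hp).2
  obtain ⟨a, b, p, q, hab, hpq, hfin⟩ := exists_finalKet_eq
    (Λ := Bits (EA.LevelIdx j × L)) e (matInput A B L j)
    (matGauge A B L j) (matXCheck A B j) hC₁ hC₂ hn₁ hn₂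
    (Nb := fun i k => NearBy A B (e.symm i).cell (e.symm k).cell)
    (fun p hp => by
      have h1 := nearBy_of_weightZ h (hmem _ p (hC₁ ▸ hp))
      exact ⟨h1, h1.symm⟩)
    (fun p hp => by
      have h1 := nearBy_of_weightX h (hmem _ p (hC₂ ▸ hp))
      exact ⟨h1, h1.symm⟩) hF
  have hBsP : ∀ f ∈ inputCoboundaries A B L j, ∀ q, q ∉ Set.range h.inputCells → f q = 0 :=
    fun f hf q hq => inputCoboundaries_apply hf q ((h.notMem_range_inputCells q).1 hq)
  have hvL : ∀ (u : Bits (EA.LevelIdx j × L)) (q : Subtype (IsDataCell A B j)), q.1.2 ∉ L →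
      restrictTo (IsDataCell A B j) (copiesEncode L EA j u) q = 0 := fun u q hq => dif_neg hq
  obtain ⟨c, K, hK, hinit⟩ := exists_initMat_mul_eq e h.inputCells (enc := enc)
    (Bs := inputCoboundaries A B L j)
    (v := fun u => restrictTo (IsDataCell A B j) (copiesEncode L EA j u)) hBsP
    (fun u q hq => hvL u q ((h.notMem_range_inputCells q).1 hq))
    (fun y u hy => (henc _ u).trans (h.isometry_copies EA hy)) Q
  set ex : Bits (Subtype (IsDataCell A B j)) :=
    fun q => if h' : ∃ i, h.inputCells i = q then (Q h'.choose).xBit else 0 with hex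
  set ez : Bits (Subtype (IsDataCell A B j)) :=
    fun q => if h' : ∃ i, h.inputCells i = q then (Q h'.choose).zBit else 0 with hez
  -- the errors on the input
  have hin : ∀ f : Bits (Subtype (IsDataCell A B j)),
      (∀ q, f q ≠ 0 → ∃ i, h.inputCells i = q ∧ Q i ≠ .I) →
      OnInput A B L j (extendZero _ f) ∧ CopySparse A B L η γ₀ (extendZero _ f) := by
    intro f hf
    have h1 : ∀ c, extendZero (IsDataCell A B j) f c ≠ 0 →
        ∃ i : A.LevelCell j × L, c = (i.1.1, i.2.1) ∧ Q i ≠ .I := by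
      intro c hc
      have hcd := of_extendZero_ne_zero hc
      rw [extendZero_of_pos f hcd] at hc
      obtain ⟨i, hi, hi'⟩ := hf _ hc
      exact ⟨i, (congrArg Subtype.val hi).symm, hi'⟩
    refine ⟨fun c hc => ?_, fun l hl => (hQ ⟨l, hl⟩).mono (fun a ha => ?_) le_rfl⟩
    · obtain ⟨i, rfl, _⟩ := h1 c hc
      exact ⟨i.1.2, i.2.2⟩
    · obtain ⟨⟨⟨a', ha'⟩, l'⟩, h2, h3⟩ := h1 _ ha
      obtain ⟨rfl, rfl⟩ := Prod.mk.inj h2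
      exact ⟨ha', h3⟩
  have hexQ : ∀ q, ex q ≠ 0 → ∃ i, h.inputCells i = q ∧ Q i ≠ .I := by
    intro q hq
    by_cases h' : ∃ i, h.inputCells i = q
    · have h1 : ex q = (Q h'.choose).xBit := dif_pos h'
      exact ⟨h'.choose, h'.choose_spec, Pauli.ne_I_of_bit (Or.inl (h1 ▸ hq))⟩
    · exact absurd (dif_neg h') hq
  have hezQ : ∀ q, ez q ≠ 0 → ∃ i, h.inputCells i = q ∧ Q i ≠ .I := by
    intro q hq
    by_cases h' : ∃ i, h.inputCells i = q
    · have h1 : ez q = (Q h'.choose).zBit := dif_pos h'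
      exact ⟨h'.choose, h'.choose_spec, Pauli.ne_I_of_bit (Or.inr (h1 ▸ hq))⟩
    · exact absurd (dif_neg h') hq
  obtain ⟨hex1, hex2⟩ := hin ex hexQ
  obtain ⟨hez1, hez2⟩ := hin ez hezQ
  -- the errors of the circuit
  have hreg : ∀ {r : A.Cell × B.Cell → Prop} [DecidablePred r] (f : Subtype r → ZMod 2)
      (ι : Subtype r → Fin N), (∀ c, (e.symm (ι c)).cell = c.1) →
      (∀ c, f c ≠ 0 → ι c ∈ spreadTwice e E) →
      Sparse G η γ₁ (φ '' {c | extendZero r f c ≠ 0}) := by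
    intro r _ f ι hι hf
    refine hS.mono (Set.image_mono fun c hc => ?_) le_rfl
    have hcr := of_extendZero_ne_zero hc
    refine ⟨ι ⟨c, hcr⟩, hf _ ?_, hι _⟩
    change extendZero r f c ≠ 0 at hc
    rwa [extendZero_of_pos f hcr] at hc
  obtain ⟨fX, hfX, hfX'⟩ := hX ex (partS e a) hex1 hex2
    (hreg _ (fun s => e (.inr (.inr (.inl s)))) (fun s => by simp [Qubit.cell])
      fun s hs => hab _ (Or.inl hs))
  obtain ⟨fZ, hfZ, hfZ'⟩ := hZ ez (partG e b) (partK e b) hez1 hez2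
    (hreg _ (fun g => e (.inr (.inl g))) (fun s => by simp [Qubit.cell])
      fun s hs => hab _ (Or.inr hs))
    (hreg _ (fun k => e (.inr (.inr (.inr k)))) (fun s => by simp [Qubit.cell])
      fun s hs => hab _ (Or.inr hs))
  refine ⟨partD e a + partD e p + fX, partD e b + partD e q + fZ, ?_, fun x => ?_⟩
  · refine (hS.union (hfX.union hfZ)).mono ?_ le_rfl
    rintro _ ⟨_, ⟨s, hs, rfl⟩, rfl⟩
    have hfs : ∀ f : Bits (Subtype (IsDataCell A B j)), f s ≠ 0 →
        φ s.1 ∈ φ '' {c | extendZero (IsDataCell A B j) f c ≠ 0} := by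
      intro f hf
      refine ⟨s.1, ?_, rfl⟩
      change extendZero _ f s.1 ≠ 0
      rwa [extendZero_of_pos f s.2]
    have hcell : (e.symm (e (.inl s))).cell = s.1 := by simp [Qubit.cell]
    by_cases h1 : fX s = 0
    · by_cases h2 : fZ s = 0
      · refine Or.inl ⟨s.1, ⟨e (.inl s), ?_, hcell⟩, rfl⟩
        have h3 : ∀ z z' : ZMod 2, z + z' + 0 ≠ 0 → z ≠ 0 ∨ z' ≠ 0 := by decide
        rcases hs with hs | hs
        · rw [Pi.add_apply, Pi.add_apply, h1] at hs
          rcases h3 _ _ hs with h4 | h4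
          · exact hab _ (Or.inl h4)
          · exact subset_spreadTwice e E (hpq _ (Or.inl h4))
        · rw [Pi.add_apply, Pi.add_apply, h2] at hs
          rcases h3 _ _ hs with h4 | h4
          · exact hab _ (Or.inr h4)
          · exact subset_spreadTwice e E (hpq _ (Or.inr h4))
      · exact Or.inr (Or.inr (hfs fZ h2))
    · exact Or.inr (Or.inl (hfs fX h1))
  · have hvOn : ∀ u : Bits (EA.LevelIdx j × L), extendZero (IsDataCell A B j)
        (restrictTo (IsDataCell A B j) (copiesEncode L EA j u)) = copiesEncode L EA j u :=
      fun u => h.extendZero_onInput (onInput_copiesEncode EA u)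
    obtain ⟨χ, hχ⟩ := exists_corrected_apply e (matInput A B L j) (matGauge A B L j)
      (matXCheck A B j) (P := fun q => q.1.2 ∈ L) (fX := fX) (fZ := fZ)
      (a := a) (b := b) (p := p) (q := q) (corrX := corrX) (corrZ := corrZ) hK
      (fun u => h.vecMul_matInput_mem_range (onInput_copiesEncode EA u) (opLeft_copiesEncode EA u))
      (fun f hf => h.vecMul_matInput_of_mem hf) h.vecMul_matXCheck_mem h.inputCoboundaries_le
      (fun f hf => inputCoboundaries_apply hf) hvL
      (fun q hq => by
        by_contra h1
        obtain ⟨i, rfl, _⟩ := hexQ q h1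
        exact hq i.2.2)
      hfX'
      (fun z κ y ω h1 h2 h3 => by
        obtain ⟨h4, h5⟩ := hfZ' z κ y ω h1 h2 h3
        refine ⟨h4, fun u => h5 _ ?_ ?_⟩
        · rw [hvOn]
          exact onInput_copiesEncode EA u
        · rw [hvOn]
          exact opLeft_copiesEncode EA u) x
    obtain ⟨c', hc'⟩ := hfin corrX corrZ (c • K) x
    refine ⟨fun g s k => c' * c * χ g s k, fun y u => ?_⟩
    rw [hinit, hc']
    simp only [Matrix.mul_smul, Matrix.smul_apply, smul_eq_mul]
    rw [hχ]
    ring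

end IsSwitching

end FaultTolerance

open IsSwitching

/-! ### The gadget -/

section Switching

variable {d : ℕ} {A : BasedComplex d} {B : BasedComplex 1} {L : Finset B.Cell} {w m j : ℕ}
  {V : Type} {G : SimpleGraph V} {η γ : ℝ} (EA : EncMap A)

/-- The rate of the errors spread in the circuit by faults of rate `γ`. -/
def spreadRate (w : ℕ) (γ : ℝ) : ℝ := circuitRate w (1 + 2 * w + 2 * w + 1 + 1 + 1) γ

/-- The rate of the errors on the output for faults of rate `γ`. -/
def outputRate (w : ℕ) (γ : ℝ) : ℝ :=
  2 * (spreadRate w γ + (residualRate w (spreadRate w γ) + residualRate w (spreadRate w γ)))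

theorem spreadRate_eq (w : ℕ) (γ : ℝ) : spreadRate w γ = spreadRate w 1 * γ := by
  unfold spreadRate circuitRate
  ring

theorem residualRate_mul (w : ℕ) (x γ : ℝ) : residualRate w (x * γ) = residualRate w x * γ := by
  unfold residualRate
  ring

theorem outputRate_eq (w : ℕ) (γ : ℝ) : outputRate w γ = outputRate w 1 * γ := by
  unfold outputRate
  rw [spreadRate_eq w γ, residualRate_mul]
  ring

theorem spreadRate_pos (w : ℕ) {γ : ℝ} (hγ : 0 < γ) : 0 < spreadRate w γ := by
  unfold spreadRate circuitRate
  positivity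

theorem residualRate_pos (w : ℕ) {γ : ℝ} (hγ : 0 < γ) : 0 < residualRate w γ := by
  unfold residualRate
  positivity

theorem outputRate_pos (w : ℕ) {γ : ℝ} (hγ : 0 < γ) : 0 < outputRate w γ := by
  have h1 := spreadRate_pos w hγ
  have h2 := residualRate_pos w h1
  unfold outputRate
  positivity

/-- Sufficiently rare errors can be corrected. -/
theorem exists_isCorrectable (w : ℕ) :
    ∃ γ₀ : ℝ, 0 < γ₀ ∧ ∀ γ, 0 < γ → γ ≤ γ₀ → IsCorrectable w γ (spreadRate w γ) := by
  set r := residualRate w (spreadRate w 1) with hr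
  have hr0 : 0 < r := residualRate_pos w (spreadRate_pos w one_pos)
  set K : ℝ := 2 * (1 + (r + 2 * (1 + w) * r)) * (1 + w) with hK
  have hK0 : 0 < K := by positivity
  refine ⟨1 / K, by positivity, fun γ hγ hγK => ⟨hγ.le, (spreadRate_pos w hγ).le, ?_⟩⟩
  rw [spreadRate_eq, residualRate_mul, ← hr]
  have h1 : K * γ ≤ 1 := by
    rw [le_div_iff₀ hK0] at hγK
    linarith
  calc _ = K * γ := by rw [hK]; ring
    _ ≤ 1 := h1

/-- The time of the circuit. -/
abbrev gadgetTime (w : ℕ) : ℕ := 1 + 2 * w + 2 * w + 1 + 1 + 1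

/-- The circuit maps Pauli deviations of the encoded states of the copies to Pauli deviations of the
encoded states of the new code. -/
theorem IsSwitching.exists_circuit {φ : A.Cell × B.Cell ↪ V} (h : IsSwitching A B L w m j G φ η)
    (hγ0 : 0 < γ) (hγ : IsCorrectable w γ (spreadRate w γ)) {N : ℕ} (e : Qubit A B L j ≃ Fin N)
    {enc : Matrix (Bits (A.LevelCell j × L)) (Bits (EA.LevelIdx j × L)) ℂ}
    (henc : ∀ y u, enc y u = ∏ l, EA.isometry j (fun p => y (p, l)) (fun q => u (q, l))) :
    ∃ 𝒬 : AdaptiveCircuit N N (gadgetTime w), ∀ (ℓ : ℕ)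
      (ρ : Matrix (Bits (EA.LevelIdx j × L) × Bits (Fin ℓ)) (Bits (EA.LevelIdx j × L) × Bits (Fin ℓ)) ℂ)
      (σ : HybridState (Fin N) (Bits (Fin ℓ)) N) (P : PauliPair (A.LevelCell j × L))
      (F : Fin (gadgetTime w) → PauliPair (Fin N)),
      (∀ l : L, Sparse A.connGraph η γ {a | ∃ ha, (⟨a, ha⟩, l) ∈ P.support}) →
      (∃ c : ℂ, partialTrace (h.inputCells.trans (dataQubits e)) σ =
        c • sandwich ρ (pauliString P.1 * enc) (pauliString P.2 * enc)) →
      Avoids (disjPow (disjPow (badSets G η γ) (Fin 4)) (Fin (gadgetTime w)))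
        {p | ∃ q, ((qubitLocation e).trans (φ.prodMap (Function.Embedding.refl (Fin 4)))) q = p.1 ∧
          q ∈ (F p.2).support} →
      ∃ (α β α' β' : Bits (Subtype (IsDataCell A B j))) (c : ℂ),
        Sparse G η (outputRate w γ)
          (φ '' (Subtype.val '' {q | α q ≠ 0 ∨ β q ≠ 0 ∨ α' q ≠ 0 ∨ β' q ≠ 0})) ∧
        partialTrace (dataQubits e) (𝒬.run F σ) = c • sandwich ρ
          (xz α β * cosetMat (LinearMap.range (Matrix.vecMulLinear (matXCheck A B j)))
            fun u => restrictTo _ (copiesEncode L EA j u))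
          (xz α' β' * cosetMat (LinearMap.range (Matrix.vecMulLinear (matXCheck A B j)))
            fun u => restrictTo _ (copiesEncode L EA j u)) := by
  classical
  obtain ⟨C₁, hC₁, hn₁⟩ := h.exists_stageZ e
  obtain ⟨C₂, hC₂, hn₂⟩ := h.exists_stageX e
  obtain ⟨corrX, corrZ, hcorr⟩ := h.exists_corrections EA hγ e hC₁ hC₂ hn₁ hn₂ henc
  refine ⟨circuitOfLayers (gadgetLayers e h.inputCells C₁ C₂ corrX corrZ (2 * w)) _,
    fun ℓ ρ σ P F hP hc hF => ?_⟩
  obtain ⟨F', hF'⟩ : ∃ F' : ℕ → PauliPair (Fin N), ∀ t, F' t =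
      if ht : t < gadgetTime w then F ⟨t, ht⟩ else (fun _ => .I, fun _ => .I) := ⟨_, fun _ => rfl⟩
  have hFF' : F = fun t : Fin (gadgetTime w) => F' t := by
    funext t
    rw [hF', dif_pos t.2]
  let S : Set (Fin N) := {q | ∃ t, q ∈ (F t).support}
  have hS : ∀ t q, (F' t).1 q ≠ .I ∨ (F' t).2 q ≠ .I → q ∈ S := by
    intro t q hq
    rw [hF'] at hq
    by_cases ht : t < gadgetTime w
    · rw [dif_pos ht] at hq
      exact ⟨⟨t, ht⟩, hq⟩
    · rw [dif_neg ht] at hq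
      rcases hq with hq | hq <;> exact absurd rfl hq
  have hsparse := h.sparse_spread e hγ0 (T := gadgetTime w) (Nat.succ_pos _) hF (E := S)
    (E₂ := spreadTwice e S) (fun i hi => hi) (fun i hi => hi) (fun i hi => hi)
  obtain ⟨α, β, hαβ, hfin⟩ := hcorr S (fun t => (F' t).1) P.1 (fun t q hq => hS t q (Or.inl hq))
    hsparse fun l => (hP l).mono (fun a ⟨ha, hap⟩ => ⟨ha, Or.inl hap⟩) le_rfl
  obtain ⟨α', β', hαβ', hfin'⟩ := hcorr S (fun t => (F' t).2) P.2
    (fun t q hq => hS t q (Or.inr hq)) hsparse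
    fun l => (hP l).mono (fun a ⟨ha, hap⟩ => ⟨ha, Or.inr hap⟩) le_rfl
  have htr := tracks_gadget e h.inputCells C₁ C₂ corrX corrZ (2 * w) F' hc
  obtain ⟨c', hc'⟩ := htr.exists_partialTrace_eq e hfin hfin'
  refine ⟨α, β, α', β', c', (hαβ.union hαβ').mono ?_ (le_of_eq ?_), ?_⟩
  · rintro _ ⟨_, ⟨q, hq, rfl⟩, rfl⟩
    rcases hq with hq | hq | hq | hq
    · exact Or.inl ⟨q.1, ⟨q, Or.inl hq, rfl⟩, rfl⟩
    · exact Or.inl ⟨q.1, ⟨q, Or.inr hq, rfl⟩, rfl⟩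
    · exact Or.inr ⟨q.1, ⟨q, Or.inl hq, rfl⟩, rfl⟩
    · exact Or.inr ⟨q.1, ⟨q, Or.inr hq, rfl⟩, rfl⟩
  · rw [outputRate]
    ring
  · rw [hFF', run_circuitOfLayers]
    exact hc'

theorem IsSwitching.exists_gadget {φ : A.Cell × B.Cell ↪ V} (h : IsSwitching A B L w m j G φ η)
    (hw : 1 ≤ w) (hγ0 : 0 < γ) (hγ : IsCorrectable w γ (spreadRate w γ)) {γout : ℝ}
    (hγout : outputRate w γ ≤ γout) {E : EncMap (A.tensor B)}
    (i : EA.LevelIdx j × L ↪ E.LevelIdx (j + 1)) (hi : ∀ p (c : A.Cell × B.Cell),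
      E.rep (i p).1 c = EA.rep p.1.1 c.1 * (Pi.single p.2.1 1 : B.Cell → ZMod 2) c.2) :
    ∃ (N : ℕ) (𝒬 : AdaptiveCircuit N N (gadgetTime w))
      (loc : Fin N ↪ (A.tensor B).Cell × Fin 4) (inp : A.LevelCell j × L ↪ Fin N)
      (out : (A.tensor B).LevelCell (j + 1) ↪ Fin N),
      N ≤ 8 * (Fintype.card ((A.tensor B).LevelCell (j + 1)) * w) ∧
      (∀ p, loc (inp p) = ((p.1.1, p.2.1), 0)) ∧ (∀ c, loc (out c) = (c.1, 0)) ∧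
      IsPauliFaultTolerantGadget 𝒬 (loc.trans (φ.prodMap (Function.Embedding.refl (Fin 4))))
        (disjPow (disjPow (badSets G η γ) (Fin 4)) (Fin (gadgetTime w)))
        ((levelCode EA j (Function.Embedding.refl A.Cell) (badSets A.connGraph η γ)).copies L) inp
        (levelCode E (j + 1) φ (badSets G η γout)) out (padZero i) := by
  obtain ⟨𝒬, h𝒬⟩ := h.exists_circuit EA hγ0 hγ (Fintype.equivFin (Qubit A B L j)) fun _ _ => rfl
  set e := Fintype.equivFin (Qubit A B L j) with he
  have hloc : ∀ s : Subtype (IsDataCell A B j), qubitLocation e (dataQubits e s) = (s.1, 0) := by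
    intro s
    change ((e.symm (e (.inl s))).cell, (e.symm (e (.inl s))).block) = _
    rw [Equiv.symm_apply_apply]
    rfl
  refine ⟨_, 𝒬, qubitLocation e, h.inputCells.trans (dataQubits e), dataQubits e,
    card_qubit_le h.locality hw, fun p => hloc _, hloc, ?_⟩
  intro ℓ ρ _ _ σ hσ F hF
  obtain ⟨P, hP, hc⟩ := isPauliDeviation_iff.1 hσ
  obtain ⟨k, hk0, hk⟩ := h.exists_isometry_mul_padMat EA i hi
  obtain ⟨α, β, α', β', c, hS, hout⟩ := h𝒬 ℓ ρ σ P F (fun l => by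
    refine (avoids_badSets_iff.1 (avoids_disjPow_iff.1 hP l)).mono ?_ le_rfl
    rintro a ⟨ha, hap⟩
    exact ⟨(⟨a, ha⟩, l), hap, rfl⟩) hc hF
  refine isPauliDeviation_of_xz (D := levelCode E (j + 1) φ (badSets G η γout)) hk0 hk
    (α := α) (β := β) (α' := α') (β' := β') (c := c) hout ?_
  refine avoids_badSets_iff.2 (hS.mono ?_ hγout)
  rintro _ ⟨q, hq, rfl⟩
  exact ⟨q.1, ⟨q, hq, rfl⟩, rfl⟩

end Switching

/-! ### Codes without qubits -/

section Empty

theorem isEmpty_cell_of_hasLocality_zero {r : ℕ} {K : BasedComplex r} (h : K.HasLocality 0) :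
    IsEmpty K.Cell := by
  refine ⟨fun c => ?_⟩
  have h1 : {c' | K.Below c' c ∨ K.Below c c'} = ∅ :=
    (Set.ncard_eq_zero (Set.toFinite _)).1 (Nat.le_zero.1 (h c))
  have h2 : c ∈ {c' | K.Below c' c ∨ K.Below c c'} := Or.inl Relation.ReflTransGen.refl
  rw [h1] at h2
  exact h2

theorem exists_mul_apply_eq {Q Λ : Type} [Fintype Q] [DecidableEq Q] [IsEmpty Q]
    (M : Matrix (Bits Q) (Bits Q) ℂ) {X : Matrix (Bits Q) Λ ℂ} (hX : ∃ k, ∀ y u, X y u = k) :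
    ∃ k, ∀ y u, (M * X) y u = k := by
  obtain ⟨k, hk⟩ := hX
  refine ⟨(∑ z, M 0 z) * k, fun y u => ?_⟩
  simp only [Matrix.mul_apply, hk]
  rw [← Finset.sum_mul, Subsingleton.elim y 0]

theorem exists_isometry_apply_eq {r : ℕ} {K : BasedComplex r} [IsEmpty K.Cell] (E : EncMap K)
    (i : ℕ) : ∃ k, k ≠ 0 ∧ ∀ y u, E.isometry i y u = k := by
  refine ⟨(((Real.sqrt (Nat.card (K.coboundaries i)))⁻¹ : ℝ) : ℂ), ?_, fun y u => if_pos ?_⟩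
  · have : 0 < Nat.card (K.coboundaries i) := Nat.card_pos
    have h2 : Real.sqrt (Nat.card (K.coboundaries i)) ≠ 0 :=
      (Real.sqrt_pos.2 (by exact_mod_cast this)).ne'
    exact_mod_cast inv_ne_zero h2
  · rw [Subsingleton.elim (K.extend i y - E.encode i u) 0]
    exact Submodule.zero_mem _

/-- Without physical qubits the encodings are constant, so the deviations of the encoded states of
two codes agree up to scalars. -/
theorem isPauliDeviation_of_isEmpty {Vin Vout : Type} {Din : DecoratedCode Vin}
    {Dout : DecoratedCode Vout} (_ : IsEmpty Din.Phys) (_ : IsEmpty Dout.Phys) {R : Type} [Fintype R]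
    [DecidableEq R] {M : ℕ} (inp : Din.Phys ↪ Fin 0) (out : Dout.Phys ↪ Fin 0)
    (i : Din.Log ↪ Dout.Log) (hin : ∃ k, ∀ y u, Din.enc y u = k)
    (hout : ∃ k, k ≠ 0 ∧ ∀ y u, Dout.enc y u = k) (hbad : Avoids Dout.bad ∅)
    {ρ : Matrix (Bits Din.Log × R) (Bits Din.Log × R) ℂ} {σ : HybridState (Fin 0) R M}
    (hσ : IsPauliDeviation Din inp ρ σ) : IsPauliDeviation Dout out (onLeft (padZero i) ρ) σ := by
  classical
  obtain ⟨F, _, c, hc⟩ := isPauliDeviation_iff.1 hσ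
  obtain ⟨k₁, hk₁⟩ := exists_mul_apply_eq (pauliString F.1) hin
  obtain ⟨k₂, hk₂⟩ := exists_mul_apply_eq (pauliString F.2) hin
  obtain ⟨k, hk0, hk⟩ := hout
  let C : Matrix (Bits Dout.Phys) (Bits Din.Log) ℂ := fun _ _ => 1
  have hxz : xz (0 : Bits Dout.Phys) 0 * C = C := by
    ext y u
    rw [xz_mul_apply]
    simp [C, sgn_zero]
  refine isPauliDeviation_of_xz (C := C) (α := 0) (β := 0) (α' := 0) (β' := 0)
    (c := c * (k₁ * star k₂)) hk0 ?_ ?_ ?_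
  · ext y u
    let y₀ : Bits Dout.Log := fun q => if hq : ∃ p, i p = q then u hq.choose else 0
    rw [mul_padMat_apply i _ y (y₀ := y₀) (fun q hq => dif_neg hq), hk, Matrix.smul_apply,
      smul_eq_mul, mul_one]
    funext p
    have hp : ∃ p', i p' = i p := ⟨p, rfl⟩
    have h1 : y₀ (i p) = u hp.choose := dif_pos hp
    exact h1.trans (congrArg u (i.injective hp.choose_spec))
  · rw [hxz]
    ext a b
    have h1 : partialTrace out σ a b = partialTrace inp σ (0, a.2) (0, b.2) := by
      simp only [partialTrace]
      refine Finset.sum_congr rfl fun x _ => Finset.sum_congr rfl fun y _ =>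
        Finset.sum_congr rfl fun y' _ => (if_pos ?_).trans (if_pos ?_).symm
      · exact ⟨Subsingleton.elim _ _, Subsingleton.elim _ _, fun q => q.elim0⟩
      · exact ⟨Subsingleton.elim _ _, Subsingleton.elim _ _, fun q => q.elim0⟩
    rw [h1, hc, Matrix.smul_apply, Matrix.smul_apply, sandwich_apply, sandwich_apply, smul_eq_mul,
      smul_eq_mul, mul_assoc, Finset.mul_sum (s := Finset.univ) (a := k₁ * star k₂)]
    refine congrArg (c * ·) (Finset.sum_congr rfl fun l _ => ?_)
    rw [Finset.mul_sum]
    refine Finset.sum_congr rfl fun l' _ => ?_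
    rw [hk₁, hk₂]
    simp only [C, star_one]
    ring
  · simpa using hbad

/-- The circuit without qubits. -/
def emptyCircuit : AdaptiveCircuit 0 0 0 where
  space_le := le_rfl
  classical := fun t => t.elim0
  gateCount := fun t => t.elim0
  gateCount_le := fun t => t.elim0
  gate := fun t => t.elim0
  disjoint_support := fun t => t.elim0

end Empty

/-! ### The theorem -/

theorem exists_isSwitching {d : ℕ} {A : BasedComplex d}
    (hA : ∀ a a', A.inc a a' ≠ 0 → A.Linked a a') {B : BasedComplex 1} {M₁ L : Finset B.Cell}
    (h₁ : IsInformationSet (B.dual.cocycles 0) (M₁ : Set B.Cell)) (hL : L ⊆ M₁) {w : ℕ}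
    (hw : (A.tensor B).HasLocality w) {j m : ℕ} (hj : 1 ≤ j) (hjd : j + 1 ≤ d)
    (hC : (A.tensor B).HasChainFlipDecoder m 0 j) (hD : (A.tensor B.dual).HasFlipDecoder m 0 (j + 1))
    (hDL : (A.tensor (B.removeCells L).dual).HasChainFlipDecoder m 0 j) {V : Type}
    {G : SimpleGraph V} {φ : A.Cell × B.Cell ↪ V}
    (hGC : ∀ c c', (A.tensor B).connGraph.Adj c c' → G.Adj (φ c) (φ c'))
    (hGD : ∀ c c', (A.tensor B.dual).connGraph.Adj c c' → G.Adj (φ c) (φ c')) {η : ℝ}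
    (hη : 0 < η) (hηm : η ≤ m) (hs : A.LeSystolicDistance j η)
    (hc : A.LeCosystolicDistance j η) : IsSwitching A B L w m j G φ η where
  linked := hA
  locality := hw
  one_le := hj
  succ_le := hjd
  decC := hC.1
  decD := hD.1
  decDL := hDL.1
  inj := φ.injective
  adjC := hGC
  adjD := hGD
  eta_pos := hη
  eta_le := hηm
  syst := hs
  cosyst := hc
  codeword := by
    classical
    intro l hl
    obtain ⟨y, hy, hy'⟩ := h₁.prop (Pi.single l 1)
    refine ⟨y, hy, ?_, fun l' hl' hne => ?_⟩
    · exact (hy' l (hL hl)).trans (Pi.single_eq_same (M := fun _ : B.Cell => ZMod 2) l 1)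
    · exact (hy' l' (hL hl')).trans (Pi.single_eq_of_ne (M := fun _ : B.Cell => ZMod 2) hne 1)

end QEC

end

theorem proposition6p1 :
    ∃ κ : ℕ, ∀ w : ℕ, ∃ γ₀ : ℝ, 0 < γ₀ ∧ ∃ ζ₀ : ℝ, 0 < ζ₀ ∧
      -- the complexes and their encoding maps
      ∀ (d : ℕ) (A : QEC.BasedComplex d) (EA : QEC.EncMap A) (_ : EA.IsCohomologyIso)
        (_ : ∀ a a', A.inc a a' ≠ 0 → A.Linked a a')
        (B : QEC.BasedComplex 1) (M₀ M₁ L : Finset B.Cell)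
        (h₀ : QEC.IsInformationSet (B.cocycles 0) (M₀ : Set B.Cell))
        (h₁ : QEC.IsInformationSet (B.dual.cocycles 0) (M₁ : Set B.Cell)) (hL : L ⊆ M₁)
        (_ : (A.tensor B).HasLocality w)
        -- the level and the decoders
        (i : ℕ) (hi : 2 ≤ i) (_ : i ≤ d) (m : ℕ)
        (_ : (A.tensor B).HasChainFlipDecoder m 0 (i - 1))
        (_ : (A.tensor B.dual).HasFlipDecoder m 0 i)
        (_ : (A.tensor (B.removeCells L).dual).HasChainFlipDecoder m 0 (i - 1))
        -- the graph
        (V : Type) (G : SimpleGraph V) (φ : (A.tensor B).Cell ↪ V)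
        (_ : ∀ c c', (A.tensor B).connGraph.Adj c c' → G.Adj (φ c) (φ c'))
        (_ : ∀ c c', (A.tensor B.dual).connGraph.Adj c c' → G.Adj (φ c) (φ c'))
        -- the parameters
        (η γin γout : ℝ) (_ : 0 < η) (_ : η ≤ m)
        (_ : A.LeSystolicDistance (i - 1) η) (_ : A.LeCosystolicDistance (i - 1) η)
        (_ : (A.tensor (B.removeCells L).dual).LeCosystolicDistance i η)
        (_ : 0 < γin) (_ : γin ≤ γ₀) (_ : ζ₀ * γin ≤ γout),
      -- the gadget
      ∃ (u N M T : ℕ) (𝒬 : QEC.AdaptiveCircuit N M T)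
        (loc : Fin N ↪ (A.tensor B).Cell × Fin u)
        (inp : A.LevelCell (i - 1) × L ↪ Fin N) (out : (A.tensor B).LevelCell i ↪ Fin N)
        (jin jout : Fin u),
        u ≤ κ ∧ T ≤ κ * w ∧ N ≤ κ * (Fintype.card ((A.tensor B).LevelCell i) * w) ∧
        (∀ p, loc (inp p) = ((p.1.1, p.2.1), jin)) ∧
        (∀ c, loc (out c) = (c.1, jout)) ∧
        QEC.IsPauliFaultTolerantGadget 𝒬
          (loc.trans (φ.prodMap (Function.Embedding.refl (Fin u))))
          (QEC.disjPow (QEC.disjPow (QEC.badSets G η γin) (Fin u)) (Fin T))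
          ((QEC.levelCode EA (i - 1) (Function.Embedding.refl A.Cell)
            (QEC.badSets A.connGraph η γin)).copies L) inp
          (QEC.levelCode (EA.tensor (QEC.EncMap.ofInfoSets B M₀ M₁ h₀ h₁)) i φ
            (QEC.badSets G η γout)) out
          (QEC.padZero (QEC.logicalInclusion EA h₀ h₁ hL (le_trans one_le_two hi))) := by
  -- the number of qubits is at most `8 * n_out * w` and the time `4 * w + 4` is at most `8 * w`
  refine ⟨8, fun w => ?_⟩
  obtain ⟨γ₀, hγ₀, hγ⟩ := QEC.exists_isCorrectable w
  refine ⟨γ₀, hγ₀, QEC.outputRate w 1, QEC.outputRate_pos w one_pos, ?_⟩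
  intro d A EA _ hA B M₀ M₁ L h₀ h₁ hL hw i hi hid m hC hD hDL V G φ hGC hGD η γin γout hη hηm
    hs hc _ hγin hγin' hγout
  obtain ⟨j, rfl⟩ : ∃ j, i = j + 1 := ⟨i - 1, by omega⟩
  have hrate : QEC.outputRate w γin ≤ γout := (QEC.outputRate_eq w γin).trans_le hγout
  rcases Nat.eq_zero_or_pos w with rfl | hw1
  · -- without locality there are no cells, hence no qubits
    have hK := QEC.isEmpty_cell_of_hasLocality_zero hw
    have hin : IsEmpty (A.LevelCell j × L) := ⟨fun p => hK.elim (p.1.1, p.2.1)⟩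
    have hout : IsEmpty ((A.tensor B).LevelCell (j + 1)) := ⟨fun c => hK.elim c.1⟩
    refine ⟨1, 0, 0, 0, QEC.emptyCircuit, ⟨fun q => q.elim0, fun q => q.elim0⟩,
      ⟨fun p => hin.elim p, fun p => hin.elim p⟩, ⟨fun c => hout.elim c, fun c => hout.elim c⟩, 0, 0,
      by norm_num, by norm_num, by norm_num, fun p => hin.elim p, fun c => hout.elim c, ?_⟩
    intro ℓ ρ _ _ σ hσ F hF
    refine QEC.isPauliDeviation_of_isEmpty hin hout _ _ _ ?_ ?_ ?_ hσ
    · rcases isEmpty_or_nonempty L with hL' | ⟨⟨l⟩⟩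
      · exact ⟨1, fun y u => Finset.prod_of_isEmpty _⟩
      · have : IsEmpty A.Cell := ⟨fun a => hK.elim (a, l.1)⟩
        obtain ⟨k, -, hk⟩ := QEC.exists_isometry_apply_eq EA j
        exact ⟨_, fun y u => Finset.prod_congr rfl fun l _ => hk _ _⟩
    · exact QEC.exists_isometry_apply_eq _ _
    · exact QEC.avoids_badSets_iff.2 (QEC.sparse_empty ((QEC.outputRate_pos 0 hγin).trans_le hrate))
  · have h := QEC.exists_isSwitching hA h₁ hL hw (Nat.le_of_succ_le_succ hi) hid hC hD hDL hGC hGD hη hηm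
      hs hc
    obtain ⟨N, 𝒬, loc, inp, out, hN, hinp, hout, hgad⟩ := h.exists_gadget EA hw1 hγin
      (hγ γin hγin hγin') hrate (E := EA.tensor (QEC.EncMap.ofInfoSets B M₀ M₁ h₀ h₁))
      (QEC.logicalInclusion EA h₀ h₁ hL (le_trans one_le_two hi)) fun _ _ => rfl
    refine ⟨4, N, N, QEC.gadgetTime w, 𝒬, loc, inp, out, 0, 0, by norm_num, ?_, hN, hinp, hout, hgad⟩
    simp only [QEC.gadgetTime]
    omega
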